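/- **Setting.** Let $d\ge 2$, $n\ge 1$, $k\ge 0$ be integers. Write points of $\mathbb R^d$ as $(x,y)\in\mathbb R\times\mathbb R^{d-1}$, and put $H^k=H^k(\mathbb R^d;\mathbb R^n)$, $H^k_y=H^k(\mathbb R^{d-1})$, $L^1_y=L^1(\mathbb R^{d-1})$, $H^k_x=H^k(\mathbb R;\mathbb R^n)$, $L^2_x=L^2(\mathbb R;\mathbb R^n)$. For $\gamma\in\mathbb R$ let $[T_\gamma z](x,y)=z(x-\gamma,y)$, and for $\theta:\mathbb R^{d-1}\to\mathbb R$ and $\zeta$ defined on $\mathbb R$ let $[T_\theta\zeta](x,y)=\zeta(x-\theta(y))$. Assume the following. * **(Hf)** (level $k$) $f\in C^{k+2}(\mathbb R^n;\mathbb R^n)$, $f(u_-)=f(u_+)=0$, and $f,Df,\dots,D^{k+2}f$ are Lipschitz on bounded sets. * **(HTw)** $\Phi_0\in C^2(\mathbb R;\mathbb R^n)$ and $c_0\in\mathbb R$ satisfy $\Phi_0''+c_0\Phi_0'+f(\Phi_0)=0$, and $|\Phi_0(x)-u_\pm|+|\Phi_0'(x)|\le Ke^{-\nu_\pm|x|}$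 for $\pm x\ge0$, with some $K,\nu_\pm>0$. The operator $\mathcal L_{\rm tw}w=w''+c_0w'+Df(\Phi_0)w$, considered from $H^2(\mathbb R;\mathbb C^n)$ to $L^2(\mathbb R;\mathbb C^n)$, has a simple eigenvalue at $0$, and for some $\beta>0$ the operator $\mathcal L_{\rm tw}-\lambda$ is invertible for all $\lambda\ne0$ with $\operatorname{Re}\lambda\ge-2\beta$. Let $\psi_{\rm tw}\in H^2_x$ be the kernel element of $\mathcal L_{\rm tw}^{\rm adj}w=w''-c_0w'+Df(\Phi_0)^\top w$ with $\langle\Phi_0',\psi_{\rm tw}\rangle_{L^2_x}=1$. * **Noise.** $\mathcal W$ is a real separable Hilbert space on which the shifts $(T_\gamma)_{\gamma\in\mathbb R}$ act as a one-parameter group of bounded linear operators, $Q\in\mathscr L(\mathcal W)$ is non-negative and symmetric, and $\mathcal W_Q=\sqrt Q\,\mathcal W$. For a linear operator $B$ with values in a normed space $\mathcal Y$ put $\|B\|_{\Pi_2(\mathcal W_Q;\mathcal Y)}=\sup\big(\sum_j\|B\sqrt Qe_j\|_{\mathcal Y}^2\big)^{1/2}$, the supremum being over all orthonormal bases $(e_j)$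 of $\mathcal W$; for Hilbert spaces $\mathcal Y$ this is the Hilbert–Schmidt norm $\|B\|_{HS(\mathcal W_Q;\mathcal Y)}$. For a measurable function $u:\mathbb R^d\to\mathbb R^n$ (up to null sets), $\xi\mapsto g(u)[\xi]$ is linear with values in the measurable functions from $\mathbb R^d$ to $\mathbb R^n$. * **(HgQ)** (level $k$) $T_\gamma g(u)[\xi]=g(T_\gamma u)[T_\gamma\xi]$ for all $\gamma$, all $u\in\Phi_0+H^k$ and all $\xi$ that are shifts of elements of $\mathcal W_Q$. For every $N>0$ there is $K_g^N$ such that $\|g(T_\gamma\Phi_0+v)\|_{HS(\mathcal W_Q;H^k)}\le K_g^N$ and $\|g(T_\gamma\Phi_0+v)-g(T_\gamma\Phi_0+w)\|_{HS(\mathcal W_Q;H^k)}\le K_g^N\|v-w\|_{H^k}$ for all $\gamma\in\mathbb R$ and $v,w\in H^k$ with norms at most $N$. * **(H$L^1$)** (level $k$) For every $N>0$ there is $K_{\rm int}^N$ such that $\|g(T_\gamma\Phi_0+v)[\,\cdot\,]^\top T_\gamma\psi_{\rm tw}\|^2_{\Pi_2(\mathcal W_Q;L^1(\mathbb R^d;\mathbb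 R))}\le K_{\rm int}^N$ for all $\gamma\in\mathbb R$ and $v\in H^k$ with $\|v\|_{H^k}\le N$. **Nonlinearities.** Fix $\chi\in C^\infty(\mathbb R;[\tfrac14,\infty))$ with $\chi(z)=\tfrac14$ for $z\le\tfrac14$ and $\chi(z)=z$ for $z\ge\tfrac12$, and an orthonormal basis $(e_j)$ of $\mathcal W$. Set $\Upsilon(\theta)=-1/\chi(\langle T_\theta\Phi_0',\psi_{\rm tw}\rangle_{L^2_x})$, $$\mathcal J(v,\theta)=f(v+T_\theta\Phi_0)-f(T_\theta\Phi_0)-Df(\Phi_0)v+|\nabla_y\theta|^2T_\theta\Phi_0'',$$ $$\mathcal J_{\rm tr}(v,\theta,\gamma)=-\tfrac12T_\theta\Phi_0''\,\Upsilon(\theta)^2\sum_j\langle g(v+T_\theta\Phi_0)T_{-\gamma}\sqrt Qe_j,\psi_{\rm tw}\rangle_{L^2_x}^2,$$ $$N_\sigma(v,\theta,\gamma)=\Upsilon(\theta)\langle\mathcal J+\sigma^2\mathcal J_{\rm tr},\psi_{\rm tw}\rangle_{L^2_x},\qquad \mathcal N_\sigma(v,\theta,\gamma)=\mathcal J+\sigma^2\mathcal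 J_{\rm tr}+N_\sigma T_\theta\Phi_0',$$ $$M(v,\theta)[\xi]=\Upsilon(\theta)\langle g(v+T_\theta\Phi_0)[\xi],\psi_{\rm tw}\rangle_{L^2_x},\qquad \mathcal M(v,\theta)[\xi]=g(v+T_\theta\Phi_0)[\xi]+M(v,\theta)[\xi]\,T_\theta\Phi_0'.$$ **Proposition.** Assume (Hf), (HTw) and (HgQ) at level $k$. (1) Let $k>d/2$ and assume (H$L^1$) at level $k$. For every $N>0$ there is $K^N>0$ such that for all $\gamma\in\mathbb R$, $v\in H^k$, $\theta\in H^k_y$ with $\|v\|_{H^k}\le N$ and $\|\theta\|_{H^k_y}\le N$, $$\|M(v,\theta)T_{-\gamma}\|_{HS(\mathcal W_Q;H^k_y)}+\|M(v,\theta)T_{-\gamma}\|_{\Pi_2(\mathcal W_Q;L^1_y)}\le K^N,\qquad\|\mathcal M(v,\theta)T_{-\gamma}\|_{HS(\mathcal W_Q;H^k)}\le K^N,$$ and, if in addition $\theta\in H^{k+1}_y$, for all $\sigma\in\mathbb R$ both $\|N_\sigma(v,\theta,\gamma)\|_{H^k_y}+\|N_\sigma(v,\theta,\gamma)\|_{L^1_y}$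 and $\|\mathcal N_\sigma(v,\theta,\gamma)\|_{H^k}$ are at most $$K^N\big(\sigma^2+\|v\|_{H^k}^2+\|v\|_{H^k}\|\theta\|_{H^k_y}+\|\nabla_y\theta\|_{H^k_y}^2\big).$$ (2) Let $k>d/2+1$. For every $N>0$ there is $K^N>0$ such that for all $\gamma\in\mathbb R$, $v_A,v_B\in H^k$, $\theta_A,\theta_B\in H^k_y$ with norms at most $N$, the differences $M(v_A,\theta_A)T_{-\gamma}-M(v_B,\theta_B)T_{-\gamma}$ in $HS(\mathcal W_Q;H^k_y)$ and $\mathcal M(v_A,\theta_A)T_{-\gamma}-\mathcal M(v_B,\theta_B)T_{-\gamma}$ in $HS(\mathcal W_Q;H^k)$ have norm at most $K^N\big[\|v_A-v_B\|_{H^k}+\|\theta_A-\theta_B\|_{H^k_y}\big]$. Moreover, for all $0\le\sigma\le1$, the norms $$\|N_\sigma(v_A,\theta_A,\gamma)-N_\sigma(v_B,\theta_B,\gamma)\|_{H^{k-1}_y}\quad\text{and}\quad\|\mathcal N_\sigma(v_A,\theta_A,\gamma)-\mathcal N_\sigma(v_B,\theta_B,\gamma)\|_{H^{k-1}}$$ are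 at most $K^N\big[\|v_A-v_B\|_{H^{k-1}}+\sigma^2\|v_A-v_B\|_{H^k}+\|\theta_A-\theta_B\|_{H^k_y}\big]$; and if (HgQ) also holds at level $k-1$, they are at most $K^N\big[\|v_A-v_B\|_{H^{k-1}}+\|\theta_A-\theta_B\|_{H^k_y}\big]$. -/

import Mathlib

open MeasureTheory
open scoped ENNReal RealInnerProductSpace ContDiff

noncomputable section

namespace PlanarWave

/-! ## Spaces -/

/-- The transverse space `ℝ^{d-1}`. -/
abbrev Y (d : ℕ) : Type := EuclideanSpace ℝ (Fin (d - 1))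

/-- The full space `ℝ^d = ℝ × ℝ^{d-1}`, with points `(x, y)` and Lebesgue measure `dx dy`. -/
abbrev X (d : ℕ) : Type := ℝ × Y d

/-- The state space `ℝⁿ`. -/
abbrev V (n : ℕ) : Type := EuclideanSpace ℝ (Fin n)

/-- The complexified state space `ℂⁿ`. -/
abbrev VC (n : ℕ) : Type := EuclideanSpace ℂ (Fin n)

/-- The coordinate direction of `ℝ`. -/
def dirR : Unit → ℝ := fun _ => 1

/-- The coordinate directions of `ℝ^{d-1}`. -/
def dirY (d : ℕ) : Fin (d - 1) → Y d := fun i => EuclideanSpace.single i 1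

/-- The coordinate directions of `ℝ × ℝ^{d-1}`; `none` is the `x`-direction. -/
def dirX (d : ℕ) : Option (Fin (d - 1)) → X d
  | none => (1, 0)
  | some i => (0, dirY d i)

/-! ## Weak derivatives and Sobolev norms -/

section Sobolev

variable {κ E F : Type*} [NormedAddCommGroup E] [NormedSpace ℝ E] [MeasureSpace E]
  [NormedAddCommGroup F] [NormedSpace ℝ F]

/-- `u'` is the weak partial derivative `∂_{b (w 0)} ⋯ ∂_{b (w (j-1))} u`. -/
def IsWeakDeriv (b : κ → E) {j : ℕ} (w : Fin j → κ) (u u' : E → F) : Prop :=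
  LocallyIntegrable u volume ∧ LocallyIntegrable u' volume ∧
    ∀ φ : E → ℝ, ContDiff ℝ ∞ φ → HasCompactSupport φ →
      ∫ x, (iteratedFDeriv ℝ j φ x fun i => b (w i)) • u x =
        (-1 : ℝ) ^ j • ∫ x, φ x • u' x

/-- The `H^k` norm `(∑_{j ≤ k} ∑_{i₁,…,i_j} ‖∂_{i₁} ⋯ ∂_{i_j} u‖²_{L²})^{1/2}`, with value `∞` if
`u` does not have all its weak partial derivatives up to order `k` in `L²`.  Weak derivatives are
unique almost everywhere, so the infimum runs over families with one common value. -/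
def sobNorm [Fintype κ] (b : κ → E) (k : ℕ) (u : E → F) : ℝ≥0∞ :=
  ⨅ (D : (j : ℕ) → (Fin j → κ) → E → F)
    (_ : ∀ j ≤ k, ∀ w : Fin j → κ, IsWeakDeriv b w u (D j w)),
    (∑ j ∈ Finset.range (k + 1), ∑ w : Fin j → κ, eLpNorm (D j w) 2 volume ^ 2) ^ (1 / 2 : ℝ)

open Classical in
/-- The weak partial derivative of first order in the direction `b i` (zero if there is none). -/
def weakPartial (b : κ → E) (i : κ) (u : E → F) : E → F :=
  if h : ∃ u', IsWeakDeriv b (fun _ : Fin 1 => i) u u' then h.choose else 0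

end Sobolev

/-- The norm of `H^k_x = H^k(ℝ; F)`. -/
def normHkx {F : Type*} [NormedAddCommGroup F] [NormedSpace ℝ F] (k : ℕ) (u : ℝ → F) : ℝ≥0∞ :=
  sobNorm dirR k u

/-- The norm of `H^k_y = H^k(ℝ^{d-1}; F)`. -/
def normHky {d : ℕ} {F : Type*} [NormedAddCommGroup F] [NormedSpace ℝ F] (k : ℕ)
    (u : Y d → F) : ℝ≥0∞ :=
  sobNorm (dirY d) k u

/-- The norm of `H^k = H^k(ℝ^d; F)`. -/
def normHk {d : ℕ} {F : Type*} [NormedAddCommGroup F] [NormedSpace ℝ F] (k : ℕ)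
    (u : X d → F) : ℝ≥0∞ :=
  sobNorm (dirX d) k u

/-- The norm of `L¹`. -/
def normL1 {E F : Type*} [MeasureSpace E] [NormedAddCommGroup F] (u : E → F) : ℝ≥0∞ :=
  eLpNorm u 1 volume

/-- The weak gradient `∇_y θ`. -/
def gradY {d : ℕ} (θ : Y d → ℝ) : Y d → Y d :=
  fun y => WithLp.toLp 2 fun i => weakPartial (dirY d) i θ y

open Classical in
/-- The class of a function modulo equality almost everywhere. -/
def cls {E F : Type*} [MeasureSpace E] [TopologicalSpace F] [Zero F] (u : E → F) :
    E →ₘ[volume] F :=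
  if h : AEStronglyMeasurable u volume then AEEqFun.mk u h else 0

/-! ## The deterministic setting -/

section Deterministic

variable {n : ℕ}

/-- Hypothesis (Hf) with smoothness parameter `k`. -/
structure HypF (k : ℕ) (f : V n → V n) (um up : V n) : Prop where
  contDiff : ContDiff ℝ (k + 2 : ℕ) f
  zero_minus : f um = 0
  zero_plus : f up = 0
  lipschitz : ∀ N : ℝ, 0 < N → ∃ K : ℝ, 0 < K ∧ ∀ uA uB : V n, ‖uA‖ ≤ N → ‖uB‖ ≤ N →
    ∑ j ∈ Finset.range (k + 3), ‖iteratedFDeriv ℝ j f uA - iteratedFDeriv ℝ j f uB‖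
      ≤ K * ‖uA - uB‖

/-- `w ∈ H²(ℝ; F)` and `w'' + c w' + A w = h` almost everywhere. -/
def SolvesODE {F : Type*} [NormedAddCommGroup F] [NormedSpace ℝ F] (c : ℝ) (A : ℝ → F → F)
    (w h : ℝ → F) : Prop :=
  normHkx 2 w < ⊤ ∧ ∃ w₁ w₂ : ℝ → F,
    IsWeakDeriv dirR (fun _ : Fin 1 => ()) w w₁ ∧ IsWeakDeriv dirR (fun _ : Fin 2 => ()) w w₂ ∧
      ∀ᵐ x, w₂ x + c • w₁ x + A x (w x) = h x

/-- The complex-linear extension to `ℂⁿ` of a linear map on `ℝⁿ`. -/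
def complexify (A : V n →L[ℝ] V n) (w : VC n) : VC n :=
  WithLp.toLp 2 fun i => ∑ j, ((A (EuclideanSpace.single j 1) i : ℝ) : ℂ) * w j

/-- `w ∈ H²(ℝ; ℂⁿ)` and `L_tw w = h`, where `L_tw w = w'' + c₀ w' + Df(Φ₀) w`. -/
def LtwEq (f : V n → V n) (Φ₀ : ℝ → V n) (c₀ : ℝ) (w h : ℝ → VC n) : Prop :=
  SolvesODE c₀ (fun x => complexify (fderiv ℝ f (Φ₀ x))) w h

/-- `w ∈ H²(ℝ; ℝⁿ)` and `L_tw^adj w = h`, where `L_tw^adj w = w'' - c₀ w' + Df(Φ₀)ᵀ w`. -/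
def LtwAdjEq (f : V n → V n) (Φ₀ : ℝ → V n) (c₀ : ℝ) (w h : ℝ → V n) : Prop :=
  SolvesODE (-c₀) (fun x => ContinuousLinearMap.adjoint (fderiv ℝ f (Φ₀ x))) w h

/-- Hypothesis (HTw): the wave profile `Φ₀` with speed `c₀`, its exponential limits, and the
spectral assumptions on `L_tw : H²(ℝ; ℂⁿ) → L²(ℝ; ℂⁿ)`. -/
structure HypTw (f : V n → V n) (um up : V n) (Φ₀ : ℝ → V n) (c₀ : ℝ) : Prop where
  contDiff : ContDiff ℝ 2 Φ₀
  ode : ∀ x, iteratedDeriv 2 Φ₀ x + c₀ • deriv Φ₀ x + f (Φ₀ x) = 0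
  limits : ∃ K νm νp : ℝ, 0 < K ∧ 0 < νm ∧ 0 < νp ∧
    (∀ x ≤ 0, ‖Φ₀ x - um‖ + ‖deriv Φ₀ x‖ ≤ K * Real.exp (-νm * |x|)) ∧
    (∀ x ≥ 0, ‖Φ₀ x - up‖ + ‖deriv Φ₀ x‖ ≤ K * Real.exp (-νp * |x|))
  /-- Zero is an eigenvalue of geometric multiplicity one … -/
  eigenvalue : ∃ w₀, LtwEq f Φ₀ c₀ w₀ 0 ∧ ¬ w₀ =ᵐ[volume] 0 ∧
    ∀ w, LtwEq f Φ₀ c₀ w 0 → ∃ a : ℂ, w =ᵐ[volume] a • w₀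
  /-- … without generalised eigenvectors. -/
  simple : ∀ w z, LtwEq f Φ₀ c₀ w z → LtwEq f Φ₀ c₀ z 0 → z =ᵐ[volume] 0
  /-- `L_tw - λ` is invertible for `Re λ ≥ -2β` except at the eigenvalue `λ = 0`. -/
  gap : ∃ β : ℝ, 0 < β ∧ ∀ lam : ℂ, -2 * β ≤ lam.re → lam ≠ 0 →
    ∀ h : ℝ → VC n, MemLp h 2 volume →
      ∃ w, LtwEq f Φ₀ c₀ w (h + lam • w) ∧
        ∀ w', LtwEq f Φ₀ c₀ w' (h + lam • w') → w' =ᵐ[volume] w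

/-- `ψ` is the element `ψ_tw` of the kernel of `L_tw^adj`, normalised by `⟨Φ₀', ψ⟩ = 1`. -/
structure IsAdjointKernel (f : V n → V n) (Φ₀ : ℝ → V n) (c₀ : ℝ) (ψ : ℝ → V n) : Prop where
  kernel : LtwAdjEq f Φ₀ c₀ ψ 0
  normalised : ∫ x, ⟪deriv Φ₀ x, ψ x⟫ = 1

end Deterministic

/-- The smooth cut-off function `χ : ℝ → [1/4, ∞)`. -/
structure IsCutoff (χ : ℝ → ℝ) : Prop where
  smooth : ContDiff ℝ ∞ χ
  ge : ∀ z, 1 / 4 ≤ χ z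
  low : ∀ z ≤ 1 / 4, χ z = 1 / 4
  high : ∀ z ≥ 1 / 2, χ z = z

/-! ## The stochastic setting

`W` is a real separable Hilbert space with an orthonormal basis indexed by the countable type `ι`
(every other orthonormal basis of `W` can be indexed by `ι` too), `S = Q^{1/2}`, and `T γ` is the
right-shift on `W`.  The noise coefficient `g` sends a class `u` of functions on `ℝ^d` and an
element `ξ` to a class of functions on `ℝ^d`, linearly in `ξ`. -/

section Stochastic

variable {d n : ℕ} {ι W : Type*} [NormedAddCommGroup W] [InnerProductSpace ℝ W]

/-- `S` is the non-negative square root of the non-negative symmetric operator `Q`. -/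
structure IsSqrt (S Q : W →L[ℝ] W) : Prop where
  nonneg : Q.IsPositive
  sqrt_nonneg : S.IsPositive
  mul_self : S ∘L S = Q

/-- The shifts on `W` form a one-parameter group. -/
structure IsShiftGroup (T : ℝ → W →L[ℝ] W) : Prop where
  zero : T 0 = ContinuousLinearMap.id ℝ W
  add : ∀ a b, T (a + b) = T a ∘L T b

/-- The right-shift `[T_γ u](x, y) = u(x - γ, y)`. -/
def shift {F : Type*} (γ : ℝ) (u : X d → F) : X d → F := fun p => u (p.1 - γ, p.2)

/-- The `2`-summing norm on `W_Q = Q^{1/2} W` of an operator `B` with values in a space of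
functions with norm `nrm`: the supremum of `(∑_j nrm(B[√Q e_j])²)^{1/2}` over all orthonormal
bases `(e_j)` of `W`. -/
def twoSummingNorm (ι : Type*) {Z : Type*} (S : W →L[ℝ] W) (nrm : Z → ℝ≥0∞) (B : W → Z) : ℝ≥0∞ :=
  ⨆ b : HilbertBasis ι ℝ W, (∑' j, nrm (B (S (b j))) ^ 2) ^ (1 / 2 : ℝ)

/-- The norm of `HS(W_Q; H^k)`; for bounded operators into a Hilbert space the sums in
`twoSummingNorm` do not depend on the basis. -/
def hsHk (ι : Type*) (S : W →L[ℝ] W) (k : ℕ) (B : W → X d → V n) : ℝ≥0∞ :=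
  twoSummingNorm ι S (normHk k) B

/-- The norm of `HS(W_Q; H^k_y)`. -/
def hsHky (ι : Type*) (S : W →L[ℝ] W) (k : ℕ) (B : W → Y d → ℝ) : ℝ≥0∞ :=
  twoSummingNorm ι S (normHky k) B

/-- The norm of `Π₂(W_Q; L¹)`. -/
def pi2L1 (ι : Type*) {E : Type*} [MeasureSpace E] (S : W →L[ℝ] W) (B : W → E → ℝ) : ℝ≥0∞ :=
  twoSummingNorm ι S normL1 B

/-- The class of `T_γ Φ₀ + v`. -/
def waveCls (Φ₀ : ℝ → V n) (γ : ℝ) (v : X d → V n) : X d →ₘ[volume] V n :=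
  cls fun p => Φ₀ (p.1 - γ) + v p

/-- Hypothesis (HgQ) with smoothness parameter `k`.  The commutation relation is asked for on
the shifts of elements of `W_Q`, where both of its sides are needed. -/
structure HypG (ι : Type*) (k : ℕ) (Φ₀ : ℝ → V n) (S : W →L[ℝ] W) (T : ℝ → W →L[ℝ] W)
    (g : (X d →ₘ[volume] V n) → W →ₗ[ℝ] (X d →ₘ[volume] V n)) : Prop where
  comm : ∀ v : X d → V n, normHk k v < ⊤ → ∀ (γ γ' : ℝ) (η : W),
    cls (shift γ (g (waveCls Φ₀ 0 v) (T γ' (S η)))) =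
      g (cls (shift γ (waveCls Φ₀ 0 v))) (T γ (T γ' (S η)))
  bounds : ∀ N : ℝ, 0 < N → ∃ K : ℝ, 0 < K ∧ ∀ (γ : ℝ) (v w : X d → V n),
    normHk k v ≤ ENNReal.ofReal N → normHk k w ≤ ENNReal.ofReal N →
      hsHk ι S k (fun ξ => ⇑(g (waveCls Φ₀ γ v) ξ)) ≤ ENNReal.ofReal K ∧
      hsHk ι S k (fun ξ p => g (waveCls Φ₀ γ v) ξ p - g (waveCls Φ₀ γ w) ξ p)
        ≤ ENNReal.ofReal K * normHk k (v - w)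

/-- Hypothesis (HL¹). -/
def HypL1 (ι : Type*) (k : ℕ) (Φ₀ ψ : ℝ → V n) (S : W →L[ℝ] W)
    (g : (X d →ₘ[volume] V n) → W →ₗ[ℝ] (X d →ₘ[volume] V n)) : Prop :=
  ∀ N : ℝ, 0 < N → ∃ K : ℝ, 0 < K ∧ ∀ (γ : ℝ) (v : X d → V n),
    normHk k v ≤ ENNReal.ofReal N →
      pi2L1 ι S (fun ξ (p : X d) => ⟪g (waveCls Φ₀ γ v) ξ p, ψ (p.1 - γ)⟫) ^ 2
        ≤ ENNReal.ofReal K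

/-! ## The nonlinearities -/

/-- `[T_θ ζ](x, y) = ζ(x - θ(y))`. -/
def translate {F : Type*} (θ : Y d → ℝ) (ζ : ℝ → F) : X d → F := fun p => ζ (p.1 - θ p.2)

/-- `y ↦ ⟨w(·, y), ψ⟩_{L²_x}`. -/
def innerX (w : X d → V n) (ψ : ℝ → V n) : Y d → ℝ := fun y => ∫ x, ⟪w (x, y), ψ x⟫

/-- `Υ(θ) = -1 / χ(⟨T_θ Φ₀', ψ⟩_{L²_x})`. -/
def Upsilon (Φ₀ ψ : ℝ → V n) (χ : ℝ → ℝ) (θ : Y d → ℝ) : Y d → ℝ :=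
  fun y => -1 / χ (innerX (translate θ (deriv Φ₀)) ψ y)

/-- The class of `v + T_θ Φ₀`. -/
def stateCls (Φ₀ : ℝ → V n) (v : X d → V n) (θ : Y d → ℝ) : X d →ₘ[volume] V n :=
  cls fun p => v p + translate θ Φ₀ p

/-- `𝒥(v, θ) = f(v + T_θ Φ₀) - f(T_θ Φ₀) - Df(Φ₀) v + |∇_y θ|² T_θ Φ₀''`. -/
def calJ (f : V n → V n) (Φ₀ : ℝ → V n) (v : X d → V n) (θ : Y d → ℝ) : X d → V n :=
  fun p => f (v p + translate θ Φ₀ p) - f (translate θ Φ₀ p) - fderiv ℝ f (Φ₀ p.1) (v p)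
    + ‖gradY θ p.2‖ ^ 2 • translate θ (iteratedDeriv 2 Φ₀) p

/-- `𝒥_tr(v, θ, γ)
  = -½ T_θ Φ₀'' Υ(θ)² ∑_j ⟨g(v + T_θ Φ₀) T_{-γ} √Q e_j, ψ⟩²_{L²_x}`. -/
def calJtr (Φ₀ ψ : ℝ → V n) (χ : ℝ → ℝ) (e : HilbertBasis ι ℝ W) (S : W →L[ℝ] W)
    (T : ℝ → W →L[ℝ] W) (g : (X d →ₘ[volume] V n) → W →ₗ[ℝ] (X d →ₘ[volume] V n))
    (v : X d → V n) (θ : Y d → ℝ) (γ : ℝ) : X d → V n :=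
  fun p => (-(1 / 2) * Upsilon Φ₀ ψ χ θ p.2 ^ 2 *
      ∑' j, innerX (g (stateCls Φ₀ v θ) (T (-γ) (S (e j)))) ψ p.2 ^ 2) •
    translate θ (iteratedDeriv 2 Φ₀) p

/-- `N_σ(v, θ, γ) = Υ(θ) ⟨𝒥(v, θ) + σ² 𝒥_tr(v, θ, γ), ψ⟩_{L²_x}`. -/
def Nsig (f : V n → V n) (Φ₀ ψ : ℝ → V n) (χ : ℝ → ℝ) (e : HilbertBasis ι ℝ W) (S : W →L[ℝ] W)
    (T : ℝ → W →L[ℝ] W) (g : (X d →ₘ[volume] V n) → W →ₗ[ℝ] (X d →ₘ[volume] V n))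
    (σ : ℝ) (v : X d → V n) (θ : Y d → ℝ) (γ : ℝ) : Y d → ℝ :=
  fun y => Upsilon Φ₀ ψ χ θ y *
    innerX (fun p => calJ f Φ₀ v θ p + σ ^ 2 • calJtr Φ₀ ψ χ e S T g v θ γ p) ψ y

/-- `𝒩_σ(v, θ, γ) = 𝒥(v, θ) + σ² 𝒥_tr(v, θ, γ) + N_σ(v, θ, γ) T_θ Φ₀'`. -/
def calNsig (f : V n → V n) (Φ₀ ψ : ℝ → V n) (χ : ℝ → ℝ) (e : HilbertBasis ι ℝ W)
    (S : W →L[ℝ] W) (T : ℝ → W →L[ℝ] W)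
    (g : (X d →ₘ[volume] V n) → W →ₗ[ℝ] (X d →ₘ[volume] V n))
    (σ : ℝ) (v : X d → V n) (θ : Y d → ℝ) (γ : ℝ) : X d → V n :=
  fun p => calJ f Φ₀ v θ p + σ ^ 2 • calJtr Φ₀ ψ χ e S T g v θ γ p
    + Nsig f Φ₀ ψ χ e S T g σ v θ γ p.2 • translate θ (deriv Φ₀) p

/-- `M(v, θ)[ξ] = Υ(θ) ⟨g(v + T_θ Φ₀)[ξ], ψ⟩_{L²_x}`. -/
def noiseM (Φ₀ ψ : ℝ → V n) (χ : ℝ → ℝ)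
    (g : (X d →ₘ[volume] V n) → W →ₗ[ℝ] (X d →ₘ[volume] V n))
    (v : X d → V n) (θ : Y d → ℝ) (ξ : W) : Y d → ℝ :=
  fun y => Upsilon Φ₀ ψ χ θ y * innerX (g (stateCls Φ₀ v θ) ξ) ψ y

/-- `ℳ(v, θ)[ξ] = g(v + T_θ Φ₀)[ξ] + M(v, θ)[ξ] T_θ Φ₀'`. -/
def calM (Φ₀ ψ : ℝ → V n) (χ : ℝ → ℝ)
    (g : (X d →ₘ[volume] V n) → W →ₗ[ℝ] (X d →ₘ[volume] V n))
    (v : X d → V n) (θ : Y d → ℝ) (ξ : W) : X d → V n :=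
  fun p => g (stateCls Φ₀ v θ) ξ p
    + noiseM Φ₀ ψ χ g v θ ξ p.2 • translate θ (deriv Φ₀) p

/-- The quantity `σ² + ‖v‖²_{H^k} + ‖v‖_{H^k} ‖θ‖_{H^k_y} + ‖∇_y θ‖²_{H^k_y}`. -/
def boundRHS (k : ℕ) (σ : ℝ) (v : X d → V n) (θ : Y d → ℝ) : ℝ≥0∞ :=
  ENNReal.ofReal (σ ^ 2) + normHk k v ^ 2 + normHk k v * normHky k θ + normHky k (gradY θ) ^ 2

end Stochastic

end PlanarWave

end

open PlanarWave

/-!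
All the estimates are consequences of the algebra property of Sobolev spaces above half the
dimension, applied to a few structural identities; the spectral assumptions on `L_tw` enter only
through the existence of `ψ_tw`.

*Sobolev calculus.*  The norm `sobNorm b s` is handled by induction on `s`, through first-order weak
derivatives (`sobNorm_succ_le`, `sobNorm_wd_le`).  The only analytic input is the product estimate
`‖p q‖_{L²} ≤ C ‖p‖_{H^r} ‖q‖_{H^t}` for `r + t > dim / 2` (`SobMul`).  For test functions it is
proved by splitting the convolution of the Fourier transforms according to which frequency is
smaller (`exists_eLpNorm_mul_le_of_smooth`), and it passes to general elements by cut-off and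
mollification.  Induction with the Leibniz rule gives `H^r · H^t ⊂ H^s`, and induction with the chain
rule shows that for `G` smooth enough, `a` bounded with its derivatives and `z` bounded in `H^k`, the
function `G(a + z)` is a multiplier on `H^s`, depends on `z` in a Lipschitz way, and has a quadratic
second-order Taylor remainder (`BddState.dom_comp_mul`, `dom_sub_mul`, `dom_sub`, `dom_tay`).

*Translates.*  The same induction, with `∂_{y_l} T_θ ζ = -(∂_{y_l} θ) T_θ ζ'`, gives bounds on and
Lipschitz dependence of `T_θ ζ` and of `(T_θ ζ) h` for profiles `ζ` (`dom_translate_mul`,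
`dom_translate_sub_mul`, `dom_translate_sub`).  They apply to `Φ₀'` and `Φ₀''`: bootstrapping in
`Φ₀'' = -c₀ Φ₀' - f(Φ₀)` puts `Φ₀'` into `H^{k+1}_x`, with bounded derivatives
(`prof_deriv_waveComp`).  Since `⟨Φ₀', ψ⟩ = 1`, the function `⟨T_θ Φ₀', ψ⟩ - 1` is small with `θ` and
lies in `H^k_y`, so that `Υ(θ)` is a smooth function of `1 +` an element of `H^k_y` and hence a
multiplier.

*Reduction.*  All four nonlinearities have the form `proj w = Υ(θ) ⟨w, ψ⟩` or
`coproj w = w + (proj w) T_θ Φ₀'`, where `w` is either a value `g(v + T_θ Φ₀) T_{-γ} √Q e_j` of the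
noise coefficient or the drift `w = 𝒥 + σ² 𝒥_tr`.  Both operations are bounded, and Lipschitz in
`(θ, w)` (`dom_proj_sub`, `dom_coproj_sub`), so only `w` has to be estimated.

*Noise.*  Shifting by `γ` does not change norms, and by the commutation relation turns
`g(v + T_θ Φ₀) T_{-γ} √Q e_j` into `g(T_γ Φ₀ + z) √Q e_j`, where `z` is the shift of the perturbation
`v + T_θ Φ₀ - Φ₀`, an element of `H^k` (`shift_noise_ae_eq`).  The hypotheses on `g` then apply as they
stand (`dom_noise`, `dom_noise_sub`, `dom_noise_L1`).

*Drift.*  The components of `w = 𝒥 + σ² 𝒥_tr` are the Taylor remainder of `f` at `Φ₀` with increments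
`T_θ Φ₀ - Φ₀` and `v`, which is of size `(‖θ‖ + ‖v‖) ‖v‖`, plus `R · T_θ Φ₀''` with
`R = |∇_y θ|² - (σ²/2) Υ(θ)² ∑_j m_j²`, where `m_j` is the pairing of the `j`-th noise value with `ψ`
(`WaveData.drift_apply`).  As `(m_j)` is square summable in `H^k_y`, the series converges there, and
`R` has size `σ² + ‖∇_y θ‖²`.  The `L¹_y` bound on `N_σ` uses in addition that products of two elements
of `L²` lie in `L¹`, and the Cauchy–Schwarz inequality on the slices `ℝ × {y}`.  The Lipschitz bound
for the drift lives at level `k - 1`, because `R` contains `∇_y θ`.  The pairings `m_j` may be estimated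
at level `k - 1` or, if the noise coefficient is only known to be Lipschitz at level `k`, at level
`k`; the latter is the origin of the term `σ² ‖v_A - v_B‖_{H^k}`.

*Uniformity.*  Estimates are written as `Dom A B`, meaning `A p ≤ C B p` with one constant for all
`p` in a parameter set.  Taking for `p` the admissible tuples `(γ, v, θ, σ)` of norm at most `N` makes
the constants depend on `N` alone.
-/


set_option linter.unusedSectionVars false

namespace PlanarWave

open scoped NNReal

/-! ### Domination up to a constant -/

/-- `A p ≤ C * B p` for all parameters `p`, with one finite constant `C`. -/
def Dom {P : Type*} (A B : P → ℝ≥0∞) : Prop := ∃ C : ℝ≥0, ∀ p, A p ≤ C * B p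

namespace Dom

variable {P : Type*} {A B A' B' D : P → ℝ≥0∞}

theorem of_le (h : ∀ p, A p ≤ B p) : Dom A B := ⟨1, fun p => by simpa using h p⟩

theorem refl (A : P → ℝ≥0∞) : Dom A A := of_le fun _ => le_rfl

theorem trans (h : Dom A B) (h' : Dom B D) : Dom A D := by
  obtain ⟨C, hC⟩ := h
  obtain ⟨C', hC'⟩ := h'
  refine ⟨C * C', fun p => (hC p).trans ?_⟩
  push_cast
  rw [mul_assoc]
  gcongr
  exact hC' p

theorem add (h : Dom A D) (h' : Dom B D) : Dom (fun p => A p + B p) D := by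
  obtain ⟨C, hC⟩ := h
  obtain ⟨C', hC'⟩ := h'
  refine ⟨C + C', fun p => ?_⟩
  push_cast
  rw [add_mul]
  exact add_le_add (hC p) (hC' p)

theorem add_add (h : Dom A A') (h' : Dom B B') :
    Dom (fun p => A p + B p) (fun p => A' p + B' p) :=
  add (h.trans (of_le fun _ => le_self_add)) (h'.trans (of_le fun _ => le_add_self))

theorem mul (h : Dom A A') (h' : Dom B B') :
    Dom (fun p => A p * B p) (fun p => A' p * B' p) := by
  obtain ⟨C, hC⟩ := h
  obtain ⟨C', hC'⟩ := h'
  refine ⟨C * C', fun p => ?_⟩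
  calc A p * B p ≤ (C * A' p) * (C' * B' p) := mul_le_mul' (hC p) (hC' p)
    _ = _ := by push_cast; ring

theorem sum {κ : Type*} {s : Finset κ} {A : κ → P → ℝ≥0∞} (h : ∀ i ∈ s, Dom (A i) D) :
    Dom (fun p => ∑ i ∈ s, A i p) D := by
  classical
  induction s using Finset.induction_on with
  | empty => exact ⟨0, fun p => by simp⟩
  | insert i s hi ih =>
    simp only [Finset.sum_insert hi]
    exact (h i (Finset.mem_insert_self _ _)).add
      (ih fun j hj => h j (Finset.mem_insert_of_mem hj))

theorem lt_top (h : Dom A B) {p : P} (hB : B p < ⊤) : A p < ⊤ := by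
  obtain ⟨C, hC⟩ := h
  exact (hC p).trans_lt (ENNReal.mul_lt_top ENNReal.coe_lt_top hB)

theorem comp {P' : Type*} (h : Dom A B) (f : P' → P) : Dom (A ∘ f) (B ∘ f) := by
  obtain ⟨C, hC⟩ := h
  exact ⟨C, fun p => hC (f p)⟩

theorem const_mul (c : ℝ≥0) (h : Dom A B) : Dom (fun p => c * A p) B := by
  obtain ⟨C, hC⟩ := h
  refine ⟨c * C, fun p => ?_⟩
  push_cast
  rw [mul_assoc]
  gcongr
  exact hC p

theorem sq (h : Dom A B) : Dom (fun p => A p ^ 2) (fun p => B p ^ 2) := by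
  simpa only [pow_two] using h.mul h

theorem exists_real (h : Dom A B) : ∃ K : ℝ, 0 < K ∧ ∀ p, A p ≤ ENNReal.ofReal K * B p := by
  obtain ⟨C, hC⟩ := h
  refine ⟨C + 1, by positivity, fun p => (hC p).trans (mul_le_mul_left ?_ _)⟩
  rw [← ENNReal.ofReal_coe_nnreal]
  exact ENNReal.ofReal_le_ofReal (by linarith)

end Dom

theorem dom_one_of_le {P : Type*} {A : P → ℝ≥0∞} {N : ℝ} (h : ∀ p, A p ≤ ENNReal.ofReal N) :
    Dom A fun _ => 1 :=
  ⟨N.toNNReal, fun p => (h p).trans (mul_one _).ge⟩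

/-! ### Weak derivatives -/

section Weak

variable {κ E F F' : Type*} [NormedAddCommGroup E] [NormedSpace ℝ E]
  [MeasureSpace E] [NormedAddCommGroup F] [NormedSpace ℝ F]
  [NormedAddCommGroup F'] [NormedSpace ℝ F']

/-- `u'` is the weak partial derivative of first order of `u` in the direction `b i`. -/
def WD (b : κ → E) (i : κ) (u u' : E → F) : Prop := IsWeakDeriv b (fun _ : Fin 1 => i) u u'

theorem wd_iff {b : κ → E} {i : κ} {u u' : E → F} :
    WD b i u u' ↔ LocallyIntegrable u volume ∧ LocallyIntegrable u' volume ∧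
      ∀ φ : E → ℝ, ContDiff ℝ ∞ φ → HasCompactSupport φ →
        ∫ x, fderiv ℝ φ x (b i) • u x = -∫ x, φ x • u' x := by
  simp [WD, IsWeakDeriv, iteratedFDeriv_one_apply]

theorem iteratedFDeriv_cons_apply (b : κ → E) {j : ℕ} (i : κ) (w : Fin j → κ) {φ : E → ℝ}
    (hφ : ContDiff ℝ ∞ φ) (x : E) :
    (iteratedFDeriv ℝ (j + 1) φ x fun l => b ((Fin.cons i w : Fin (j + 1) → κ) l)) =
      fderiv ℝ (fun x => iteratedFDeriv ℝ j φ x fun l => b (w l)) x (b i) := by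
  rw [iteratedFDeriv_succ_apply_left]
  have hd : DifferentiableAt ℝ (iteratedFDeriv ℝ j φ) x :=
    (hφ.differentiable_iteratedFDeriv (by exact_mod_cast ENat.natCast_lt_top j)) x
  rw [fderiv_continuousMultilinear_apply_const_apply hd]
  rfl

theorem contDiff_iteratedFDeriv_apply (b : κ → E) {j : ℕ} (w : Fin j → κ) {φ : E → ℝ}
    (hφ : ContDiff ℝ ∞ φ) : ContDiff ℝ ∞ (fun x => iteratedFDeriv ℝ j φ x fun l => b (w l)) := by
  have h : ContDiff ℝ ∞ (iteratedFDeriv ℝ j φ) :=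
    hφ.iteratedFDeriv_right (m := ∞) (by norm_cast)
  exact (ContinuousMultilinearMap.apply ℝ (fun _ : Fin j => E) ℝ
    (fun l => b (w l))).contDiff.comp h

theorem hasCompactSupport_iteratedFDeriv_apply (b : κ → E) {j : ℕ} (w : Fin j → κ) {φ : E → ℝ}
    (hφ : HasCompactSupport φ) :
    HasCompactSupport (fun x => iteratedFDeriv ℝ j φ x fun l => b (w l)) :=
  (hφ.iteratedFDeriv j).comp_left (g := fun (A : ContinuousMultilinearMap ℝ _ ℝ) =>
    A fun l => b (w l)) rfl

/-- Weak derivatives compose: `∂_w (∂_i u)` is a weak derivative of `u` in the directions `i, w`. -/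
theorem IsWeakDeriv.cons {b : κ → E} {i : κ} {j : ℕ} {w : Fin j → κ} {u u₁ u₂ : E → F}
    (h₁ : WD b i u u₁) (h₂ : IsWeakDeriv b w u₁ u₂) :
    IsWeakDeriv b (Fin.cons i w : Fin (j + 1) → κ) u u₂ := by
  rw [wd_iff] at h₁
  refine ⟨h₁.1, h₂.2.1, fun φ hφ hc => ?_⟩
  simp_rw [iteratedFDeriv_cons_apply b i w hφ]
  rw [h₁.2.2 _ (contDiff_iteratedFDeriv_apply b w hφ)
    (hasCompactSupport_iteratedFDeriv_apply b w hc), h₂.2.2 φ hφ hc, pow_succ]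
  simp

/-- Conversely, if `u` has the first-order derivative `u₁` in the direction `i` and the higher
derivative `u₂` in the directions `i, w`, then `u₂` is a weak derivative of `u₁`. -/
theorem IsWeakDeriv.tail {b : κ → E} {i : κ} {j : ℕ} {w : Fin j → κ} {u u₁ u₂ : E → F}
    (h₁ : WD b i u u₁) (h₂ : IsWeakDeriv b (Fin.cons i w : Fin (j + 1) → κ) u u₂) :
    IsWeakDeriv b w u₁ u₂ := by
  rw [wd_iff] at h₁
  refine ⟨h₁.2.1, h₂.2.1, fun φ hφ hc => ?_⟩
  have h := h₂.2.2 φ hφ hc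
  simp_rw [iteratedFDeriv_cons_apply b i w hφ] at h
  rw [h₁.2.2 _ (contDiff_iteratedFDeriv_apply b w hφ)
    (hasCompactSupport_iteratedFDeriv_apply b w hc), pow_succ] at h
  simpa using h

variable [FiniteDimensional ℝ E] [BorelSpace E] [(volume : Measure E).IsAddHaarMeasure]

theorem integrable_smul_of_locallyIntegrable {φ : E → ℝ} (hφ : Continuous φ)
    (hc : HasCompactSupport φ) {u : E → F} (hu : LocallyIntegrable u volume) :
    Integrable (fun x => φ x • u x) volume :=
  hu.integrable_smul_left_of_hasCompactSupport hφ hc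

theorem IsWeakDeriv.ae_eq [CompleteSpace F] {b : κ → E} {j : ℕ} {w : Fin j → κ} {u u₁ u₂ : E → F}
    (h₁ : IsWeakDeriv b w u u₁) (h₂ : IsWeakDeriv b w u u₂) : u₁ =ᵐ[volume] u₂ := by
  refine ae_eq_of_integral_contDiff_smul_eq h₁.2.1 h₂.2.1 fun φ hφ hc => ?_
  have h := (h₁.2.2 φ hφ hc).symm.trans (h₂.2.2 φ hφ hc)
  exact smul_right_injective F (pow_ne_zero j (by norm_num : (-1 : ℝ) ≠ 0)) h

theorem contDiff_fderiv_apply_const {φ : E → ℝ} (hφ : ContDiff ℝ ∞ φ) (e : E) :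
    ContDiff ℝ ∞ (fun x => fderiv ℝ φ x e) :=
  (hφ.fderiv_right (m := ∞) (by norm_cast)).clm_apply contDiff_const

theorem hasCompactSupport_fderiv_apply_const {φ : E → ℝ} (hφ : HasCompactSupport φ) (e : E) :
    HasCompactSupport (fun x => fderiv ℝ φ x e) :=
  hφ.fderiv_apply (𝕜 := ℝ) e

theorem WD.add {b : κ → E} {i : κ} {u u' v v' : E → F} (h : WD b i u u') (h' : WD b i v v') :
    WD b i (fun x => u x + v x) (fun x => u' x + v' x) := by
  rw [wd_iff] at h h' ⊢
  refine ⟨h.1.add h'.1, h.2.1.add h'.2.1, fun φ hφ hc => ?_⟩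
  have hφ' := contDiff_fderiv_apply_const hφ (b i)
  have hc' := hasCompactSupport_fderiv_apply_const hc (b i)
  simp_rw [smul_add]
  rw [integral_add (integrable_smul_of_locallyIntegrable hφ'.continuous hc' h.1)
    (integrable_smul_of_locallyIntegrable hφ'.continuous hc' h'.1),
    integral_add (integrable_smul_of_locallyIntegrable hφ.continuous hc h.2.1)
    (integrable_smul_of_locallyIntegrable hφ.continuous hc h'.2.1),
    h.2.2 φ hφ hc, h'.2.2 φ hφ hc, neg_add]

theorem WD.clm [CompleteSpace F] [CompleteSpace F'] (A : F →L[ℝ] F') {b : κ → E} {i : κ}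
    {u u' : E → F} (h : WD b i u u') : WD b i (fun x => A (u x)) (fun x => A (u' x)) := by
  rw [wd_iff] at h ⊢
  have hA : ∀ {w : E → F}, LocallyIntegrable w volume →
      LocallyIntegrable (fun x => A (w x)) volume := fun hw x => by
    obtain ⟨s, hs, hi⟩ := hw x
    exact ⟨s, hs, A.integrable_comp hi⟩
  refine ⟨hA h.1, hA h.2.1, fun φ hφ hc => ?_⟩
  have hφ' := contDiff_fderiv_apply_const hφ (b i)
  have hc' := hasCompactSupport_fderiv_apply_const hc (b i)
  simp_rw [← map_smul]
  rw [A.integral_comp_comm (integrable_smul_of_locallyIntegrable hφ'.continuous hc' h.1),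
    A.integral_comp_comm (integrable_smul_of_locallyIntegrable hφ.continuous hc h.2.1),
    h.2.2 φ hφ hc, map_neg]

theorem WD.const_smul [CompleteSpace F] {b : κ → E} {i : κ} {u u' : E → F} (h : WD b i u u')
    (c : ℝ) : WD b i (fun x => c • u x) (fun x => c • u' x) := by
  simpa using h.clm (c • ContinuousLinearMap.id ℝ F)

theorem WD.neg [CompleteSpace F] {b : κ → E} {i : κ} {u u' : E → F} (h : WD b i u u') :
    WD b i (fun x => -u x) (fun x => -u' x) := by
  simpa using h.const_smul (-1)

theorem WD.sub [CompleteSpace F] {b : κ → E} {i : κ} {u u' v v' : E → F} (h : WD b i u u')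
    (h' : WD b i v v') : WD b i (fun x => u x - v x) (fun x => u' x - v' x) := by
  simpa [sub_eq_add_neg] using h.add h'.neg

theorem wd_zero {b : κ → E} {i : κ} : WD b i (fun _ => (0 : F)) (fun _ => 0) := by
  rw [wd_iff]
  exact ⟨locallyIntegrable_zero, locallyIntegrable_zero, fun φ _ _ => by simp⟩

theorem WD.sum {ι : Type*} {s : Finset ι} {b : κ → E} {i : κ} {u u' : ι → E → F}
    (h : ∀ c ∈ s, WD b i (u c) (u' c)) :
    WD b i (fun x => ∑ c ∈ s, u c x) (fun x => ∑ c ∈ s, u' c x) := by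
  classical
  induction s using Finset.induction_on with
  | empty => simpa using wd_zero
  | insert c s hc ih =>
    simp only [Finset.sum_insert hc]
    exact (h c (Finset.mem_insert_self _ _)).add
      (ih fun j hj => h j (Finset.mem_insert_of_mem hj))

/-- A classical derivative is a weak derivative. -/
theorem wd_of_contDiff {b : κ → E} {i : κ} {u : E → F} (hu : ContDiff ℝ 1 u) :
    WD b i u (fun x => fderiv ℝ u x (b i)) := by
  have h1 : Continuous fun x => fderiv ℝ u x (b i) :=
    (hu.continuous_fderiv one_ne_zero).clm_apply continuous_const
  rw [wd_iff]
  refine ⟨hu.continuous.locallyIntegrable, h1.locallyIntegrable, fun φ hφ hc => ?_⟩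
  have hφ' := contDiff_fderiv_apply_const hφ (b i)
  have hc' := hasCompactSupport_fderiv_apply_const hc (b i)
  have key := integral_smul_fderiv_eq_neg_fderiv_smul_of_integrable (𝕜 := ℝ) (μ := volume)
    (f := φ) (g := u) (v := b i)
    (integrable_smul_of_locallyIntegrable hφ'.continuous hc' hu.continuous.locallyIntegrable)
    (integrable_smul_of_locallyIntegrable hφ.continuous hc h1.locallyIntegrable)
    (integrable_smul_of_locallyIntegrable hφ.continuous hc hu.continuous.locallyIntegrable)
    (fun x _ => (hφ.differentiable (by simp)) x)
    (fun x _ => (hu.differentiable one_ne_zero) x)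
  rw [key, neg_neg]

/-! ### The Sobolev norm as a recursion on first-order derivatives -/

variable [Fintype κ]

/-- By uniqueness of weak derivatives, any family of them computes the infimum in the definition of
the Sobolev norm. -/
theorem sobNorm_eq [CompleteSpace F] {b : κ → E} {k : ℕ} {u : E → F}
    {D : (j : ℕ) → (Fin j → κ) → E → F}
    (hD : ∀ j ≤ k, ∀ w : Fin j → κ, IsWeakDeriv b w u (D j w)) :
    sobNorm b k u =
      (∑ j ∈ Finset.range (k + 1), ∑ w : Fin j → κ, eLpNorm (D j w) 2 volume ^ 2) ^ (1 / 2 : ℝ) := by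
  refine le_antisymm (iInf₂_le D hD) (le_iInf₂ fun D' hD' => le_of_eq ?_)
  congr 1
  refine Finset.sum_congr rfl fun j hj => Finset.sum_congr rfl fun w _ => ?_
  have hj : j ≤ k := by simpa [Nat.lt_succ_iff] using hj
  rw [eLpNorm_congr_ae ((hD j hj w).ae_eq (hD' j hj w))]

theorem exists_of_sobNorm_lt_top {b : κ → E} {k : ℕ} {u : E → F} (h : sobNorm b k u < ⊤) :
    ∃ D : (j : ℕ) → (Fin j → κ) → E → F, ∀ j ≤ k, ∀ w : Fin j → κ, IsWeakDeriv b w u (D j w) := by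
  obtain ⟨D, hD⟩ := iInf_lt_iff.1 h
  obtain ⟨hD', -⟩ := iInf_lt_iff.1 hD
  exact ⟨D, hD'⟩

theorem isWeakDeriv_zero {b : κ → E} {w : Fin 0 → κ} {u : E → F}
    (hu : LocallyIntegrable u volume) : IsWeakDeriv b w u u :=
  ⟨hu, hu, fun φ _ _ => by simp⟩

theorem locallyIntegrable_of_sobNorm_lt_top {b : κ → E} {k : ℕ} {u : E → F}
    (h : sobNorm b k u < ⊤) : LocallyIntegrable u volume := by
  obtain ⟨D, hD⟩ := exists_of_sobNorm_lt_top h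
  exact (hD 0 (Nat.zero_le _) default).1

theorem eLpNorm_le_sobNorm [CompleteSpace F] (b : κ → E) (k : ℕ) (u : E → F) :
    eLpNorm u 2 volume ≤ sobNorm b k u := by
  refine le_iInf₂ fun D hD => ?_
  have h0 := hD 0 (Nat.zero_le _) default
  rw [eLpNorm_congr_ae ((isWeakDeriv_zero h0.1).ae_eq h0)]
  calc eLpNorm (D 0 default) 2 volume
      = (eLpNorm (D 0 default) 2 volume ^ 2) ^ (1 / 2 : ℝ) := by
        rw [← ENNReal.rpow_natCast, ← ENNReal.rpow_mul]; norm_num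
    _ ≤ _ := by
        gcongr
        calc _ = ∑ w : Fin 0 → κ, eLpNorm (D 0 w) 2 volume ^ 2 := by simp
          _ ≤ _ := Finset.single_le_sum (f := fun j => ∑ w : Fin j → κ,
            eLpNorm (D j w) 2 volume ^ 2) (fun _ _ => zero_le) (by simp)

theorem memLp_of_sobNorm_lt_top [CompleteSpace F] {b : κ → E} {k : ℕ} {u : E → F}
    (h : sobNorm b k u < ⊤) : MemLp u 2 volume :=
  ⟨(locallyIntegrable_of_sobNorm_lt_top h).aestronglyMeasurable,
    (eLpNorm_le_sobNorm b k u).trans_lt h⟩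

theorem sobNorm_zero_le {b : κ → E} {u : E → F} (hu : LocallyIntegrable u volume) :
    sobNorm b 0 u ≤ eLpNorm u 2 volume := by
  refine (iInf₂_le (fun _ _ => u) fun j hj w => ?_).trans ?_
  · obtain rfl : j = 0 := by omega
    exact isWeakDeriv_zero hu
  · rw [zero_add, Finset.sum_range_one, Fintype.sum_unique, ← ENNReal.rpow_natCast,
      ← ENNReal.rpow_mul]
    norm_num

theorem sobNorm_mono (b : κ → E) {s t : ℕ} (hst : s ≤ t) (u : E → F) :
    sobNorm b s u ≤ sobNorm b t u := by
  refine le_iInf₂ fun D hD => (iInf₂_le D fun j hj => hD j (hj.trans hst)).trans ?_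
  gcongr

theorem exists_wd_of_sobNorm_lt_top {b : κ → E} {s : ℕ} {u : E → F}
    (h : sobNorm b (s + 1) u < ⊤) (i : κ) : ∃ u', WD b i u u' := by
  obtain ⟨D, hD⟩ := exists_of_sobNorm_lt_top h
  exact ⟨_, hD 1 (by omega) fun _ => i⟩

/-- Words of length `j + 1` split into their first letter and the rest. -/
theorem sum_cons {j : ℕ} (f : (Fin (j + 1) → κ) → ℝ≥0∞) :
    ∑ w, f w = ∑ i : κ, ∑ w : Fin j → κ, f (Fin.cons i w) := by
  rw [← (Fin.consEquiv fun _ : Fin (j + 1) => κ).sum_comp, Fintype.sum_prod_type]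
  rfl

/-- Differentiation loses one order.  Together with `sobNorm_succ_le` this is the recursion on which
all the inductions over the order of a Sobolev norm rest. -/
theorem sobNorm_wd_le {b : κ → E} {s : ℕ} {u u' : E → F} {i : κ} (h : WD b i u u') :
    sobNorm b s u' ≤ sobNorm b (s + 1) u := by
  refine le_iInf₂ fun D hD => (iInf₂_le (fun j w => D (j + 1) (Fin.cons i w))
    fun j hj w => IsWeakDeriv.tail h (hD (j + 1) (by omega) _)).trans ?_
  gcongr
  rw [Finset.sum_range_succ' _ (s + 1)]
  refine le_trans (Finset.sum_le_sum fun j _ => ?_) le_self_add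
  rw [sum_cons]
  exact Finset.single_le_sum (f := fun i => ∑ w : Fin j → κ,
    eLpNorm (D (j + 1) (Fin.cons i w)) 2 volume ^ 2) (fun _ _ => zero_le) (Finset.mem_univ i)

theorem sum_sq_le_sq_sum {ι : Type*} (s : Finset ι) (f : ι → ℝ≥0∞) :
    ∑ i ∈ s, f i ^ 2 ≤ (∑ i ∈ s, f i) ^ 2 := by
  classical
  induction s using Finset.induction_on with
  | empty => simp
  | insert i s hi ih =>
    rw [Finset.sum_insert hi, Finset.sum_insert hi, add_sq]
    calc f i ^ 2 + ∑ i ∈ s, f i ^ 2 ≤ f i ^ 2 + (∑ i ∈ s, f i) ^ 2 := by gcongr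
      _ ≤ _ := by gcongr; exact le_self_add

/-- The `H^{s+1}` norm is controlled by the `L²` norm and the `H^s` norms of the first-order weak
derivatives. -/
theorem sobNorm_succ_le [CompleteSpace F] {b : κ → E} {s : ℕ} {u : E → F} {u' : κ → E → F}
    (hu : LocallyIntegrable u volume) (h : ∀ i, WD b i u (u' i)) :
    sobNorm b (s + 1) u ≤ eLpNorm u 2 volume + ∑ i, sobNorm b s (u' i) := by
  by_cases hfin : ∀ i, sobNorm b s (u' i) < ⊤
  · choose D hD using fun i => exists_of_sobNorm_lt_top (hfin i)
    let D' : (j : ℕ) → (Fin j → κ) → E → F := fun j => match j with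
      | 0 => fun _ => u
      | j + 1 => fun w => D (w 0) j (Fin.tail w)
    have hD' : ∀ j ≤ s + 1, ∀ w : Fin j → κ, IsWeakDeriv b w u (D' j w) := by
      intro j hj w
      match j, hj, w with
      | 0, _, w => exact isWeakDeriv_zero hu
      | j + 1, hj, w =>
        have := IsWeakDeriv.cons (h (w 0)) (hD (w 0) j (by omega) (Fin.tail w))
        rwa [Fin.cons_self_tail] at this
    refine (iInf₂_le D' hD').trans ?_
    simp_rw [sobNorm_eq (hD _)]
    rw [Finset.sum_range_succ' _ (s + 1)]
    simp_rw [sum_cons]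
    have e1 : ∑ w : Fin 0 → κ, eLpNorm (D' 0 w) 2 volume ^ 2 = eLpNorm u 2 volume ^ 2 := by
      simp [D']
    have e2 : ∑ j ∈ Finset.range (s + 1), ∑ i, ∑ w : Fin j → κ,
        eLpNorm (D' (j + 1) (Fin.cons i w)) 2 volume ^ 2 = ∑ i, ((∑ j ∈ Finset.range (s + 1),
          ∑ w : Fin j → κ, eLpNorm (D i j w) 2 volume ^ 2) ^ (1 / 2 : ℝ)) ^ 2 := by
      rw [Finset.sum_comm]
      refine Finset.sum_congr rfl fun i _ => ?_
      rw [← ENNReal.rpow_natCast, ← ENNReal.rpow_mul]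
      norm_num [D']
    rw [e1, e2]
    refine (ENNReal.rpow_le_rpow (z := 1 / 2) (y := (eLpNorm u 2 volume + ∑ i,
      (∑ j ∈ Finset.range (s + 1), ∑ w : Fin j → κ, eLpNorm (D i j w) 2 volume ^ 2) ^
        (1 / 2 : ℝ)) ^ 2) ?_ (by norm_num)).trans ?_
    · rw [add_sq]
      calc _ ≤ _ := add_le_add_left (sum_sq_le_sq_sum _ _) _
        _ ≤ _ := by
          rw [add_comm]
          gcongr
          exact le_self_add
    · rw [← ENNReal.rpow_natCast, ← ENNReal.rpow_mul]
      norm_num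
  · push Not at hfin
    obtain ⟨i, hi⟩ := hfin
    have : ∑ i, sobNorm b s (u' i) = ⊤ :=
      ENNReal.sum_eq_top.2 ⟨i, Finset.mem_univ i, top_le_iff.1 hi⟩
    simp [this]

theorem sobNorm_congr {b : κ → E} {s : ℕ} {u v : E → F} (h : u =ᵐ[volume] v) :
    sobNorm b s u = sobNorm b s v := by
  have key : ∀ {u v : E → F}, u =ᵐ[volume] v → ∀ {j : ℕ} {w : Fin j → κ} {u' : E → F},
      IsWeakDeriv b w u u' → IsWeakDeriv b w v u' := by
    intro u v h j w u' hw
    refine ⟨(locallyIntegrable_congr h).1 hw.1, hw.2.1, fun φ hφ hc => ?_⟩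
    rw [← hw.2.2 φ hφ hc]
    exact integral_congr_ae (h.mono fun x hx => by simp only [hx])
  refine le_antisymm (le_iInf₂ fun D hD => ?_) (le_iInf₂ fun D hD => ?_)
  · exact iInf₂_le D fun j hj w => key h.symm (hD j hj w)
  · exact iInf₂_le D fun j hj w => key h (hD j hj w)

/-- The triangle inequality in `H^s`, up to a constant. -/
theorem exists_sobNorm_add_le [CompleteSpace F] (b : κ → E) (s : ℕ) :
    ∃ C : ℝ≥0, ∀ u v : E → F,
      sobNorm b s (fun x => u x + v x) ≤ C * (sobNorm b s u + sobNorm b s v) := by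
  induction s with
  | zero =>
    refine ⟨1, fun u v => ?_⟩
    by_cases hf : sobNorm b 0 u < ⊤ ∧ sobNorm b 0 v < ⊤
    · have hu := memLp_of_sobNorm_lt_top hf.1
      have hv := memLp_of_sobNorm_lt_top hf.2
      refine (sobNorm_zero_le ((locallyIntegrable_of_sobNorm_lt_top hf.1).add
        (locallyIntegrable_of_sobNorm_lt_top hf.2))).trans ?_
      refine (eLpNorm_add_le hu.1 hv.1 (by norm_num)).trans ?_
      simpa using add_le_add (eLpNorm_le_sobNorm b 0 u) (eLpNorm_le_sobNorm b 0 v)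
    · have : sobNorm b 0 u + sobNorm b 0 v = ⊤ := by
        rw [ENNReal.add_eq_top]; by_contra hc; push Not at hc
        exact hf ⟨lt_top_iff_ne_top.2 hc.1, lt_top_iff_ne_top.2 hc.2⟩
      simp [this]
  | succ s ih =>
    obtain ⟨C, hC⟩ := ih
    refine ⟨1 + Fintype.card κ * C, fun u v => ?_⟩
    by_cases hf : sobNorm b (s + 1) u < ⊤ ∧ sobNorm b (s + 1) v < ⊤
    · choose u' hu' using exists_wd_of_sobNorm_lt_top hf.1
      choose v' hv' using exists_wd_of_sobNorm_lt_top hf.2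
      have hu := memLp_of_sobNorm_lt_top hf.1
      have hv := memLp_of_sobNorm_lt_top hf.2
      refine (sobNorm_succ_le ((locallyIntegrable_of_sobNorm_lt_top hf.1).add
        (locallyIntegrable_of_sobNorm_lt_top hf.2)) fun i => (hu' i).add (hv' i)).trans ?_
      have h1 := (eLpNorm_add_le hu.1 hv.1 (by norm_num)).trans
        (add_le_add (eLpNorm_le_sobNorm b (s + 1) u) (eLpNorm_le_sobNorm b (s + 1) v))
      have h2 : ∀ i, sobNorm b s (fun x => u' i x + v' i x) ≤
          C * (sobNorm b (s + 1) u + sobNorm b (s + 1) v) := fun i =>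
        (hC _ _).trans (by gcongr <;> [exact sobNorm_wd_le (hu' i); exact sobNorm_wd_le (hv' i)])
      refine (add_le_add h1 (Finset.sum_le_sum fun i _ => h2 i)).trans (le_of_eq ?_)
      simp only [Finset.sum_const, Finset.card_univ, nsmul_eq_mul]
      push_cast
      ring
    · have : sobNorm b (s + 1) u + sobNorm b (s + 1) v = ⊤ := by
        rw [ENNReal.add_eq_top]; by_contra hc; push Not at hc
        exact hf ⟨lt_top_iff_ne_top.2 hc.1, lt_top_iff_ne_top.2 hc.2⟩
      rw [this, ENNReal.mul_top (by positivity)]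
      exact le_top

/-- A bounded linear map acts on `H^s` through the values. -/
theorem exists_sobNorm_clm_le [CompleteSpace F] [CompleteSpace F'] (b : κ → E) (s : ℕ) :
    ∃ C : ℝ≥0, ∀ (A : F →L[ℝ] F') (u : E → F), sobNorm b s u < ⊤ →
      sobNorm b s (fun x => A (u x)) ≤ C * (‖A‖ₑ * sobNorm b s u) := by
  have h0 : ∀ (A : F →L[ℝ] F') (u : E → F),
      eLpNorm (fun x => A (u x)) 2 volume ≤ ‖A‖ₑ * eLpNorm u 2 volume := fun A u =>
    eLpNorm_le_nnreal_smul_eLpNorm_of_ae_le_mul (c := ‖A‖₊)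
      (.of_forall fun x => A.le_opNNNorm (u x)) 2
  have hloc : ∀ (A : F →L[ℝ] F') (u : E → F), MemLp u 2 volume →
      LocallyIntegrable (fun x => A (u x)) volume := fun A u hu =>
    (A.comp_memLp' hu).locallyIntegrable (by norm_num)
  induction s with
  | zero =>
    refine ⟨1, fun A u hf => (sobNorm_zero_le (hloc A u (memLp_of_sobNorm_lt_top hf))).trans ?_⟩
    refine (h0 A u).trans ?_
    rw [ENNReal.coe_one, one_mul]
    gcongr
    exact eLpNorm_le_sobNorm b 0 u
  | succ s ih =>
    obtain ⟨C, hC⟩ := ih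
    refine ⟨1 + Fintype.card κ * C, fun A u hf => ?_⟩
    choose u' hu' using exists_wd_of_sobNorm_lt_top hf
    refine (sobNorm_succ_le (hloc A u (memLp_of_sobNorm_lt_top hf))
      fun i => (hu' i).clm A).trans ?_
    have h1 : eLpNorm (fun x => A (u x)) 2 volume ≤ ‖A‖ₑ * sobNorm b (s + 1) u :=
      (h0 A u).trans (by gcongr; exact eLpNorm_le_sobNorm b _ u)
    have h2 : ∀ i, sobNorm b s (fun x => A (u' i x)) ≤ C * (‖A‖ₑ * sobNorm b (s + 1) u) :=
      fun i => (hC A _ ((sobNorm_wd_le (hu' i)).trans_lt hf)).trans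
        (by gcongr; exact sobNorm_wd_le (hu' i))
    refine (add_le_add h1 (Finset.sum_le_sum fun i _ => h2 i)).trans (le_of_eq ?_)
    simp only [Finset.sum_const, Finset.card_univ, nsmul_eq_mul]
    push_cast
    ring

end Weak

end PlanarWave

namespace PlanarWave

open scoped NNReal Convolution Topology
open Filter

/-! ### Weak limits in `L²` -/

section WeakLimit

variable {α : Type*} [MeasurableSpace α] {μ : Measure α}

/-- Fatou: an `L²` bound passes to the almost everywhere limit. -/
theorem eLpNorm_le_of_ae_tendsto_of_bound {f : ℕ → α → ℝ} {g : α → ℝ} {C : ℝ≥0∞}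
    (hf : ∀ n, AEStronglyMeasurable (f n) μ) (hC : ∀ n, eLpNorm (f n) 2 μ ≤ C)
    (hlim : ∀ᵐ x ∂μ, Tendsto (fun n => f n x) atTop (𝓝 (g x))) : eLpNorm g 2 μ ≤ C := by
  refine (Lp.eLpNorm_lim_le_liminf_eLpNorm hf g hlim).trans ?_
  refine (liminf_le_liminf (.of_forall hC)).trans ?_
  simp

theorem lintegral_sq_eq_eLpNorm (f : α → ℝ) : ∫⁻ x, ‖f x‖ₑ ^ 2 ∂μ = eLpNorm f 2 μ ^ 2 := by
  rw [eLpNorm_eq_lintegral_rpow_enorm_toReal (by norm_num) (by norm_num), ← ENNReal.rpow_natCast,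
    ← ENNReal.rpow_mul]
  norm_num

/-- A sequence bounded in `L²` that converges almost everywhere converges weakly in `L²`:
where `|f_n - g| ≤ c |h|` dominated convergence applies, and elsewhere
`|h| |f_n - g| ≤ c⁻¹ |f_n - g|²` is small when `c` is large. -/
theorem tendsto_integral_mul_of_ae_tendsto {f : ℕ → α → ℝ} {g h : α → ℝ} {C : ℝ≥0}
    (hf : ∀ n, AEStronglyMeasurable (f n) μ) (hC : ∀ n, eLpNorm (f n) 2 μ ≤ C)
    (hlim : ∀ᵐ x ∂μ, Tendsto (fun n => f n x) atTop (𝓝 (g x))) (hh : MemLp h 2 μ) :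
    Tendsto (fun n => ∫ x, h x * f n x ∂μ) atTop (𝓝 (∫ x, h x * g x ∂μ)) := by
  have hg : AEStronglyMeasurable g μ := aestronglyMeasurable_of_tendsto_ae _ hf hlim
  have hgC := eLpNorm_le_of_ae_tendsto_of_bound hf hC hlim
  have hgm : MemLp g 2 μ := ⟨hg, hgC.trans_lt ENNReal.coe_lt_top⟩
  have hfm : ∀ n, MemLp (f n) 2 μ := fun n => ⟨hf n, (hC n).trans_lt ENNReal.coe_lt_top⟩
  have hd : ∀ n, ∫⁻ x, ‖f n x - g x‖ₑ ^ 2 ∂μ ≤ (2 * C) ^ 2 := fun n => by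
    rw [lintegral_sq_eq_eLpNorm (fun x => f n x - g x)]
    gcongr
    refine (eLpNorm_sub_le (hf n) hg (by norm_num)).trans ?_
    rw [two_mul]
    exact add_le_add (hC n) hgC
  refine tendsto_integral_of_L1 _ (hh.integrable_mul hgm).1
    (.of_forall fun n => hh.integrable_mul (hfm n)) ?_
  rw [ENNReal.tendsto_nhds_zero]
  intro ε hε
  obtain ⟨c, hc0, hc⟩ : ∃ c : ℝ≥0, c ≠ 0 ∧ (c : ℝ≥0∞)⁻¹ * (2 * C) ^ 2 ≤ ε / 2 := by
    have hε2 : ε / 2 ≠ 0 := (ENNReal.half_pos hε.ne').ne'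
    have hlt : ∃ c : ℝ≥0, (2 * (C : ℝ≥0∞)) ^ 2 / (ε / 2) < c :=
      ENNReal.lt_iff_exists_nnreal_btwn.1 (lt_top_iff_ne_top.2
        (ENNReal.div_ne_top (by finiteness) hε2)) |>.imp fun c hc => hc.1
    obtain ⟨c, hc⟩ := hlt
    have hc0 : c ≠ 0 := by rintro rfl; simp at hc
    refine ⟨c, hc0, ?_⟩
    rw [mul_comm (c : ℝ≥0∞)⁻¹, ← div_eq_mul_inv]
    refine ENNReal.div_le_of_le_mul ?_
    by_cases hε' : ε / 2 = ⊤
    · rw [hε', ENNReal.top_mul (by simpa using hc0)]; exact le_top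
    · rw [mul_comm (ε / 2)]
      exact (ENNReal.div_le_iff hε2 hε').1 hc.le
  have hcc : (c : ℝ≥0∞) ≠ 0 := by simpa using hc0
  let G : ℕ → α → ℝ≥0∞ := fun n x => min (‖h x‖ₑ * ‖f n x - g x‖ₑ) (c * ‖h x‖ₑ ^ 2)
  have hGm : ∀ n, AEMeasurable (G n) μ := fun n =>
    (hh.1.enorm.mul ((hf n).sub hg).enorm).min ((hh.1.enorm.pow_const 2).const_mul _)
  have hG : Tendsto (fun n => ∫⁻ x, G n x ∂μ) atTop (𝓝 (∫⁻ _, 0 ∂μ)) := by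
    refine tendsto_lintegral_of_dominated_convergence' (fun x => c * ‖h x‖ₑ ^ 2) hGm
      (fun n => .of_forall fun x => min_le_right _ _) ?_ ?_
    · rw [lintegral_const_mul' _ _ ENNReal.coe_ne_top, lintegral_sq_eq_eLpNorm]
      have := hh.2
      finiteness
    · filter_upwards [hlim] with x hx
      have h1 : Tendsto (fun n => ‖f n x - g x‖ₑ) atTop (𝓝 0) := by
        have := (hx.sub_const (g x)).enorm
        simpa using this
      have h2 : Tendsto (fun n => ‖h x‖ₑ * ‖f n x - g x‖ₑ) atTop (𝓝 0) := by
        simpa using ENNReal.Tendsto.const_mul h1 (Or.inr (by simp : ‖h x‖ₑ ≠ ⊤))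
      exact tendsto_of_tendsto_of_tendsto_of_le_of_le tendsto_const_nhds h2
        (fun n => zero_le) (fun n => min_le_left _ _)
  rw [lintegral_zero, ENNReal.tendsto_nhds_zero] at hG
  filter_upwards [hG (ε / 2) (ENNReal.half_pos hε.ne')] with n hn
  calc ∫⁻ x, ‖h x * f n x - h x * g x‖ₑ ∂μ
      ≤ ∫⁻ x, (G n x + (c : ℝ≥0∞)⁻¹ * ‖f n x - g x‖ₑ ^ 2) ∂μ := by
        refine lintegral_mono fun x => ?_
        rw [← mul_sub, enorm_mul]
        rcases le_total (‖f n x - g x‖ₑ) (c * ‖h x‖ₑ) with hle | hle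
        · have : ‖h x‖ₑ * ‖f n x - g x‖ₑ ≤ c * ‖h x‖ₑ ^ 2 := by
            calc _ ≤ ‖h x‖ₑ * (c * ‖h x‖ₑ) := by gcongr
              _ = _ := by ring
          simp only [G, min_eq_left this]
          exact le_self_add
        · refine le_trans ?_ le_add_self
          have : ‖h x‖ₑ ≤ (c : ℝ≥0∞)⁻¹ * ‖f n x - g x‖ₑ := by
            rw [mul_comm, ← div_eq_mul_inv, ENNReal.le_div_iff_mul_le (Or.inl hcc)
              (Or.inl ENNReal.coe_ne_top), mul_comm]
            exact hle
          calc _ ≤ ((c : ℝ≥0∞)⁻¹ * ‖f n x - g x‖ₑ) * ‖f n x - g x‖ₑ := by gcongr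
            _ = _ := by ring
    _ = ∫⁻ x, G n x ∂μ + (c : ℝ≥0∞)⁻¹ * ∫⁻ x, ‖f n x - g x‖ₑ ^ 2 ∂μ := by
        rw [lintegral_add_left' (hGm n), lintegral_const_mul' _ _ (by simpa using hc0)]
    _ ≤ ε / 2 + ε / 2 := by
        refine add_le_add hn (le_trans ?_ hc)
        gcongr
        exact hd n
    _ = ε := ENNReal.add_halves ε

end WeakLimit

/-! ### Young's inequality and mollification -/

section Mollify

variable {κ E : Type*} [NormedAddCommGroup E] [NormedSpace ℝ E] [FiniteDimensional ℝ E]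
  [MeasureSpace E] [BorelSpace E] [(volume : Measure E).IsAddHaarMeasure]

/-- Young's inequality `‖A * B‖_{L²} ≤ ‖A‖_{L²} ‖B‖_{L¹}` for non-negative functions. -/
theorem lintegral_sq_convolution_le {A B : E → ℝ≥0∞} (hA : Measurable A) (hB : Measurable B) :
    ∫⁻ x, (∫⁻ t, B t * A (x - t)) ^ 2 ≤ (∫⁻ t, B t) ^ 2 * ∫⁻ x, A x ^ 2 := by
  have h1 : ∀ x, (∫⁻ t, B t * A (x - t)) ^ 2 ≤ (∫⁻ t, B t) * ∫⁻ t, B t * A (x - t) ^ 2 := by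
    intro x
    have hAx : Measurable fun t => A (x - t) := hA.comp (measurable_const.sub measurable_id)
    have := ENNReal.lintegral_mul_le_Lp_mul_Lq volume Real.HolderConjugate.two_two
      (f := fun t => B t ^ (1 / 2 : ℝ)) (g := fun t => B t ^ (1 / 2 : ℝ) * A (x - t))
      (hB.pow_const _).aemeasurable ((hB.pow_const _).mul hAx).aemeasurable
    have e0 : ∀ t, B t ^ (1 / 2 : ℝ) * B t ^ (1 / 2 : ℝ) = B t := fun t => by
      rw [← ENNReal.rpow_add_of_nonneg _ _ (by norm_num) (by norm_num)]; norm_num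
    have e1 : ∀ t, ((fun t => B t ^ (1 / 2 : ℝ)) * fun t => B t ^ (1 / 2 : ℝ) * A (x - t)) t =
        B t * A (x - t) := fun t => by simp only [Pi.mul_apply, ← mul_assoc, e0]
    have e2 : ∀ t, (B t ^ (1 / 2 : ℝ)) ^ (2 : ℝ) = B t := fun t => by
      rw [← ENNReal.rpow_mul]; norm_num
    have e3 : ∀ t, (B t ^ (1 / 2 : ℝ) * A (x - t)) ^ (2 : ℝ) = B t * A (x - t) ^ 2 := fun t => by
      rw [ENNReal.mul_rpow_of_nonneg _ _ (by norm_num), e2]; norm_num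
    simp_rw [e1, e2, e3] at this
    calc _ ≤ ((∫⁻ t, B t) ^ (1 / 2 : ℝ) * (∫⁻ t, B t * A (x - t) ^ 2) ^ (1 / 2 : ℝ)) ^ 2 := by
          gcongr
      _ = _ := by
          rw [mul_pow, ← ENNReal.rpow_natCast, ← ENNReal.rpow_natCast, ← ENNReal.rpow_mul,
            ← ENNReal.rpow_mul]
          norm_num
  have hm : Measurable fun z : E × E => B z.2 * A (z.1 - z.2) ^ 2 :=
    (hB.comp measurable_snd).mul ((hA.comp (measurable_fst.sub measurable_snd)).pow_const 2)
  calc _ ≤ ∫⁻ x, (∫⁻ t, B t) * ∫⁻ t, B t * A (x - t) ^ 2 := lintegral_mono h1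
    _ = (∫⁻ t, B t) * ∫⁻ x, ∫⁻ t, B t * A (x - t) ^ 2 :=
        lintegral_const_mul _ hm.lintegral_prod_right'
    _ = (∫⁻ t, B t) * ∫⁻ t, ∫⁻ x, B t * A (x - t) ^ 2 := by
        rw [lintegral_lintegral_swap hm.aemeasurable]
    _ = (∫⁻ t, B t) * ∫⁻ t, B t * ∫⁻ x, A x ^ 2 := by
        congr 1
        refine lintegral_congr fun t => ?_
        have hAt : Measurable fun x => A (x - t) := hA.comp (measurable_id.sub measurable_const)
        rw [lintegral_const_mul _ (hAt.pow_const 2), lintegral_sub_right_eq_self (fun x => A x ^ 2) t]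
    _ = _ := by rw [lintegral_mul_const _ hB]; ring

variable (E) in
/-- A sequence of bump functions shrinking to the origin. -/
noncomputable def bump (n : ℕ) : ContDiffBump (0 : E) where
  rIn := 1 / (n + 1)
  rOut := 2 / (n + 1)
  rIn_pos := by positivity
  rIn_lt_rOut := by gcongr; norm_num

/-- The mollification of `u` with the `n`-th bump function. -/
noncomputable def mol (n : ℕ) (u : E → ℝ) : E → ℝ :=
  (bump E n).normed volume ⋆[ContinuousLinearMap.lsmul ℝ ℝ, volume] u

theorem mol_apply (n : ℕ) (u : E → ℝ) (x : E) :
    mol n u x = ∫ t, (bump E n).normed volume t * u (x - t) := rfl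

theorem mol_apply_swap (n : ℕ) (u : E → ℝ) (x : E) :
    mol n u x = ∫ t, (bump E n).normed volume (x - t) * u t := by
  rw [mol, convolution_eq_swap]; rfl

theorem contDiff_mol (n : ℕ) {u : E → ℝ} (hu : LocallyIntegrable u volume) :
    ContDiff ℝ ∞ (mol n u) :=
  (bump E n).hasCompactSupport_normed.contDiff_convolution_left _ (bump E n).contDiff_normed hu

theorem ae_tendsto_mol {u : E → ℝ} (hu : LocallyIntegrable u volume) :
    ∀ᵐ x, Tendsto (fun n => mol n u x) atTop (𝓝 (u x)) := by
  refine ContDiffBump.ae_convolution_tendsto_right_of_locallyIntegrable (K := 2) ?_ ?_ hu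
  · have : Tendsto (fun n : ℕ => 2 * (1 / ((n : ℝ) + 1))) atTop (𝓝 (2 * 0)) :=
      tendsto_one_div_add_atTop_nhds_zero_nat.const_mul 2
    simpa [bump, div_eq_mul_inv] using this
  · exact .of_forall fun n => le_of_eq (by simp [bump, div_eq_mul_inv])

/-- Mollification commutes with weak differentiation. -/
theorem fderiv_mol {b : κ → E} {i : κ} {u u' : E → ℝ} (h : WD b i u u') (n : ℕ) (x : E) :
    fderiv ℝ (mol n u) x (b i) = mol n u' x := by
  rw [wd_iff] at h
  have hs : ContDiff ℝ ∞ ((bump E n).normed (volume : Measure E)) := (bump E n).contDiff_normed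
  have hc := (bump E n).hasCompactSupport_normed (μ := (volume : Measure E))
  have hd := hc.hasFDerivAt_convolution_left (ContinuousLinearMap.lsmul ℝ ℝ)
    (hs.of_le (by norm_cast)) h.1 x
  have hcd : HasCompactSupport (fderiv ℝ ((bump E n).normed (volume : Measure E))) := hc.fderiv ℝ
  rw [mol, hd.fderiv, convolution_eq_swap, ContinuousLinearMap.integral_apply]
  · have hφ : ContDiff ℝ ∞ fun t => (bump E n).normed volume (x - t) :=
      hs.comp (contDiff_const.sub contDiff_id)
    have hcφ : HasCompactSupport fun t => (bump E n).normed volume (x - t) :=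
      hc.comp_homeomorph (Homeomorph.subLeft x)
    have hder : ∀ t, fderiv ℝ (fun t => (bump E n).normed volume (x - t)) t (b i) =
        -fderiv ℝ ((bump E n).normed volume) (x - t) (b i) := fun t => by
      have h1 : HasFDerivAt (fun t : E => x - t) (-(ContinuousLinearMap.id ℝ E)) t :=
        (hasFDerivAt_id t).const_sub x
      have h2 := ((hs.differentiable (by simp)) (x - t)).hasFDerivAt.comp t h1
      have h3 : fderiv ℝ (fun t => (bump E n).normed volume (x - t)) t = _ := h2.fderiv
      rw [h3]
      simp
    have key := h.2.2 _ hφ hcφ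
    simp_rw [hder, neg_smul] at key
    rw [integral_neg, neg_inj] at key
    rw [mol_apply_swap]
    exact key
  · have := (hcd.convolutionExists_left (L := (ContinuousLinearMap.lsmul ℝ ℝ).precompL E)
      (hs.continuous_fderiv (by simp)) h.1) x
    exact (convolutionExistsAt_iff_integrable_swap).1 this

theorem mol_congr {u v : E → ℝ} (h : u =ᵐ[volume] v) (n : ℕ) : mol n u = mol n v := by
  ext x
  rw [mol_apply_swap, mol_apply_swap]
  exact integral_congr_ae (h.mono fun t ht => by simp only [ht])

theorem abs_mol_le {u : E → ℝ} {R : ℝ} (hu : ∀ᵐ x, |u x| ≤ R) (n : ℕ) (x : E) :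
    |mol n u x| ≤ R := by
  rw [mol_apply_swap]
  have hs : Continuous ((bump E n).normed (volume : Measure E)) := (bump E n).continuous_normed
  have hc := (bump E n).hasCompactSupport_normed (μ := (volume : Measure E))
  have hi : Integrable fun t => (bump E n).normed volume (x - t) :=
    (hs.integrable_of_hasCompactSupport hc).comp_sub_left x
  rw [← Real.norm_eq_abs]
  calc ‖∫ t, (bump E n).normed volume (x - t) * u t‖
      ≤ ∫ t, (bump E n).normed volume (x - t) * R := by
        refine norm_integral_le_of_norm_le (hi.mul_const R) (hu.mono fun t (ht : |u t| ≤ R) => ?_)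
        rw [norm_mul, Real.norm_of_nonneg ((bump E n).nonneg_normed _)]
        exact mul_le_mul_of_nonneg_left ht ((bump E n).nonneg_normed _)
    _ = R := by
        rw [integral_mul_const, integral_sub_left_eq_self, (bump E n).integral_normed, one_mul]

theorem eLpNorm_mol_le {u : E → ℝ} (hu : MemLp u 2 volume) (n : ℕ) :
    eLpNorm (mol n u) 2 volume ≤ eLpNorm u 2 volume := by
  obtain ⟨v, hv', huv⟩ := hu.1
  have hv : Measurable v := hv'.measurable
  rw [mol_congr huv, eLpNorm_congr_ae huv]
  have hs : Continuous ((bump E n).normed (volume : Measure E)) := (bump E n).continuous_normed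
  have hc := (bump E n).hasCompactSupport_normed (μ := (volume : Measure E))
  have h1 : ∫⁻ t, ‖(bump E n).normed (volume : Measure E) t‖ₑ = 1 := by
    have := ofReal_integral_eq_lintegral_ofReal (μ := volume) (hs.integrable_of_hasCompactSupport hc)
      (.of_forall fun x => (bump E n).nonneg_normed x)
    rw [(bump E n).integral_normed, ENNReal.ofReal_one] at this
    rw [this]
    exact lintegral_congr fun t => Real.enorm_of_nonneg ((bump E n).nonneg_normed _)
  have h2 : eLpNorm (mol n v) 2 volume ^ 2 ≤ eLpNorm v 2 volume ^ 2 := by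
    rw [← lintegral_sq_eq_eLpNorm, ← lintegral_sq_eq_eLpNorm]
    calc ∫⁻ x, ‖mol n v x‖ₑ ^ 2
        ≤ ∫⁻ x, (∫⁻ t, ‖(bump E n).normed (volume : Measure E) t‖ₑ * ‖v (x - t)‖ₑ) ^ 2 := by
          refine lintegral_mono fun x => ?_
          gcongr
          rw [mol_apply]
          refine (enorm_integral_le_lintegral_enorm _).trans (le_of_eq ?_)
          simp_rw [enorm_mul]
      _ ≤ _ := lintegral_sq_convolution_le (A := fun x => ‖v x‖ₑ) hv.enorm hs.measurable.enorm
      _ = _ := by rw [h1]; simp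
  exact (ENNReal.pow_le_pow_left_iff two_ne_zero).1 h2

end Mollify

end PlanarWave

namespace PlanarWave

open scoped NNReal Convolution Topology
open Filter

/-! ### The product and chain rules for weak derivatives -/

section Rules

variable {κ E : Type*} [NormedAddCommGroup E] [NormedSpace ℝ E] [FiniteDimensional ℝ E]
  [MeasureSpace E] [BorelSpace E] [(volume : Measure E).IsAddHaarMeasure]

theorem integrable_fun_mul {α : Type*} [MeasurableSpace α] {μ : Measure α} {f g : α → ℝ}
    (hf : MemLp f 2 μ) (hg : MemLp g 2 μ) : Integrable (fun x => f x * g x) μ :=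
  hf.integrable_mul hg

/-- `p` is square integrable on compact sets. -/
def L2loc (p : E → ℝ) : Prop := ∀ K : Set E, IsCompact K → MemLp p 2 (volume.restrict K)

theorem _root_.MeasureTheory.MemLp.l2loc {p : E → ℝ} (hp : MemLp p 2 volume) : L2loc p :=
  fun _ _ => hp.restrict _

theorem L2loc.add {p q : E → ℝ} (hp : L2loc p) (hq : L2loc q) : L2loc (fun x => p x + q x) :=
  fun K hK => (hp K hK).add (hq K hK)

theorem L2loc.sum {ι : Type*} {s : Finset ι} {p : ι → E → ℝ} (h : ∀ c ∈ s, L2loc (p c)) :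
    L2loc (fun x => ∑ c ∈ s, p c x) :=
  fun K hK => memLp_finsetSum s fun c hc => h c hc K hK

theorem l2loc_of_bound {p : E → ℝ} (hp : AEStronglyMeasurable p volume) {R : ℝ}
    (hR : ∀ᵐ x, |p x| ≤ R) : L2loc p := fun K hK => by
  have : Fact (volume K < ⊤) := ⟨hK.measure_lt_top⟩
  exact MemLp.of_bound hp.restrict R (ae_restrict_of_ae hR)

theorem l2loc_of_continuous {p : E → ℝ} (hp : Continuous p) : L2loc p := fun K hK => by
  have : Fact (volume K < ⊤) := ⟨hK.measure_lt_top⟩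
  obtain ⟨R, hR⟩ := hK.exists_bound_of_continuousOn hp.continuousOn
  exact MemLp.of_bound hp.aestronglyMeasurable R
    ((ae_restrict_iff' hK.measurableSet).2 (.of_forall hR))

theorem L2loc.bdd_mul {m p : E → ℝ} (hp : L2loc p) (hm : AEStronglyMeasurable m volume) {R : ℝ}
    (hR : ∀ᵐ x, |m x| ≤ R) : L2loc (fun x => m x * p x) := fun K hK =>
  MemLp.of_le_mul (c := R) (hp K hK) (hm.restrict.mul (hp K hK).1)
    ((ae_restrict_of_ae hR).mono fun x hx => by
      rw [norm_mul]; exact mul_le_mul_of_nonneg_right hx (norm_nonneg _))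

theorem L2loc.memLp_mul {φ p : E → ℝ} (hp : L2loc p) (hφ : Continuous φ)
    (hc : HasCompactSupport φ) : MemLp (fun x => φ x * p x) 2 volume := by
  obtain ⟨R, hR⟩ := hφ.bounded_above_of_compact_support hc
  have h1 : MemLp (fun x => φ x * p x) 2 (volume.restrict (tsupport φ)) :=
    MemLp.of_le_mul (c := R) (hp _ hc) (hφ.aestronglyMeasurable.mul (hp _ hc).1)
      (.of_forall fun x => by
        rw [norm_mul]; exact mul_le_mul_of_nonneg_right (hR x) (norm_nonneg _))
  rw [← memLp_indicator_iff_restrict (isClosed_tsupport φ).measurableSet] at h1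
  convert h1 using 1
  ext x
  by_cases hx : x ∈ tsupport φ
  · simp [hx]
  · simp [hx, image_eq_zero_of_notMem_tsupport hx]

theorem L2loc.locallyIntegrable_mul {p q : E → ℝ} (hp : L2loc p) (hq : L2loc q) :
    LocallyIntegrable (fun x => p x * q x) volume :=
  locallyIntegrable_iff.2 fun K hK => (hp K hK).integrable_mul (hq K hK)

theorem L2loc.locallyIntegrable {p : E → ℝ} (hp : L2loc p) : LocallyIntegrable p volume := by
  simpa using hp.locallyIntegrable_mul (l2loc_of_continuous (continuous_const (y := (1 : ℝ))))

theorem memLp_mol {u : E → ℝ} (hu : MemLp u 2 volume) (n : ℕ) : MemLp (mol n u) 2 volume :=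
  ⟨(contDiff_mol n (hu.locallyIntegrable (by norm_num))).continuous.aestronglyMeasurable,
    (eLpNorm_mol_le hu n).trans_lt hu.2⟩

/-- The mollifications of an element of `L²` converge to it weakly in `L²`; strong convergence is
not needed for the product and chain rules. -/
theorem tendsto_integral_mul_mol {h u : E → ℝ} (hh : MemLp h 2 volume) (hu : MemLp u 2 volume) :
    Tendsto (fun n => ∫ x, h x * mol n u x) atTop (𝓝 (∫ x, h x * u x)) :=
  tendsto_integral_mul_of_ae_tendsto (C := (eLpNorm u 2 volume).toNNReal)
    (fun n => (memLp_mol hu n).1)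
    (fun n => by rw [ENNReal.coe_toNNReal hu.2.ne]; exact eLpNorm_mol_le hu n)
    (ae_tendsto_mol (hu.locallyIntegrable (by norm_num))) hh

/-- The product rule: mollify the factor that is globally square integrable, and pass to the weak
limit. -/
theorem WD.mul {b : κ → E} {i : κ} {p p' q q' : E → ℝ} (hp : WD b i p p') (hq : WD b i q q')
    (hp2 : L2loc p) (hp2' : L2loc p') (hq2 : MemLp q 2 volume) (hq2' : MemLp q' 2 volume) :
    WD b i (fun x => p x * q x) (fun x => p' x * q x + p x * q' x) := by
  rw [wd_iff]
  refine ⟨hp2.locallyIntegrable_mul hq2.l2loc, (hp2'.locallyIntegrable_mul hq2.l2loc).add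
    (hp2.locallyIntegrable_mul hq2'.l2loc), fun φ hφ hc => ?_⟩
  have hφ' := contDiff_fderiv_apply_const hφ (b i)
  have hc' := hasCompactSupport_fderiv_apply_const hc (b i)
  have m1 := hp2.memLp_mul hφ'.continuous hc'
  have m2 := hp2'.memLp_mul hφ.continuous hc
  have m3 := hp2.memLp_mul hφ.continuous hc
  have hql := hq2.locallyIntegrable (by norm_num)
  have key : ∀ n, ∫ x, (fderiv ℝ φ x (b i) * p x) * mol n q x =
      -((∫ x, (φ x * p' x) * mol n q x) + ∫ x, (φ x * p x) * mol n q' x) := fun n => by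
    have hs := contDiff_mol n hql
    have h1 := (wd_iff.1 hp).2.2 _ (hφ.mul hs) hc.mul_right
    have h2 : ∀ x, fderiv ℝ (fun x => φ x * mol n q x) x (b i) =
        fderiv ℝ φ x (b i) * mol n q x + φ x * mol n q' x := fun x => by
      rw [fderiv_fun_mul (hφ.differentiable (by simp) x) (hs.differentiable (by simp) x)]
      simp only [_root_.add_apply, _root_.smul_apply, smul_eq_mul, fderiv_mol hq n x]
      ring
    have i1 := integrable_fun_mul m1 (memLp_mol hq2 n)
    have i3 := integrable_fun_mul m3 (memLp_mol hq2' n)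
    have e1 : ∫ x, fderiv ℝ (fun x => φ x * mol n q x) x (b i) • p x =
        (∫ x, (fderiv ℝ φ x (b i) * p x) * mol n q x) + ∫ x, (φ x * p x) * mol n q' x := by
      rw [← integral_add i1 i3]
      refine integral_congr_ae (.of_forall fun x => ?_)
      simp only [h2, smul_eq_mul]
      ring
    have e2 : ∫ x, (φ x * mol n q x) • p' x = ∫ x, (φ x * p' x) * mol n q x := by
      refine integral_congr_ae (.of_forall fun x => ?_)
      simp only [smul_eq_mul]
      ring
    have h3 : (∫ x, (fderiv ℝ φ x (b i) * p x) * mol n q x) + ∫ x, (φ x * p x) * mol n q' x =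
        -∫ x, (φ x * p' x) * mol n q x := by
      rw [← e1, ← e2]; exact h1
    linarith
  have t1 := tendsto_integral_mul_mol m1 hq2
  have t2 := ((tendsto_integral_mul_mol m2 hq2).add (tendsto_integral_mul_mol m3 hq2')).neg
  have h := tendsto_nhds_unique t1 (t2.congr fun n => (key n).symm)
  have e1 : ∫ x, fderiv ℝ φ x (b i) • (p x * q x) = ∫ x, (fderiv ℝ φ x (b i) * p x) * q x :=
    integral_congr_ae (.of_forall fun x => by simp only [smul_eq_mul]; ring)
  have e2 : ∫ x, φ x • (p' x * q x + p x * q' x) =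
      (∫ x, (φ x * p' x) * q x) + ∫ x, (φ x * p x) * q' x := by
    rw [← integral_add (integrable_fun_mul m2 hq2) (integrable_fun_mul m3 hq2')]
    exact integral_congr_ae (.of_forall fun x => by simp only [smul_eq_mul]; ring)
  rw [e1, e2, h]

theorem exists_bound_of_continuous {m : ℕ} {G : (Fin m → ℝ) → ℝ} (hG : Continuous G) (R : ℝ) :
    ∃ M : ℝ, 0 ≤ M ∧ ∀ y, ‖y‖ ≤ R → |G y| ≤ M := by
  obtain ⟨M, hM⟩ := (isCompact_closedBall (0 : Fin m → ℝ) R).exists_bound_of_continuousOn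
    hG.continuousOn
  refine ⟨max M 0, le_max_right _ _, fun y hy => (hM y ?_).trans (le_max_left _ _)⟩
  simpa using hy

/-- The partial derivative of a function on `ℝ^m`. -/
noncomputable def pd {m : ℕ} (c : Fin m) (G : (Fin m → ℝ) → ℝ) : (Fin m → ℝ) → ℝ :=
  fun y => fderiv ℝ G y (Pi.single c 1)

theorem fderiv_apply_eq_sum_pd {m : ℕ} (G : (Fin m → ℝ) → ℝ) (y h : Fin m → ℝ) :
    fderiv ℝ G y h = ∑ c, pd c G y * h c := by
  conv_lhs => rw [← Finset.univ_sum_single h]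
  rw [map_sum]
  refine Finset.sum_congr rfl fun c _ => ?_
  have : (Pi.single c (h c) : Fin m → ℝ) = h c • Pi.single c 1 := by
    rw [← Pi.single_smul, smul_eq_mul, mul_one]
  rw [this, map_smul, pd, smul_eq_mul, mul_comm]

theorem contDiff_pd {m : ℕ} {G : (Fin m → ℝ) → ℝ} {s : ℕ} (hG : ContDiff ℝ (s + 1 : ℕ) G)
    (c : Fin m) : ContDiff ℝ s (pd c G) :=
  (hG.fderiv_right (m := s) (by norm_cast)).clm_apply contDiff_const

/-- The chain rule for `G (a + z)` with `a` smooth and `z` weakly differentiable, both bounded. -/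
theorem WD.comp {m : ℕ} {G : (Fin m → ℝ) → ℝ} (hG : ContDiff ℝ 1 G) {b : κ → E} {i : κ}
    {a z z' : Fin m → E → ℝ} {R : ℝ} (ha : ∀ c, ContDiff ℝ 1 (a c)) (haR : ∀ c x, |a c x| ≤ R)
    (hz : ∀ c, WD b i (z c) (z' c)) (hz2 : ∀ c, MemLp (z c) 2 volume)
    (hz2' : ∀ c, MemLp (z' c) 2 volume) (hzR : ∀ c, ∀ᵐ x, |z c x| ≤ R) :
    WD b i (fun x => G fun c => a c x + z c x)
      (fun x => ∑ c, pd c G (fun c => a c x + z c x) * (fderiv ℝ (a c) x (b i) + z' c x)) := by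
  rcases Nat.eq_zero_or_pos m with rfl | hm
  · have : (fun x => G fun c => a c x + z c x) = fun _ => G default := by
      ext x; congr 1; exact Subsingleton.elim _ _
    rw [this]
    simpa using wd_of_contDiff (b := b) (i := i) (u := fun _ : E => G default) contDiff_const
  have hR0 : 0 ≤ R := (abs_nonneg _).trans (haR ⟨0, hm⟩ 0)
  have hpd : ∀ c, Continuous (pd c G) := fun c => (contDiff_pd (s := 0) (by simpa using hG) c).continuous
  obtain ⟨M, hM0, hM⟩ := exists_bound_of_continuous hG.continuous (R + R)
  choose M' hM'0 hM' using fun c => exists_bound_of_continuous (hpd c) (R + R)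
  have hzl : ∀ c, LocallyIntegrable (z c) volume := fun c =>
    (hz2 c).locallyIntegrable (by norm_num)
  let y : E → Fin m → ℝ := fun x c => a c x + z c x
  let yn : ℕ → E → Fin m → ℝ := fun n x c => a c x + mol n (z c) x
  have hyn : ∀ n x, ‖yn n x‖ ≤ R + R := fun n x =>
    (pi_norm_le_iff_of_nonneg (by positivity)).2 fun c =>
      (abs_add_le _ _).trans (add_le_add (haR c x) (abs_mol_le (hzR c) n x))
  have hyae : ∀ᵐ x, ‖y x‖ ≤ R + R := by
    filter_upwards [ae_all_iff.2 hzR] with x hx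
    exact (pi_norm_le_iff_of_nonneg (by positivity)).2 fun c =>
      (abs_add_le _ _).trans (add_le_add (haR c x) (hx c))
  have hlim : ∀ᵐ x, Tendsto (fun n => yn n x) atTop (𝓝 (y x)) := by
    filter_upwards [ae_all_iff.2 fun c => ae_tendsto_mol (hzl c)] with x hx
    exact tendsto_pi_nhds.2 fun c => (hx c).const_add _
  have hym : AEStronglyMeasurable y volume :=
    (aemeasurable_pi_iff.2 fun c => ((ha c).continuous.aestronglyMeasurable.add
      (hz2 c).1).aemeasurable).aestronglyMeasurable
  have hync : ∀ n, ContDiff ℝ 1 (yn n) := fun n => contDiff_pi.2 fun c =>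
    (ha c).add ((contDiff_mol n (hzl c)).of_le (by norm_cast))
  have hda : ∀ c, Continuous fun x => fderiv ℝ (a c) x (b i) := fun c =>
    ((ha c).continuous_fderiv one_ne_zero).clm_apply continuous_const
  have hpdm : ∀ c, AEStronglyMeasurable (fun x => pd c G (y x)) volume := fun c =>
    (hpd c).comp_aestronglyMeasurable hym
  have hl2 : ∀ c, L2loc fun x => pd c G (y x) * (fderiv ℝ (a c) x (b i) + z' c x) := fun c =>
    ((l2loc_of_continuous (hda c)).add (hz2' c).l2loc).bdd_mul (hpdm c)
      (hyae.mono fun x hx => hM' c _ hx)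
  rw [wd_iff]
  refine ⟨(l2loc_of_bound (hG.continuous.comp_aestronglyMeasurable hym)
    (hyae.mono fun x hx => hM _ hx)).locallyIntegrable,
    (L2loc.sum fun c _ => hl2 c).locallyIntegrable, fun φ hφ hc => ?_⟩
  have hφ' := contDiff_fderiv_apply_const hφ (b i)
  have hc' := hasCompactSupport_fderiv_apply_const hc (b i)
  have hφi := hφ.continuous.integrable_of_hasCompactSupport (μ := volume) hc
  have hφ'i := hφ'.continuous.integrable_of_hasCompactSupport (μ := volume) hc'
  have hφ2 : MemLp φ 2 volume := hφ.continuous.memLp_of_hasCompactSupport hc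
  have hfn : ∀ n c, MemLp (fun x => pd c G (yn n x) * mol n (z' c) x) 2 volume := fun n c =>
    MemLp.of_le_mul (c := M' c) (memLp_mol (hz2' c) n)
      ((((hpd c).comp (hync n).continuous).aestronglyMeasurable).mul (memLp_mol (hz2' c) n).1)
      (.of_forall fun x => by
        rw [norm_mul]; exact mul_le_mul_of_nonneg_right (hM' c _ (hyn n x)) (norm_nonneg _))
  have hdc : ∀ n c, Continuous fun x => pd c G (yn n x) * fderiv ℝ (a c) x (b i) := fun n c =>
    ((hpd c).comp (hync n).continuous).mul (hda c)
  have key : ∀ n, ∫ x, fderiv ℝ φ x (b i) * G (yn n x) =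
      -∑ c, ((∫ x, φ x * (pd c G (yn n x) * fderiv ℝ (a c) x (b i))) +
        ∫ x, φ x * (pd c G (yn n x) * mol n (z' c) x)) := fun n => by
    have h1 := (wd_iff.1 (wd_of_contDiff (b := b) (i := i) (hG.comp (hync n)))).2.2 φ hφ hc
    have h2 : ∀ x, fderiv ℝ (G ∘ yn n) x (b i) =
        ∑ c, pd c G (yn n x) * (fderiv ℝ (a c) x (b i) + mol n (z' c) x) := fun x => by
      rw [fderiv_comp x (hG.differentiable one_ne_zero _) ((hync n).differentiable one_ne_zero x),
        ContinuousLinearMap.comp_apply, fderiv_apply_eq_sum_pd]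
      refine Finset.sum_congr rfl fun c _ => ?_
      congr 1
      have hdiff : ∀ c, DifferentiableAt ℝ (fun x => yn n x c) x := fun c =>
        ((ha c).differentiable one_ne_zero x).add ((contDiff_mol n (hzl c)).differentiable (by simp) x)
      have : fderiv ℝ (yn n) x (b i) c = fderiv ℝ (fun x => yn n x c) x (b i) := by
        have := fderiv_pi (𝕜 := ℝ) (φ := fun c x => yn n x c) (x := x) hdiff
        have h3 : fderiv ℝ (yn n) x = _ := this
        rw [h3]; rfl
      rw [this]
      simp only [yn]
      rw [fderiv_fun_add ((ha c).differentiable one_ne_zero x)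
        ((contDiff_mol n (hzl c)).differentiable (by simp) x), _root_.add_apply,
        fderiv_mol (hz c)]
    simp only [smul_eq_mul, h2, Function.comp] at h1
    rw [h1, neg_inj]
    have h3 : ∀ c, (∫ x, φ x * (pd c G (yn n x) * fderiv ℝ (a c) x (b i))) +
        ∫ x, φ x * (pd c G (yn n x) * mol n (z' c) x) =
        ∫ x, φ x * (pd c G (yn n x) * (fderiv ℝ (a c) x (b i) + mol n (z' c) x)) := fun c => by
      rw [← integral_add]
      · exact integral_congr_ae (.of_forall fun x => by ring)
      · exact (hφ.continuous.mul (hdc n c)).integrable_of_hasCompactSupport hc.mul_right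
      · exact hφ2.integrable_mul (hfn n c)
    simp_rw [h3]
    rw [← integral_finsetSum]
    · exact integral_congr_ae (.of_forall fun x => by simp only [Finset.mul_sum])
    · intro c _
      have hcont : Continuous fun x => pd c G (yn n x) *
          (fderiv ℝ (a c) x (b i) + mol n (z' c) x) :=
        ((hpd c).comp (hync n).continuous).mul ((hda c).add
          (contDiff_mol n ((hz2' c).locallyIntegrable (by norm_num))).continuous)
      exact (hφ.continuous.mul hcont).integrable_of_hasCompactSupport hc.mul_right
  have t1 : Tendsto (fun n => ∫ x, fderiv ℝ φ x (b i) * G (yn n x)) atTop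
      (𝓝 (∫ x, fderiv ℝ φ x (b i) * G (y x))) := by
    refine tendsto_integral_of_dominated_convergence (fun x => ‖fderiv ℝ φ x (b i)‖ * M)
      (fun n => (hφ'.continuous.mul (hG.continuous.comp (hync n).continuous)).aestronglyMeasurable)
      (hφ'i.norm.mul_const M) (fun n => .of_forall fun x => ?_) ?_
    · rw [norm_mul]; exact mul_le_mul_of_nonneg_left (hM _ (hyn n x)) (norm_nonneg _)
    · exact hlim.mono fun x hx => ((hG.continuous.tendsto _).comp hx).const_mul _
  have t2 : ∀ c, Tendsto (fun n => ∫ x, φ x * (pd c G (yn n x) * fderiv ℝ (a c) x (b i))) atTop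
      (𝓝 (∫ x, φ x * (pd c G (y x) * fderiv ℝ (a c) x (b i)))) := fun c => by
    have hb : Integrable (fun x => φ x * fderiv ℝ (a c) x (b i)) volume :=
      (hφ.continuous.mul (hda c)).integrable_of_hasCompactSupport hc.mul_right
    refine tendsto_integral_of_dominated_convergence (fun x => M' c * ‖φ x * fderiv ℝ (a c) x (b i)‖)
      (fun n => (hφ.continuous.mul (hdc n c)).aestronglyMeasurable)
      (hb.norm.const_mul _) (fun n => .of_forall fun x => ?_) ?_
    · rw [mul_left_comm, norm_mul]
      exact mul_le_mul_of_nonneg_right (hM' c _ (hyn n x)) (norm_nonneg _)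
    · exact hlim.mono fun x hx => ((((hpd c).tendsto _).comp hx).mul_const _).const_mul _
  have t3 : ∀ c, Tendsto (fun n => ∫ x, φ x * (pd c G (yn n x) * mol n (z' c) x)) atTop
      (𝓝 (∫ x, φ x * (pd c G (y x) * z' c x))) := fun c => by
    refine tendsto_integral_mul_of_ae_tendsto
      (C := (M' c).toNNReal * (eLpNorm (z' c) 2 volume).toNNReal) (fun n => (hfn n c).1)
      (fun n => ?_) ?_ hφ2
    · have h1 := eLpNorm_le_nnreal_smul_eLpNorm_of_ae_le_mul (c := (M' c).toNNReal) (p := 2)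
        (f := fun x => pd c G (yn n x) * mol n (z' c) x) (g := mol n (z' c)) (μ := volume)
        (.of_forall fun x => by
          rw [nnnorm_mul]
          gcongr
          rw [← NNReal.coe_le_coe, Real.coe_toNNReal _ (hM'0 c)]
          exact hM' c _ (hyn n x))
      refine h1.trans ?_
      rw [ENNReal.smul_def, smul_eq_mul, ENNReal.coe_mul, ENNReal.coe_toNNReal (hz2' c).2.ne]
      gcongr
      exact eLpNorm_mol_le (hz2' c) n
    · filter_upwards [hlim, ae_tendsto_mol ((hz2' c).locallyIntegrable (by norm_num))] with x hx hx'
      exact (((hpd c).tendsto _).comp hx).mul hx'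
  have t4 := (tendsto_finsetSum Finset.univ fun c _ => (t2 c).add (t3 c)).neg
  have h := tendsto_nhds_unique t1 (t4.congr fun n => (key n).symm)
  simp only [smul_eq_mul]
  change ∫ x, fderiv ℝ φ x (b i) * G (y x) = _
  rw [h, neg_inj]
  have i1 : ∀ c, Integrable (fun x => φ x * (pd c G (y x) * fderiv ℝ (a c) x (b i))) volume :=
    fun c => integrable_smul_of_locallyIntegrable hφ.continuous hc
      ((l2loc_of_continuous (hda c)).bdd_mul (hpdm c)
        (hyae.mono fun x hx => hM' c _ hx)).locallyIntegrable
  have i2 : ∀ c, Integrable (fun x => φ x * (pd c G (y x) * z' c x)) volume :=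
    fun c => integrable_smul_of_locallyIntegrable hφ.continuous hc
      ((hz2' c).l2loc.bdd_mul (hpdm c) (hyae.mono fun x hx => hM' c _ hx)).locallyIntegrable
  have h3 : ∀ c, (∫ x, φ x * (pd c G (y x) * fderiv ℝ (a c) x (b i))) +
      ∫ x, φ x * (pd c G (y x) * z' c x) =
      ∫ x, φ x * (pd c G (y x) * (fderiv ℝ (a c) x (b i) + z' c x)) := fun c => by
    rw [← integral_add (i1 c) (i2 c)]
    exact integral_congr_ae (.of_forall fun x => by ring)
  simp_rw [h3]
  rw [← integral_finsetSum]
  · exact integral_congr_ae (.of_forall fun x => by simp only [Finset.mul_sum]; rfl)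
  · exact fun c _ => integrable_smul_of_locallyIntegrable hφ.continuous hc (hl2 c).locallyIntegrable

/-! ### Multiplication by functions with bounded derivatives -/

/-- A family of functions with uniformly bounded continuous derivatives up to order `s`. -/
def BddDeriv {P : Type*} (b : κ → E) : ℕ → (P → E → ℝ) → Prop
  | 0, m => (∀ p, Continuous (m p)) ∧ ∃ C : ℝ, ∀ p x, |m p x| ≤ C
  | s + 1, m => ((∀ p, ContDiff ℝ 1 (m p)) ∧ ∃ C : ℝ, ∀ p x, |m p x| ≤ C) ∧
      ∀ i, BddDeriv b s fun p x => fderiv ℝ (m p) x (b i)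

theorem BddDeriv.zero {P : Type*} {b : κ → E} {s : ℕ} {m : P → E → ℝ} (h : BddDeriv b s m) :
    BddDeriv b 0 m := by
  cases s with
  | zero => exact h
  | succ s => exact ⟨fun p => (h.1.1 p).continuous, h.1.2⟩

theorem BddDeriv.pred {P : Type*} {b : κ → E} {s : ℕ} : ∀ {m : P → E → ℝ},
    BddDeriv b (s + 1) m → BddDeriv b s m := by
  induction s with
  | zero => exact fun h => h.zero
  | succ s ih => exact fun h => ⟨h.1, fun i => ih (h.2 i)⟩

theorem BddDeriv.mono {P : Type*} {b : κ → E} {s t : ℕ} (hst : s ≤ t) {m : P → E → ℝ}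
    (h : BddDeriv b t m) : BddDeriv b s m := by
  induction t, hst using Nat.le_induction with
  | base => exact h
  | succ t _ ih => exact ih h.pred

variable [Fintype κ]

theorem dom_sobNorm_add {P : Type*} {b : κ → E} {s : ℕ} {u v : P → E → ℝ} {B : P → ℝ≥0∞}
    (hu : Dom (fun p => sobNorm b s (u p)) B) (hv : Dom (fun p => sobNorm b s (v p)) B) :
    Dom (fun p => sobNorm b s fun x => u p x + v p x) B := by
  obtain ⟨C, hC⟩ := exists_sobNorm_add_le (F := ℝ) b s
  exact Dom.trans ⟨C, fun p => hC _ _⟩ (hu.add hv)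

theorem eLpNorm_mul_le_of_bound {α : Type*} [MeasurableSpace α] {μ : Measure α} {m w : α → ℝ}
    {C : ℝ} (hC : ∀ᵐ x ∂μ, |m x| ≤ C) :
    eLpNorm (fun x => m x * w x) 2 μ ≤ C.toNNReal * eLpNorm w 2 μ := by
  have := eLpNorm_le_nnreal_smul_eLpNorm_of_ae_le_mul (c := C.toNNReal) (p := 2)
    (f := fun x => m x * w x) (g := w) (μ := μ) (hC.mono fun x hx => by
      rw [nnnorm_mul]
      gcongr
      rw [← NNReal.coe_le_coe, Real.coe_toNNReal _ ((abs_nonneg _).trans hx)]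
      exact hx)
  rwa [ENNReal.smul_def, smul_eq_mul] at this

/-- Functions with bounded derivatives up to order `s` are multipliers on `H^s`. -/
theorem BddDeriv.dom_sobNorm_mul {P : Type*} {b : κ → E} {s : ℕ} :
    ∀ {m w : P → E → ℝ}, BddDeriv b s m → (∀ p, sobNorm b s (w p) < ⊤) →
      Dom (fun p => sobNorm b s fun x => m p x * w p x) (fun p => sobNorm b s (w p)) := by
  have h0 : ∀ {s : ℕ} {m w : P → E → ℝ}, BddDeriv b s m → (∀ p, sobNorm b s (w p) < ⊤) →
      Dom (fun p => eLpNorm (fun x => m p x * w p x) 2 volume) (fun p => sobNorm b s (w p)) := by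
    intro s m w hm hw
    obtain ⟨C, hC⟩ := hm.zero.2
    refine ⟨C.toNNReal, fun p => (eLpNorm_mul_le_of_bound (.of_forall (hC p))).trans ?_⟩
    gcongr
    exact eLpNorm_le_sobNorm b s _
  have hloc : ∀ {s : ℕ} {m w : P → E → ℝ}, BddDeriv b s m → (∀ p, sobNorm b s (w p) < ⊤) →
      ∀ p, LocallyIntegrable (fun x => m p x * w p x) volume := fun hm hw p =>
    (l2loc_of_continuous (hm.zero.1 p)).locallyIntegrable_mul
      (memLp_of_sobNorm_lt_top (hw p)).l2loc
  induction s with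
  | zero =>
    intro m w hm hw
    exact (Dom.of_le fun p => sobNorm_zero_le (hloc hm hw p)).trans (h0 hm hw)
  | succ s ih =>
    intro m w hm hw
    choose w' hw' using fun p => exists_wd_of_sobNorm_lt_top (hw p)
    have hle : ∀ p i, sobNorm b s (w' p i) ≤ sobNorm b (s + 1) (w p) := fun p i =>
      sobNorm_wd_le (hw' p i)
    have hlt : ∀ p i, sobNorm b s (w' p i) < ⊤ := fun p i => (hle p i).trans_lt (hw p)
    have hd : ∀ p i, WD b i (fun x => m p x * w p x)
        (fun x => fderiv ℝ (m p) x (b i) * w p x + m p x * w' p i x) := fun p i =>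
      (wd_of_contDiff (hm.1.1 p)).mul (hw' p i) (l2loc_of_continuous (hm.1.1 p).continuous)
        (l2loc_of_continuous ((hm.2 i).zero.1 p)) (memLp_of_sobNorm_lt_top (hw p))
        (memLp_of_sobNorm_lt_top (hlt p i))
    refine (Dom.of_le fun p => sobNorm_succ_le (hloc hm hw p) (hd p)).trans
      ((h0 hm hw).add (Dom.sum fun i _ => dom_sobNorm_add ?_ ?_))
    · exact (ih (hm.2 i) fun p => (sobNorm_mono b (Nat.le_succ s) _).trans_lt (hw p)).trans
        (Dom.of_le fun p => sobNorm_mono b (Nat.le_succ s) _)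
    · exact (ih hm.pred fun p => hlt p i).trans (Dom.of_le fun p => hle p i)

end Rules

end PlanarWave

namespace PlanarWave

open scoped NNReal Convolution Topology FourierTransform SchwartzMap LineDeriv
open Filter

/-! ### The product estimate in `L²` by Fourier transform -/

section Fourier

variable {κ H : Type*} [Fintype κ] [NormedAddCommGroup H] [InnerProductSpace ℝ H]
  [FiniteDimensional ℝ H] [MeasurableSpace H] [BorelSpace H]

/-- A real smooth compactly supported function as a complex Schwartz function. -/
noncomputable def schwartzOf (u : H → ℝ) (hu : ContDiff ℝ ∞ u) (hc : HasCompactSupport u) :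
    𝓢(H, ℂ) :=
  (hc.comp_left Complex.ofReal_zero : HasCompactSupport fun x => (u x : ℂ)).toSchwartzMap
    (Complex.ofRealCLM.contDiff.comp hu)

theorem schwartzOf_apply (u : H → ℝ) (hu : ContDiff ℝ ∞ u) (hc : HasCompactSupport u) (x : H) :
    schwartzOf u hu hc x = (u x : ℂ) := rfl

/-- Plancherel. -/
theorem eLpNorm_fourier (f : 𝓢(H, ℂ)) :
    eLpNorm (fun ξ : H => ‖(𝓕 f : 𝓢(H, ℂ)) ξ‖) 2 volume = eLpNorm (fun x => f x) 2 volume := by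
  have h := SchwartzMap.norm_fourier_toL2_eq f
  have h1 : ‖(𝓕 f).toLp 2‖ = (eLpNorm (fun ξ => (𝓕 f : 𝓢(H, ℂ)) ξ) 2 volume).toReal := SchwartzMap.norm_toLp
  have h2 : ‖f.toLp 2‖ = (eLpNorm (fun x => f x) 2 volume).toReal := SchwartzMap.norm_toLp
  rw [h1, h2] at h
  have h3 := ((𝓕 f).memLp 2 (volume : Measure H)).2.ne
  have h4 := (f.memLp 2 (volume : Measure H)).2.ne
  have h5 : eLpNorm (fun ξ => (𝓕 f : 𝓢(H, ℂ)) ξ) 2 volume = eLpNorm (fun x => f x) 2 volume :=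
    (ENNReal.toReal_eq_toReal_iff' h3 h4).1 h
  rw [← h5]
  exact eLpNorm_norm _

/-- On test functions, the `L²` norm of the Fourier transform with weight `(1 + |ξ|)^s` is
controlled by the `H^s` norm. -/
theorem exists_weighted_fourier_le {b : κ → H} (hb : ∀ ξ, ‖ξ‖ ≤ ∑ i, |⟪ξ, b i⟫|) (s : ℕ) :
    ∃ C : ℝ≥0, ∀ (u : H → ℝ) (hu : ContDiff ℝ ∞ u) (hc : HasCompactSupport u),
      eLpNorm (fun ξ => (1 + ‖ξ‖) ^ s * ‖𝓕 (schwartzOf u hu hc) ξ‖) 2 volume ≤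
        C * sobNorm b s u := by
  induction s with
  | zero =>
    refine ⟨1, fun u hu hc => ?_⟩
    simp only [pow_zero, one_mul, ENNReal.coe_one]
    rw [eLpNorm_fourier]
    refine le_trans (le_of_eq ?_) (eLpNorm_le_sobNorm b 0 u)
    exact eLpNorm_congr_norm_ae (.of_forall fun x => by simp [schwartzOf_apply])
  | succ s ih =>
    obtain ⟨C, hC⟩ := ih
    refine ⟨C + Fintype.card κ * C, fun u hu hc => ?_⟩
    have hu' := fun i => contDiff_fderiv_apply_const hu (b i)
    have hc' := fun i => hasCompactSupport_fderiv_apply_const hc (b i)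
    have hF : ∀ i ξ, 𝓕 (schwartzOf _ (hu' i) (hc' i)) ξ =
        (2 * Real.pi * Complex.I) * (⟪ξ, b i⟫ * 𝓕 (schwartzOf u hu hc) ξ) := by
      intro i ξ
      have h1 : schwartzOf _ (hu' i) (hc' i) = ∂_{b i} (schwartzOf u hu hc) := by
        ext x
        rw [SchwartzMap.lineDerivOp_apply_eq_fderiv]
        have h2 : HasFDerivAt (schwartzOf u hu hc) (Complex.ofRealCLM.comp (fderiv ℝ u x)) x :=
          Complex.ofRealCLM.hasFDerivAt.comp x (hu.differentiable (by simp) x).hasFDerivAt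
        rw [h2.fderiv]
        rfl
      have : (inner ℝ · (b i) : H → ℝ).HasTemperateGrowth := by fun_prop
      rw [h1, SchwartzMap.fourier_lineDerivOp_eq, smul_apply,
        SchwartzMap.smulLeftCLM_apply_apply this]
      simp
    have hbd : ∀ ξ, ‖(1 + ‖ξ‖) ^ (s + 1) * ‖𝓕 (schwartzOf u hu hc) ξ‖‖ ≤
        (1 + ‖ξ‖) ^ s * ‖𝓕 (schwartzOf u hu hc) ξ‖ +
          ∑ i, (1 + ‖ξ‖) ^ s * ‖𝓕 (schwartzOf _ (hu' i) (hc' i)) ξ‖ := by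
      intro ξ
      rw [Real.norm_of_nonneg (by positivity), pow_succ, mul_assoc, ← Finset.mul_sum, ← mul_add]
      gcongr
      rw [add_mul, one_mul]
      gcongr
      calc ‖ξ‖ * ‖𝓕 (schwartzOf u hu hc) ξ‖
          ≤ (∑ i, |⟪ξ, b i⟫|) * ‖𝓕 (schwartzOf u hu hc) ξ‖ := by gcongr; exact hb ξ
        _ = ∑ i, |⟪ξ, b i⟫| * ‖𝓕 (schwartzOf u hu hc) ξ‖ := by rw [Finset.sum_mul]
        _ ≤ _ := by
            refine Finset.sum_le_sum fun i _ => ?_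
            rw [hF, norm_mul, norm_mul (⟪ξ, b i⟫ : ℂ), Complex.norm_real ⟪ξ, b i⟫,
              Real.norm_eq_abs]
            refine le_mul_of_one_le_left (by positivity) ?_
            simp only [norm_mul, Complex.norm_ofNat, Complex.norm_real, Complex.norm_I, mul_one,
              Real.norm_of_nonneg Real.pi_pos.le]
            linarith [Real.pi_gt_three]
    have hm : ∀ f : 𝓢(H, ℂ), AEStronglyMeasurable (fun ξ => (1 + ‖ξ‖) ^ s * ‖𝓕 f ξ‖)
        (volume : Measure H) := fun f => by
      have := (𝓕 f).continuous
      exact Continuous.aestronglyMeasurable (by fun_prop)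
    refine (eLpNorm_mono_real hbd).trans ((eLpNorm_add_le (hm _)
      (Finset.aestronglyMeasurable_fun_sum _ fun i _ => hm _) (by norm_num)).trans ?_)
    have h1 := (hC u hu hc).trans (mul_le_mul_right (sobNorm_mono b (Nat.le_succ s) u) _)
    have h2 : ∀ i, eLpNorm (fun ξ => (1 + ‖ξ‖) ^ s * ‖𝓕 (schwartzOf _ (hu' i) (hc' i)) ξ‖) 2
        volume ≤ C * sobNorm b (s + 1) u := fun i =>
      (hC _ (hu' i) (hc' i)).trans (mul_le_mul_right (sobNorm_wd_le (wd_of_contDiff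
        (hu.of_le (by norm_cast)))) _)
    have h3 := (eLpNorm_sum_le (s := Finset.univ) (μ := volume) (p := 2)
      (f := fun i ξ => (1 + ‖ξ‖) ^ s * ‖𝓕 (schwartzOf _ (hu' i) (hc' i)) ξ‖)
      (fun i _ => hm _) (by norm_num)).trans (Finset.sum_le_sum fun i _ => h2 i)
    have e : (∑ i, fun ξ => (1 + ‖ξ‖) ^ s * ‖𝓕 (schwartzOf _ (hu' i) (hc' i)) ξ‖) =
        fun ξ => ∑ i, (1 + ‖ξ‖) ^ s * ‖𝓕 (schwartzOf _ (hu' i) (hc' i)) ξ‖ := by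
      ext ξ; simp
    rw [e] at h3
    refine (add_le_add h1 h3).trans (le_of_eq ?_)
    simp only [Finset.sum_const, Finset.card_univ, nsmul_eq_mul]
    push_cast
    ring

theorem lintegral_mul_sq_le {α : Type*} [MeasurableSpace α] {μ : Measure α} {f g : α → ℝ≥0∞}
    (hf : AEMeasurable f μ) (hg : AEMeasurable g μ) :
    (∫⁻ x, f x * g x ∂μ) ^ 2 ≤ (∫⁻ x, f x ^ 2 ∂μ) * ∫⁻ x, g x ^ 2 ∂μ := by
  have := ENNReal.lintegral_mul_le_Lp_mul_Lq μ Real.HolderConjugate.two_two hf hg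
  calc _ ≤ ((∫⁻ x, f x ^ (2 : ℝ) ∂μ) ^ (1 / 2 : ℝ) * (∫⁻ x, g x ^ (2 : ℝ) ∂μ) ^ (1 / 2 : ℝ)) ^ 2 := by
        gcongr; exact this
    _ = _ := by
        rw [mul_pow, ← ENNReal.rpow_natCast, ← ENNReal.rpow_natCast, ← ENNReal.rpow_mul,
          ← ENNReal.rpow_mul]
        norm_num

theorem add_sq_le_two_mul (a b : ℝ≥0∞) : (a + b) ^ 2 ≤ 2 * (a ^ 2 + b ^ 2) := by
  have := ENNReal.rpow_add_le_mul_rpow_add_rpow a b (p := 2) (by norm_num)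
  norm_num at this
  simpa using this

/-- `‖p q‖_{L²} ≤ C ‖p‖_{H^r} ‖q‖_{H^t}` for test functions when `r + t` exceeds half the
dimension: in the convolution of the Fourier transforms, all the weights can be put on the factor
with the smaller frequency, where they make it integrable. -/
theorem exists_eLpNorm_mul_le_of_smooth {b : κ → H} (hb : ∀ ξ, ‖ξ‖ ≤ ∑ i, |⟪ξ, b i⟫|) {r t : ℕ}
    (hrt : Module.finrank ℝ H < 2 * (r + t)) :
    ∃ C : ℝ≥0, ∀ p q : H → ℝ, ContDiff ℝ ∞ p → HasCompactSupport p → ContDiff ℝ ∞ q →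
      HasCompactSupport q →
      eLpNorm (fun x => p x * q x) 2 volume ≤ C * (sobNorm b r p * sobNorm b t q) := by
  obtain ⟨C₁, hC₁⟩ := exists_weighted_fourier_le hb r
  obtain ⟨C₂, hC₂⟩ := exists_weighted_fourier_le hb t
  let w : H → ℝ≥0∞ := fun ξ => ENNReal.ofReal (1 + ‖ξ‖)
  have hwm : Measurable w := by fun_prop
  have hw1 : ∀ ξ, 1 ≤ w ξ := fun ξ => by
    simp only [w]; rw [ENNReal.one_le_ofReal]; linarith [norm_nonneg ξ]
  have hw0 : ∀ ξ, w ξ ≠ 0 := fun ξ => (zero_lt_one.trans_le (hw1 ξ)).ne'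
  have hwt : ∀ ξ, w ξ ≠ ⊤ := fun ξ => ENNReal.ofReal_ne_top
  -- The product of the two weights at the smaller frequency; its square is integrable because `2 (r
  -- + t)` exceeds the dimension.
  let W : H → ℝ≥0∞ := fun ξ => (w ξ)⁻¹ ^ (r + t)
  have hWm : Measurable W := hwm.inv.pow_const _
  have hI : ∫⁻ ξ, W ξ ^ 2 < ⊤ := by
    have h := finite_integral_one_add_norm (E := H) (μ := volume) (r := 2 * (r + t))
      (by exact_mod_cast hrt)
    refine lt_of_le_of_lt (lintegral_mono fun ξ => le_of_eq ?_) h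
    simp only [W, w]
    have h1 : 0 < 1 + ‖ξ‖ := by positivity
    rw [← pow_mul, ← ENNReal.ofReal_inv_of_pos h1, ← ENNReal.ofReal_pow (by positivity),
      Real.rpow_neg h1.le, inv_pow]
    congr 2
    rw [← Real.rpow_natCast]
    congr 1
    push_cast
    ring
  set I := ∫⁻ ξ, W ξ ^ 2
  have hI' : I ^ (1 / 2 : ℝ) ≠ ⊤ := by finiteness
  refine ⟨2 * (I ^ (1 / 2 : ℝ)).toNNReal * (C₁ * C₂), fun p q hp hpc hq hqc => ?_⟩
  set f := 𝓕 (schwartzOf p hp hpc)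
  set g := 𝓕 (schwartzOf q hq hqc)
  let B := ContinuousLinearMap.mul ℂ ℂ
  have hconv : eLpNorm (fun x => p x * q x) 2 volume =
      eLpNorm (fun ξ => SchwartzMap.convolution B f g ξ) 2 volume := by
    rw [← eLpNorm_fourier, SchwartzMap.fourier_convolution]
    have h1 : ∀ (u : H → ℝ) (hu : ContDiff ℝ ∞ u) (hc : HasCompactSupport u) (x : H),
        𝓕 (𝓕 (schwartzOf u hu hc)) x = u (-x) := fun u hu hc x => by
      have h2 : 𝓕⁻ (𝓕 (schwartzOf u hu hc)) (-x) = schwartzOf u hu hc (-x) := by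
        rw [FourierTransform.fourierInv_fourier_eq]
      rw [SchwartzMap.fourierInv_apply_eq] at h2
      simpa [schwartzOf_apply] using h2
    have h3 : ∀ x, ‖SchwartzMap.pairing B (𝓕 f) (𝓕 g) x‖ = ‖p (-x) * q (-x)‖ := fun x => by
      simp [f, g, h1, B]
    simp_rw [h3]
    rw [eLpNorm_norm]
    exact ((eLpNorm_comp_measurePreserving (g := fun x => p x * q x)
      ((hp.continuous.mul hq.continuous).aestronglyMeasurable)
      (Measure.measurePreserving_neg (volume : Measure H)))).symm
  rw [hconv]
  let P : H → ℝ≥0∞ := fun ξ => w ξ ^ r * ‖f ξ‖ₑ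
  let Q : H → ℝ≥0∞ := fun ξ => w ξ ^ t * ‖g ξ‖ₑ
  have hPm : Measurable P := (hwm.pow_const _).mul f.continuous.measurable.enorm
  have hQm : Measurable Q := (hwm.pow_const _).mul g.continuous.measurable.enorm
  have hsq : ∀ (h : 𝓢(H, ℂ)) (s : ℕ), ∫⁻ ξ, (w ξ ^ s * ‖h ξ‖ₑ) ^ 2 =
      eLpNorm (fun ξ => (1 + ‖ξ‖) ^ s * ‖h ξ‖) 2 volume ^ 2 := fun h s => by
    rw [← lintegral_sq_eq_eLpNorm]
    refine lintegral_congr fun ξ => ?_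
    rw [enorm_mul, enorm_norm, enorm_pow, Real.enorm_of_nonneg (by positivity)]
  have hP : ∫⁻ ξ, P ξ ^ 2 ≤ (C₁ * sobNorm b r p) ^ 2 := by
    rw [hsq f r]; gcongr; exact hC₁ p hp hpc
  have hQ : ∫⁻ ξ, Q ξ ^ 2 ≤ (C₂ * sobNorm b t q) ^ 2 := by
    rw [hsq g t]; gcongr; exact hC₂ q hq hqc
  have hpt : ∀ x, ‖SchwartzMap.convolution B f g x‖ₑ ≤
      (∫⁻ η, (Q η * W η) * P (x - η)) + ∫⁻ η, (P η * W η) * Q (x - η) := by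
    intro x
    have e1 : SchwartzMap.convolution B f g x = ∫ η, f η * g (x - η) := by
      rw [SchwartzMap.convolution_apply]; rfl
    rw [e1]
    refine (enorm_integral_le_lintegral_enorm _).trans ?_
    have hsplit : ∀ η, ‖f η * g (x - η)‖ₑ ≤
        (Q (x - η) * W (x - η)) * P (x - (x - η)) + (P η * W η) * Q (x - η) := by
      intro η
      rw [sub_sub_cancel]
      set ζ := x - η
      have hf' : ‖f η‖ₑ = P η * (w η)⁻¹ ^ r := by
        simp only [P]
        rw [mul_comm, ← mul_assoc, ← mul_pow, ENNReal.inv_mul_cancel (hw0 _) (hwt _), one_pow,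
          one_mul]
      have hg' : ‖g ζ‖ₑ = Q ζ * (w ζ)⁻¹ ^ t := by
        simp only [Q]
        rw [mul_comm, ← mul_assoc, ← mul_pow, ENNReal.inv_mul_cancel (hw0 _) (hwt _), one_pow,
          one_mul]
      rw [enorm_mul, hf', hg']
      -- Both inverse weights are moved to the smaller of the frequencies `η` and `ζ = x - η`.
      rcases le_total (w η) (w ζ) with hle | hle
      · refine le_trans ?_ le_add_self
        have : (w ζ)⁻¹ ≤ (w η)⁻¹ := ENNReal.inv_le_inv.2 hle
        calc _ = P η * Q ζ * ((w η)⁻¹ ^ r * (w ζ)⁻¹ ^ t) := by ring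
          _ ≤ P η * Q ζ * ((w η)⁻¹ ^ r * (w η)⁻¹ ^ t) := by gcongr
          _ = _ := by simp only [W]; rw [pow_add]; ring
      · refine le_trans ?_ le_self_add
        have : (w η)⁻¹ ≤ (w ζ)⁻¹ := ENNReal.inv_le_inv.2 hle
        calc _ = P η * Q ζ * ((w η)⁻¹ ^ r * (w ζ)⁻¹ ^ t) := by ring
          _ ≤ P η * Q ζ * ((w ζ)⁻¹ ^ r * (w ζ)⁻¹ ^ t) := by gcongr
          _ = _ := by simp only [W]; rw [pow_add]; ring
    refine (lintegral_mono hsplit).trans ?_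
    have hsm : Measurable fun η : H => x - η := by fun_prop
    have hm1 : Measurable fun ζ => (Q ζ * W ζ) * P (x - ζ) :=
      (hQm.mul hWm).mul (hPm.comp hsm)
    have hm2 : Measurable fun η => (Q (x - η) * W (x - η)) * P (x - (x - η)) := hm1.comp hsm
    rw [lintegral_add_left hm2,
      lintegral_sub_left_eq_self (fun ζ => (Q ζ * W ζ) * P (x - ζ)) x]
  have hfinal : eLpNorm (fun ξ => SchwartzMap.convolution B f g ξ) 2 volume ^ 2 ≤
      (2 * I ^ (1 / 2 : ℝ) * ((C₁ * sobNorm b r p) * (C₂ * sobNorm b t q))) ^ 2 := by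
    have e0 : eLpNorm (fun ξ => SchwartzMap.convolution B f g ξ) 2 volume ^ 2 =
        ∫⁻ x, ‖SchwartzMap.convolution B f g x‖ₑ ^ 2 := by
      rw [← eLpNorm_norm, ← lintegral_sq_eq_eLpNorm]; simp
    -- Young bounds each half of the convolution by an `L¹` norm times an `L²` norm, and
    -- Cauchy–Schwarz turns the `L¹` norm of `Q W` or `P W` into the `L²` norm of `Q` or `P`.
    have y1 := lintegral_sq_convolution_le hPm (hQm.mul hWm)
    have y2 := lintegral_sq_convolution_le hQm (hPm.mul hWm)
    have c1 := lintegral_mul_sq_le (μ := volume) hQm.aemeasurable hWm.aemeasurable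
    have c2 := lintegral_mul_sq_le (μ := volume) hPm.aemeasurable hWm.aemeasurable
    have hm1 : Measurable fun x => ∫⁻ η, (Q η * W η) * P (x - η) := by
      have : Measurable fun z : H × H => (Q z.2 * W z.2) * P (z.1 - z.2) :=
        ((hQm.mul hWm).comp measurable_snd).mul (hPm.comp (measurable_fst.sub measurable_snd))
      exact this.lintegral_prod_right'
    rw [e0]
    calc _ ≤ ∫⁻ x, 2 * ((∫⁻ η, (Q η * W η) * P (x - η)) ^ 2 +
            (∫⁻ η, (P η * W η) * Q (x - η)) ^ 2) :=
          lintegral_mono fun x => (pow_le_pow_left₀ zero_le (hpt x) 2).trans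
            (add_sq_le_two_mul _ _)
      _ = 2 * ((∫⁻ x, (∫⁻ η, (Q η * W η) * P (x - η)) ^ 2) +
            ∫⁻ x, (∫⁻ η, (P η * W η) * Q (x - η)) ^ 2) := by
          rw [lintegral_const_mul' _ _ (by norm_num), lintegral_add_left (hm1.pow_const 2)]
      _ ≤ 2 * (((∫⁻ ξ, Q ξ ^ 2) * I) * (∫⁻ ξ, P ξ ^ 2) +
            ((∫⁻ ξ, P ξ ^ 2) * I) * ∫⁻ ξ, Q ξ ^ 2) := by
          gcongr
          · exact y1.trans (by gcongr; exact c1)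
          · exact y2.trans (by gcongr; exact c2)
      _ = 4 * I * ((∫⁻ ξ, P ξ ^ 2) * ∫⁻ ξ, Q ξ ^ 2) := by ring
      _ ≤ 4 * I * ((C₁ * sobNorm b r p) ^ 2 * (C₂ * sobNorm b t q) ^ 2) := by gcongr
      _ = _ := by
          have : (I ^ (1 / 2 : ℝ)) ^ 2 = I := by
            rw [← ENNReal.rpow_natCast, ← ENNReal.rpow_mul]; norm_num
          conv_rhs => rw [mul_pow, mul_pow, this]
          ring
  refine ((ENNReal.pow_le_pow_left_iff two_ne_zero).1 hfinal).trans (le_of_eq ?_)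
  push_cast
  rw [ENNReal.coe_toNNReal hI']
  ring

end Fourier

end PlanarWave

namespace PlanarWave

open scoped NNReal Convolution Topology
open Filter

/-! ### Approximation by test functions -/

section Approx

variable {κ E : Type*} [Fintype κ] [NormedAddCommGroup E] [NormedSpace ℝ E] [FiniteDimensional ℝ E]
  [MeasureSpace E] [BorelSpace E] [(volume : Measure E).IsAddHaarMeasure]

theorem exists_sobNorm_mol_le (b : κ → E) (s : ℕ) :
    ∃ C : ℝ≥0, ∀ (n : ℕ) (u : E → ℝ), sobNorm b s u < ⊤ →
      sobNorm b s (mol n u) ≤ C * sobNorm b s u := by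
  have hl : ∀ {s n} {u : E → ℝ}, sobNorm b s u < ⊤ → LocallyIntegrable (mol n u) volume :=
    fun h => (contDiff_mol _ (locallyIntegrable_of_sobNorm_lt_top h)).continuous.locallyIntegrable
  have h0 : ∀ {s n} {u : E → ℝ}, sobNorm b s u < ⊤ →
      eLpNorm (mol n u) 2 volume ≤ sobNorm b s u := fun h =>
    (eLpNorm_mol_le (memLp_of_sobNorm_lt_top h) _).trans (eLpNorm_le_sobNorm b _ _)
  induction s with
  | zero => exact ⟨1, fun n u h => (sobNorm_zero_le (hl h)).trans (by simpa using h0 h)⟩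
  | succ s ih =>
    obtain ⟨C, hC⟩ := ih
    refine ⟨1 + Fintype.card κ * C, fun n u h => ?_⟩
    choose u' hu' using exists_wd_of_sobNorm_lt_top h
    have hd : ∀ i, WD b i (mol n u) (mol n (u' i)) := fun i => by
      have := wd_of_contDiff (b := b) (i := i)
        ((contDiff_mol n (locallyIntegrable_of_sobNorm_lt_top h)).of_le (by norm_cast))
      simpa only [fderiv_mol (hu' i)] using this
    have h2 : ∀ i, sobNorm b s (mol n (u' i)) ≤ C * sobNorm b (s + 1) u := fun i =>
      (hC n _ ((sobNorm_wd_le (hu' i)).trans_lt h)).trans (by gcongr; exact sobNorm_wd_le (hu' i))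
    refine (sobNorm_succ_le (hl h) hd).trans
      ((add_le_add (h0 h) (Finset.sum_le_sum fun i _ => h2 i)).trans (le_of_eq ?_))
    simp only [Finset.sum_const, Finset.card_univ, nsmul_eq_mul]
    push_cast
    ring

/-- The dilations `η(ε x)` with `|ε| ≤ 1` of a test function have uniformly bounded derivatives; the
factor `c` makes the induction go through, since each derivative produces a factor `ε`. -/
theorem bddDeriv_dilation {P : Type*} (b : κ → E) (s : ℕ) : ∀ {η : E → ℝ} (_ : ContDiff ℝ ∞ η)
    (_ : HasCompactSupport η) {c ε : P → ℝ} (_ : ∀ p, |c p| ≤ 1) (_ : ∀ p, |ε p| ≤ 1),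
    BddDeriv b s fun p x => c p * η (ε p • x) := by
  have hcd : ∀ {η : E → ℝ} (_ : ContDiff ℝ ∞ η) (c ε : ℝ),
      ContDiff ℝ ∞ fun x => c * η (ε • x) := fun hη c ε =>
    contDiff_const.mul (hη.comp (contDiff_const_smul ε))
  have hbd : ∀ {η : E → ℝ} (_ : ContDiff ℝ ∞ η) (_ : HasCompactSupport η) {c ε : P → ℝ}
      (_ : ∀ p, |c p| ≤ 1), ∃ C : ℝ, ∀ p x, |c p * η (ε p • x)| ≤ C := by
    intro η hη hc c ε h1
    obtain ⟨C, hC⟩ := hη.continuous.bounded_above_of_compact_support hc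
    refine ⟨C, fun p x => ?_⟩
    rw [abs_mul]
    exact (mul_le_of_le_one_left (abs_nonneg _) (h1 p)).trans (hC _)
  induction s with
  | zero => exact fun hη hc _ _ h1 _ => ⟨fun p => (hcd hη _ _).continuous, hbd hη hc h1⟩
  | succ s ih =>
    intro η hη hc c ε h1 h2
    refine ⟨⟨fun p => (hcd hη _ _).of_le (by norm_cast), hbd hη hc h1⟩, fun i => ?_⟩
    have key : ∀ p x, fderiv ℝ (fun x => c p * η (ε p • x)) x (b i) =
        (c p * ε p) * (fderiv ℝ η (ε p • x) (b i)) := fun p x => by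
      have e1 : HasFDerivAt (fun x : E => ε p • x) (ε p • ContinuousLinearMap.id ℝ E) x :=
        (hasFDerivAt_id x).const_smul (ε p)
      have e2 := ((hη.differentiable (by simp) (ε p • x)).hasFDerivAt.comp x e1).const_mul (c p)
      have e3 : fderiv ℝ (fun x => c p * η (ε p • x)) x = _ := e2.fderiv
      rw [e3]
      simp only [_root_.smul_apply, ContinuousLinearMap.comp_apply, ContinuousLinearMap.id_apply,
        map_smul, smul_eq_mul]
      ring
    simp_rw [key]
    refine ih (contDiff_fderiv_apply_const hη (b i)) (hasCompactSupport_fderiv_apply_const hc (b i))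
      (fun p => ?_) h2
    rw [abs_mul]
    exact mul_le_one₀ (h1 p) (abs_nonneg _) (h2 p)

/-- Cut-off and mollification: elements of `H^s` are almost everywhere limits of test functions
with comparable norms. -/
theorem exists_smooth_approx (b : κ → E) (s : ℕ) :
    ∃ C : ℝ≥0, ∀ u : E → ℝ, sobNorm b s u < ⊤ → ∃ v : ℕ → E → ℝ,
      (∀ n, ContDiff ℝ ∞ (v n)) ∧ (∀ n, HasCompactSupport (v n)) ∧
      (∀ n, sobNorm b s (v n) ≤ C * sobNorm b s u) ∧
      ∀ᵐ x, Tendsto (fun n => v n x) atTop (𝓝 (u x)) := by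
  let η : ContDiffBump (0 : E) := ⟨1, 2, by norm_num, by norm_num⟩
  let P := {u : E → ℝ // sobNorm b s u < ⊤} × ℕ
  let ε : ℕ → ℝ := fun n => 1 / ((n : ℝ) + 1)
  have hε0 : ∀ n, 0 < ε n := fun n => by positivity
  have hε1 : ∀ n, |ε n| ≤ 1 := fun n => by
    rw [abs_of_pos (hε0 n)]
    simp only [ε]
    rw [div_le_one (by positivity)]
    linarith [(Nat.cast_nonneg n : (0 : ℝ) ≤ n)]
  obtain ⟨C₁, hC₁⟩ := exists_sobNorm_mol_le b s
  have hm := bddDeriv_dilation (P := P) b s η.contDiff η.hasCompactSupport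
    (c := fun _ => 1) (ε := fun p => ε p.2) (by simp) (fun p => hε1 _)
  obtain ⟨C₂, hC₂⟩ := hm.dom_sobNorm_mul (w := fun p : P => mol p.2 p.1.1) fun p =>
    (hC₁ _ _ p.1.2).trans_lt (ENNReal.mul_lt_top ENNReal.coe_lt_top p.1.2)
  refine ⟨C₂ * C₁, fun u hu => ⟨fun n x => 1 * η (ε n • x) * mol n u x, fun n => ?_, fun n => ?_,
    fun n => ?_, ?_⟩⟩
  · exact (contDiff_const.mul (η.contDiff.comp (contDiff_const_smul (ε n)))).mul
      (contDiff_mol n (locallyIntegrable_of_sobNorm_lt_top hu))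
  · have h1 : HasCompactSupport fun x : E => η (ε n • x) :=
      η.hasCompactSupport.comp_homeomorph (Homeomorph.smulOfNeZero (ε n) (hε0 n).ne')
    exact (h1.mul_left (f := fun _ => 1)).mul_right
  · refine (hC₂ (⟨u, hu⟩, n)).trans ?_
    push_cast
    rw [mul_assoc]
    gcongr
    exact hC₁ n u hu
  · filter_upwards [ae_tendsto_mol (locallyIntegrable_of_sobNorm_lt_top hu)] with x hx
    have h1 : Tendsto (fun n => η (ε n • x)) atTop (𝓝 1) := by
      have h2 : Tendsto (fun n => ε n • x) atTop (𝓝 0) := by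
        have := (tendsto_one_div_add_atTop_nhds_zero_nat (𝕜 := ℝ)).smul_const x
        rwa [zero_smul] at this
      have h3 := (η.contDiff (n := 0)).continuous.tendsto 0 |>.comp h2
      rwa [η.one_of_mem_closedBall (by simp [η])] at h3
    simpa using h1.mul hx

/-- Sobolev norms under a linear change of variables, with the derivatives taken in the
corresponding directions. -/
theorem sobNorm_comp_le_of_continuousLinearEquiv {H : Type*} [NormedAddCommGroup H]
    [NormedSpace ℝ H] [FiniteDimensional ℝ H] [MeasureSpace H] [BorelSpace H]
    [(volume : Measure H).IsAddHaarMeasure] (L : H ≃L[ℝ] E) :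
    ∃ c : ℝ≥0, c ≠ 0 ∧ (∀ u : E → ℝ, eLpNorm (u ∘ L) 2 volume = c * eLpNorm u 2 volume) ∧
      ∀ (b : κ → H) (s : ℕ), ∃ C : ℝ≥0, ∀ u : E → ℝ, sobNorm (fun i => L (b i)) s u < ⊤ →
        sobNorm b s (u ∘ L) ≤ C * sobNorm (fun i => L (b i)) s u := by
  let ν : Measure E := (volume : Measure H).map L
  have : ν.IsAddHaarMeasure := L.isAddHaarMeasure_map volume
  have hν : ν = ν.addHaarScalarFactor (volume : Measure E) • (volume : Measure E) :=
    Measure.isAddLeftInvariant_eq_smul _ _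
  set c := ν.addHaarScalarFactor (volume : Measure E) with hc
  have hc0 : c ≠ 0 := (Measure.addHaarScalarFactor_pos_of_isAddHaarMeasure _ _).ne'
  have hemb : MeasurableEmbedding L := L.toHomeomorph.measurableEmbedding
  have hLp : ∀ u : E → ℝ, eLpNorm (u ∘ L) 2 volume =
      (c ^ (1 / 2 : ℝ) : ℝ≥0) * eLpNorm u 2 volume := fun u => by
    rw [← hemb.eLpNorm_map_measure]
    change eLpNorm u 2 ν = _
    rw [hν]
    have := eLpNorm_smul_measure_of_ne_top' (p := 2) (by norm_num) c u (μ := (volume : Measure E))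
    rw [this]
    simp [ENNReal.smul_def]
  have hint : ∀ f : E → ℝ, ∫ x, f (L x) = c • ∫ x, f x := fun f => by
    rw [← integral_smul_nnreal_measure, ← hν, hemb.integral_map]
  have hloc : ∀ {u : E → ℝ}, LocallyIntegrable u volume → LocallyIntegrable (u ∘ L) volume := by
    intro u hu
    have h1 : LocallyIntegrable u ν := by
      intro x
      obtain ⟨S, hS, hi⟩ := hu x
      refine ⟨S, hS, ?_⟩
      rw [hν, IntegrableOn, Measure.restrict_smul]
      exact Integrable.smul_measure_nnreal hi
    exact (locallyIntegrable_map_homeomorph L.toHomeomorph).1 h1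
  have hwd : ∀ {b : κ → H} {i : κ} {u u' : E → ℝ}, WD (fun i => L (b i)) i u u' →
      WD b i (u ∘ L) (u' ∘ L) := by
    intro b i u u' h
    rw [wd_iff] at h ⊢
    refine ⟨hloc h.1, hloc h.2.1, fun φ hφ hcφ => ?_⟩
    have hψ : ContDiff ℝ ∞ (φ ∘ L.symm) := hφ.comp L.symm.contDiff
    have hcψ : HasCompactSupport (φ ∘ L.symm) := hcφ.comp_homeomorph L.symm.toHomeomorph
    have key := h.2.2 _ hψ hcψ
    have h1 : ∀ x, fderiv ℝ (φ ∘ L.symm) (L x) (L (b i)) = fderiv ℝ φ x (b i) := fun x => by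
      rw [L.symm.comp_right_fderiv]
      simp
    have e1 := hint fun y => fderiv ℝ (φ ∘ L.symm) y (L (b i)) • u y
    have e2 := hint fun y => (φ ∘ L.symm) y • u' y
    simp only [h1] at e1
    simp only [Function.comp, L.symm_apply_apply] at e2 ⊢
    rw [e1, e2]
    rw [show (∫ x, fderiv ℝ (φ ∘ L.symm) x (L (b i)) • u x) = _ from key, smul_neg]
    rfl
  refine ⟨c ^ (1 / 2 : ℝ), by simpa using hc0, hLp, fun b s => ?_⟩
  have h0 : ∀ {s} {u : E → ℝ}, eLpNorm (u ∘ L) 2 volume ≤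
      (c ^ (1 / 2 : ℝ) : ℝ≥0) * sobNorm (fun i => L (b i)) s u := fun {s u} => by
    rw [hLp]; gcongr; exact eLpNorm_le_sobNorm _ _ _
  induction s with
  | zero =>
    exact ⟨_, fun u hu => (sobNorm_zero_le (hloc (locallyIntegrable_of_sobNorm_lt_top hu))).trans h0⟩
  | succ s ih =>
    obtain ⟨C, hC⟩ := ih
    refine ⟨c ^ (1 / 2 : ℝ) + Fintype.card κ * C, fun u hu => ?_⟩
    choose u' hu' using exists_wd_of_sobNorm_lt_top hu
    have h2 : ∀ i, sobNorm b s (u' i ∘ L) ≤ C * sobNorm (fun i => L (b i)) (s + 1) u := fun i =>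
      (hC _ ((sobNorm_wd_le (hu' i)).trans_lt hu)).trans (by gcongr; exact sobNorm_wd_le (hu' i))
    refine (sobNorm_succ_le (hloc (locallyIntegrable_of_sobNorm_lt_top hu))
      fun i => hwd (hu' i)).trans
      ((add_le_add (h0 (s := s + 1)) (Finset.sum_le_sum fun i _ => h2 i)).trans (le_of_eq ?_))
    simp only [Finset.sum_const, Finset.card_univ, nsmul_eq_mul]
    push_cast
    ring

/-- The basic product estimate at regularity `k`: `H^r · H^t ⊂ L²` whenever `k ≤ r + t`.  It holds
when `k` exceeds half the dimension. -/
def SobMul (b : κ → E) (k : ℕ) : Prop :=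
  ∀ r t : ℕ, k ≤ r + t → ∃ C : ℝ≥0, ∀ p q : E → ℝ, sobNorm b r p < ⊤ → sobNorm b t q < ⊤ →
    eLpNorm (fun x => p x * q x) 2 volume ≤ C * (sobNorm b r p * sobNorm b t q)

/-- The product estimate needs to be checked for test functions only, by approximation and Fatou. -/
theorem sobMul_of_smooth {b : κ → E} {k : ℕ} (h : ∀ r t : ℕ, k ≤ r + t →
    ∃ C : ℝ≥0, ∀ p q : E → ℝ, ContDiff ℝ ∞ p → HasCompactSupport p → ContDiff ℝ ∞ q →
      HasCompactSupport q →
      eLpNorm (fun x => p x * q x) 2 volume ≤ C * (sobNorm b r p * sobNorm b t q)) :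
    SobMul b k := by
  intro r t hrt
  obtain ⟨C, hC⟩ := h r t hrt
  obtain ⟨C₁, h₁⟩ := exists_smooth_approx b r
  obtain ⟨C₂, h₂⟩ := exists_smooth_approx b t
  refine ⟨C * (C₁ * C₂), fun p q hp hq => ?_⟩
  obtain ⟨v, hv, hvc, hvn, hvl⟩ := h₁ p hp
  obtain ⟨w, hw, hwc, hwn, hwl⟩ := h₂ q hq
  refine eLpNorm_le_of_ae_tendsto_of_bound (f := fun n x => v n x * w n x)
    (fun n => ((hv n).continuous.mul (hw n).continuous).aestronglyMeasurable) (fun n => ?_) ?_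
  · refine (hC _ _ (hv n) (hvc n) (hw n) (hwc n)).trans ?_
    calc _ ≤ (C : ℝ≥0∞) * ((C₁ * sobNorm b r p) * (C₂ * sobNorm b t q)) := by
          gcongr <;> [exact hvn n; exact hwn n]
      _ = _ := by push_cast; ring
  · filter_upwards [hvl, hwl] with x h1 h2 using h1.mul h2

/-- The product estimate holds above half the dimension for derivatives along any basis: a linear
change of variables reduces it to the coordinate directions of a Euclidean space, where the Fourier
transform is available. -/
theorem sobMul_of_basis (B : Module.Basis κ ℝ E) {k : ℕ} (hk : Fintype.card κ < 2 * k) :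
    SobMul B k := by
  classical
  let H := EuclideanSpace ℝ κ
  let e : κ → H := fun i => EuclideanSpace.single i 1
  let L : H ≃L[ℝ] E := ((WithLp.linearEquiv 2 ℝ (κ → ℝ)).trans
    B.equivFun.symm).toContinuousLinearEquiv
  have hL : ∀ i, L (e i) = B i := fun i => by
    change B.equivFun.symm (Pi.single i 1) = B i
    simp
  have hB : (fun i => L (e i)) = B := funext hL
  have hb : ∀ ξ : H, ‖ξ‖ ≤ ∑ i, |⟪ξ, e i⟫| := fun ξ => by
    have h1 : ∀ i, ⟪ξ, e i⟫ = ξ i := fun i => by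
      simp only [e]; rw [EuclideanSpace.inner_single_right]; simp
    simp_rw [h1]
    rw [EuclideanSpace.norm_eq]
    refine Real.sqrt_le_iff.2 ⟨by positivity, ?_⟩
    simp only [Real.norm_eq_abs]
    exact Finset.sum_sq_le_sq_sum_of_nonneg fun i _ => abs_nonneg _
  have hH : SobMul e k := sobMul_of_smooth fun r t hrt =>
    exists_eLpNorm_mul_le_of_smooth hb (by
      have : Module.finrank ℝ H = Fintype.card κ := finrank_euclideanSpace
      omega)
  obtain ⟨c, hc0, hLp, hN⟩ := sobNorm_comp_le_of_continuousLinearEquiv (κ := κ) L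
  intro r t hrt
  obtain ⟨C, hC⟩ := hH r t hrt
  obtain ⟨C₁, h₁⟩ := hN e r
  obtain ⟨C₂, h₂⟩ := hN e t
  rw [hB] at h₁ h₂
  refine ⟨c⁻¹ * (C * (C₁ * C₂)), fun p q hp hq => ?_⟩
  have hcc : (c : ℝ≥0∞) ≠ 0 := by simpa using hc0
  have key : (c : ℝ≥0∞) * eLpNorm (fun x => p x * q x) 2 volume ≤
      C * ((C₁ * sobNorm B r p) * (C₂ * sobNorm B t q)) := by
    rw [← hLp]
    refine (hC (p ∘ L) (q ∘ L) ((h₁ p hp).trans_lt (ENNReal.mul_lt_top ENNReal.coe_lt_top hp))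
      ((h₂ q hq).trans_lt (ENNReal.mul_lt_top ENNReal.coe_lt_top hq))).trans ?_
    gcongr <;> [exact h₁ p hp; exact h₂ q hq]
  calc _ = (c : ℝ≥0∞)⁻¹ * (c * eLpNorm (fun x => p x * q x) 2 volume) := by
        rw [← mul_assoc, ENNReal.inv_mul_cancel hcc ENNReal.coe_ne_top, one_mul]
    _ ≤ (c : ℝ≥0∞)⁻¹ * (C * ((C₁ * sobNorm B r p) * (C₂ * sobNorm B t q))) := by gcongr
    _ = _ := by
        push_cast
        rw [ENNReal.coe_inv hc0]
        ring

/-- `H^k ⊂ L^∞`: multiplication by an element of `H^k` is bounded on `L²`. -/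
theorem SobMul.exists_ae_bound {b : κ → E} {k : ℕ} (hk : SobMul b k) :
    ∃ C : ℝ≥0, ∀ q : E → ℝ, sobNorm b k q < ⊤ → ∀ᵐ x, ‖q x‖ₑ ≤ C * sobNorm b k q := by
  obtain ⟨C, hC⟩ := hk 0 k (by simp)
  refine ⟨C, fun q hq => ?_⟩
  have hqm := (memLp_of_sobNorm_lt_top hq).1
  have key : (fun x => ‖q x‖ₑ ^ 2) ≤ᵐ[volume] fun _ => (C * sobNorm b k q) ^ 2 := by
    refine ae_le_of_forall_setLIntegral_le_of_sigmaFinite₀ (hqm.enorm.pow_const 2) fun S hS hSt => ?_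
    -- Testing with the indicator functions of sets `S` of finite measure bounds the mean of `|q|²`
    -- on each `S`.
    let p : E → ℝ := S.indicator 1
    have hp : MemLp p 2 volume := (memLp_indicator_const 2 hS (1 : ℝ) (Or.inr hSt.ne))
    have hp2 : eLpNorm p 2 volume ^ 2 = volume S := by
      rw [← lintegral_sq_eq_eLpNorm]
      have : ∀ x, ‖p x‖ₑ ^ 2 = S.indicator 1 x := fun x => by
        by_cases hx : x ∈ S <;> simp [p, hx]
      simp_rw [this]
      rw [lintegral_indicator_one hS]
    have hp0 : sobNorm b 0 p ≤ eLpNorm p 2 volume :=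
      sobNorm_zero_le (hp.locallyIntegrable (by norm_num))
    have e1 : ∫⁻ x in S, ‖q x‖ₑ ^ 2 = eLpNorm (fun x => p x * q x) 2 volume ^ 2 := by
      rw [← lintegral_sq_eq_eLpNorm, ← lintegral_indicator hS]
      refine lintegral_congr fun x => ?_
      by_cases hx : x ∈ S <;> simp [p, hx]
    rw [e1, setLIntegral_const, ← hp2, ← mul_pow]
    gcongr
    calc _ ≤ C * (sobNorm b 0 p * sobNorm b k q) := hC p q (hp0.trans_lt hp.2) hq
      _ ≤ C * (eLpNorm p 2 volume * sobNorm b k q) := by gcongr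
      _ = _ := by ring
  exact key.mono fun x hx => (ENNReal.pow_le_pow_left_iff two_ne_zero).1 hx

theorem SobMul.mono {b : κ → E} {k l : ℕ} (hk : SobMul b k) (hkl : k ≤ l) : SobMul b l :=
  fun r t h => hk r t (hkl.trans h)

/-- The product estimate `H^r · H^t ⊂ H^s`. -/
theorem SobMul.exists_sobNorm_mul_le {b : κ → E} {k : ℕ} (hk : SobMul b k) (s : ℕ) :
    ∀ r t : ℕ, s ≤ r → s ≤ t → s + k ≤ r + t → ∃ C : ℝ≥0, ∀ p q : E → ℝ, sobNorm b r p < ⊤ →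
      sobNorm b t q < ⊤ →
      sobNorm b s (fun x => p x * q x) ≤ C * (sobNorm b r p * sobNorm b t q) := by
  have hl : ∀ {r t} {p q : E → ℝ}, sobNorm b r p < ⊤ → sobNorm b t q < ⊤ →
      LocallyIntegrable (fun x => p x * q x) volume := fun hp hq =>
    (memLp_of_sobNorm_lt_top hp).l2loc.locallyIntegrable_mul (memLp_of_sobNorm_lt_top hq).l2loc
  induction s with
  | zero =>
    intro r t _ _ h
    obtain ⟨C, hC⟩ := hk r t (by omega)
    exact ⟨C, fun p q hp hq => (sobNorm_zero_le (hl hp hq)).trans (hC p q hp hq)⟩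
  | succ s ih =>
    intro r t hr ht h
    obtain ⟨r, rfl⟩ : ∃ r', r = r' + 1 := ⟨r - 1, by omega⟩
    obtain ⟨t, rfl⟩ : ∃ t', t = t' + 1 := ⟨t - 1, by omega⟩
    obtain ⟨C₀, h₀⟩ := hk (r + 1) (t + 1) (by omega)
    obtain ⟨C₁, h₁⟩ := ih r (t + 1) (by omega) (by omega) (by omega)
    obtain ⟨C₂, h₂⟩ := ih (r + 1) t (by omega) (by omega) (by omega)
    obtain ⟨C₃, h₃⟩ := exists_sobNorm_add_le (F := ℝ) b s
    refine ⟨C₀ + Fintype.card κ * (C₃ * (C₁ + C₂)), fun p q hp hq => ?_⟩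
    choose p' hp' using exists_wd_of_sobNorm_lt_top hp
    choose q' hq' using exists_wd_of_sobNorm_lt_top hq
    have hpl : ∀ i, sobNorm b r (p' i) < ⊤ := fun i => (sobNorm_wd_le (hp' i)).trans_lt hp
    have hql : ∀ i, sobNorm b t (q' i) < ⊤ := fun i => (sobNorm_wd_le (hq' i)).trans_lt hq
    have hd := fun i => (hp' i).mul (hq' i) (memLp_of_sobNorm_lt_top hp).l2loc
      (memLp_of_sobNorm_lt_top (hpl i)).l2loc (memLp_of_sobNorm_lt_top hq)
      (memLp_of_sobNorm_lt_top (hql i))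
    set A := sobNorm b (r + 1) p * sobNorm b (t + 1) q
    have hi : ∀ i, sobNorm b s (fun x => p' i x * q x + p x * q' i x) ≤ C₃ * (C₁ + C₂) * A := by
      intro i
      refine (h₃ _ _).trans ?_
      rw [mul_assoc, add_mul]
      gcongr
      · refine (h₁ _ _ (hpl i) hq).trans ?_
        simp only [A]
        gcongr
        exact sobNorm_wd_le (hp' i)
      · refine (h₂ _ _ hp (hql i)).trans ?_
        simp only [A]
        gcongr
        exact sobNorm_wd_le (hq' i)
    refine (sobNorm_succ_le (hl hp hq) hd).trans
      ((add_le_add (h₀ p q hp hq) (Finset.sum_le_sum fun i _ => hi i)).trans (le_of_eq ?_))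
    simp only [Finset.sum_const, Finset.card_univ, nsmul_eq_mul]
    push_cast
    ring

theorem SobMul.dom_mul {P : Type*} {b : κ → E} {k : ℕ} (hk : SobMul b k) {s r t : ℕ} (hr : s ≤ r)
    (ht : s ≤ t) (h : s + k ≤ r + t) {p q : P → E → ℝ} (hp : ∀ i, sobNorm b r (p i) < ⊤)
    (hq : ∀ i, sobNorm b t (q i) < ⊤) :
    Dom (fun i => sobNorm b s fun x => p i x * q i x)
      (fun i => sobNorm b r (p i) * sobNorm b t (q i)) := by
  obtain ⟨C, hC⟩ := hk.exists_sobNorm_mul_le s r t hr ht h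
  exact ⟨C, fun i => hC _ _ (hp i) (hq i)⟩

end Approx

end PlanarWave

namespace PlanarWave

open scoped NNReal Topology
open Filter

/-! ### Superposition operators on `H^k` -/

section Pointwise

variable {m : ℕ}

theorem exists_lipschitz_bound {G : (Fin m → ℝ) → ℝ} (hG : ContDiff ℝ 1 G) (R : ℝ) :
    ∃ M : ℝ, 0 ≤ M ∧ ∀ y y', ‖y‖ ≤ R → ‖y'‖ ≤ R → |G y - G y'| ≤ M * ∑ c, |y c - y' c| := by
  obtain ⟨M, hM⟩ := (isCompact_closedBall (0 : Fin m → ℝ) R).exists_bound_of_continuousOn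
    (hG.continuous_fderiv one_ne_zero).continuousOn
  refine ⟨max M 0, le_max_right _ _, fun y y' hy hy' => ?_⟩
  have h1 := (convex_closedBall (0 : Fin m → ℝ) R).norm_image_sub_le_of_norm_fderiv_le (𝕜 := ℝ)
    (f := G) (fun x _ => hG.differentiable one_ne_zero x) hM
    (mem_closedBall_zero_iff.2 hy') (mem_closedBall_zero_iff.2 hy)
  rw [Real.norm_eq_abs] at h1
  refine h1.trans ?_
  have h2 : ‖y - y'‖ ≤ ∑ c, |y c - y' c| :=
    (pi_norm_le_iff_of_nonneg (Finset.sum_nonneg fun c _ => abs_nonneg _)).2 fun c =>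
      Finset.single_le_sum (f := fun c => |y c - y' c|) (fun c _ => abs_nonneg _)
        (Finset.mem_univ c)
  exact mul_le_mul (le_max_left _ _) h2 (norm_nonneg _) (le_max_right _ _)

theorem pd_comm {G : (Fin m → ℝ) → ℝ} (hG : ContDiff ℝ 2 G) (c e : Fin m) (y : Fin m → ℝ) :
    pd c (pd e G) y = pd e (pd c G) y := by
  have hd : DifferentiableAt ℝ (fderiv ℝ G) y :=
    (hG.fderiv_right (m := 1) (by norm_num)).differentiable one_ne_zero y
  have h : ∀ c e, pd c (pd e G) y = fderiv ℝ (fderiv ℝ G) y (Pi.single c 1) (Pi.single e 1) := by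
    intro c e
    have : HasFDerivAt (fun y => fderiv ℝ G y (Pi.single e 1))
        ((ContinuousLinearMap.apply ℝ ℝ (Pi.single e 1 : Fin m → ℝ)).comp
          (fderiv ℝ (fderiv ℝ G) y)) y :=
      (ContinuousLinearMap.apply ℝ ℝ (Pi.single e 1 : Fin m → ℝ)).hasFDerivAt.comp y hd.hasFDerivAt
    change fderiv ℝ (fun y => fderiv ℝ G y (Pi.single e 1)) y (Pi.single c 1) = _
    rw [this.fderiv]
    rfl
  rw [h, h]
  exact (hG.contDiffAt.isSymmSndFDerivAt (by simp)) _ _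

/-- The second-order remainder `F(α + υ + ν) - F(α + υ) - DF(α) ν` is at most bilinear. -/
theorem exists_taylor_bound {F : (Fin m → ℝ) → ℝ} (hF : ContDiff ℝ 2 F) (R : ℝ) :
    ∃ M : ℝ, 0 ≤ M ∧ ∀ α υ ν : Fin m → ℝ, ‖α‖ ≤ R → ‖υ‖ ≤ R → ‖ν‖ ≤ R →
      |F (α + υ + ν) - F (α + υ) - ∑ c, pd c F α * ν c| ≤
        M * ∑ c, ∑ e, (|υ e| + |ν e|) * |ν c| := by
  have hpd : ∀ c, ContDiff ℝ 1 (pd c F) := fun c => contDiff_pd (s := 1) (by simpa using hF) c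
  choose M hM0 hM using fun c => exists_lipschitz_bound (hpd c) (R + R + R)
  refine ⟨∑ c, M c, Finset.sum_nonneg fun c _ => hM0 c, fun α υ ν hα hυ hν => ?_⟩
  have hR : 0 ≤ R := (norm_nonneg _).trans hα
  let φ : ℝ → ℝ := fun t => F (α + υ + t • ν) - t * ∑ c, pd c F α * ν c
  have hφ : ∀ t, HasDerivAt φ (∑ c, (pd c F (α + υ + t • ν) - pd c F α) * ν c) t := fun t => by
    have h1 : HasDerivAt (fun t : ℝ => α + υ + t • ν) ν t := by
      simpa using ((hasDerivAt_id t).smul_const ν).const_add (α + υ)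
    have h2 := (hF.differentiable (by simp) (α + υ + t • ν)).hasFDerivAt.comp_hasDerivAt t h1
    have h3 := h2.sub ((hasDerivAt_id t).mul_const (∑ c, pd c F α * ν c))
    rw [fderiv_apply_eq_sum_pd, one_mul, ← Finset.sum_sub_distrib] at h3
    simp_rw [sub_mul]
    exact h3
  have hb : ∀ t ∈ Set.Ico (0 : ℝ) 1, ‖∑ c, (pd c F (α + υ + t • ν) - pd c F α) * ν c‖ ≤
      (∑ c, M c) * ∑ c, ∑ e, (|υ e| + |ν e|) * |ν c| := by
    intro t ht
    have ht1 : |t| ≤ 1 := by rw [abs_of_nonneg ht.1]; exact ht.2.le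
    have hy : ‖α + υ + t • ν‖ ≤ R + R + R := by
      refine (norm_add_le _ _).trans (add_le_add ((norm_add_le _ _).trans (add_le_add hα hυ)) ?_)
      rw [norm_smul]
      exact (mul_le_of_le_one_left (norm_nonneg _) ht1).trans hν
    have hy' : ‖α‖ ≤ R + R + R := by linarith
    calc ‖∑ c, (pd c F (α + υ + t • ν) - pd c F α) * ν c‖
        ≤ ∑ c, ‖(pd c F (α + υ + t • ν) - pd c F α) * ν c‖ := norm_sum_le _ _
      _ ≤ ∑ c, (∑ c, M c) * ∑ e, (|υ e| + |ν e|) * |ν c| := by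
          refine Finset.sum_le_sum fun c _ => ?_
          rw [norm_mul, Real.norm_eq_abs, Real.norm_eq_abs, ← Finset.sum_mul, ← mul_assoc]
          refine mul_le_mul_of_nonneg_right ?_ (abs_nonneg _)
          refine (hM c _ _ hy hy').trans (mul_le_mul (Finset.single_le_sum
            (f := M) (fun c _ => hM0 c) (Finset.mem_univ c)) (Finset.sum_le_sum fun e _ => ?_)
            (Finset.sum_nonneg fun e _ => abs_nonneg _) (Finset.sum_nonneg fun c _ => hM0 c))
          have : (α + υ + t • ν) e - α e = υ e + t * ν e := by
            simp only [Pi.add_apply, Pi.smul_apply, smul_eq_mul]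
            ring
          rw [this]
          refine (abs_add_le _ _).trans (add_le_add le_rfl ?_)
          rw [abs_mul]
          exact mul_le_of_le_one_left (abs_nonneg _) ht1
      _ = _ := by rw [Finset.mul_sum]
  have := norm_image_sub_le_of_norm_deriv_le_segment_01' (f := φ)
    (fun t _ => (hφ t).hasDerivWithinAt) hb
  rw [Real.norm_eq_abs] at this
  convert this using 2
  simp [φ]
  ring

theorem eLpNorm_le_of_abs_le_sum {α ι : Type*} [MeasurableSpace α] {μ : Measure α} {s : Finset ι}
    {p : ℝ≥0∞} (hp : 1 ≤ p) {f : α → ℝ} {g : ι → α → ℝ} {M : ℝ} (hM : 0 ≤ M)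
    (hg : ∀ c ∈ s, AEStronglyMeasurable (g c) μ) (h : ∀ᵐ x ∂μ, |f x| ≤ M * ∑ c ∈ s, |g c x|) :
    eLpNorm f p μ ≤ M.toNNReal * ∑ c ∈ s, eLpNorm (g c) p μ := by
  have h1 : eLpNorm f p μ ≤ M.toNNReal • eLpNorm (fun x => ∑ c ∈ s, |g c x|) p μ := by
    refine eLpNorm_le_nnreal_smul_eLpNorm_of_ae_le_mul (h.mono fun x hx => ?_) p
    rw [← NNReal.coe_le_coe, NNReal.coe_mul, Real.coe_toNNReal _ hM, coe_nnnorm, coe_nnnorm,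
      Real.norm_eq_abs, Real.norm_of_nonneg (Finset.sum_nonneg fun c _ => abs_nonneg _)]
    exact hx
  rw [ENNReal.smul_def, smul_eq_mul] at h1
  refine h1.trans ?_
  gcongr
  have h2 := eLpNorm_sum_le (s := s) (μ := μ) (p := p) (f := fun c x => |g c x|)
    (fun c hc => (hg c hc).norm) hp
  have e : (∑ c ∈ s, fun x => |g c x|) = fun x => ∑ c ∈ s, |g c x| := by ext x; simp
  rw [e] at h2
  refine h2.trans (le_of_eq (Finset.sum_congr rfl fun c _ => ?_))
  exact eLpNorm_norm (g c)

end Pointwise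

section Superposition

variable {κ E P : Type*} [Fintype κ] [NormedAddCommGroup E] [NormedSpace ℝ E]
  [FiniteDimensional ℝ E] [MeasureSpace E] [BorelSpace E] [(volume : Measure E).IsAddHaarMeasure]
  {m : ℕ} {b : κ → E} {k : ℕ}

theorem sobNorm_zero_fun {F : Type*} [NormedAddCommGroup F] [NormedSpace ℝ F] (b : κ → E) (s : ℕ) :
    sobNorm b s (fun _ : E => (0 : F)) = 0 := by
  refine le_antisymm ((iInf₂_le (fun _ _ _ => 0) fun j _ w => ?_).trans ?_) zero_le
  · exact ⟨locallyIntegrable_zero, locallyIntegrable_zero, fun φ _ _ => by simp⟩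
  · simp

theorem dom_sobNorm_sum {ι : Type*} {S : Finset ι} {s : ℕ} {u : ι → P → E → ℝ} {B : P → ℝ≥0∞}
    (h : ∀ c ∈ S, Dom (fun p => sobNorm b s (u c p)) B) :
    Dom (fun p => sobNorm b s fun x => ∑ c ∈ S, u c p x) B := by
  classical
  induction S using Finset.induction_on with
  | empty => exact ⟨0, fun p => by simp [sobNorm_zero_fun]⟩
  | insert c S hc ih =>
    simp only [Finset.sum_insert hc]
    exact dom_sobNorm_add (h c (Finset.mem_insert_self _ _))
      (ih fun j hj => h j (Finset.mem_insert_of_mem hj))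

theorem dom_sobNorm_neg {s : ℕ} {u : P → E → ℝ} {B : P → ℝ≥0∞}
    (hB : ∀ p, B p < ⊤) (h : Dom (fun p => sobNorm b s (u p)) B) :
    Dom (fun p => sobNorm b s fun x => -u p x) B := by
  obtain ⟨C, hC⟩ := exists_sobNorm_clm_le (F := ℝ) (F' := ℝ) b s
  refine Dom.trans ⟨C, fun p => ?_⟩ h
  have h1 : ‖-ContinuousLinearMap.id ℝ ℝ‖ₑ = 1 := by
    rw [enorm_neg, ← ofReal_norm, ContinuousLinearMap.norm_id, ENNReal.ofReal_one]
  have h2 := hC (-ContinuousLinearMap.id ℝ ℝ) (u p) (h.lt_top (hB p))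
  rwa [h1, one_mul] at h2

theorem dom_sobNorm_sub {s : ℕ} {u v : P → E → ℝ} {B : P → ℝ≥0∞} (hB : ∀ p, B p < ⊤)
    (hu : Dom (fun p => sobNorm b s (u p)) B) (hv : Dom (fun p => sobNorm b s (v p)) B) :
    Dom (fun p => sobNorm b s fun x => u p x - v p x) B := by
  simp only [sub_eq_add_neg]
  exact dom_sobNorm_add hu (dom_sobNorm_neg hB hv)

theorem sobNorm_sub_lt_top {s : ℕ} {u v : E → ℝ} (hu : sobNorm b s u < ⊤)
    (hv : sobNorm b s v < ⊤) : sobNorm b s (fun x => u x - v x) < ⊤ :=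
  (dom_sobNorm_sub (P := Unit) (u := fun _ => u) (v := fun _ => v)
    (B := fun _ => sobNorm b s u + sobNorm b s v) (fun _ => by finiteness)
    (Dom.of_le fun _ => le_self_add) (Dom.of_le fun _ => le_add_self)).lt_top (p := ())
    (by finiteness)

/-- The function `a + z` with values in `ℝ^m`, for families of components. -/
def bgAdd (a z : Fin m → E → ℝ) (x : E) : Fin m → ℝ := fun c => a c x + z c x

/-- A background `a` with bounded derivatives up to order `k`, and a family of perturbations `z`
that is bounded in `H^k`. -/
structure BddState (b : κ → E) (k : ℕ) (a : Fin m → E → ℝ) (z : P → Fin m → E → ℝ) : Prop where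
  bg : ∀ c, BddDeriv b k fun _ : P => a c
  dom : ∀ c, Dom (fun p => sobNorm b k (z p c)) fun _ => 1

/-- The sum of the `H^k` norms of the components. -/
noncomputable def compNorm (b : κ → E) (k : ℕ) (z : Fin m → E → ℝ) : ℝ≥0∞ :=
  ∑ c, sobNorm b k (z c)

theorem sobNorm_le_compNorm (b : κ → E) (k : ℕ) (z : Fin m → E → ℝ) (c : Fin m) :
    sobNorm b k (z c) ≤ compNorm b k z :=
  Finset.single_le_sum (f := fun c => sobNorm b k (z c)) (fun _ _ => zero_le) (Finset.mem_univ c)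

namespace BddState

variable {a : Fin m → E → ℝ} {z zA zB u v : P → Fin m → E → ℝ}

theorem lt_top (h : BddState b k a z) (p : P) (c : Fin m) : sobNorm b k (z p c) < ⊤ :=
  (h.dom c).lt_top ENNReal.one_lt_top

theorem compNorm_lt_top (h : BddState b k a z) (p : P) : compNorm b k (z p) < ⊤ :=
  ENNReal.sum_lt_top.2 fun c _ => h.lt_top p c

theorem zero (h : BddState b k a z) : BddState b k a (fun (_ : P) (_ : Fin m) (_ : E) => (0 : ℝ)) :=
  ⟨h.bg, fun _ => ⟨0, fun p => by simp [sobNorm_zero_fun]⟩⟩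

theorem add (hu : BddState b k a u) (hv : BddState b k a v) :
    BddState b k a fun p c x => u p c x + v p c x :=
  ⟨hu.bg, fun c => dom_sobNorm_add (hu.dom c) (hv.dom c)⟩

theorem sub_lt_top (hA : BddState b k a zA) (hB : BddState b k a zB) (p : P) (c : Fin m) :
    sobNorm b k (fun x => zA p c x - zB p c x) < ⊤ :=
  sobNorm_sub_lt_top (hA.lt_top p c) (hB.lt_top p c)

theorem compNorm_sub_lt_top (hA : BddState b k a zA) (hB : BddState b k a zB) (p : P) :
    compNorm b k (fun c x => zA p c x - zB p c x) < ⊤ :=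
  ENNReal.sum_lt_top.2 fun c _ => sub_lt_top hA hB p c

theorem memLp (h : BddState b k a z) (p : P) (c : Fin m) : MemLp (z p c) 2 volume :=
  memLp_of_sobNorm_lt_top (h.lt_top p c)

theorem exists_bound (h : BddState b k a z) (hk : SobMul b k) :
    ∃ R : ℝ, 0 ≤ R ∧ ∀ p, (∀ c x, |a c x| ≤ R) ∧ ∀ c, ∀ᵐ x, |z p c x| ≤ R := by
  obtain ⟨C, hC⟩ := hk.exists_ae_bound
  choose C₁ h₁ using fun c => (h.bg c).zero.2
  choose C₂ h₂ using h.dom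
  refine ⟨(∑ c, |C₁ c|) + ∑ c, (C * C₂ c : ℝ), by positivity, fun p => ⟨fun c x => ?_, fun c => ?_⟩⟩
  · refine (h₁ c p x).trans ((le_abs_self _).trans ?_)
    refine (Finset.single_le_sum (f := fun c => |C₁ c|) (fun _ _ => abs_nonneg _)
      (Finset.mem_univ c)).trans ?_
    exact le_add_of_nonneg_right (by positivity)
  · filter_upwards [hC _ (h.lt_top p c)] with x hx
    have h3 : ‖z p c x‖ₑ ≤ ((C * C₂ c : ℝ≥0) : ℝ≥0∞) := by
      refine hx.trans ?_
      push_cast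
      gcongr
      simpa using h₂ c p
    have h4 : |z p c x| ≤ C * C₂ c := by
      rw [enorm_le_coe, ← NNReal.coe_le_coe] at h3
      simpa using h3
    refine h4.trans ?_
    refine (Finset.single_le_sum (f := fun c => (C * C₂ c : ℝ)) (fun _ _ => by positivity)
      (Finset.mem_univ c)).trans ?_
    exact le_add_of_nonneg_left (by positivity)

theorem exists_norm_bound (h : BddState b k a z) (hk : SobMul b k) :
    ∃ R : ℝ, 0 ≤ R ∧ ∀ p, ∀ᵐ x, ‖bgAdd a (z p) x‖ ≤ R := by
  obtain ⟨R, hR0, hR⟩ := h.exists_bound hk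
  refine ⟨R + R, by positivity, fun p => ?_⟩
  filter_upwards [ae_all_iff.2 (hR p).2] with x hx
  exact (pi_norm_le_iff_of_nonneg (by positivity)).2 fun c =>
    (abs_add_le _ _).trans (add_le_add ((hR p).1 c x) (hx c))

theorem aestronglyMeasurable (h : BddState b k a z) {G : (Fin m → ℝ) → ℝ} (hG : Continuous G)
    (p : P) : AEStronglyMeasurable (fun x => G (bgAdd a (z p) x)) volume := by
  have : AEStronglyMeasurable (bgAdd a (z p)) volume :=
    (aemeasurable_pi_iff.2 fun c => (((h.bg c).zero.1 p).aestronglyMeasurable.add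
      (h.memLp p c).1).aemeasurable).aestronglyMeasurable
  exact hG.comp_aestronglyMeasurable this

theorem exists_comp_bound (h : BddState b k a z) (hk : SobMul b k) {G : (Fin m → ℝ) → ℝ}
    (hG : Continuous G) : ∃ M : ℝ, 0 ≤ M ∧ ∀ p, ∀ᵐ x, |G (bgAdd a (z p) x)| ≤ M := by
  obtain ⟨R, -, hR⟩ := h.exists_norm_bound hk
  obtain ⟨M, hM0, hM⟩ := exists_bound_of_continuous hG R
  exact ⟨M, hM0, fun p => (hR p).mono fun x hx => hM _ hx⟩

theorem l2loc_comp (h : BddState b k a z) (hk : SobMul b k) {G : (Fin m → ℝ) → ℝ}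
    (hG : Continuous G) (p : P) : L2loc fun x => G (bgAdd a (z p) x) := by
  obtain ⟨M, -, hM⟩ := h.exists_comp_bound hk hG
  exact l2loc_of_bound (h.aestronglyMeasurable hG p) (hM p)

theorem wd_comp (h : BddState b (k + 1) a z) (hk : SobMul b (k + 1)) {G : (Fin m → ℝ) → ℝ}
    (hG : ContDiff ℝ 1 G) {p : P} {i : κ} {z' : Fin m → E → ℝ} (hz : ∀ c, WD b i (z p c) (z' c)) :
    WD b i (fun x => G (bgAdd a (z p) x)) (fun x => ∑ c, pd c G (bgAdd a (z p) x) *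
      (fderiv ℝ (a c) x (b i) + z' c x)) := by
  obtain ⟨R, -, hR⟩ := h.exists_bound hk
  exact WD.comp hG (fun c => (h.bg c).1.1 p) (hR p).1 hz (h.memLp p)
    (fun c => memLp_of_sobNorm_lt_top ((sobNorm_wd_le (hz c)).trans_lt (h.lt_top p c))) (hR p).2

theorem l2loc_wd_comp (h : BddState b (k + 1) a z) (hk : SobMul b (k + 1)) {G : (Fin m → ℝ) → ℝ}
    (hG : ContDiff ℝ 1 G) {p : P} {i : κ} {z' : Fin m → E → ℝ} (hz : ∀ c, WD b i (z p c) (z' c)) :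
    L2loc fun x => ∑ c, pd c G (bgAdd a (z p) x) * (fderiv ℝ (a c) x (b i) + z' c x) := by
  have hpd : ∀ c, Continuous (pd c G) := fun c =>
    (contDiff_pd (s := 0) (by simpa using hG) c).continuous
  refine L2loc.sum fun c _ => ?_
  obtain ⟨M, -, hM⟩ := h.exists_comp_bound hk (hpd c)
  exact ((l2loc_of_continuous (((h.bg c).2 i).zero.1 p)).add (memLp_of_sobNorm_lt_top
    ((sobNorm_wd_le (hz c)).trans_lt (h.lt_top p c))).l2loc).bdd_mul
    (h.aestronglyMeasurable (hpd c) p) (hM p)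

/-- Composition with a `C^s` function is a multiplier on `H^s`.  A derivative of `G (a + z) w` consists
of terms `D G (a + z)` times an element of `H^{s-1}`, to which the induction applies with `w` replaced
by `(∂ a) w`, `(∂ z) w` or `∂ w`. -/
theorem dom_comp_mul (h : BddState b k a z) (hk : SobMul b k) (s : ℕ) : s ≤ k →
    ∀ {G : (Fin m → ℝ) → ℝ}, ContDiff ℝ s G → ∀ {w : P → E → ℝ}, (∀ p, sobNorm b s (w p) < ⊤) →
      Dom (fun p => sobNorm b s fun x => G (bgAdd a (z p) x) * w p x)
        (fun p => sobNorm b s (w p)) := by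
  have h0 : ∀ {s} {G : (Fin m → ℝ) → ℝ}, Continuous G → ∀ {w : P → E → ℝ},
      (∀ p, sobNorm b s (w p) < ⊤) → Dom (fun p => eLpNorm (fun x => G (bgAdd a (z p) x) * w p x)
        2 volume) (fun p => sobNorm b s (w p)) := by
    intro s G hG w hw
    obtain ⟨M, -, hM⟩ := h.exists_comp_bound hk hG
    refine ⟨M.toNNReal, fun p => (eLpNorm_mul_le_of_bound (hM p)).trans ?_⟩
    gcongr
    exact eLpNorm_le_sobNorm b s _
  have hl : ∀ {s} {G : (Fin m → ℝ) → ℝ}, Continuous G → ∀ {w : P → E → ℝ},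
      (∀ p, sobNorm b s (w p) < ⊤) → ∀ p,
      LocallyIntegrable (fun x => G (bgAdd a (z p) x) * w p x) volume := fun hG w hw p =>
    (h.l2loc_comp hk hG p).locallyIntegrable_mul (memLp_of_sobNorm_lt_top (hw p)).l2loc
  induction s with
  | zero =>
    intro _ G hG w hw
    exact (Dom.of_le fun p => sobNorm_zero_le (hl hG.continuous hw p)).trans (h0 hG.continuous hw)
  | succ s ih =>
    intro hsk G hG w hw
    obtain ⟨k, rfl⟩ : ∃ k', k = k' + 1 := ⟨k - 1, by omega⟩
    have hG1 : ContDiff ℝ 1 G := hG.of_le (by norm_cast; omega)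
    choose w' hw' using fun p => exists_wd_of_sobNorm_lt_top (hw p)
    choose z' hz' using fun p c => exists_wd_of_sobNorm_lt_top (h.lt_top p c)
    have hws : ∀ p, sobNorm b s (w p) < ⊤ := fun p =>
      (sobNorm_mono b (Nat.le_succ s) _).trans_lt (hw p)
    have hw'l : ∀ p i, sobNorm b s (w' p i) < ⊤ := fun p i => (sobNorm_wd_le (hw' p i)).trans_lt (hw p)
    have hz'l : ∀ p c i, sobNorm b k (z' p c i) < ⊤ := fun p c i =>
      (sobNorm_wd_le (hz' p c i)).trans_lt (h.lt_top p c)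
    have hz'd : ∀ c i, Dom (fun p => sobNorm b k (z' p c i)) fun _ => 1 := fun c i =>
      (Dom.of_le fun p => sobNorm_wd_le (hz' p c i)).trans (h.dom c)
    have hd : ∀ p i, WD b i (fun x => G (bgAdd a (z p) x) * w p x) (fun x =>
        (∑ c, pd c G (bgAdd a (z p) x) * (fderiv ℝ (a c) x (b i) * w p x + z' p c i x * w p x)) +
          G (bgAdd a (z p) x) * w' p i x) := fun p i => by
      have := (h.wd_comp hk hG1 (fun c => hz' p c i)).mul (hw' p i) (h.l2loc_comp hk hG.continuous p)
        (h.l2loc_wd_comp hk hG1 fun c => hz' p c i) (memLp_of_sobNorm_lt_top (hw p))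
        (memLp_of_sobNorm_lt_top (hw'l p i))
      convert this using 2 with x
      rw [Finset.sum_mul]
      congr 1
      exact Finset.sum_congr rfl fun c _ => by ring
    refine (Dom.of_le fun p => sobNorm_succ_le (hl hG.continuous hw p) (hd p)).trans
      ((h0 hG.continuous hw).add (Dom.sum fun i _ => dom_sobNorm_add (dom_sobNorm_sum fun c _ => ?_) ?_))
    · have hq : Dom (fun p => sobNorm b s fun x =>
          fderiv ℝ (a c) x (b i) * w p x + z' p c i x * w p x) (fun p => sobNorm b (s + 1) (w p)) := by
        refine dom_sobNorm_add ?_ ?_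
        · exact ((((h.bg c).2 i).mono (by omega : s ≤ k)).dom_sobNorm_mul hws).trans
            (Dom.of_le fun p => sobNorm_mono b (Nat.le_succ s) _)
        · refine (hk.dom_mul (by omega : s ≤ k) (Nat.le_succ s) (by omega)
            (fun p => hz'l p c i) hw).trans ?_
          simpa using (hz'd c i).mul (Dom.refl fun p => sobNorm b (s + 1) (w p))
      exact (ih (by omega) (contDiff_pd hG c) fun p => hq.lt_top (hw p)).trans hq
    · exact (ih (by omega) (hG.of_le (by norm_cast; omega)) fun p => hw'l p i).trans
        (Dom.of_le fun p => sobNorm_wd_le (hw' p i))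

theorem exists_sub_bound (hA : BddState b k a zA) (hB : BddState b k a zB) (hk : SobMul b k)
    {G : (Fin m → ℝ) → ℝ} (hG : ContDiff ℝ 1 G) : ∃ M : ℝ, 0 ≤ M ∧ ∀ p, ∀ᵐ x,
      |G (bgAdd a (zA p) x) - G (bgAdd a (zB p) x)| ≤ M * ∑ c, |zA p c x - zB p c x| := by
  obtain ⟨R, -, hR⟩ := hA.exists_norm_bound hk
  obtain ⟨R', -, hR'⟩ := hB.exists_norm_bound hk
  obtain ⟨M, hM0, hM⟩ := exists_lipschitz_bound hG (max R R')
  refine ⟨M, hM0, fun p => ?_⟩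
  filter_upwards [hR p, hR' p] with x h1 h2
  refine (hM _ _ (h1.trans (le_max_left _ _)) (h2.trans (le_max_right _ _))).trans (le_of_eq ?_)
  simp [bgAdd]

/-- Lipschitz estimate for composition as a multiplier on `H^s`. -/
theorem dom_sub_mul (hA : BddState b k a zA) (hB : BddState b k a zB) (hk : SobMul b k) (s : ℕ) :
    s ≤ k → ∀ {G : (Fin m → ℝ) → ℝ}, ContDiff ℝ (s + 1 : ℕ) G → ∀ {w : P → E → ℝ},
      (∀ p, sobNorm b s (w p) < ⊤) →
      Dom (fun p => sobNorm b s fun x => (G (bgAdd a (zA p) x) - G (bgAdd a (zB p) x)) * w p x)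
        (fun p => compNorm b k (fun c x => zA p c x - zB p c x) * sobNorm b s (w p)) := by
  have h0 : ∀ {s} {G : (Fin m → ℝ) → ℝ}, ContDiff ℝ 1 G → ∀ {w : P → E → ℝ},
      (∀ p, sobNorm b s (w p) < ⊤) → Dom (fun p => eLpNorm (fun x =>
        (G (bgAdd a (zA p) x) - G (bgAdd a (zB p) x)) * w p x) 2 volume)
        (fun p => compNorm b k (fun c x => zA p c x - zB p c x) * sobNorm b s (w p)) := by
    intro s G hG w hw
    obtain ⟨M, hM0, hM⟩ := exists_sub_bound hA hB hk hG
    obtain ⟨C, hC⟩ := hk k s (by omega)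
    refine ⟨M.toNNReal * C, fun p => ?_⟩
    have h1 := eLpNorm_le_of_abs_le_sum (s := Finset.univ) (p := 2) (by norm_num) hM0
      (f := fun x => (G (bgAdd a (zA p) x) - G (bgAdd a (zB p) x)) * w p x)
      (g := fun c x => (zA p c x - zB p c x) * w p x) (μ := (volume : Measure E))
      (fun c _ => ((hA.memLp p c).1.sub (hB.memLp p c).1).mul (memLp_of_sobNorm_lt_top (hw p)).1)
      ((hM p).mono fun x hx => by
        simp_rw [abs_mul, ← Finset.sum_mul, ← mul_assoc]
        exact mul_le_mul_of_nonneg_right hx (abs_nonneg _))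
    refine h1.trans ?_
    push_cast
    rw [mul_assoc]
    simp only [compNorm, Finset.sum_mul, Finset.mul_sum]
    refine Finset.sum_le_sum fun c _ => mul_le_mul_right (hC _ _ (sub_lt_top hA hB p c) (hw p)) _
  have hl : ∀ {s} {G : (Fin m → ℝ) → ℝ}, Continuous G → ∀ {w : P → E → ℝ},
      (∀ p, sobNorm b s (w p) < ⊤) → ∀ p, LocallyIntegrable (fun x =>
        (G (bgAdd a (zA p) x) - G (bgAdd a (zB p) x)) * w p x) volume := fun hG w hw p => by
    have := ((hA.l2loc_comp hk hG p).locallyIntegrable_mul (memLp_of_sobNorm_lt_top (hw p)).l2loc).sub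
      ((hB.l2loc_comp hk hG p).locallyIntegrable_mul (memLp_of_sobNorm_lt_top (hw p)).l2loc)
    refine this.congr (.of_forall fun x => ?_)
    simp only [Pi.sub_apply]
    ring
  induction s with
  | zero =>
    intro _ G hG w hw
    exact (Dom.of_le fun p => sobNorm_zero_le (hl hG.continuous hw p)).trans
      (h0 (hG.of_le (by norm_cast)) hw)
  | succ s ih =>
    intro hsk G hG w hw
    obtain ⟨k, rfl⟩ : ∃ k', k = k' + 1 := ⟨k - 1, by omega⟩
    have hG1 : ContDiff ℝ 1 G := hG.of_le (by norm_cast; omega)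
    choose w' hw' using fun p => exists_wd_of_sobNorm_lt_top (hw p)
    choose zA' hzA' using fun p c => exists_wd_of_sobNorm_lt_top (hA.lt_top p c)
    choose zB' hzB' using fun p c => exists_wd_of_sobNorm_lt_top (hB.lt_top p c)
    have hws : ∀ p, sobNorm b s (w p) < ⊤ := fun p =>
      (sobNorm_mono b (Nat.le_succ s) _).trans_lt (hw p)
    have hw'l : ∀ p i, sobNorm b s (w' p i) < ⊤ := fun p i => (sobNorm_wd_le (hw' p i)).trans_lt (hw p)
    have hzB'l : ∀ p c i, sobNorm b k (zB' p c i) < ⊤ := fun p c i =>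
      (sobNorm_wd_le (hzB' p c i)).trans_lt (hB.lt_top p c)
    have hzB'd : ∀ c i, Dom (fun p => sobNorm b k (zB' p c i)) fun _ => 1 := fun c i =>
      (Dom.of_le fun p => sobNorm_wd_le (hzB' p c i)).trans (hB.dom c)
    have hδ : ∀ p c i, sobNorm b k (fun x => zA' p c i x - zB' p c i x) ≤
        sobNorm b (k + 1) (fun x => zA p c x - zB p c x) := fun p c i =>
      sobNorm_wd_le ((hzA' p c i).sub (hzB' p c i))
    have hδl : ∀ p c i, sobNorm b k (fun x => zA' p c i x - zB' p c i x) < ⊤ := fun p c i =>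
      (hδ p c i).trans_lt (sub_lt_top hA hB p c)
    have hd : ∀ p i, WD b i
        (fun x => (G (bgAdd a (zA p) x) - G (bgAdd a (zB p) x)) * w p x) (fun x =>
        (∑ c, ((pd c G (bgAdd a (zA p) x) - pd c G (bgAdd a (zB p) x)) *
            (fderiv ℝ (a c) x (b i) * w p x + zB' p c i x * w p x) +
          pd c G (bgAdd a (zA p) x) * ((zA' p c i x - zB' p c i x) * w p x))) +
        (G (bgAdd a (zA p) x) - G (bgAdd a (zB p) x)) * w' p i x) := fun p i => by
      have h1 := (hA.wd_comp hk hG1 (fun c => hzA' p c i)).mul (hw' p i)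
        (hA.l2loc_comp hk hG.continuous p) (hA.l2loc_wd_comp hk hG1 fun c => hzA' p c i)
        (memLp_of_sobNorm_lt_top (hw p)) (memLp_of_sobNorm_lt_top (hw'l p i))
      have h2 := (hB.wd_comp hk hG1 (fun c => hzB' p c i)).mul (hw' p i)
        (hB.l2loc_comp hk hG.continuous p) (hB.l2loc_wd_comp hk hG1 fun c => hzB' p c i)
        (memLp_of_sobNorm_lt_top (hw p)) (memLp_of_sobNorm_lt_top (hw'l p i))
      convert h1.sub h2 using 2 with x x
      · ring
      · rw [add_sub_add_comm, Finset.sum_mul, Finset.sum_mul, ← Finset.sum_sub_distrib]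
        congr 1
        · exact Finset.sum_congr rfl fun c _ => by ring
        · ring
    have hstep : ∀ {B : P → ℝ≥0∞}, Dom B (fun p => sobNorm b (s + 1) (w p)) →
        Dom (fun p => compNorm b (k + 1) (fun c x => zA p c x - zB p c x) * B p)
          (fun p => compNorm b (k + 1) (fun c x => zA p c x - zB p c x) *
            sobNorm b (s + 1) (w p)) := fun hB =>
      (Dom.refl fun p => compNorm b (k + 1) (fun c x => zA p c x - zB p c x)).mul hB
    refine (Dom.of_le fun p => sobNorm_succ_le (hl hG.continuous hw p) (hd p)).trans
      ((h0 hG1 hw).add (Dom.sum fun i _ => dom_sobNorm_add (dom_sobNorm_sum fun c _ =>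
        dom_sobNorm_add ?_ ?_) ?_))
    · have hq : Dom (fun p => sobNorm b s fun x =>
          fderiv ℝ (a c) x (b i) * w p x + zB' p c i x * w p x) (fun p => sobNorm b (s + 1) (w p)) := by
        refine dom_sobNorm_add ?_ ?_
        · exact ((((hA.bg c).2 i).mono (by omega : s ≤ k)).dom_sobNorm_mul hws).trans
            (Dom.of_le fun p => sobNorm_mono b (Nat.le_succ s) _)
        · refine (hk.dom_mul (by omega : s ≤ k) (Nat.le_succ s) (by omega)
            (fun p => hzB'l p c i) hw).trans ?_
          simpa using (hzB'd c i).mul (Dom.refl fun p => sobNorm b (s + 1) (w p))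
      exact (ih (by omega) (contDiff_pd hG c) fun p => hq.lt_top (hw p)).trans (hstep hq)
    · have hq : Dom (fun p => sobNorm b s fun x => (zA' p c i x - zB' p c i x) * w p x)
          (fun p => sobNorm b k (fun x => zA' p c i x - zB' p c i x) * sobNorm b (s + 1) (w p)) :=
        hk.dom_mul (by omega : s ≤ k) (Nat.le_succ s) (by omega) (fun p => hδl p c i) hw
      have hq' : Dom
          (fun p => sobNorm b k (fun x => zA' p c i x - zB' p c i x) * sobNorm b (s + 1) (w p))
          (fun p => compNorm b (k + 1) (fun c x => zA p c x - zB p c x) * sobNorm b (s + 1) (w p)) :=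
        Dom.of_le fun p => mul_le_mul_left
          ((hδ p c i).trans (sobNorm_le_compNorm b (k + 1) (fun c x => zA p c x - zB p c x) c)) _
      have hcomp := hA.dom_comp_mul hk s (by omega)
        (G := pd c G) ((contDiff_pd hG c).of_le (by norm_cast; omega))
        (w := fun p x => (zA' p c i x - zB' p c i x) * w p x)
        fun p => hq.lt_top (ENNReal.mul_lt_top (hδl p c i) (hw p))
      exact hcomp.trans (hq.trans hq')
    · exact (ih (by omega) (hG.of_le (by norm_cast; omega)) fun p => hw'l p i).trans
        (hstep (Dom.of_le fun p => sobNorm_wd_le (hw' p i)))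

/-- Lipschitz estimate for composition.  It does not follow from `dom_sub_mul` with `w = 1`, as
constants are not in `H^s`. -/
theorem dom_sub (hA : BddState b k a zA) (hB : BddState b k a zB) (hk : SobMul b k) (s : ℕ) :
    s ≤ k → ∀ {G : (Fin m → ℝ) → ℝ}, ContDiff ℝ (s + 1 : ℕ) G →
      Dom (fun p => sobNorm b s fun x => G (bgAdd a (zA p) x) - G (bgAdd a (zB p) x))
        (fun p => compNorm b k (fun c x => zA p c x - zB p c x)) := by
  have h0 : ∀ {G : (Fin m → ℝ) → ℝ}, ContDiff ℝ 1 G → Dom (fun p => eLpNorm (fun x =>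
        G (bgAdd a (zA p) x) - G (bgAdd a (zB p) x)) 2 volume)
        (fun p => compNorm b k (fun c x => zA p c x - zB p c x)) := by
    intro G hG
    obtain ⟨M, hM0, hM⟩ := exists_sub_bound hA hB hk hG
    refine ⟨M.toNNReal, fun p => ?_⟩
    refine (eLpNorm_le_of_abs_le_sum (s := Finset.univ) (p := 2) (by norm_num) hM0
      (fun c _ => (hA.memLp p c).1.sub (hB.memLp p c).1) (hM p)).trans ?_
    refine mul_le_mul_right (Finset.sum_le_sum fun c _ => ?_) _
    exact eLpNorm_le_sobNorm b k _
  have hl : ∀ {G : (Fin m → ℝ) → ℝ}, Continuous G → ∀ p, LocallyIntegrable (fun x =>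
        G (bgAdd a (zA p) x) - G (bgAdd a (zB p) x)) volume := fun hG p =>
    (hA.l2loc_comp hk hG p).locallyIntegrable.sub (hB.l2loc_comp hk hG p).locallyIntegrable
  induction s with
  | zero =>
    intro _ G hG
    exact (Dom.of_le fun p => sobNorm_zero_le (hl hG.continuous p)).trans
      (h0 (hG.of_le (by norm_cast)))
  | succ s ih =>
    intro hsk G hG
    obtain ⟨k, rfl⟩ : ∃ k', k = k' + 1 := ⟨k - 1, by omega⟩
    have hG1 : ContDiff ℝ 1 G := hG.of_le (by norm_cast; omega)
    choose zA' hzA' using fun p c => exists_wd_of_sobNorm_lt_top (hA.lt_top p c)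
    choose zB' hzB' using fun p c => exists_wd_of_sobNorm_lt_top (hB.lt_top p c)
    have hzB'k : ∀ p c i, sobNorm b s (zB' p c i) ≤ sobNorm b (k + 1) (zB p c) := fun p c i =>
      (sobNorm_mono b (by omega) _).trans (sobNorm_wd_le (hzB' p c i))
    have hδ : ∀ p c i, sobNorm b s (fun x => zA' p c i x - zB' p c i x) ≤
        sobNorm b (k + 1) (fun x => zA p c x - zB p c x) := fun p c i =>
      (sobNorm_mono b (by omega) _).trans (sobNorm_wd_le ((hzA' p c i).sub (hzB' p c i)))
    have hd : ∀ p i, WD b i (fun x => G (bgAdd a (zA p) x) - G (bgAdd a (zB p) x)) (fun x =>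
        ∑ c, ((fderiv ℝ (a c) x (b i) *
            (pd c G (bgAdd a (zA p) x) - pd c G (bgAdd a (zB p) x)) +
          (pd c G (bgAdd a (zA p) x) - pd c G (bgAdd a (zB p) x)) * zB' p c i x) +
          pd c G (bgAdd a (zA p) x) * (zA' p c i x - zB' p c i x))) := fun p i => by
      have h1 := hA.wd_comp hk hG1 fun c => hzA' p c i
      have h2 := hB.wd_comp hk hG1 fun c => hzB' p c i
      convert h1.sub h2 using 2 with x
      rw [← Finset.sum_sub_distrib]
      exact Finset.sum_congr rfl fun c _ => by ring
    refine (Dom.of_le fun p => sobNorm_succ_le (hl hG.continuous p) (hd p)).trans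
      ((h0 hG1).add (Dom.sum fun i _ => dom_sobNorm_sum fun c _ =>
        dom_sobNorm_add (dom_sobNorm_add ?_ ?_) ?_))
    · have hq := ih (by omega) (contDiff_pd hG c)
      exact ((((hA.bg c).2 i).mono (by omega : s ≤ k)).dom_sobNorm_mul
        fun p => hq.lt_top (compNorm_sub_lt_top hA hB p)).trans hq
    · refine (dom_sub_mul hA hB hk s (by omega) (contDiff_pd hG c)
        fun p => (hzB'k p c i).trans_lt (hB.lt_top p c)).trans ?_
      simpa using (Dom.refl fun p => compNorm b (k + 1) (fun c x => zA p c x - zB p c x)).mul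
        ((Dom.of_le fun p => hzB'k p c i).trans (hB.dom c))
    · have hcomp := hA.dom_comp_mul hk s (by omega)
        (G := pd c G) ((contDiff_pd hG c).of_le (by norm_cast; omega))
        (w := fun p x => zA' p c i x - zB' p c i x)
        fun p => (hδ p c i).trans_lt (sub_lt_top hA hB p c)
      exact hcomp.trans (Dom.of_le fun p => (hδ p c i).trans
        (sobNorm_le_compNorm b (k + 1) (fun c x => zA p c x - zB p c x) c))

/-- The second-order remainder `F(a + u + v) - F(a + u) - DF(a) v`. -/
noncomputable def tay (F : (Fin m → ℝ) → ℝ) (a u v : Fin m → E → ℝ) (x : E) : ℝ :=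
  F (bgAdd a (fun c x => u c x + v c x) x) - F (bgAdd a u x) -
    ∑ c, pd c F (bgAdd a (fun _ _ => 0) x) * v c x

theorem exists_tay_bound (hu : BddState b k a u) (hv : BddState b k a v) (hk : SobMul b k)
    {F : (Fin m → ℝ) → ℝ} (hF : ContDiff ℝ 2 F) : ∃ M : ℝ, 0 ≤ M ∧ ∀ p, ∀ᵐ x,
      |tay F a (u p) (v p) x| ≤ M * ∑ ce : Fin m × Fin m,
        |(|u p ce.2 x| + |v p ce.2 x|) * v p ce.1 x| := by
  obtain ⟨R, hR0, hR⟩ := hu.exists_bound hk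
  obtain ⟨R', hR'0, hR'⟩ := hv.exists_bound hk
  obtain ⟨M, hM0, hM⟩ := exists_taylor_bound hF (max R R')
  refine ⟨M, hM0, fun p => ?_⟩
  have hmax : 0 ≤ max R R' := hR0.trans (le_max_left _ _)
  filter_upwards [ae_all_iff.2 (hR p).2, ae_all_iff.2 (hR' p).2] with x h1 h2
  have := hM (fun c => a c x) (fun c => u p c x) (fun c => v p c x)
    ((pi_norm_le_iff_of_nonneg hmax).2 fun c => ((hR p).1 c x).trans (le_max_left _ _))
    ((pi_norm_le_iff_of_nonneg hmax).2 fun c => (h1 c).trans (le_max_left _ _))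
    ((pi_norm_le_iff_of_nonneg hmax).2 fun c => (h2 c).trans (le_max_right _ _))
  rw [Fintype.sum_prod_type]
  have e : ∀ c e, |(|u p e x| + |v p e x|) * v p c x| = (|u p e x| + |v p e x|) * |v p c x| :=
    fun c e => by rw [abs_mul, abs_of_nonneg (by positivity : 0 ≤ |u p e x| + |v p e x|)]
  simp_rw [e]
  convert this using 3
  have e1 : bgAdd a (fun c x => u p c x + v p c x) x =
      (fun c => a c x) + (fun c => u p c x) + fun c => v p c x := by
    ext c; simp [bgAdd, add_assoc]
  have e2 : bgAdd a (u p) x = (fun c => a c x) + fun c => u p c x := rfl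
  have e3 : bgAdd a (fun _ _ => 0) x = fun c => a c x := by ext c; simp [bgAdd]
  rw [tay, e1, e2, e3]

/-- The second-order remainder is quadratically small in `H^s`.  The derivative of the remainder of
`F` along `∂ a` is the remainder of `D F`; the other terms are products of a difference of values of
`D F` with a derivative of `u` or `v`. -/
theorem dom_tay (hu : BddState b k a u) (hv : BddState b k a v) (hk : SobMul b k) (s : ℕ) :
    s ≤ k → ∀ {F : (Fin m → ℝ) → ℝ}, ContDiff ℝ (s + 2 : ℕ) F →
      Dom (fun p => sobNorm b s (tay F a (u p) (v p)))
        (fun p => (compNorm b k (u p) + compNorm b k (v p)) * compNorm b k (v p)) := by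
  set B : P → ℝ≥0∞ := fun p => (compNorm b k (u p) + compNorm b k (v p)) * compNorm b k (v p)
    with hB
  have hBt : ∀ p, B p < ⊤ := fun p => by
    have := hu.compNorm_lt_top p
    have := hv.compNorm_lt_top p
    simp only [hB]
    finiteness
  have h0 : ∀ {F : (Fin m → ℝ) → ℝ}, ContDiff ℝ 2 F →
      Dom (fun p => eLpNorm (tay F a (u p) (v p)) 2 volume) B := by
    intro F hF
    obtain ⟨M, hM0, hM⟩ := exists_tay_bound hu hv hk hF
    have hmeas : ∀ p (ce : Fin m × Fin m), AEStronglyMeasurable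
        (fun x => (|u p ce.2 x| + |v p ce.2 x|) * v p ce.1 x) volume := fun p ce =>
      ((hu.memLp p ce.2).1.norm.add (hv.memLp p ce.2).1.norm).mul (hv.memLp p ce.1).1
    refine Dom.trans ⟨M.toNNReal, fun p => eLpNorm_le_of_abs_le_sum (s := Finset.univ) (p := 2)
      (by norm_num) hM0 (fun c _ => hmeas p c) (hM p)⟩ (Dom.sum fun ce _ => ?_)
    obtain ⟨C, hC⟩ := hk k k (by omega)
    refine ⟨C, fun p => ?_⟩
    have e1 : eLpNorm (fun x => (|u p ce.2 x| + |v p ce.2 x|) * v p ce.1 x) 2 volume ≤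
        eLpNorm (fun x => u p ce.2 x * v p ce.1 x) 2 volume +
          eLpNorm (fun x => v p ce.2 x * v p ce.1 x) 2 volume := by
      have := eLpNorm_add_le (μ := volume) (p := 2)
        (f := fun x => |u p ce.2 x| * v p ce.1 x) (g := fun x => |v p ce.2 x| * v p ce.1 x)
        ((hu.memLp p ce.2).1.norm.mul (hv.memLp p ce.1).1)
        ((hv.memLp p ce.2).1.norm.mul (hv.memLp p ce.1).1) (by norm_num)
      refine le_trans (le_of_eq ?_) (this.trans (le_of_eq ?_))
      · congr 1; ext x; simp only [Pi.add_apply]; ring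
      · congr 1 <;> exact eLpNorm_congr_norm_ae (.of_forall fun x => by simp)
    refine e1.trans ?_
    calc _ ≤ (C : ℝ≥0∞) * (sobNorm b k (u p ce.2) * sobNorm b k (v p ce.1)) +
          C * (sobNorm b k (v p ce.2) * sobNorm b k (v p ce.1)) :=
          add_le_add (hC _ _ (hu.lt_top p _) (hv.lt_top p _)) (hC _ _ (hv.lt_top p _) (hv.lt_top p _))
      _ ≤ C * (compNorm b k (u p) * compNorm b k (v p)) +
          C * (compNorm b k (v p) * compNorm b k (v p)) := by
          gcongr <;> exact sobNorm_le_compNorm b k _ _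
      _ = _ := by simp only [hB]; ring
  -- The term `DF(a) v` is treated as a composition with zero perturbation.
  have hz := hu.zero
  have huv := hu.add hv
  have hl : ∀ {F : (Fin m → ℝ) → ℝ}, ContDiff ℝ 2 F →
      ∀ p, LocallyIntegrable (tay F a (u p) (v p)) volume := by
    intro F hF p
    have h1 : ∀ c, LocallyIntegrable (fun x => pd c F (bgAdd a (fun _ _ => 0) x) * v p c x) volume :=
      fun c => (hz.l2loc_comp hk (contDiff_pd (s := 1) (by simpa using hF) c).continuous
        p).locallyIntegrable_mul (hv.memLp p c).l2loc
    have h2 : LocallyIntegrable (fun x => ∑ c, pd c F (bgAdd a (fun _ _ => 0) x) * v p c x) volume := by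
      have := locallyIntegrable_finsetSum (μ := volume) Finset.univ fun c _ => h1 c
      exact this
    exact ((huv.l2loc_comp hk hF.continuous p).locallyIntegrable.sub
      (hu.l2loc_comp hk hF.continuous p).locallyIntegrable).sub h2
  induction s with
  | zero =>
    intro _ F hF
    have hF2 : ContDiff ℝ 2 F := by simpa using hF
    exact (Dom.of_le fun p => sobNorm_zero_le (hl hF2 p)).trans (h0 hF2)
  | succ s ih =>
    intro hsk F hF
    have hF2 : ContDiff ℝ 2 F := hF.of_le (by norm_cast; omega)
    have hF1 : ContDiff ℝ 1 F := hF.of_le (by norm_cast; omega)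
    have hpd1 : ∀ c, ContDiff ℝ 1 (pd c F) := fun c => contDiff_pd (s := 1) (by simpa using hF2) c
    have hpds : ∀ c, ContDiff ℝ (s + 2 : ℕ) (pd c F) := fun c => contDiff_pd hF c
    obtain ⟨k, rfl⟩ : ∃ k', k = k' + 1 := ⟨k - 1, by omega⟩
    choose u' hu' using fun p c => exists_wd_of_sobNorm_lt_top (hu.lt_top p c)
    choose v' hv' using fun p c => exists_wd_of_sobNorm_lt_top (hv.lt_top p c)
    have hu'k : ∀ p c i, sobNorm b s (u' p c i) ≤ sobNorm b (k + 1) (u p c) := fun p c i =>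
      (sobNorm_mono b (by omega) _).trans (sobNorm_wd_le (hu' p c i))
    have hv'k : ∀ p c i, sobNorm b s (v' p c i) ≤ sobNorm b (k + 1) (v p c) := fun p c i =>
      (sobNorm_mono b (by omega) _).trans (sobNorm_wd_le (hv' p c i))
    have hd : ∀ p i, WD b i (tay F a (u p) (v p)) (fun x =>
        ∑ c, ((fderiv ℝ (a c) x (b i) * tay (pd c F) a (u p) (v p) x +
          (pd c F (bgAdd a (fun c x => u p c x + v p c x) x) - pd c F (bgAdd a (u p) x)) *
            u' p c i x) +
          (pd c F (bgAdd a (fun c x => u p c x + v p c x) x) -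
            pd c F (bgAdd a (fun _ _ => 0) x)) * v' p c i x)) := fun p i => by
      have h1 := huv.wd_comp hk hF1 fun c => (hu' p c i).add (hv' p c i)
      have h2 := hu.wd_comp hk hF1 fun c => hu' p c i
      have h3 := fun c => (hz.wd_comp hk (hpd1 c) (p := p) (i := i) (z' := fun _ _ => 0)
        fun _ => wd_zero).mul (hv' p c i) (hz.l2loc_comp hk (hpd1 c).continuous p)
        (hz.l2loc_wd_comp hk (hpd1 c) (p := p) (i := i) (z' := fun _ _ => 0) fun _ => wd_zero) (hv.memLp p c)
        (memLp_of_sobNorm_lt_top ((hv'k p c i).trans_lt (hv.lt_top p c)))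
      -- Symmetry of second derivatives moves the derivative of `DF(a)` along `∂ a` onto the
      -- remainder of `DF`.
      have hsym : ∀ x, ∑ c, (∑ e, pd e (pd c F) (bgAdd a (fun _ _ => 0) x) *
          (fderiv ℝ (a e) x (b i) + 0)) * v p c x =
          ∑ c, fderiv ℝ (a c) x (b i) * ∑ e, pd e (pd c F) (bgAdd a (fun _ _ => 0) x) * v p e x := by
        intro x
        simp_rw [Finset.sum_mul, Finset.mul_sum]
        rw [Finset.sum_comm]
        refine Finset.sum_congr rfl fun c _ => Finset.sum_congr rfl fun e _ => ?_
        rw [pd_comm hF2 c e]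
        ring
      convert (h1.sub h2).sub (WD.sum (s := Finset.univ) fun c _ => h3 c) using 2 with x x
      · rfl
      · rw [Finset.sum_add_distrib (f := fun c => (∑ e, pd e (pd c F) (bgAdd a (fun _ _ => 0) x) *
            (fderiv ℝ (a e) x (b i) + 0)) * v p c x), hsym, ← Finset.sum_add_distrib,
            ← Finset.sum_sub_distrib, ← Finset.sum_sub_distrib]
        refine Finset.sum_congr rfl fun c _ => ?_
        simp only [tay]
        ring
    refine (Dom.of_le fun p => sobNorm_succ_le (hl hF2 p) (hd p)).trans
      ((h0 hF2).add (Dom.sum fun i _ => dom_sobNorm_sum fun c _ =>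
        dom_sobNorm_add (dom_sobNorm_add ?_ ?_) ?_))
    · have hq := ih (by omega) (hpds c)
      exact ((((hu.bg c).2 i).mono (by omega : s ≤ k)).dom_sobNorm_mul
        fun p => hq.lt_top (hBt p)).trans hq
    · refine (dom_sub_mul huv hu hk s (by omega) ((hpds c).of_le (by norm_cast; omega))
        fun p => (hu'k p c i).trans_lt (hu.lt_top p c)).trans (Dom.of_le fun p => ?_)
      simp only [add_sub_cancel_left]
      rw [hB, mul_comm]
      simp only
      gcongr
      exact ((hu'k p c i).trans (sobNorm_le_compNorm b (k + 1) _ c)).trans le_self_add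
    · refine (dom_sub_mul huv hz hk s (by omega) ((hpds c).of_le (by norm_cast; omega))
        fun p => (hv'k p c i).trans_lt (hv.lt_top p c)).trans ?_
      refine Dom.mul ?_ (Dom.of_le fun p => (hv'k p c i).trans (sobNorm_le_compNorm b (k + 1) _ c))
      simp only [sub_zero]
      refine Dom.sum fun c _ => dom_sobNorm_add ?_ ?_
      · exact Dom.of_le fun p => (sobNorm_le_compNorm b (k + 1) _ c).trans le_self_add
      · exact Dom.of_le fun p => (sobNorm_le_compNorm b (k + 1) _ c).trans le_add_self

end BddState

end Superposition

end PlanarWave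

namespace PlanarWave

open scoped NNReal Topology
open Filter

/-! ### Weak derivatives on `ℝ × ℝ^{d-1}` -/

section Product

variable {d : ℕ}

instance : (volume : Measure (X d)).IsAddHaarMeasure :=
  inferInstanceAs ((volume : Measure ℝ).prod (volume : Measure (Y d))).IsAddHaarMeasure

theorem sobMul_dirR : SobMul dirR 1 := by
  have h := sobMul_of_basis (Module.Basis.singleton Unit ℝ) (k := 1) (by simp)
  rwa [show (Module.Basis.singleton Unit ℝ : Unit → ℝ) = dirR from
    funext fun _ => Module.Basis.singleton_apply _ _ _] at h

theorem sobMul_dirY {k : ℕ} (hk : d - 1 < 2 * k) : SobMul (dirY d) k := by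
  have h := sobMul_of_basis (EuclideanSpace.basisFun (Fin (d - 1)) ℝ).toBasis (k := k) (by simpa)
  rwa [show ((EuclideanSpace.basisFun (Fin (d - 1)) ℝ).toBasis : Fin (d - 1) → Y d) = dirY d from
    funext fun i => by simp [dirY]] at h

/-- For the coordinate directions of `ℝ × ℝ^{d-1}`, which form a basis although the norm of the
product space is not Euclidean. -/
theorem sobMul_dirX {k : ℕ} (hd : 1 ≤ d) (hk : d < 2 * k) : SobMul (dirX d) k := by
  let B := ((Module.Basis.singleton Unit ℝ).prod
    (EuclideanSpace.basisFun (Fin (d - 1)) ℝ).toBasis).reindex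
    ((Equiv.sumComm _ _).trans (Equiv.optionEquivSumPUnit _).symm)
  have h := sobMul_of_basis B (k := k) (by simp; omega)
  rwa [show (B : Option (Fin (d - 1)) → X d) = dirX d from funext fun i => by
    cases i <;> simp [B, dirX, dirY]] at h

/-- A function that is weakly differentiable in `y_l` on almost every slice `{x} × ℝ^{d-1}`. -/
theorem wd_some_of_ae {u u' : X d → ℝ} {l : Fin (d - 1)} (hu : LocallyIntegrable u volume)
    (hu' : LocallyIntegrable u' volume)
    (h : ∀ᵐ x : ℝ, WD (dirY d) l (fun y => u (x, y)) (fun y => u' (x, y))) :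
    WD (dirX d) (some l) u u' := by
  rw [wd_iff]
  refine ⟨hu, hu', fun φ hφ hc => ?_⟩
  have hφ' := contDiff_fderiv_apply_const hφ (dirX d (some l))
  have hc' := hasCompactSupport_fderiv_apply_const hc (dirX d (some l))
  have i1 := integrable_smul_of_locallyIntegrable hφ'.continuous hc' hu
  have i2 := integrable_smul_of_locallyIntegrable hφ.continuous hc hu'
  rw [Measure.volume_eq_prod] at i1 i2 ⊢
  rw [integral_prod _ i1, integral_prod _ i2, ← integral_neg]
  refine integral_congr_ae (h.mono fun x hx => ?_)
  have hφx : ContDiff ℝ ∞ fun y : Y d => φ (x, y) := hφ.comp (contDiff_const.prodMk contDiff_id)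
  have hcx : HasCompactSupport fun y : Y d => φ (x, y) :=
    HasCompactSupport.intro (hc.image continuous_snd) fun y hy =>
      image_eq_zero_of_notMem_tsupport fun h => hy ⟨_, h, rfl⟩
  have := (wd_iff.1 hx).2.2 _ hφx hcx
  have e : ∀ y : Y d, fderiv ℝ (fun y : Y d => φ (x, y)) y (dirY d l) =
      fderiv ℝ φ (x, y) (dirX d (some l)) := fun y => by
    have h1 := ((hφ.differentiable (by simp)) (x, y)).hasFDerivAt.comp y
      ((hasFDerivAt_const x y).prodMk (hasFDerivAt_id y))
    have h2 : fderiv ℝ (fun y : Y d => φ (x, y)) y = _ := h1.fderiv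
    rw [h2]
    simp [dirX]
  simp_rw [e] at this
  exact this

/-- A function that is weakly differentiable in `x` on almost every slice `ℝ × {y}`. -/
theorem wd_none_of_ae {u u' : X d → ℝ} (hu : LocallyIntegrable u volume)
    (hu' : LocallyIntegrable u' volume)
    (h : ∀ᵐ y : Y d, WD dirR () (fun x => u (x, y)) (fun x => u' (x, y))) :
    WD (dirX d) none u u' := by
  rw [wd_iff]
  refine ⟨hu, hu', fun φ hφ hc => ?_⟩
  have hφ' := contDiff_fderiv_apply_const hφ (dirX d none)
  have hc' := hasCompactSupport_fderiv_apply_const hc (dirX d none)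
  have i1 := integrable_smul_of_locallyIntegrable hφ'.continuous hc' hu
  have i2 := integrable_smul_of_locallyIntegrable hφ.continuous hc hu'
  rw [Measure.volume_eq_prod] at i1 i2 ⊢
  rw [integral_prod_symm _ i1, integral_prod_symm _ i2, ← integral_neg]
  refine integral_congr_ae (h.mono fun y hy => ?_)
  have hφx : ContDiff ℝ ∞ fun x : ℝ => φ (x, y) := hφ.comp (contDiff_id.prodMk contDiff_const)
  have hcx : HasCompactSupport fun x : ℝ => φ (x, y) :=
    HasCompactSupport.intro (hc.image continuous_fst) fun x hx =>
      image_eq_zero_of_notMem_tsupport fun h => hx ⟨_, h, rfl⟩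
  have := (wd_iff.1 hy).2.2 _ hφx hcx
  have e : ∀ x : ℝ, fderiv ℝ (fun x : ℝ => φ (x, y)) x (dirR ()) =
      fderiv ℝ φ (x, y) (dirX d none) := fun x => by
    have h0 : HasFDerivAt (fun x : ℝ => (x, y)) ((ContinuousLinearMap.id ℝ ℝ).prod 0) x :=
      (hasFDerivAt_id x).prodMk (hasFDerivAt_const y x)
    have h1 := ((hφ.differentiable (by simp)) (x, y)).hasFDerivAt.comp x h0
    have h2 : fderiv ℝ (fun x : ℝ => φ (x, y)) x = _ := h1.fderiv
    rw [h2]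
    simp [dirX, dirR]
  simp_rw [e] at this
  exact this

/-- An `L²` bound on almost every slice `ℝ × {y}` by a function of `y`. -/
theorem eLpNorm_le_of_slices {u : X d → ℝ} {h : Y d → ℝ} {C : ℝ≥0∞}
    (hu : AEStronglyMeasurable u volume)
    (hb : ∀ᵐ y : Y d, ∫⁻ x : ℝ, ‖u (x, y)‖ₑ ^ 2 ≤ (C * ‖h y‖ₑ) ^ 2) (hC : C ≠ ⊤) :
    eLpNorm u 2 volume ≤ C * eLpNorm h 2 volume := by
  have h1 : eLpNorm u 2 volume ^ 2 ≤ (C * eLpNorm h 2 volume) ^ 2 := by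
    rw [← lintegral_sq_eq_eLpNorm, mul_pow, ← lintegral_sq_eq_eLpNorm, ← lintegral_const_mul']
    · rw [Measure.volume_eq_prod] at hu ⊢
      rw [lintegral_prod_symm _ (hu.enorm.pow_const 2)]
      refine lintegral_mono_ae (hb.mono fun y hy => ?_)
      rwa [← mul_pow]
    · finiteness
  exact (ENNReal.pow_le_pow_left_iff two_ne_zero).1 h1

/-- `‖ζ(· - a) - ζ(· - b)‖_{L²} ≤ ‖ζ'‖_{L²} |a - b|`. -/
theorem lintegral_sub_sq_le {ζ : ℝ → ℝ} (hζ : ContDiff ℝ 1 ζ) (a b : ℝ) :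
    ∫⁻ x, ‖ζ (x - a) - ζ (x - b)‖ₑ ^ 2 ≤ (eLpNorm (deriv ζ) 2 volume * ‖a - b‖ₑ) ^ 2 := by
  wlog hab : a ≤ b generalizing a b
  · have := this b a (le_of_not_ge hab)
    rw [← enorm_neg (a - b), neg_sub]
    refine le_trans (le_of_eq (lintegral_congr fun x => ?_)) this
    rw [← enorm_neg, neg_sub]
  have hc : Continuous (deriv ζ) := hζ.continuous_deriv le_rfl
  have hA : Measurable fun t => ‖deriv ζ t‖ₑ := hc.enorm.measurable
  have hB : Measurable ((Set.Ioc a b).indicator (fun _ => (1 : ℝ≥0∞))) :=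
    measurable_const.indicator measurableSet_Ioc
  have key : ∀ x, ‖ζ (x - a) - ζ (x - b)‖ₑ ≤
      ∫⁻ t, (Set.Ioc a b).indicator (fun _ => (1 : ℝ≥0∞)) t * ‖deriv ζ (x - t)‖ₑ := fun x => by
    have h1 : ∫ t in a..b, deriv ζ (x - t) = ζ (x - a) - ζ (x - b) := by
      rw [intervalIntegral.integral_comp_sub_left (fun t => deriv ζ t)]
      exact intervalIntegral.integral_eq_sub_of_hasDerivAt
        (fun t _ => (hζ.differentiable one_ne_zero t).hasDerivAt) (hc.intervalIntegrable _ _)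
    rw [← h1, intervalIntegral.integral_of_le hab]
    refine (enorm_integral_le_lintegral_enorm _).trans (le_of_eq ?_)
    rw [← lintegral_indicator measurableSet_Ioc]
    refine lintegral_congr fun t => ?_
    by_cases ht : t ∈ Set.Ioc a b <;> simp [ht]
  calc ∫⁻ x, ‖ζ (x - a) - ζ (x - b)‖ₑ ^ 2
      ≤ ∫⁻ x, (∫⁻ t, (Set.Ioc a b).indicator (fun _ => (1 : ℝ≥0∞)) t * ‖deriv ζ (x - t)‖ₑ) ^ 2 :=
        lintegral_mono fun x => pow_le_pow_left₀ zero_le (key x) 2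
    _ ≤ (∫⁻ t, (Set.Ioc a b).indicator (fun _ => (1 : ℝ≥0∞)) t) ^ 2 * ∫⁻ t, ‖deriv ζ t‖ₑ ^ 2 :=
        lintegral_sq_convolution_le hA hB
    _ = _ := by
        rw [lintegral_indicator measurableSet_Ioc, lintegral_sq_eq_eLpNorm, mul_pow, mul_comm]
        congr 2
        rw [lintegral_const, one_mul, Measure.restrict_apply_univ, Real.volume_Ioc,
          ← enorm_neg, neg_sub, Real.enorm_eq_ofReal (by linarith)]

/-- Profiles whose derivatives up to order `s` are bounded and square integrable. -/
def Prof : ℕ → (ℝ → ℝ) → Prop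
  | 0, ζ => Continuous ζ ∧ MemLp ζ 2 volume ∧ ∃ C : ℝ, ∀ x, |ζ x| ≤ C
  | s + 1, ζ => (ContDiff ℝ 1 ζ ∧ MemLp ζ 2 volume ∧ ∃ C : ℝ, ∀ x, |ζ x| ≤ C) ∧ Prof s (deriv ζ)

theorem Prof.zero {s : ℕ} {ζ : ℝ → ℝ} (h : Prof s ζ) : Prof 0 ζ := by
  cases s with
  | zero => exact h
  | succ s => exact ⟨h.1.1.continuous, h.1.2⟩

theorem Prof.pred {s : ℕ} : ∀ {ζ : ℝ → ℝ}, Prof (s + 1) ζ → Prof s ζ := by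
  induction s with
  | zero => exact fun h => h.zero
  | succ s ih => exact fun h => ⟨h.1, ih h.2⟩

theorem Prof.mono {s t : ℕ} (hst : s ≤ t) {ζ : ℝ → ℝ} (h : Prof t ζ) : Prof s ζ := by
  induction t, hst using Nat.le_induction with
  | base => exact h
  | succ t _ ih => exact ih h.pred

/-- The chain rule for `ζ(x - θ(y))` in the direction `y_l`, at a fixed `x`. -/
theorem wd_comp_sub {ζ : ℝ → ℝ} (hζ : ContDiff ℝ 1 ζ) {θ θ' : Y d → ℝ} {l : Fin (d - 1)}
    (hθ : WD (dirY d) l θ θ') (h2 : MemLp θ 2 volume) (h2' : MemLp θ' 2 volume) {R : ℝ}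
    (hR : ∀ᵐ y, |θ y| ≤ R) (hR0 : 0 ≤ R) (x : ℝ) :
    WD (dirY d) l (fun y => ζ (x - θ y)) (fun y => -(deriv ζ (x - θ y) * θ' y)) := by
  let G : (Fin 1 → ℝ) → ℝ := fun v => ζ (x - v 0)
  have hG : ContDiff ℝ 1 G := hζ.comp (contDiff_const.sub (contDiff_apply ℝ ℝ 0))
  have hpd : ∀ v, pd 0 G v = -deriv ζ (x - v 0) := fun v => by
    have h1 : HasFDerivAt (fun v : Fin 1 → ℝ => x - v 0)
        (-(ContinuousLinearMap.proj 0 : (Fin 1 → ℝ) →L[ℝ] ℝ)) v :=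
      (ContinuousLinearMap.proj 0 : (Fin 1 → ℝ) →L[ℝ] ℝ).hasFDerivAt.const_sub x
    have h2 : HasFDerivAt G _ v :=
      ((hζ.differentiable one_ne_zero) (x - v 0)).hasDerivAt.comp_hasFDerivAt v h1
    rw [pd, h2.fderiv]
    simp
  have := WD.comp (a := fun _ _ => 0) (z := fun _ => θ) (z' := fun _ => θ') hG
    (fun _ => contDiff_const) (fun _ _ => by simpa) (fun _ => hθ) (fun _ => h2) (fun _ => h2')
    fun _ => hR
  convert this using 2 with y y
  · simp [G]
  · simp [hpd]

end Product

end PlanarWave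

namespace PlanarWave

open scoped NNReal Topology
open Filter

/-! ### Translates of profiles -/

section Translates

variable {d k : ℕ} {P : Type*}

theorem aestronglyMeasurable_comp_sub {ζ : ℝ → ℝ} (hζ : Continuous ζ) {θ : Y d → ℝ}
    (hθ : AEStronglyMeasurable θ volume) :
    AEStronglyMeasurable (fun q : X d => ζ (q.1 - θ q.2)) volume := by
  rw [Measure.volume_eq_prod]
  exact hζ.comp_aestronglyMeasurable (continuous_fst.aestronglyMeasurable.sub hθ.comp_snd)

theorem aestronglyMeasurable_comp_snd {h : Y d → ℝ} (hh : AEStronglyMeasurable h volume) :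
    AEStronglyMeasurable (fun q : X d => h q.2) volume := by
  rw [Measure.volume_eq_prod]
  exact hh.comp_snd

theorem eLpNorm_comp_sub_mul_le {ζ : ℝ → ℝ} (hζ : Continuous ζ) (hζ2 : MemLp ζ 2 volume)
    {θ h : Y d → ℝ} (hθ : AEStronglyMeasurable θ volume) (hh : AEStronglyMeasurable h volume) :
    eLpNorm (fun q : X d => ζ (q.1 - θ q.2) * h q.2) 2 volume ≤
      eLpNorm ζ 2 volume * eLpNorm h 2 volume := by
  refine eLpNorm_le_of_slices ((aestronglyMeasurable_comp_sub hζ hθ).mul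
    (aestronglyMeasurable_comp_snd hh)) (.of_forall fun y => ?_) hζ2.2.ne
  simp only [enorm_mul, mul_pow]
  rw [lintegral_mul_const' _ _ (by finiteness),
    lintegral_sub_right_eq_self (fun x => ‖ζ x‖ₑ ^ 2), lintegral_sq_eq_eLpNorm]

theorem eLpNorm_comp_sub_sub_mul_le {ζ : ℝ → ℝ} (hζ : ContDiff ℝ 1 ζ)
    (hζ2 : MemLp (deriv ζ) 2 volume) {θA θB h : Y d → ℝ} (hA : AEStronglyMeasurable θA volume)
    (hB : AEStronglyMeasurable θB volume) (hh : AEStronglyMeasurable h volume) :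
    eLpNorm (fun q : X d => (ζ (q.1 - θA q.2) - ζ (q.1 - θB q.2)) * h q.2) 2 volume ≤
      eLpNorm (deriv ζ) 2 volume * eLpNorm (fun y => (θA y - θB y) * h y) 2 volume := by
  refine eLpNorm_le_of_slices (((aestronglyMeasurable_comp_sub hζ.continuous hA).sub
    (aestronglyMeasurable_comp_sub hζ.continuous hB)).mul
    (aestronglyMeasurable_comp_snd hh)) (.of_forall fun y => ?_) hζ2.2.ne
  simp only [enorm_mul, mul_pow]
  rw [lintegral_mul_const' _ _ (by finiteness), ← mul_assoc, ← mul_pow]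
  gcongr
  exact lintegral_sub_sq_le hζ _ _

theorem exists_abs_le_of_sobNorm {θ : Y d → ℝ} (hk : SobMul (dirY d) k)
    (hθ : sobNorm (dirY d) k θ < ⊤) : ∃ R : ℝ, 0 ≤ R ∧ ∀ᵐ y, |θ y| ≤ R := by
  obtain ⟨C, hC⟩ := hk.exists_ae_bound
  refine ⟨(C * sobNorm (dirY d) k θ).toReal, ENNReal.toReal_nonneg, (hC θ hθ).mono fun y hy => ?_⟩
  rw [← Real.norm_eq_abs, ← toReal_enorm]
  exact ENNReal.toReal_mono (by finiteness) hy

theorem Dom.one_mul_of {A B : P → ℝ≥0∞} (hA : Dom A fun _ => 1) : Dom (fun p => A p * B p) B := by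
  simpa using hA.mul (Dom.refl B)

variable {θ θA θB : P → Y d → ℝ}

theorem wd_comp_sub_of_sobNorm {ζ : ℝ → ℝ} (hζ : ContDiff ℝ 1 ζ) (hk : SobMul (dirY d) (k + 1))
    {θ θ' : Y d → ℝ} (hθ : sobNorm (dirY d) (k + 1) θ < ⊤) {l : Fin (d - 1)}
    (h : WD (dirY d) l θ θ') (x : ℝ) :
    WD (dirY d) l (fun y => ζ (x - θ y)) (fun y => -(deriv ζ (x - θ y) * θ' y)) := by
  obtain ⟨R, hR0, hR⟩ := exists_abs_le_of_sobNorm hk hθ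
  exact wd_comp_sub hζ h (memLp_of_sobNorm_lt_top hθ)
    (memLp_of_sobNorm_lt_top ((sobNorm_wd_le h).trans_lt hθ)) hR hR0 x

/-- The weak derivatives of `(T_θ ζ) h`. -/
theorem wd_translate_mul {ζ : ℝ → ℝ} (hζ : Prof 1 ζ) (hk : SobMul (dirY d) (k + 1))
    {θ h : Y d → ℝ} {θ' h' : Fin (d - 1) → Y d → ℝ} (hθ : sobNorm (dirY d) (k + 1) θ < ⊤)
    (hθ' : ∀ l, WD (dirY d) l θ (θ' l)) (hh' : ∀ l, WD (dirY d) l h (h' l))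
    (h2 : MemLp h 2 volume) (h2' : ∀ l, MemLp (h' l) 2 volume)
    (hθh : ∀ l, MemLp (fun y => θ' l y * h y) 2 volume) (i : Option (Fin (d - 1))) :
    WD (dirX d) i (fun q => ζ (q.1 - θ q.2) * h q.2) (fun q => match i with
      | none => deriv ζ (q.1 - θ q.2) * h q.2
      | some l => ζ (q.1 - θ q.2) * h' l q.2 - deriv ζ (q.1 - θ q.2) * (θ' l q.2 * h q.2)) := by
  obtain ⟨⟨hζ1, hζ2, Cζ, hCζ⟩, hζc', hζ2', Cζ', hCζ'⟩ := hζ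
  have hθm : AEStronglyMeasurable θ volume := (memLp_of_sobNorm_lt_top hθ).1
  have hL : ∀ {z : ℝ → ℝ}, Continuous z → MemLp z 2 volume → ∀ {g : Y d → ℝ}, MemLp g 2 volume →
      LocallyIntegrable (fun q : X d => z (q.1 - θ q.2) * g q.2) volume := fun hz hz2 g hg =>
    MemLp.locallyIntegrable (p := 2) ⟨(aestronglyMeasurable_comp_sub hz hθm).mul
      (aestronglyMeasurable_comp_snd hg.1), (eLpNorm_comp_sub_mul_le hz hz2 hθm hg.1).trans_lt
      (ENNReal.mul_lt_top hz2.2 hg.2)⟩ (by norm_num)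
  cases i with
  | none =>
    refine wd_none_of_ae (hL hζ1.continuous hζ2 h2) (hL hζc' hζ2' h2) (.of_forall fun y => ?_)
    have hcd : ContDiff ℝ 1 fun x : ℝ => ζ (x - θ y) * h y :=
      (hζ1.comp (contDiff_id.sub contDiff_const)).mul contDiff_const
    have := wd_of_contDiff (b := dirR) (i := ()) hcd
    convert this using 2 with x
    have hd : HasDerivAt (fun x : ℝ => ζ (x - θ y) * h y) (deriv ζ (x - θ y) * h y) x :=
      (((hζ1.differentiable one_ne_zero) (x - θ y)).hasDerivAt.comp_sub_const x (θ y)).mul_const _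
    rw [dirR, fderiv_apply_one_eq_deriv, hd.deriv]
  | some l =>
    refine wd_some_of_ae (hL hζ1.continuous hζ2 h2)
      ((hL hζ1.continuous hζ2 (h2' l)).sub (hL hζc' hζ2' (hθh l))) (.of_forall fun x => ?_)
    have hm : ∀ {z : ℝ → ℝ}, Continuous z → AEStronglyMeasurable (fun y => z (x - θ y)) volume :=
      fun hz => hz.comp_aestronglyMeasurable (aestronglyMeasurable_const.sub hθm)
    have h1 := wd_comp_sub_of_sobNorm hζ1 hk hθ (hθ' l) x
    have h3 : L2loc fun y => -(deriv ζ (x - θ y) * θ' l y) := by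
      have := (memLp_of_sobNorm_lt_top ((sobNorm_wd_le (hθ' l)).trans_lt hθ)).l2loc.bdd_mul
        (hm (z := fun t => -deriv ζ t) hζc'.neg) (R := Cζ')
        (.of_forall fun y => by rw [abs_neg]; exact hCζ' _)
      simpa only [neg_mul] using this
    convert h1.mul (hh' l) (l2loc_of_bound (hm hζ1.continuous) (.of_forall fun y => hCζ _))
      h3 h2 (h2' l) using 2 with y
    ring

theorem dom_eLpNorm_translate_mul {ζ : ℝ → ℝ} (hζ : Prof 0 ζ) {s : ℕ} {h : P → Y d → ℝ}
    (hθ : ∀ p, sobNorm (dirY d) k (θ p) < ⊤) (hh : ∀ p, sobNorm (dirY d) s (h p) < ⊤) :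
    Dom (fun p => eLpNorm (fun q : X d => ζ (q.1 - θ p q.2) * h p q.2) 2 volume)
      (fun p => sobNorm (dirY d) s (h p)) := by
  refine ⟨(eLpNorm ζ 2 volume).toNNReal, fun p => ?_⟩
  rw [ENNReal.coe_toNNReal hζ.2.1.2.ne]
  refine (eLpNorm_comp_sub_mul_le hζ.1 hζ.2.1 (memLp_of_sobNorm_lt_top (hθ p)).1
    (memLp_of_sobNorm_lt_top (hh p)).1).trans ?_
  gcongr
  exact eLpNorm_le_sobNorm _ _ _

theorem locallyIntegrable_translate_mul {ζ : ℝ → ℝ} (hζ : Prof 0 ζ) {s : ℕ} {θ h : Y d → ℝ}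
    (hθ : sobNorm (dirY d) k θ < ⊤) (hh : sobNorm (dirY d) s h < ⊤) :
    LocallyIntegrable (fun q : X d => ζ (q.1 - θ q.2) * h q.2) volume :=
  MemLp.locallyIntegrable (p := 2) ⟨(aestronglyMeasurable_comp_sub hζ.1
    (memLp_of_sobNorm_lt_top hθ).1).mul (aestronglyMeasurable_comp_snd
    (memLp_of_sobNorm_lt_top hh).1), (dom_eLpNorm_translate_mul (P := Unit) (θ := fun _ => θ)
      (h := fun _ => h) hζ (fun _ => hθ) (fun _ => hh)).lt_top (p := ()) hh⟩ (by norm_num)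

/-- `h ↦ (T_θ ζ) h` is bounded from `H^s_y` to `H^s`. -/
theorem dom_translate_mul (hk : SobMul (dirY d) k)
    (hθ : Dom (fun p => sobNorm (dirY d) k (θ p)) fun _ => 1) (s : ℕ) : s ≤ k →
    ∀ {ζ : ℝ → ℝ}, Prof s ζ → ∀ {h : P → Y d → ℝ}, (∀ p, sobNorm (dirY d) s (h p) < ⊤) →
      Dom (fun p => sobNorm (dirX d) s fun q => ζ (q.1 - θ p q.2) * h p q.2)
        (fun p => sobNorm (dirY d) s (h p)) := by
  have hθt : ∀ p, sobNorm (dirY d) k (θ p) < ⊤ := fun p => hθ.lt_top ENNReal.one_lt_top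
  induction s with
  | zero =>
    intro _ ζ hζ h hh
    exact (Dom.of_le fun p => sobNorm_zero_le
      (locallyIntegrable_translate_mul hζ (hθt p) (hh p))).trans
      (dom_eLpNorm_translate_mul hζ hθt hh)
  | succ s ih =>
    intro hsk ζ hζ h hh
    obtain ⟨k, rfl⟩ : ∃ k', k = k' + 1 := ⟨k - 1, by omega⟩
    choose θ' hθ' using fun p => exists_wd_of_sobNorm_lt_top (hθt p)
    choose h' hh' using fun p => exists_wd_of_sobNorm_lt_top (hh p)
    have hhs : ∀ p, sobNorm (dirY d) s (h p) < ⊤ := fun p =>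
      (sobNorm_mono _ (Nat.le_succ s) _).trans_lt (hh p)
    have hh'l : ∀ p l, sobNorm (dirY d) s (h' p l) < ⊤ := fun p l =>
      (sobNorm_wd_le (hh' p l)).trans_lt (hh p)
    have hq : ∀ l, Dom (fun p => sobNorm (dirY d) s fun y => θ' p l y * h p y)
        (fun p => sobNorm (dirY d) (s + 1) (h p)) := fun l =>
      (hk.dom_mul (by omega : s ≤ k) (Nat.le_succ s) (by omega)
        (fun p => (sobNorm_wd_le (hθ' p l)).trans_lt (hθt p)) hh).trans
        (((Dom.of_le fun p => sobNorm_wd_le (hθ' p l)).trans hθ).one_mul_of)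
    have hd := fun p => wd_translate_mul (hζ.mono (by omega)) hk (hθt p) (hθ' p) (hh' p)
      (memLp_of_sobNorm_lt_top (hh p)) (fun l => memLp_of_sobNorm_lt_top (hh'l p l))
      (fun l => memLp_of_sobNorm_lt_top ((hq l).lt_top (hh p)))
    refine (Dom.of_le fun p => sobNorm_succ_le
      (locallyIntegrable_translate_mul hζ.zero (hθt p) (hh p)) (hd p)).trans
      ((dom_eLpNorm_translate_mul hζ.zero hθt hh).add (Dom.sum fun i _ => ?_))
    have hpred : Dom (fun p => sobNorm (dirY d) s (h p)) fun p => sobNorm (dirY d) (s + 1) (h p) :=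
      Dom.of_le fun p => sobNorm_mono _ (Nat.le_succ s) _
    cases i with
    | none => exact (ih (by omega) hζ.2 hhs).trans hpred
    | some l =>
      refine dom_sobNorm_sub hh ?_ ?_
      · exact (ih (by omega) hζ.pred fun p => hh'l p l).trans
          (Dom.of_le fun p => sobNorm_wd_le (hh' p l))
      · exact (ih (by omega) hζ.2 fun p => (hq l).lt_top (hh p)).trans (hq l)

/-- `θ ↦ (T_θ ζ) h` is Lipschitz continuous. -/
theorem dom_translate_sub_mul (hk : SobMul (dirY d) k)
    (hA : Dom (fun p => sobNorm (dirY d) k (θA p)) fun _ => 1)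
    (hB : Dom (fun p => sobNorm (dirY d) k (θB p)) fun _ => 1) (s : ℕ) : s ≤ k →
    ∀ {ζ : ℝ → ℝ}, Prof (s + 1) ζ → ∀ {h : P → Y d → ℝ}, (∀ p, sobNorm (dirY d) s (h p) < ⊤) →
      Dom (fun p => sobNorm (dirX d) s fun q =>
          (ζ (q.1 - θA p q.2) - ζ (q.1 - θB p q.2)) * h p q.2)
        (fun p => sobNorm (dirY d) k (fun y => θA p y - θB p y) * sobNorm (dirY d) s (h p)) := by
  have hAt : ∀ p, sobNorm (dirY d) k (θA p) < ⊤ := fun p => hA.lt_top ENNReal.one_lt_top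
  have hBt : ∀ p, sobNorm (dirY d) k (θB p) < ⊤ := fun p => hB.lt_top ENNReal.one_lt_top
  have hδt : ∀ p, sobNorm (dirY d) k (fun y => θA p y - θB p y) < ⊤ := fun p =>
    sobNorm_sub_lt_top (hAt p) (hBt p)
  -- The `L²` estimate on slices produces `(θ_A - θ_B) h`, which the product estimate bounds in
  -- `L²`.
  have h0 : ∀ {s : ℕ} {ζ : ℝ → ℝ}, Prof 1 ζ → ∀ {h : P → Y d → ℝ},
      (∀ p, sobNorm (dirY d) s (h p) < ⊤) → Dom (fun p => eLpNorm (fun q : X d =>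
          (ζ (q.1 - θA p q.2) - ζ (q.1 - θB p q.2)) * h p q.2) 2 volume)
        (fun p => sobNorm (dirY d) k (fun y => θA p y - θB p y) * sobNorm (dirY d) s (h p)) := by
    intro s ζ hζ h hh
    obtain ⟨C, hC⟩ := hk k s (by omega)
    refine ⟨(eLpNorm (deriv ζ) 2 volume).toNNReal * C, fun p => ?_⟩
    push_cast
    rw [ENNReal.coe_toNNReal hζ.2.2.1.2.ne, mul_assoc]
    exact (eLpNorm_comp_sub_sub_mul_le hζ.1.1 hζ.2.2.1 (memLp_of_sobNorm_lt_top (hAt p)).1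
      (memLp_of_sobNorm_lt_top (hBt p)).1 (memLp_of_sobNorm_lt_top (hh p)).1).trans
      (mul_le_mul_right (hC _ _ (hδt p) (hh p)) _)
  have hl : ∀ {s : ℕ} {ζ : ℝ → ℝ}, Prof 0 ζ → ∀ {h : P → Y d → ℝ},
      (∀ p, sobNorm (dirY d) s (h p) < ⊤) → ∀ p, LocallyIntegrable (fun q : X d =>
        (ζ (q.1 - θA p q.2) - ζ (q.1 - θB p q.2)) * h p q.2) volume := fun hζ h hh p => by
    simp_rw [sub_mul]
    exact (locallyIntegrable_translate_mul hζ (hAt p) (hh p)).sub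
      (locallyIntegrable_translate_mul hζ (hBt p) (hh p))
  induction s with
  | zero =>
    intro _ ζ hζ h hh
    exact (Dom.of_le fun p => sobNorm_zero_le (hl hζ.zero hh p)).trans (h0 hζ hh)
  | succ s ih =>
    intro hsk ζ hζ h hh
    obtain ⟨k, rfl⟩ : ∃ k', k = k' + 1 := ⟨k - 1, by omega⟩
    choose θA' hθA' using fun p => exists_wd_of_sobNorm_lt_top (hAt p)
    choose θB' hθB' using fun p => exists_wd_of_sobNorm_lt_top (hBt p)
    choose h' hh' using fun p => exists_wd_of_sobNorm_lt_top (hh p)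
    have hhs : ∀ p, sobNorm (dirY d) s (h p) < ⊤ := fun p =>
      (sobNorm_mono _ (Nat.le_succ s) _).trans_lt (hh p)
    have hh'l : ∀ p l, sobNorm (dirY d) s (h' p l) < ⊤ := fun p l =>
      (sobNorm_wd_le (hh' p l)).trans_lt (hh p)
    have hqA : ∀ l, Dom (fun p => sobNorm (dirY d) s fun y => θA' p l y * h p y)
        (fun p => sobNorm (dirY d) (s + 1) (h p)) := fun l =>
      (hk.dom_mul (by omega : s ≤ k) (Nat.le_succ s) (by omega)
        (fun p => (sobNorm_wd_le (hθA' p l)).trans_lt (hAt p)) hh).trans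
        (((Dom.of_le fun p => sobNorm_wd_le (hθA' p l)).trans hA).one_mul_of)
    have hqB : ∀ l, Dom (fun p => sobNorm (dirY d) s fun y => θB' p l y * h p y)
        (fun p => sobNorm (dirY d) (s + 1) (h p)) := fun l =>
      (hk.dom_mul (by omega : s ≤ k) (Nat.le_succ s) (by omega)
        (fun p => (sobNorm_wd_le (hθB' p l)).trans_lt (hBt p)) hh).trans
        (((Dom.of_le fun p => sobNorm_wd_le (hθB' p l)).trans hB).one_mul_of)
    have hδ' : ∀ p l, sobNorm (dirY d) k (fun y => θA' p l y - θB' p l y) ≤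
        sobNorm (dirY d) (k + 1) (fun y => θA p y - θB p y) := fun p l =>
      sobNorm_wd_le ((hθA' p l).sub (hθB' p l))
    have hqδ : ∀ l, Dom (fun p => sobNorm (dirY d) s fun y => (θA' p l y - θB' p l y) * h p y)
        (fun p => sobNorm (dirY d) (k + 1) (fun y => θA p y - θB p y) *
          sobNorm (dirY d) (s + 1) (h p)) := fun l =>
      (hk.dom_mul (by omega : s ≤ k) (Nat.le_succ s) (by omega)
        (fun p => (hδ' p l).trans_lt (hδt p)) hh).trans
        (Dom.of_le fun p => mul_le_mul_left (hδ' p l) _)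
    have hRt : ∀ p, sobNorm (dirY d) (k + 1) (fun y => θA p y - θB p y) *
          sobNorm (dirY d) (s + 1) (h p) < ⊤ := fun p => ENNReal.mul_lt_top (hδt p) (hh p)
    have hd : ∀ p i, WD (dirX d) i
        (fun q => (ζ (q.1 - θA p q.2) - ζ (q.1 - θB p q.2)) * h p q.2) (fun q => match i with
          | none => (deriv ζ (q.1 - θA p q.2) - deriv ζ (q.1 - θB p q.2)) * h p q.2
          | some l => (ζ (q.1 - θA p q.2) - ζ (q.1 - θB p q.2)) * h' p l q.2 -
            ((deriv ζ (q.1 - θA p q.2) - deriv ζ (q.1 - θB p q.2)) * (θA' p l q.2 * h p q.2) +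
              deriv ζ (q.1 - θB p q.2) * ((θA' p l q.2 - θB' p l q.2) * h p q.2))) := by
      intro p i
      have h1 := wd_translate_mul (hζ.mono (by omega)) hk (hAt p) (hθA' p) (hh' p)
        (memLp_of_sobNorm_lt_top (hh p)) (fun l => memLp_of_sobNorm_lt_top (hh'l p l))
        (fun l => memLp_of_sobNorm_lt_top ((hqA l).lt_top (hh p))) i
      have h2 := wd_translate_mul (hζ.mono (by omega)) hk (hBt p) (hθB' p) (hh' p)
        (memLp_of_sobNorm_lt_top (hh p)) (fun l => memLp_of_sobNorm_lt_top (hh'l p l))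
        (fun l => memLp_of_sobNorm_lt_top ((hqB l).lt_top (hh p))) i
      convert h1.sub h2 using 2 with q q
      · ring
      · cases i <;> ring
    refine (Dom.of_le fun p => sobNorm_succ_le (hl hζ.zero hh p) (hd p)).trans
      ((h0 (hζ.mono (by omega)) hh).add (Dom.sum fun i _ => ?_))
    cases i with
    | none =>
      exact (ih (by omega) hζ.2 hhs).trans
        (Dom.of_le fun p => mul_le_mul_right (sobNorm_mono _ (Nat.le_succ s) _) _)
    | some l =>
      refine dom_sobNorm_sub hRt ?_ (dom_sobNorm_add ?_ ?_)
      · exact (ih (by omega) hζ.pred fun p => hh'l p l).trans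
          (Dom.of_le fun p => mul_le_mul_right (sobNorm_wd_le (hh' p l)) _)
      · exact (ih (by omega) hζ.2 fun p => (hqA l).lt_top (hh p)).trans ((Dom.refl _).mul (hqA l))
      · exact (dom_translate_mul hk hB s (by omega) (hζ.2.mono (by omega))
          fun p => (hqδ l).lt_top (hRt p)).trans (hqδ l)

/-- `θ ↦ T_θ ζ` is Lipschitz continuous; `ζ` itself need not be integrable. -/
theorem dom_translate_sub (hk : SobMul (dirY d) k)
    (hA : Dom (fun p => sobNorm (dirY d) k (θA p)) fun _ => 1)
    (hB : Dom (fun p => sobNorm (dirY d) k (θB p)) fun _ => 1) (s : ℕ) : s ≤ k →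
    ∀ {ζ : ℝ → ℝ}, ContDiff ℝ 1 ζ → (∃ C : ℝ, ∀ x, |ζ x| ≤ C) → Prof s (deriv ζ) →
      Dom (fun p => sobNorm (dirX d) s fun q => ζ (q.1 - θA p q.2) - ζ (q.1 - θB p q.2))
        (fun p => sobNorm (dirY d) k (fun y => θA p y - θB p y)) := by
  have hAt : ∀ p, sobNorm (dirY d) k (θA p) < ⊤ := fun p => hA.lt_top ENNReal.one_lt_top
  have hBt : ∀ p, sobNorm (dirY d) k (θB p) < ⊤ := fun p => hB.lt_top ENNReal.one_lt_top
  have hδt : ∀ p, sobNorm (dirY d) k (fun y => θA p y - θB p y) < ⊤ := fun p =>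
    sobNorm_sub_lt_top (hAt p) (hBt p)
  have h0 : ∀ {ζ : ℝ → ℝ}, ContDiff ℝ 1 ζ → Prof 0 (deriv ζ) → Dom (fun p => eLpNorm (fun q : X d =>
          ζ (q.1 - θA p q.2) - ζ (q.1 - θB p q.2)) 2 volume)
        (fun p => sobNorm (dirY d) k (fun y => θA p y - θB p y)) := by
    intro ζ hζ hζ'
    refine ⟨(eLpNorm (deriv ζ) 2 volume).toNNReal, fun p => ?_⟩
    rw [ENNReal.coe_toNNReal hζ'.2.1.2.ne]
    have := eLpNorm_comp_sub_sub_mul_le hζ hζ'.2.1 (memLp_of_sobNorm_lt_top (hAt p)).1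
      (memLp_of_sobNorm_lt_top (hBt p)).1 (aestronglyMeasurable_const (b := (1 : ℝ)))
    simp only [mul_one] at this
    exact this.trans (mul_le_mul_right (eLpNorm_le_sobNorm _ _ _) _)
  have hl : ∀ {ζ : ℝ → ℝ}, ContDiff ℝ 1 ζ → Prof 0 (deriv ζ) → ∀ p, LocallyIntegrable
      (fun q : X d => ζ (q.1 - θA p q.2) - ζ (q.1 - θB p q.2)) volume := fun hζ hζ' p =>
    MemLp.locallyIntegrable (p := 2) ⟨(aestronglyMeasurable_comp_sub hζ.continuous
      (memLp_of_sobNorm_lt_top (hAt p)).1).sub (aestronglyMeasurable_comp_sub hζ.continuous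
      (memLp_of_sobNorm_lt_top (hBt p)).1), (h0 hζ hζ').lt_top (hδt p)⟩ (by norm_num)
  induction s with
  | zero =>
    intro _ ζ hζ _ hζ'
    exact (Dom.of_le fun p => sobNorm_zero_le (hl hζ hζ' p)).trans (h0 hζ hζ')
  | succ s ih =>
    intro hsk ζ hζ hζb hζ'
    obtain ⟨k, rfl⟩ : ∃ k', k = k' + 1 := ⟨k - 1, by omega⟩
    choose θA' hθA' using fun p => exists_wd_of_sobNorm_lt_top (hAt p)
    choose θB' hθB' using fun p => exists_wd_of_sobNorm_lt_top (hBt p)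
    have hA'd : ∀ l, Dom (fun p => sobNorm (dirY d) s (θA' p l)) fun _ => 1 := fun l =>
      (Dom.of_le fun p => (sobNorm_mono _ (by omega : s ≤ k) _).trans
        (sobNorm_wd_le (hθA' p l))).trans hA
    have hA'l : ∀ p l, sobNorm (dirY d) s (θA' p l) < ⊤ := fun p l =>
      (hA'd l).lt_top ENNReal.one_lt_top
    have hB'l : ∀ p l, sobNorm (dirY d) s (θB' p l) < ⊤ := fun p l =>
      ((sobNorm_mono _ (by omega : s ≤ k) _).trans (sobNorm_wd_le (hθB' p l))).trans_lt (hBt p)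
    have hδ' : ∀ p l, sobNorm (dirY d) s (fun y => θA' p l y - θB' p l y) ≤
        sobNorm (dirY d) (k + 1) (fun y => θA p y - θB p y) := fun p l =>
      (sobNorm_mono _ (by omega : s ≤ k) _).trans (sobNorm_wd_le ((hθA' p l).sub (hθB' p l)))
    have hζ'0 := hζ'.zero
    have hlm : ∀ p l, LocallyIntegrable (fun q : X d =>
        (deriv ζ (q.1 - θA p q.2) - deriv ζ (q.1 - θB p q.2)) * θA' p l q.2 +
          deriv ζ (q.1 - θB p q.2) * (θA' p l q.2 - θB' p l q.2)) volume := fun p l => by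
      have h1 := locallyIntegrable_translate_mul hζ'0 (hAt p) (hA'l p l)
      have h2 := locallyIntegrable_translate_mul hζ'0 (hBt p) (hB'l p l)
      refine (h1.sub h2).congr (.of_forall fun q => ?_)
      simp only [Pi.sub_apply]
      ring
    have hd : ∀ p i, WD (dirX d) i
        (fun q => ζ (q.1 - θA p q.2) - ζ (q.1 - θB p q.2)) (fun q => match i with
          | none => deriv ζ (q.1 - θA p q.2) - deriv ζ (q.1 - θB p q.2)
          | some l => -((deriv ζ (q.1 - θA p q.2) - deriv ζ (q.1 - θB p q.2)) * θA' p l q.2 +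
              deriv ζ (q.1 - θB p q.2) * (θA' p l q.2 - θB' p l q.2))) := by
      intro p i
      cases i with
      | none =>
        refine wd_none_of_ae (hl hζ hζ'0 p) (hl hζ'.1.1 hζ'.2.zero p) (.of_forall fun y => ?_)
        have hcd : ContDiff ℝ 1 fun x : ℝ => ζ (x - θA p y) - ζ (x - θB p y) :=
          (hζ.comp (contDiff_id.sub contDiff_const)).sub (hζ.comp (contDiff_id.sub contDiff_const))
        have := wd_of_contDiff (b := dirR) (i := ()) hcd
        convert this using 2 with x
        have hdζ : ∀ c : ℝ, HasDerivAt (fun x : ℝ => ζ (x - c)) (deriv ζ (x - c)) x := fun c =>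
          ((hζ.differentiable one_ne_zero) (x - c)).hasDerivAt.comp_sub_const x c
        have h3 : deriv (fun x : ℝ => ζ (x - θA p y) - ζ (x - θB p y)) x = _ :=
          ((hdζ (θA p y)).sub (hdζ (θB p y))).deriv
        rw [dirR, fderiv_apply_one_eq_deriv, h3]
      | some l =>
        refine wd_some_of_ae (hl hζ hζ'0 p) (hlm p l).neg (.of_forall fun x => ?_)
        convert (wd_comp_sub_of_sobNorm hζ hk (hAt p) (hθA' p l) x).sub
          (wd_comp_sub_of_sobNorm hζ hk (hBt p) (hθB' p l) x) using 2 with y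
        ring
    refine (Dom.of_le fun p => sobNorm_succ_le (hl hζ hζ'0 p) (hd p)).trans
      ((h0 hζ hζ'0).add (Dom.sum fun i _ => ?_))
    cases i with
    | none => exact ih (by omega) hζ'.1.1 hζ'.1.2.2 hζ'.2
    | some l =>
      refine dom_sobNorm_neg hδt (dom_sobNorm_add ?_ ?_)
      · refine (dom_translate_sub_mul hk hA hB s (by omega) hζ' fun p => hA'l p l).trans ?_
        simpa using (Dom.refl fun p =>
          sobNorm (dirY d) (k + 1) fun y => θA p y - θB p y).mul (hA'd l)
      · exact (dom_translate_mul hk hB s (by omega) hζ'.pred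
          fun p => (hδ' p l).trans_lt (hδt p)).trans (Dom.of_le fun p => hδ' p l)

end Translates

end PlanarWave

namespace PlanarWave

open scoped NNReal Topology
open Filter

/-! ### Countable sums in `H^s` -/

section Tsum

variable {α ι : Type*} [MeasurableSpace α] {μ : Measure α} [Countable ι] {q : ι → α → ℝ}

theorem lintegral_tsum_enorm_sq_le (hq : ∀ j, AEStronglyMeasurable (q j) μ) :
    ∫⁻ x, (∑' j, ‖q j x‖ₑ) ^ 2 ∂μ ≤ (∑' j, eLpNorm (q j) 2 μ) ^ 2 := by
  have hF : ∀ F : Finset ι, ∫⁻ x, (∑ j ∈ F, ‖q j x‖ₑ) ^ 2 ∂μ ≤ (∑' j, eLpNorm (q j) 2 μ) ^ 2 := by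
    intro F
    have h1 : ∀ x, ∑ j ∈ F, ‖q j x‖ₑ = ‖∑ j ∈ F, |q j x|‖ₑ := fun x => by
      rw [Real.enorm_eq_ofReal (Finset.sum_nonneg fun _ _ => abs_nonneg _),
        ENNReal.ofReal_sum_of_nonneg fun _ _ => abs_nonneg _]
      exact Finset.sum_congr rfl fun j _ => Real.enorm_eq_ofReal_abs _
    simp_rw [h1]
    rw [lintegral_sq_eq_eLpNorm]
    refine pow_le_pow_left₀ zero_le ?_ 2
    have h2 := eLpNorm_le_of_abs_le_sum (s := F) (p := 2) (M := 1) (by norm_num) zero_le_one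
      (f := fun x => ∑ j ∈ F, |q j x|) (g := q) (fun j _ => hq j)
      (.of_forall fun x => by
        rw [one_mul, abs_of_nonneg (Finset.sum_nonneg fun _ _ => abs_nonneg _)])
    rw [Real.toNNReal_one, ENNReal.coe_one, one_mul] at h2
    exact h2.trans (ENNReal.sum_le_tsum F)
  have h3 : ∀ x, (∑' j, ‖q j x‖ₑ) ^ 2 = ⨆ F : Finset ι, (∑ j ∈ F, ‖q j x‖ₑ) ^ 2 := fun x => by
    rw [ENNReal.tsum_eq_iSup_sum]
    exact Monotone.map_iSup_of_continuousAt (f := fun t : ℝ≥0∞ => t ^ 2)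
      (ENNReal.continuous_pow 2).continuousAt (fun a b h => pow_le_pow_left₀ zero_le h 2) (by simp)
  simp_rw [h3]
  rw [lintegral_iSup_directed]
  · exact iSup_le hF
  · exact fun F => (Finset.aemeasurable_fun_sum F fun j _ => (hq j).enorm).pow_const 2
  · refine Monotone.directed_le fun F F' h x => ?_
    exact pow_le_pow_left₀ zero_le (Finset.sum_le_sum_of_subset h) 2

theorem ae_summable_of_tsum_eLpNorm_two (hq : ∀ j, AEStronglyMeasurable (q j) μ)
    (h : ∑' j, eLpNorm (q j) 2 μ < ⊤) : ∀ᵐ x ∂μ, Summable fun j => q j x := by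
  have h1 := (lintegral_tsum_enorm_sq_le hq).trans_lt (by finiteness)
  have h2 := ae_lt_top' ((AEMeasurable.tsum fun j => (hq j).enorm).pow_const 2) h1.ne
  refine h2.mono fun x hx => ?_
  have h3 : ∑' j, ‖q j x‖ₑ ≠ ⊤ := fun hc => by simp [hc] at hx
  exact .of_norm (tsum_enorm_ne_top_iff_summable_norm.1 h3)

theorem aestronglyMeasurable_tsum (hq : ∀ j, AEStronglyMeasurable (q j) μ)
    (h : ∀ᵐ x ∂μ, Summable fun j => q j x) :
    AEStronglyMeasurable (fun x => ∑' j, q j x) μ := by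
  refine aestronglyMeasurable_of_tendsto_ae (atTop : Filter (Finset ι))
    (f := fun F x => ∑ j ∈ F, q j x) (fun F => Finset.aestronglyMeasurable_fun_sum F fun j _ => hq j)
    (h.mono fun x hx => ?_)
  have := hx.hasSum
  rwa [HasSum, SummationFilter.unconditional_filter] at this

theorem eLpNorm_tsum_le (hq : ∀ j, AEStronglyMeasurable (q j) μ) :
    eLpNorm (fun x => ∑' j, q j x) 2 μ ≤ ∑' j, eLpNorm (q j) 2 μ := by
  have h1 : eLpNorm (fun x => ∑' j, q j x) 2 μ ^ 2 ≤ (∑' j, eLpNorm (q j) 2 μ) ^ 2 := by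
    rw [← lintegral_sq_eq_eLpNorm]
    refine (lintegral_mono fun x => ?_).trans (lintegral_tsum_enorm_sq_le hq)
    exact pow_le_pow_left₀ zero_le (enorm_tsum_le_tsum_enorm) 2
  exact (ENNReal.pow_le_pow_left_iff two_ne_zero).1 h1

theorem memLp_tsum (hq : ∀ j, AEStronglyMeasurable (q j) μ)
    (h : ∑' j, eLpNorm (q j) 2 μ < ⊤) : MemLp (fun x => ∑' j, q j x) 2 μ :=
  ⟨aestronglyMeasurable_tsum hq (ae_summable_of_tsum_eLpNorm_two hq h),
    (eLpNorm_tsum_le hq).trans_lt h⟩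

/-- Series that converge absolutely in `L²` may be integrated termwise against elements of `L²`. -/
theorem hasSum_integral_mul {φ : α → ℝ} (hφ : MemLp φ 2 μ)
    (hq : ∀ j, AEStronglyMeasurable (q j) μ) (h : ∑' j, eLpNorm (q j) 2 μ < ⊤) :
    HasSum (fun j => ∫ x, φ x * q j x ∂μ) (∫ x, φ x * ∑' j, q j x ∂μ) := by
  have hm : ∀ j, MemLp (q j) 2 μ := fun j => ⟨hq j, (ENNReal.le_tsum j).trans_lt h⟩
  have hi : ∀ j, Integrable (fun x => φ x * q j x) μ := fun j => integrable_fun_mul hφ (hm j)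
  have hb : ∀ j, ∫ x, ‖φ x * q j x‖ ∂μ ≤ (eLpNorm φ 2 μ * eLpNorm (q j) 2 μ).toReal := fun j => by
    rw [integral_norm_eq_lintegral_enorm (hi j).1]
    refine ENNReal.toReal_mono (ENNReal.mul_ne_top hφ.2.ne (hm j).2.ne) ?_
    have := lintegral_mul_sq_le hφ.1.enorm (hq j).enorm
    rw [lintegral_sq_eq_eLpNorm, lintegral_sq_eq_eLpNorm, ← mul_pow] at this
    simp_rw [enorm_mul]
    exact (ENNReal.pow_le_pow_left_iff two_ne_zero).1 this
  have hs : Summable fun j => ∫ x, ‖φ x * q j x‖ ∂μ := by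
    refine Summable.of_nonneg_of_le (fun j => integral_nonneg fun x => norm_nonneg _) hb
      (ENNReal.summable_toReal ?_)
    rw [ENNReal.tsum_mul_left]
    exact ENNReal.mul_ne_top hφ.2.ne h.ne
  have := hasSum_integral_of_summable_integral_norm hi hs
  simp_rw [tsum_mul_left] at this
  exact this

end Tsum

section SobolevTsum

variable {κ E ι : Type*} [Fintype κ] [NormedAddCommGroup E] [NormedSpace ℝ E]
  [FiniteDimensional ℝ E] [MeasureSpace E] [BorelSpace E] [(volume : Measure E).IsAddHaarMeasure]
  [Countable ι]

theorem WD.tsum {b : κ → E} {i : κ} {q q' : ι → E → ℝ} (h : ∀ j, WD b i (q j) (q' j))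
    (hq : ∀ j, AEStronglyMeasurable (q j) volume) (hs : ∑' j, eLpNorm (q j) 2 volume < ⊤)
    (hq' : ∀ j, AEStronglyMeasurable (q' j) volume) (hs' : ∑' j, eLpNorm (q' j) 2 volume < ⊤) :
    WD b i (fun x => ∑' j, q j x) (fun x => ∑' j, q' j x) := by
  rw [wd_iff]
  refine ⟨(memLp_tsum hq hs).locallyIntegrable (by norm_num),
    (memLp_tsum hq' hs').locallyIntegrable (by norm_num), fun φ hφ hc => ?_⟩
  have hm : ∀ {φ : E → ℝ}, Continuous φ → HasCompactSupport φ → MemLp φ 2 volume := fun h h' =>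
    h.memLp_of_hasCompactSupport h'
  have h1 := hasSum_integral_mul (hm (contDiff_fderiv_apply_const hφ (b i)).continuous
    (hasCompactSupport_fderiv_apply_const hc (b i))) hq hs
  have h2 := hasSum_integral_mul (hm hφ.continuous hc) hq' hs'
  simp only [smul_eq_mul]
  refine h1.unique (h2.neg.congr_fun fun j => ?_)
  simpa using (wd_iff.1 (h j)).2.2 φ hφ hc

/-- A series that converges absolutely in `H^s` has a sum in `H^s`, although the sum is taken
pointwise. -/
theorem exists_sobNorm_tsum_le (b : κ → E) (s : ℕ) : ∃ C : ℝ≥0, ∀ q : ι → E → ℝ,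
    ∑' j, sobNorm b s (q j) < ⊤ →
      sobNorm b s (fun x => ∑' j, q j x) ≤ C * ∑' j, sobNorm b s (q j) := by
  have hq : ∀ {s} {q : ι → E → ℝ}, ∑' j, sobNorm b s (q j) < ⊤ →
      ∀ j, AEStronglyMeasurable (q j) volume := fun h j =>
    (memLp_of_sobNorm_lt_top ((ENNReal.le_tsum j).trans_lt h)).1
  have h0 : ∀ {s} {q : ι → E → ℝ}, ∑' j, eLpNorm (q j) 2 volume ≤ ∑' j, sobNorm b s (q j) :=
    ENNReal.tsum_le_tsum fun j => eLpNorm_le_sobNorm b _ _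
  have hl : ∀ {s} {q : ι → E → ℝ}, ∑' j, sobNorm b s (q j) < ⊤ →
      LocallyIntegrable (fun x => ∑' j, q j x) volume := fun h =>
    (memLp_tsum (hq h) (h0.trans_lt h)).locallyIntegrable (by norm_num)
  induction s with
  | zero =>
    refine ⟨1, fun q h => ?_⟩
    rw [ENNReal.coe_one, one_mul]
    exact (sobNorm_zero_le (hl h)).trans ((eLpNorm_tsum_le (hq h)).trans h0)
  | succ s ih =>
    obtain ⟨C, hC⟩ := ih
    refine ⟨1 + Fintype.card κ * C, fun q h => ?_⟩
    choose q' hq' using fun j : ι => exists_wd_of_sobNorm_lt_top (u := q j)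
      ((ENNReal.le_tsum j).trans_lt h)
    have hle : ∀ i, ∑' j, sobNorm b s (q' j i) ≤ ∑' j, sobNorm b (s + 1) (q j) := fun i =>
      ENNReal.tsum_le_tsum fun j => sobNorm_wd_le (hq' j i)
    have hlt : ∀ i, ∑' j, sobNorm b s (q' j i) < ⊤ := fun i => (hle i).trans_lt h
    refine (sobNorm_succ_le (hl h) fun i => WD.tsum (fun j => hq' j i) (hq h) (h0.trans_lt h)
      (hq (hlt i)) (h0.trans_lt (hlt i))).trans ?_
    have hi : ∀ i, sobNorm b s (fun x => ∑' j, q' j i x) ≤ C * ∑' j, sobNorm b (s + 1) (q j) :=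
      fun i => (hC _ (hlt i)).trans (mul_le_mul_right (hle i) _)
    refine (add_le_add ((eLpNorm_tsum_le (hq h)).trans (h0 (s := s + 1))) (Finset.sum_le_sum fun i _ => hi i)).trans
      (le_of_eq ?_)
    rw [Finset.sum_const, Finset.card_univ, nsmul_eq_mul]
    push_cast
    ring

end SobolevTsum

/-! ### Integration over slices -/

section Slices

variable {d : ℕ}

theorem memLp_fst_mul_snd {ψ : ℝ → ℝ} (hψ : MemLp ψ 2 volume) {h : Y d → ℝ}
    (hh : MemLp h 2 volume) : MemLp (fun q : X d => ψ q.1 * h q.2) 2 volume ∧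
      eLpNorm (fun q : X d => ψ q.1 * h q.2) 2 volume ≤ eLpNorm ψ 2 volume * eLpNorm h 2 volume := by
  have hm : AEStronglyMeasurable (fun q : X d => ψ q.1 * h q.2) volume := by
    rw [Measure.volume_eq_prod]
    exact hψ.1.comp_fst.mul hh.1.comp_snd
  have hb := eLpNorm_le_of_slices (C := eLpNorm ψ 2 volume) hm (.of_forall fun y => by
    simp only [enorm_mul, mul_pow]
    rw [lintegral_mul_const' _ _ (by finiteness), lintegral_sq_eq_eLpNorm]) hψ.2.ne
  exact ⟨⟨hm, hb.trans_lt (ENNReal.mul_lt_top hψ.2 hh.2)⟩, hb⟩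

/-- `y ↦ ⟨u(·, y), ψ⟩_{L²_x}` for scalar functions. -/
noncomputable def sliceInt (u : X d → ℝ) (ψ : ℝ → ℝ) (y : Y d) : ℝ := ∫ x, u (x, y) * ψ x

theorem aestronglyMeasurable_sliceInt {u : X d → ℝ} (hu : AEStronglyMeasurable u volume)
    {ψ : ℝ → ℝ} (hψ : AEStronglyMeasurable ψ volume) :
    AEStronglyMeasurable (sliceInt u ψ) volume := by
  rw [Measure.volume_eq_prod] at hu
  have h1 : AEStronglyMeasurable (fun q : X d => u q * ψ q.1)
      ((volume : Measure ℝ).prod (volume : Measure (Y d))) := hu.mul hψ.comp_fst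
  exact h1.prod_swap.integral_prod_right'

theorem eLpNorm_sliceInt_le {u : X d → ℝ} (hu : AEStronglyMeasurable u volume)
    {ψ : ℝ → ℝ} (hψ : MemLp ψ 2 volume) :
    eLpNorm (sliceInt u ψ) 2 volume ≤ eLpNorm ψ 2 volume * eLpNorm u 2 volume := by
  refine (ENNReal.pow_le_pow_left_iff two_ne_zero).1 ?_
  rw [mul_pow, ← lintegral_sq_eq_eLpNorm, ← lintegral_sq_eq_eLpNorm u,
    ← lintegral_const_mul' _ _ (by have := hψ.2; finiteness)]
  rw [Measure.volume_eq_prod] at hu ⊢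
  rw [lintegral_prod_symm _ ((hu.enorm.pow_const 2).const_mul _)]
  have hs : ∀ᵐ y : Y d, AEStronglyMeasurable (fun x => u (x, y)) volume := hu.prod_swap.prodMk_left
  refine lintegral_mono_ae (hs.mono fun y hy => ?_)
  rw [lintegral_const_mul' _ _ (by have := hψ.2; finiteness), mul_comm, ← lintegral_sq_eq_eLpNorm ψ]
  refine le_trans (pow_le_pow_left₀ zero_le (enorm_integral_le_lintegral_enorm _) 2) ?_
  simp_rw [enorm_mul]
  exact lintegral_mul_sq_le hy.enorm hψ.1.enorm

theorem integral_snd_mul_sliceInt {u : X d → ℝ} (hu : MemLp u 2 volume) {ψ : ℝ → ℝ}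
    (hψ : MemLp ψ 2 volume) {h : Y d → ℝ} (hh : MemLp h 2 volume) :
    ∫ q : X d, u q * (ψ q.1 * h q.2) = ∫ y, h y * sliceInt u ψ y := by
  have hi := integrable_fun_mul hu (memLp_fst_mul_snd hψ hh).1
  rw [Measure.volume_eq_prod] at hi ⊢
  rw [integral_prod_symm _ hi]
  refine integral_congr_ae (.of_forall fun y => ?_)
  simp only [sliceInt]
  rw [← integral_const_mul]
  exact integral_congr_ae (.of_forall fun x => by simp only; ring)

/-- Pairing with `ψ` in the variable `x` commutes with weak differentiation in `y`. -/
theorem wd_sliceInt {u u' : X d → ℝ} {l : Fin (d - 1)} (h : WD (dirX d) (some l) u u')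
    (hu : MemLp u 2 volume) (hu' : MemLp u' 2 volume) {ψ : ℝ → ℝ} (hψ : MemLp ψ 2 volume) :
    WD (dirY d) l (sliceInt u ψ) (sliceInt u' ψ) := by
  have hL : ∀ {u : X d → ℝ}, MemLp u 2 volume → LocallyIntegrable (sliceInt u ψ) volume :=
    fun hu => MemLp.locallyIntegrable (p := 2) ⟨aestronglyMeasurable_sliceInt hu.1 hψ.1,
      (eLpNorm_sliceInt_le hu.1 hψ).trans_lt (ENNReal.mul_lt_top hψ.2 hu.2)⟩ (by norm_num)
  rw [wd_iff]
  refine ⟨hL hu, hL hu', fun φ hφ hc => ?_⟩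
  have hm : ∀ {φ : Y d → ℝ}, Continuous φ → HasCompactSupport φ → MemLp φ 2 volume := fun h h' =>
    h.memLp_of_hasCompactSupport h'
  have hφm := hm hφ.continuous hc
  have hφm' := hm (contDiff_fderiv_apply_const hφ (dirY d l)).continuous
    (hasCompactSupport_fderiv_apply_const hc (dirY d l))
  simp only [smul_eq_mul]
  rw [← integral_snd_mul_sliceInt hu hψ hφm', ← integral_snd_mul_sliceInt hu' hψ hφm]
  obtain ⟨C, hC⟩ := exists_smooth_approx dirR 0
  have hψ0 : sobNorm dirR 0 ψ < ⊤ :=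
    (sobNorm_zero_le (hψ.locallyIntegrable (by norm_num))).trans_lt hψ.2
  obtain ⟨v, hv1, hv2, hv3, hv4⟩ := hC ψ hψ0
  have hvm : ∀ n, MemLp (v n) 2 volume := fun n =>
    (hv1 n).continuous.memLp_of_hasCompactSupport (hv2 n)
  have hlim : ∀ {u : X d → ℝ}, MemLp u 2 volume → ∀ {g : Y d → ℝ}, MemLp g 2 volume →
      Tendsto (fun n => ∫ q : X d, u q * (v n q.1 * g q.2)) atTop
        (𝓝 (∫ q : X d, u q * (ψ q.1 * g q.2))) := by
    intro u hu g hg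
    refine tendsto_integral_mul_of_ae_tendsto
      (C := (C * sobNorm dirR 0 ψ * eLpNorm g 2 volume).toNNReal)
      (fun n => (memLp_fst_mul_snd (hvm n) hg).1.1) (fun n => ?_) ?_ hu
    · rw [ENNReal.coe_toNNReal (by have := hg.2; finiteness)]
      refine (memLp_fst_mul_snd (hvm n) hg).2.trans (mul_le_mul_left ?_ _)
      exact (eLpNorm_le_sobNorm dirR 0 _).trans (hv3 n)
    · have : ∀ᵐ q : X d, Tendsto (fun n => v n q.1) atTop (𝓝 (ψ q.1)) := by
        rw [Measure.volume_eq_prod]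
        exact Measure.quasiMeasurePreserving_fst.ae hv4
      exact this.mono fun q hq => hq.mul_const _
  refine tendsto_nhds_unique (hlim hu hφm') (((hlim hu' hφm).neg).congr fun n => ?_)
  have htest : ContDiff ℝ ∞ fun q : X d => v n q.1 * φ q.2 :=
    ((hv1 n).comp contDiff_fst).mul (hφ.comp contDiff_snd)
  have hcs : HasCompactSupport fun q : X d => v n q.1 * φ q.2 := by
    refine HasCompactSupport.intro ((hv2 n).isCompact.prod hc.isCompact) fun q hq => ?_
    by_cases h1 : q.1 ∈ tsupport (v n)
    · have h2 : q.2 ∉ tsupport φ := fun h2 => hq ⟨h1, h2⟩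
      simp [image_eq_zero_of_notMem_tsupport h2]
    · simp [image_eq_zero_of_notMem_tsupport h1]
  have h3 := (wd_iff.1 h).2.2 _ htest hcs
  have e : ∀ q : X d, fderiv ℝ (fun q : X d => v n q.1 * φ q.2) q (dirX d (some l)) =
      v n q.1 * fderiv ℝ φ q.2 (dirY d l) := fun q => by
    have hf1 : HasFDerivAt (fun q : X d => v n q.1) _ q :=
      ((hv1 n).differentiable (by simp) q.1).hasFDerivAt.comp q hasFDerivAt_fst
    have hf2 : HasFDerivAt (fun q : X d => φ q.2) _ q :=
      (hφ.differentiable (by simp) q.2).hasFDerivAt.comp q hasFDerivAt_snd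
    have hf : fderiv ℝ (fun q : X d => v n q.1 * φ q.2) q = _ := (hf1.mul hf2).fderiv
    rw [hf]
    simp [dirX]
  simp_rw [e, smul_eq_mul] at h3
  rw [neg_eq_iff_eq_neg]
  calc ∫ q : X d, u' q * (v n q.1 * φ q.2) = ∫ q : X d, v n q.1 * φ q.2 * u' q :=
        integral_congr_ae (.of_forall fun q => mul_comm _ _)
    _ = -∫ q : X d, v n q.1 * fderiv ℝ φ q.2 (dirY d l) * u q := by rw [h3, neg_neg]
    _ = _ := by
        congr 1
        exact integral_congr_ae (.of_forall fun q => mul_comm _ _)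

/-- Pairing with `ψ ∈ L²_x` maps `H^s` to `H^s_y`. -/
theorem exists_sobNorm_sliceInt_le {ψ : ℝ → ℝ} (hψ : MemLp ψ 2 volume) (s : ℕ) :
    ∃ C : ℝ≥0, ∀ u : X d → ℝ, sobNorm (dirX d) s u < ⊤ →
      sobNorm (dirY d) s (sliceInt u ψ) ≤ C * sobNorm (dirX d) s u := by
  have hl : ∀ {s} {u : X d → ℝ}, sobNorm (dirX d) s u < ⊤ →
      LocallyIntegrable (sliceInt u ψ) volume := fun h =>
    MemLp.locallyIntegrable (p := 2) ⟨aestronglyMeasurable_sliceInt (memLp_of_sobNorm_lt_top h).1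
      hψ.1, (eLpNorm_sliceInt_le (memLp_of_sobNorm_lt_top h).1 hψ).trans_lt
      (ENNReal.mul_lt_top hψ.2 (memLp_of_sobNorm_lt_top h).2)⟩ (by norm_num)
  have h0 : ∀ {s} {u : X d → ℝ}, sobNorm (dirX d) s u < ⊤ → eLpNorm (sliceInt u ψ) 2 volume ≤
      (eLpNorm ψ 2 volume).toNNReal * sobNorm (dirX d) s u := fun h => by
    rw [ENNReal.coe_toNNReal hψ.2.ne]
    exact (eLpNorm_sliceInt_le (memLp_of_sobNorm_lt_top h).1 hψ).trans
      (mul_le_mul_right (eLpNorm_le_sobNorm _ _ _) _)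
  induction s with
  | zero => exact ⟨_, fun u h => (sobNorm_zero_le (hl h)).trans (h0 h)⟩
  | succ s ih =>
    obtain ⟨C, hC⟩ := ih
    refine ⟨(eLpNorm ψ 2 volume).toNNReal + Fintype.card (Fin (d - 1)) * C, fun u h => ?_⟩
    choose u' hu' using exists_wd_of_sobNorm_lt_top h
    have hlt : ∀ i, sobNorm (dirX d) s (u' i) < ⊤ := fun i => (sobNorm_wd_le (hu' i)).trans_lt h
    refine (sobNorm_succ_le (hl h) fun l => wd_sliceInt (hu' (some l)) (memLp_of_sobNorm_lt_top h)
      (memLp_of_sobNorm_lt_top (hlt _)) hψ).trans ?_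
    have hi : ∀ l, sobNorm (dirY d) s (sliceInt (u' (some l)) ψ) ≤ C * sobNorm (dirX d) (s + 1) u :=
      fun l => (hC _ (hlt _)).trans (mul_le_mul_right (sobNorm_wd_le (hu' _)) _)
    refine (add_le_add (h0 h) (Finset.sum_le_sum fun i _ => hi i)).trans (le_of_eq ?_)
    rw [Finset.sum_const, Finset.card_univ, nsmul_eq_mul]
    push_cast
    ring

end Slices

end PlanarWave

namespace PlanarWave

open scoped NNReal Topology
open Filter

/-! ### Regularity of the wave profile -/

section Profiles

theorem Prof.add {s : ℕ} : ∀ {ζ η : ℝ → ℝ}, Prof s ζ → Prof s η → Prof s fun x => ζ x + η x := by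
  have hb : ∀ {ζ η : ℝ → ℝ}, (∃ C : ℝ, ∀ x, |ζ x| ≤ C) → (∃ C : ℝ, ∀ x, |η x| ≤ C) →
      ∃ C : ℝ, ∀ x, |ζ x + η x| ≤ C := by
    rintro ζ η ⟨C, hC⟩ ⟨C', hC'⟩
    exact ⟨C + C', fun x => (abs_add_le _ _).trans (add_le_add (hC x) (hC' x))⟩
  induction s with
  | zero => exact fun h h' => ⟨h.1.add h'.1, h.2.1.add h'.2.1, hb h.2.2 h'.2.2⟩
  | succ s ih =>
    intro ζ η h h'
    refine ⟨⟨h.1.1.add h'.1.1, h.1.2.1.add h'.1.2.1, hb h.1.2.2 h'.1.2.2⟩, ?_⟩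
    have : deriv (fun x => ζ x + η x) = fun x => deriv ζ x + deriv η x := by
      ext x
      exact deriv_add (h.1.1.differentiable one_ne_zero x) (h'.1.1.differentiable one_ne_zero x)
    rw [this]
    exact ih h.2 h'.2

theorem prof_zero (s : ℕ) : Prof s fun _ => 0 := by
  induction s with
  | zero => exact ⟨continuous_const, MemLp.zero', 0, by simp⟩
  | succ s ih => exact ⟨⟨contDiff_const, MemLp.zero', 0, by simp⟩, by simpa using ih⟩

theorem Prof.sum {s : ℕ} {ι : Type*} {S : Finset ι} {ζ : ι → ℝ → ℝ} (h : ∀ c ∈ S, Prof s (ζ c)) :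
    Prof s fun x => ∑ c ∈ S, ζ c x := by
  classical
  induction S using Finset.induction_on with
  | empty => simpa using prof_zero s
  | insert c S hc ih =>
    simp only [Finset.sum_insert hc]
    exact (h c (Finset.mem_insert_self _ _)).add (ih fun j hj => h j (Finset.mem_insert_of_mem hj))

theorem Prof.const_mul {s : ℕ} (a : ℝ) : ∀ {ζ : ℝ → ℝ}, Prof s ζ → Prof s fun x => a * ζ x := by
  have hb : ∀ {ζ : ℝ → ℝ}, (∃ C : ℝ, ∀ x, |ζ x| ≤ C) → ∃ C : ℝ, ∀ x, |a * ζ x| ≤ C := by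
    rintro ζ ⟨C, hC⟩
    exact ⟨|a| * C, fun x => by rw [abs_mul]; exact mul_le_mul_of_nonneg_left (hC x) (abs_nonneg _)⟩
  induction s with
  | zero => exact fun h => ⟨continuous_const.mul h.1, h.2.1.const_mul a, hb h.2.2⟩
  | succ s ih =>
    intro ζ h
    refine ⟨⟨contDiff_const.mul h.1.1, h.1.2.1.const_mul a, hb h.1.2.2⟩, ?_⟩
    have : deriv (fun x => a * ζ x) = fun x => a * deriv ζ x := by
      ext x
      exact deriv_const_mul a (h.1.1.differentiable one_ne_zero x)
    rw [this]
    exact ih h.2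

theorem memLp_bdd_mul {ζ η : ℝ → ℝ} (hζ : Continuous ζ) (hb : ∃ C : ℝ, ∀ x, |ζ x| ≤ C)
    (hη : MemLp η 2 volume) : MemLp (fun x => ζ x * η x) 2 volume := by
  obtain ⟨C, hC⟩ := hb
  exact MemLp.of_le_mul (c := C) hη (hζ.aestronglyMeasurable.mul hη.1) (.of_forall fun x => by
    rw [norm_mul]; exact mul_le_mul_of_nonneg_right (hC x) (norm_nonneg _))

theorem bdd_mul_bdd {ζ η : ℝ → ℝ} (hζ : ∃ C : ℝ, ∀ x, |ζ x| ≤ C) (hη : ∃ C : ℝ, ∀ x, |η x| ≤ C) :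
    ∃ C : ℝ, ∀ x, |ζ x * η x| ≤ C := by
  obtain ⟨C, hC⟩ := hζ
  obtain ⟨C', hC'⟩ := hη
  refine ⟨C * C', fun x => ?_⟩
  rw [abs_mul]
  exact mul_le_mul (hC x) (hC' x) (abs_nonneg _) ((abs_nonneg _).trans (hC x))

theorem Prof.mul {s : ℕ} : ∀ {ζ η : ℝ → ℝ}, Prof s ζ → Prof s η → Prof s fun x => ζ x * η x := by
  induction s with
  | zero =>
    exact fun h h' => ⟨h.1.mul h'.1, memLp_bdd_mul h.1 h.2.2 h'.2.1, bdd_mul_bdd h.2.2 h'.2.2⟩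
  | succ s ih =>
    intro ζ η h h'
    refine ⟨⟨h.1.1.mul h'.1.1, memLp_bdd_mul h.1.1.continuous h.1.2.2 h'.1.2.1,
      bdd_mul_bdd h.1.2.2 h'.1.2.2⟩, ?_⟩
    have : deriv (fun x => ζ x * η x) = fun x => deriv ζ x * η x + ζ x * deriv η x := by
      ext x
      exact deriv_fun_mul (h.1.1.differentiable one_ne_zero x)
        (h'.1.1.differentiable one_ne_zero x)
    rw [this]
    exact (ih h.2 h'.pred).add (ih h.pred h'.2)

variable {m : ℕ} {φ : Fin m → ℝ → ℝ}

theorem hasDerivAt_comp_pi {G : (Fin m → ℝ) → ℝ} (hG : ContDiff ℝ 1 G)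
    (hφ : ∀ c, ContDiff ℝ 1 (φ c)) (x : ℝ) :
    HasDerivAt (fun x => G fun c => φ c x) (∑ c, pd c G (fun c => φ c x) * deriv (φ c) x) x := by
  have h1 : HasDerivAt (fun x c => φ c x) (fun c => deriv (φ c) x) x :=
    hasDerivAt_pi.2 fun c => ((hφ c).differentiable one_ne_zero x).hasDerivAt
  have h2 := ((hG.differentiable one_ne_zero) (fun c => φ c x)).hasFDerivAt.comp_hasDerivAt x h1
  rwa [fderiv_apply_eq_sum_pd] at h2

theorem bdd_comp_pi {G : (Fin m → ℝ) → ℝ} (hG : Continuous G)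
    (hb : ∀ c, ∃ C : ℝ, ∀ x, |φ c x| ≤ C) : ∃ C : ℝ, ∀ x, |G fun c => φ c x| ≤ C := by
  choose C hC using hb
  obtain ⟨M, -, hM⟩ := exists_bound_of_continuous hG (∑ c, |C c|)
  refine ⟨M, fun x => hM _ ((pi_norm_le_iff_of_nonneg (by positivity)).2 fun c => ?_)⟩
  exact ((hC c x).trans (le_abs_self _)).trans
    (Finset.single_le_sum (f := fun c => |C c|) (fun _ _ => abs_nonneg _) (Finset.mem_univ c))

/-- A `C^s` function of bounded functions with profile derivatives is a multiplier on profiles. -/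
theorem Prof.comp_mul {s : ℕ} (hφ : ∀ c, ContDiff ℝ 1 (φ c)) (hb : ∀ c, ∃ C : ℝ, ∀ x, |φ c x| ≤ C)
    (hφ' : ∀ c, Prof s (deriv (φ c))) : ∀ {G : (Fin m → ℝ) → ℝ}, ContDiff ℝ s G →
      ∀ {ζ : ℝ → ℝ}, Prof s ζ → Prof s fun x => (G fun c => φ c x) * ζ x := by
  have hc : ∀ {G : (Fin m → ℝ) → ℝ}, Continuous G → Continuous fun x => G fun c => φ c x :=
    fun hG => hG.comp (continuous_pi fun c => (hφ c).continuous)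
  induction s with
  | zero =>
    intro G hG ζ h
    have hG0 := hG.continuous
    exact ⟨(hc hG0).mul h.1, memLp_bdd_mul (hc hG0) (bdd_comp_pi hG0 hb) h.2.1,
      bdd_mul_bdd (bdd_comp_pi hG0 hb) h.2.2⟩
  | succ s ih =>
    intro G hG ζ h
    have hG0 := hG.continuous
    have hG1 : ContDiff ℝ 1 G := hG.of_le (by norm_cast; omega)
    refine ⟨⟨(hG1.comp (contDiff_pi.2 hφ)).mul h.1.1, memLp_bdd_mul (hc hG0) (bdd_comp_pi hG0 hb)
      h.1.2.1, bdd_mul_bdd (bdd_comp_pi hG0 hb) h.1.2.2⟩, ?_⟩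
    have : deriv (fun x => (G fun c => φ c x) * ζ x) = fun x =>
        (∑ c, pd c G (fun c => φ c x) * (deriv (φ c) x * ζ x)) + (G fun c => φ c x) * deriv ζ x := by
      ext x
      have hd : deriv (fun x => (G fun c => φ c x) * ζ x) x = _ := ((hasDerivAt_comp_pi hG1 hφ x).mul
        (h.1.1.differentiable one_ne_zero x).hasDerivAt).deriv
      rw [hd, Finset.sum_mul]
      congr 1
      exact Finset.sum_congr rfl fun c _ => by ring
    rw [this]
    refine Prof.add (Prof.sum fun c _ => ?_) ?_
    · exact ih (fun c => (hφ' c).pred) (contDiff_pd hG c) ((hφ' c).pred.mul h.pred)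
    · exact ih (fun c => (hφ' c).pred) (hG.of_le (by norm_cast; omega)) h.2

theorem memLp_two_of_exp_decay {ζ : ℝ → ℝ} (hζ : Continuous ζ) {K ν ν' : ℝ} (hν : 0 < ν)
    (hν' : 0 < ν') (h : ∀ x ≤ 0, |ζ x| ≤ K * Real.exp (-ν * |x|))
    (h' : ∀ x ≥ 0, |ζ x| ≤ K * Real.exp (-ν' * |x|)) : MemLp ζ 2 volume := by
  rw [memLp_two_iff_integrable_sq hζ.aestronglyMeasurable, ← integrableOn_univ,
    ← Set.Iic_union_Ioi (a := (0 : ℝ)), integrableOn_union]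
  have hsq : ∀ {a b : ℝ}, |a| ≤ K * Real.exp b → ‖a ^ 2‖ ≤ K ^ 2 * Real.exp (2 * b) := by
    intro a b hab
    rw [norm_pow, Real.norm_eq_abs, two_mul, Real.exp_add, ← sq, ← mul_pow]
    exact pow_le_pow_left₀ (abs_nonneg _) hab 2
  have hc : Continuous fun x => ζ x ^ 2 := hζ.pow 2
  constructor
  · refine Integrable.mono' ((integrableOn_exp_mul_Iic (a := 2 * ν) (by positivity) 0).const_mul
      (K ^ 2)) hc.aestronglyMeasurable ((ae_restrict_iff' measurableSet_Iic).2
      (.of_forall fun x hx => (hsq (h x hx)).trans (le_of_eq ?_)))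
    rw [abs_of_nonpos hx]
    congr 2
    ring
  · refine Integrable.mono' ((integrableOn_exp_mul_Ioi (a := -(2 * ν')) (by linarith) 0).const_mul
      (K ^ 2)) hc.aestronglyMeasurable ((ae_restrict_iff' measurableSet_Ioi).2
      (.of_forall fun x hx => (hsq (h' x (le_of_lt hx))).trans (le_of_eq ?_)))
    rw [abs_of_pos hx]
    congr 2
    ring

end Profiles

section Wave

variable {n : ℕ}

/-- The component `f_c` of a map of `ℝⁿ`, as a function on coordinates. -/
def comp (f : V n → V n) (c : Fin n) (y : Fin n → ℝ) : ℝ := f (WithLp.toLp 2 y) c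

theorem contDiff_comp {f : V n → V n} {j : ℕ} (hf : ContDiff ℝ j f) (c : Fin n) :
    ContDiff ℝ j (comp f c) :=
  ((contDiff_euclidean.1 hf) c).comp (PiLp.continuousLinearEquiv 2 ℝ fun _ : Fin n => ℝ).symm.contDiff

theorem fderiv_apply_eq_sum_pd_comp {f : V n → V n} (hf : Differentiable ℝ f) (u v : V n)
    (c : Fin n) : fderiv ℝ f u v c = ∑ a, pd a (comp f c) (fun j => u j) * v a := by
  let L := (PiLp.continuousLinearEquiv 2 ℝ fun _ : Fin n => ℝ).symm
  have h1 : HasFDerivAt (comp f c) (((EuclideanSpace.proj c : V n →L[ℝ] ℝ).comp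
      (fderiv ℝ f u)).comp (L : (Fin n → ℝ) →L[ℝ] V n)) (fun j => u j) := by
    have h2 : HasFDerivAt f (fderiv ℝ f u) (L fun j => u j) := (hf u).hasFDerivAt
    exact ((EuclideanSpace.proj c : V n →L[ℝ] ℝ).hasFDerivAt.comp _ h2).comp _ L.hasFDerivAt
  have h3 := fderiv_apply_eq_sum_pd (comp f c) (fun j => u j) (fun j => v j)
  rw [h1.fderiv] at h3
  exact h3

variable {f : V n → V n} {um up : V n} {Φ₀ : ℝ → V n} {c₀ : ℝ} {k : ℕ}

/-- The component `Φ₀,c` of the wave profile. -/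
def waveComp (Φ₀ : ℝ → V n) (c : Fin n) (x : ℝ) : ℝ := Φ₀ x c

theorem contDiff_waveComp {j : ℕ} (h : ContDiff ℝ j Φ₀) (c : Fin n) :
    ContDiff ℝ j (waveComp Φ₀ c) := (contDiff_euclidean.1 h) c

theorem deriv_apply_eq (h : ContDiff ℝ 1 Φ₀) (c : Fin n) (x : ℝ) :
    deriv Φ₀ x c = deriv (waveComp Φ₀ c) x := by
  have h1 := (h.differentiable one_ne_zero x).hasDerivAt
  have h2 : HasDerivAt (waveComp Φ₀ c) (deriv Φ₀ x c) x :=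
    (EuclideanSpace.proj c : V n →L[ℝ] ℝ).hasFDerivAt.comp_hasDerivAt x h1
  exact h2.deriv.symm

theorem iteratedDeriv_two_apply_eq (h : ContDiff ℝ 2 Φ₀) (c : Fin n) (x : ℝ) :
    iteratedDeriv 2 Φ₀ x c = deriv (deriv (waveComp Φ₀ c)) x := by
  have h' : ContDiff ℝ (1 + 1) Φ₀ := by norm_num; exact h
  have h1 : ContDiff ℝ 1 (deriv Φ₀) := (contDiff_succ_iff_deriv.1 h').2.2
  rw [iteratedDeriv_succ, iteratedDeriv_one, deriv_apply_eq h1]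
  congr 1
  ext x
  exact deriv_apply_eq (h.of_le (by norm_num)) c x

theorem HypTw.bdd_deriv (h : HypTw f um up Φ₀ c₀) : ∃ K : ℝ, ∀ x, ‖deriv Φ₀ x‖ ≤ K := by
  obtain ⟨K, νm, νp, hK, hm, hp, hneg, hpos⟩ := h.limits
  refine ⟨K, fun x => ?_⟩
  have he : ∀ {ν : ℝ}, 0 < ν → K * Real.exp (-ν * |x|) ≤ K := fun hν =>
    mul_le_of_le_one_right hK.le (Real.exp_le_one_iff.2 (by
      have := mul_nonneg hν.le (abs_nonneg x); linarith))
  rcases le_total x 0 with hx | hx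
  · exact ((le_add_of_nonneg_left (norm_nonneg _)).trans (hneg x hx)).trans (he hm)
  · exact ((le_add_of_nonneg_left (norm_nonneg _)).trans (hpos x hx)).trans (he hp)

theorem HypTw.bdd (h : HypTw f um up Φ₀ c₀) : ∃ K : ℝ, 0 < K ∧ ∀ x, ‖Φ₀ x‖ ≤ K := by
  obtain ⟨K, νm, νp, hK, hm, hp, hneg, hpos⟩ := h.limits
  refine ⟨K + ‖um‖ + ‖up‖, by positivity, fun x => ?_⟩
  have he : ∀ {ν : ℝ}, 0 < ν → K * Real.exp (-ν * |x|) ≤ K := fun hν =>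
    mul_le_of_le_one_right hK.le (Real.exp_le_one_iff.2 (by
      have := mul_nonneg hν.le (abs_nonneg x); linarith))
  rcases le_total x 0 with hx | hx
  · have h1 : ‖Φ₀ x - um‖ ≤ K :=
      ((le_add_of_nonneg_right (norm_nonneg _)).trans (hneg x hx)).trans (he hm)
    have h2 := norm_add_le (Φ₀ x - um) um
    rw [sub_add_cancel] at h2
    linarith [norm_nonneg up]
  · have h1 : ‖Φ₀ x - up‖ ≤ K :=
      ((le_add_of_nonneg_right (norm_nonneg _)).trans (hpos x hx)).trans (he hp)
    have h2 := norm_add_le (Φ₀ x - up) up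
    rw [sub_add_cancel] at h2
    linarith [norm_nonneg um]

theorem bdd_waveComp (h : HypTw f um up Φ₀ c₀) (c : Fin n) : ∃ C : ℝ, ∀ x, |waveComp Φ₀ c x| ≤ C := by
  obtain ⟨K, -, hK⟩ := h.bdd
  exact ⟨K, fun x => (PiLp.norm_apply_le (Φ₀ x) c).trans (hK x)⟩

theorem prof_zero_deriv_waveComp (h : HypTw f um up Φ₀ c₀) (c : Fin n) :
    Prof 0 (deriv (waveComp Φ₀ c)) := by
  have h1 : ContDiff ℝ 1 Φ₀ := h.contDiff.of_le (by norm_num)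
  have hle : ∀ x, |deriv (waveComp Φ₀ c) x| ≤ ‖deriv Φ₀ x‖ := fun x => by
    rw [← deriv_apply_eq h1]; exact PiLp.norm_apply_le (deriv Φ₀ x) c
  have hc : Continuous (deriv (waveComp Φ₀ c)) :=
    (contDiff_waveComp (j := 1) (by exact_mod_cast h1) c).continuous_deriv le_rfl
  obtain ⟨K', hK'⟩ := h.bdd_deriv
  obtain ⟨K, νm, νp, hK, hm, hp, hneg, hpos⟩ := h.limits
  refine ⟨hc, memLp_two_of_exp_decay (K := K) hc hm hp (fun x hx => ?_) (fun x hx => ?_), K',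
    fun x => (hle x).trans (hK' x)⟩
  · exact (hle x).trans ((le_add_of_nonneg_left (norm_nonneg _)).trans (hneg x hx))
  · exact (hle x).trans ((le_add_of_nonneg_left (norm_nonneg _)).trans (hpos x hx))

/-- `f(Φ₀)` is a profile: `f` is locally Lipschitz and vanishes at the limits `u_±`, which `Φ₀`
approaches exponentially. -/
theorem prof_zero_comp_wave (hf : HypF k f um up) (h : HypTw f um up Φ₀ c₀) (c : Fin n) :
    Prof 0 fun x => comp f c fun e => waveComp Φ₀ e x := by
  have hcf : ∀ x, comp f c (fun e => waveComp Φ₀ e x) = f (Φ₀ x) c := fun x => rfl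
  have hcont : Continuous fun x => comp f c fun e => waveComp Φ₀ e x :=
    (contDiff_comp hf.contDiff c).continuous.comp (continuous_pi fun e =>
      (contDiff_waveComp (j := 2) (by exact_mod_cast h.contDiff) e).continuous)
  obtain ⟨R, hR, hΦ⟩ := h.bdd
  obtain ⟨L, hL, hLip⟩ := hf.lipschitz (R + ‖um‖ + ‖up‖) (by positivity)
  have hfl : ∀ x (u : V n), f u = 0 → ‖u‖ ≤ R + ‖um‖ + ‖up‖ →
      |f (Φ₀ x) c| ≤ L * ‖Φ₀ x - u‖ := fun x u hu hur => by
    have h1 := hLip (Φ₀ x) u (by linarith [hΦ x, norm_nonneg um, norm_nonneg up]) hur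
    have h2 := (Finset.single_le_sum (f := fun j =>
      ‖iteratedFDeriv ℝ j f (Φ₀ x) - iteratedFDeriv ℝ j f u‖) (fun _ _ => norm_nonneg _)
      (Finset.mem_range.2 (by omega : 0 < k + 3))).trans h1
    have h3 := (iteratedFDeriv ℝ 0 f (Φ₀ x) - iteratedFDeriv ℝ 0 f u).le_opNorm (fun _ => 0)
    simp only [sub_apply, iteratedFDeriv_zero_apply, hu, sub_zero,
      Finset.univ_eq_empty, Finset.prod_empty, mul_one] at h3
    exact ((PiLp.norm_apply_le (f (Φ₀ x)) c).trans h3).trans h2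
  obtain ⟨K, νm, νp, hK, hm, hp, hneg, hpos⟩ := h.limits
  refine ⟨hcont, memLp_two_of_exp_decay (K := L * K) hcont hm hp (fun x hx => ?_) (fun x hx => ?_),
    bdd_comp_pi (contDiff_comp hf.contDiff c).continuous fun e => bdd_waveComp h e⟩
  · rw [hcf, mul_assoc]
    refine (hfl x um hf.zero_minus (by linarith [norm_nonneg up])).trans
      (mul_le_mul_of_nonneg_left ?_ hL.le)
    exact (le_add_of_nonneg_right (norm_nonneg _)).trans (hneg x hx)
  · rw [hcf, mul_assoc]
    refine (hfl x up hf.zero_plus (by linarith [norm_nonneg um])).trans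
      (mul_le_mul_of_nonneg_left ?_ hL.le)
    exact (le_add_of_nonneg_right (norm_nonneg _)).trans (hpos x hx)

/-- Bootstrapping in the travelling wave equation `Φ₀'' = -c₀ Φ₀' - f(Φ₀)`: if `Φ₀'` is a profile of
order `s`, then so is the right-hand side, and `Φ₀'` is one of order `s + 1`. -/
theorem prof_deriv_waveComp (hf : HypF k f um up) (h : HypTw f um up Φ₀ c₀) (s : ℕ) :
    s ≤ k + 1 → ∀ c, Prof s (deriv (waveComp Φ₀ c)) := by
  have hΦ2 : ∀ c, ContDiff ℝ 2 (waveComp Φ₀ c) := fun c =>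
    contDiff_waveComp (j := 2) (by exact_mod_cast h.contDiff) c
  have hΦ1 : ∀ c, ContDiff ℝ 1 (waveComp Φ₀ c) := fun c => (hΦ2 c).of_le (by norm_num)
  induction s with
  | zero => exact fun _ c => prof_zero_deriv_waveComp h c
  | succ s ih =>
    intro hs c
    have ih' := ih (by omega)
    have h' : ContDiff ℝ (1 + 1) (waveComp Φ₀ c) := by norm_num; exact hΦ2 c
    refine ⟨⟨(contDiff_succ_iff_deriv.1 h').2.2, (prof_zero_deriv_waveComp h c).2⟩, ?_⟩
    have hode : deriv (deriv (waveComp Φ₀ c)) = fun x =>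
        -c₀ * deriv (waveComp Φ₀ c) x + -1 * comp f c fun e => waveComp Φ₀ e x := by
      ext x
      have h1 := congrArg (fun v : V n => v c) (h.ode x)
      simp only [PiLp.add_apply, PiLp.smul_apply, smul_eq_mul, PiLp.zero_apply] at h1
      rw [iteratedDeriv_two_apply_eq h.contDiff, deriv_apply_eq (h.contDiff.of_le (by norm_num))] at h1
      have h2 : comp f c (fun e => waveComp Φ₀ e x) = f (Φ₀ x) c := rfl
      rw [h2]
      linarith
    rw [hode]
    refine ((ih' c).const_mul (-c₀)).add (Prof.const_mul (-1) ?_)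
    -- At order zero `f(Φ₀)` decays because `f(u_±) = 0`; its derivative `Df(Φ₀) Φ₀'` decays because
    -- `Φ₀'` does.
    cases s with
    | zero => exact prof_zero_comp_wave hf h c
    | succ s =>
      have hf1 : ContDiff ℝ 1 (comp f c) :=
        (contDiff_comp hf.contDiff c).of_le (by norm_cast; omega)
      have h0 := prof_zero_comp_wave hf h c
      refine ⟨⟨hf1.comp (contDiff_pi.2 hΦ1), h0.2⟩, ?_⟩
      have : deriv (fun x => comp f c fun e => waveComp Φ₀ e x) = fun x =>
          ∑ e, pd e (comp f c) (fun e => waveComp Φ₀ e x) * deriv (waveComp Φ₀ e) x :=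
        funext fun x => (hasDerivAt_comp_pi hf1 hΦ1 x).deriv
      rw [this]
      refine Prof.sum fun e _ => Prof.comp_mul hΦ1 (bdd_waveComp h) (fun e => (ih' e).pred) ?_
        (ih' e).pred
      exact contDiff_pd ((contDiff_comp hf.contDiff c).of_le (by norm_cast; omega)) e

section Background

variable {κ E P : Type*} [NormedAddCommGroup E] [NormedSpace ℝ E] {d : ℕ}

theorem bddDeriv_const (b : κ → E) (s : ℕ) : ∀ a : ℝ, BddDeriv b s fun (_ : P) (_ : E) => a := by
  induction s with
  | zero => exact fun a => ⟨fun _ => continuous_const, |a|, fun _ _ => le_rfl⟩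
  | succ s ih =>
    refine fun a => ⟨⟨fun _ => contDiff_const, |a|, fun _ _ => le_rfl⟩, fun i => ?_⟩
    simpa using ih 0

theorem fderiv_comp_fst {ζ : ℝ → ℝ} (hζ : ContDiff ℝ 1 ζ) (i : Option (Fin (d - 1))) (q : X d) :
    fderiv ℝ (fun q : X d => ζ q.1) q (dirX d i) = match i with
      | none => deriv ζ q.1
      | some _ => 0 := by
  have h0 : HasFDerivAt (fun q : X d => q.1) (ContinuousLinearMap.fst ℝ ℝ (Y d)) q := hasFDerivAt_fst
  have h : HasFDerivAt (fun q : X d => ζ q.1) _ q :=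
    (hζ.differentiable one_ne_zero q.1).hasDerivAt.comp_hasFDerivAt q h0
  rw [h.fderiv]
  cases i <;> simp [dirX]

theorem bddDeriv_comp_fst {s : ℕ} : ∀ {ζ : ℝ → ℝ}, Prof s ζ →
    BddDeriv (dirX d) s fun (_ : P) (q : X d) => ζ q.1 := by
  induction s with
  | zero =>
    intro ζ h
    obtain ⟨C, hC⟩ := h.2.2
    exact ⟨fun _ => h.1.comp continuous_fst, C, fun _ q => hC q.1⟩
  | succ s ih =>
    intro ζ h
    obtain ⟨C, hC⟩ := h.1.2.2
    refine ⟨⟨fun _ => h.1.1.comp contDiff_fst, C, fun _ q => hC q.1⟩, fun i => ?_⟩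
    simp_rw [fderiv_comp_fst h.1.1]
    cases i with
    | none => exact ih h.2
    | some l => exact bddDeriv_const _ _ _

/-- The wave profile is a background with bounded derivatives; it is not itself integrable. -/
theorem bddDeriv_waveComp (hf : HypF k f um up) (h : HypTw f um up Φ₀ c₀) (c : Fin n) :
    BddDeriv (dirX d) k fun (_ : P) (q : X d) => waveComp Φ₀ c q.1 := by
  obtain ⟨C, hC⟩ := bdd_waveComp h c
  have h1 : ContDiff ℝ 1 (waveComp Φ₀ c) :=
    contDiff_waveComp (j := 1) (by exact_mod_cast h.contDiff.of_le (by norm_num)) c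
  refine BddDeriv.pred ⟨⟨fun _ => h1.comp contDiff_fst, C, fun _ q => hC q.1⟩, fun i => ?_⟩
  simp_rw [fderiv_comp_fst h1]
  cases i with
  | none => exact bddDeriv_comp_fst (prof_deriv_waveComp hf h k (by omega) c)
  | some l => exact bddDeriv_const _ _ _

end Background

theorem sobNorm_adjointKernel_lt_top {ψ : ℝ → V n} (hψ : IsAdjointKernel f Φ₀ c₀ ψ) (c : Fin n) :
    sobNorm dirR 2 (fun x => ψ x c) < ⊤ := by
  obtain ⟨C, hC⟩ := exists_sobNorm_clm_le (F := V n) (F' := ℝ) dirR 2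
  have h : sobNorm dirR 2 ψ < ⊤ := hψ.kernel.1
  exact (hC (EuclideanSpace.proj c) ψ h).trans_lt (by finiteness)

theorem memLp_adjointKernel {ψ : ℝ → V n} (hψ : IsAdjointKernel f Φ₀ c₀ ψ) (c : Fin n) :
    MemLp (fun x => ψ x c) 2 volume := memLp_of_sobNorm_lt_top (sobNorm_adjointKernel_lt_top hψ c)

/-- `ψ` is bounded, by the embedding of `H²_x` into `L^∞`. -/
theorem exists_bound_adjointKernel {ψ : ℝ → V n} (hψ : IsAdjointKernel f Φ₀ c₀ ψ) :
    ∃ R : ℝ, 0 ≤ R ∧ ∀ c, ∀ᵐ x, |ψ x c| ≤ R := by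
  obtain ⟨C, hC⟩ := (sobMul_dirR.mono one_le_two).exists_ae_bound
  refine ⟨∑ c, (C * sobNorm dirR 2 (fun x => ψ x c)).toReal, by positivity, fun c => ?_⟩
  have hc := sobNorm_adjointKernel_lt_top hψ c
  filter_upwards [hC _ hc] with x hx
  rw [← Real.norm_eq_abs, ← toReal_enorm]
  refine (ENNReal.toReal_mono (by finiteness) hx).trans ?_
  exact Finset.single_le_sum (f := fun c => (C * sobNorm dirR 2 (fun x => ψ x c)).toReal)
    (fun _ _ => by positivity) (Finset.mem_univ c)

end Wave

end PlanarWave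

namespace PlanarWave

open scoped NNReal Topology
open Filter

/-! ### Components, and the projection along the translates of the wave -/

section Components

variable {κ E P : Type*} [Fintype κ] [NormedAddCommGroup E] [NormedSpace ℝ E]
  [FiniteDimensional ℝ E] [MeasureSpace E] [BorelSpace E] [(volume : Measure E).IsAddHaarMeasure]
  {m : ℕ} {b : κ → E} {s : ℕ}

theorem dom_sobNorm_apply {w : P → E → V m} (hw : ∀ p, sobNorm b s (w p) < ⊤) (c : Fin m) :
    Dom (fun p => sobNorm b s fun x => w p x c) (fun p => sobNorm b s (w p)) := by
  obtain ⟨C, hC⟩ := exists_sobNorm_clm_le (F := V m) (F' := ℝ) b s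
  refine ⟨C * ‖(EuclideanSpace.proj c : V m →L[ℝ] ℝ)‖₊, fun p => ?_⟩
  push_cast
  rw [mul_assoc]
  exact hC (EuclideanSpace.proj c) (w p) (hw p)

theorem sobNorm_apply_lt_top {w : E → V m} (hw : sobNorm b s w < ⊤) (c : Fin m) :
    sobNorm b s (fun x => w x c) < ⊤ :=
  (dom_sobNorm_apply (P := Unit) (w := fun _ => w) (fun _ => hw) c).lt_top (p := ()) hw

theorem memLp_apply {w : E → V m} (hw : sobNorm b s w < ⊤) (c : Fin m) :
    MemLp (fun x => w x c) 2 volume := memLp_of_sobNorm_lt_top (sobNorm_apply_lt_top hw c)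

/-- Sobolev norms of vector-valued functions are controlled by their components, to which the scalar
product and chain rules apply. -/
theorem dom_sobNorm_of_apply {w : P → E → V m} {B : P → ℝ≥0∞} (hB : ∀ p, B p < ⊤)
    (h : ∀ c, Dom (fun p => sobNorm b s fun x => w p x c) B) :
    Dom (fun p => sobNorm b s (w p)) B := by
  classical
  obtain ⟨C, hC⟩ := exists_sobNorm_clm_le (F := ℝ) (F' := V m) b s
  obtain ⟨C', hC'⟩ := exists_sobNorm_add_le (F := V m) b s
  have key : ∀ S : Finset (Fin m), Dom (fun p => sobNorm b s fun x =>
      ∑ c ∈ S, w p x c • (EuclideanSpace.single c 1 : V m)) B := by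
    intro S
    induction S using Finset.induction_on with
    | empty =>
      exact ⟨0, fun p => by simp [sobNorm_zero_fun]⟩
    | insert c S hc ih =>
      simp only [Finset.sum_insert hc]
      refine Dom.trans ⟨C', fun p => hC' _ _⟩ (Dom.add ?_ ih)
      refine Dom.trans ⟨C * ‖ContinuousLinearMap.toSpanSingleton ℝ
        (EuclideanSpace.single c 1 : V m)‖₊, fun p => ?_⟩ (h c)
      push_cast
      rw [mul_assoc]
      exact hC (ContinuousLinearMap.toSpanSingleton ℝ (EuclideanSpace.single c 1 : V m))
        (fun x => w p x c) ((h c).lt_top (hB p))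
  have e : ∀ p, (fun x => ∑ c, w p x c • (EuclideanSpace.single c 1 : V m)) = w p := fun p => by
    ext x c
    simp [Finset.sum_apply, Pi.single_apply]
  simpa only [e] using key Finset.univ

theorem sobNorm_vec_sub_lt_top {v v' : E → V m} (h : sobNorm b s v < ⊤)
    (h' : sobNorm b s v' < ⊤) : sobNorm b s (fun x => v x - v' x) < ⊤ :=
  (dom_sobNorm_of_apply (P := Unit) (w := fun _ x => v x - v' x)
    (B := fun _ => sobNorm b s v + sobNorm b s v')
    (fun _ => ENNReal.add_lt_top.2 ⟨h, h'⟩) fun c => by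
      simp only [PiLp.sub_apply]
      exact dom_sobNorm_sub (fun _ => ENNReal.add_lt_top.2 ⟨h, h'⟩)
        ((dom_sobNorm_apply (fun _ => h) c).trans (Dom.of_le fun _ => le_self_add))
        ((dom_sobNorm_apply (fun _ => h') c).trans (Dom.of_le fun _ => le_add_self))).lt_top
    (p := ()) (ENNReal.add_lt_top.2 ⟨h, h'⟩)

end Components

section InnerX

variable {d n s : ℕ} {P : Type*} {ψ : ℝ → V n}

/-- By Fubini, an element of `L²(ℝ^d)` restricts to an element of `L²` on almost every slice. -/
theorem ae_memLp_slice {u : X d → ℝ} (hu : MemLp u 2 volume) :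
    ∀ᵐ y : Y d, MemLp (fun x => u (x, y)) 2 volume := by
  have hm := hu.1
  have h2 : ∫⁻ q : X d, ‖u q‖ₑ ^ 2 < ⊤ := by
    rw [lintegral_sq_eq_eLpNorm]
    have := hu.2
    finiteness
  rw [Measure.volume_eq_prod] at hm h2
  rw [lintegral_prod_symm _ (hm.enorm.pow_const 2)] at h2
  have h3 : ∀ᵐ y : Y d, AEStronglyMeasurable (fun x => u (x, y)) volume := hm.prod_swap.prodMk_left
  have hme : AEMeasurable (fun y : Y d => ∫⁻ x : ℝ, ‖u (x, y)‖ₑ ^ 2) volume :=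
    (hm.enorm.pow_const 2).prod_swap.lintegral_prod_right'
  filter_upwards [h3, ae_lt_top' hme h2.ne] with y hy hy2
  refine ⟨hy, ?_⟩
  rw [lintegral_sq_eq_eLpNorm] at hy2
  by_contra hc
  rw [not_lt, top_le_iff] at hc
  simp [hc] at hy2

theorem inner_eq_sum (u v : V n) : ⟪u, v⟫ = ∑ c, u c * v c := by
  simp [PiLp.inner_apply, mul_comm]

/-- The slice integral of the inner product splits into components where all the slices are square
integrable, which is almost everywhere. -/
theorem innerX_ae_eq {w : X d → V n} (hw : ∀ c, MemLp (fun q => w q c) 2 volume)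
    (hψ : ∀ c, MemLp (fun x => ψ x c) 2 volume) :
    innerX w ψ =ᵐ[volume] fun y => ∑ c, sliceInt (fun q => w q c) (fun x => ψ x c) y := by
  filter_upwards [ae_all_iff.2 fun c => ae_memLp_slice (hw c)] with y hy
  simp only [innerX, inner_eq_sum, sliceInt]
  exact integral_finsetSum _ fun c _ => integrable_fun_mul (hy c) (hψ c)

theorem innerX_sub_ae_eq {w w' : X d → V n} (hw : ∀ c, MemLp (fun q => w q c) 2 volume)
    (hw' : ∀ c, MemLp (fun q => w' q c) 2 volume) (hψ : ∀ c, MemLp (fun x => ψ x c) 2 volume) :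
    innerX (fun q => w q - w' q) ψ =ᵐ[volume] fun y => innerX w ψ y - innerX w' ψ y := by
  filter_upwards [ae_all_iff.2 fun c => ae_memLp_slice (hw c),
    ae_all_iff.2 fun c => ae_memLp_slice (hw' c)] with y hy hy'
  simp only [innerX]
  rw [← integral_sub]
  · simp only [inner_sub_left]
  · simp only [inner_eq_sum]
    exact integrable_finsetSum _ fun c _ => integrable_fun_mul (hy c) (hψ c)
  · simp only [inner_eq_sum]
    exact integrable_finsetSum _ fun c _ => integrable_fun_mul (hy' c) (hψ c)

theorem dom_innerX (hψ : ∀ c, MemLp (fun x => ψ x c) 2 volume) {w : P → X d → V n}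
    (hw : ∀ p, sobNorm (dirX d) s (w p) < ⊤) :
    Dom (fun p => sobNorm (dirY d) s (innerX (w p) ψ)) (fun p => sobNorm (dirX d) s (w p)) := by
  have e : (fun p => sobNorm (dirY d) s (innerX (w p) ψ)) = fun p => sobNorm (dirY d) s fun y =>
      ∑ c, sliceInt (fun q => w p q c) (fun x => ψ x c) y :=
    funext fun p => sobNorm_congr (innerX_ae_eq (fun c => memLp_apply (hw p) c) hψ)
  rw [e]
  refine dom_sobNorm_sum fun c _ => ?_
  obtain ⟨C, hC⟩ := exists_sobNorm_sliceInt_le (d := d) (hψ c) s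
  exact Dom.trans ⟨C, fun p => hC _ (sobNorm_apply_lt_top (hw p) c)⟩ (dom_sobNorm_apply hw c)

theorem dom_innerX_sub (hψ : ∀ c, MemLp (fun x => ψ x c) 2 volume) {w w' : P → X d → V n}
    (hw : ∀ p c, MemLp (fun q => w p q c) 2 volume) (hw' : ∀ p c, MemLp (fun q => w' p q c) 2 volume)
    (h : ∀ p, sobNorm (dirX d) s (fun q => w p q - w' p q) < ⊤) :
    Dom (fun p => sobNorm (dirY d) s fun y => innerX (w p) ψ y - innerX (w' p) ψ y)
      (fun p => sobNorm (dirX d) s fun q => w p q - w' p q) := by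
  have e : (fun p => sobNorm (dirY d) s fun y => innerX (w p) ψ y - innerX (w' p) ψ y) =
      fun p => sobNorm (dirY d) s (innerX (fun q => w p q - w' p q) ψ) :=
    funext fun p => (sobNorm_congr (innerX_sub_ae_eq (hw p) (hw' p) hψ)).symm
  rw [e]
  exact dom_innerX hψ h

end InnerX

/-- What the estimates use about the wave profile `Φ₀`, the adjoint kernel element `ψ` and the cut-off
function `χ`: their regularity, and the normalisation `⟨Φ₀', ψ⟩ = 1`. -/
structure WaveData {n : ℕ} (k : ℕ) (Φ₀ ψ : ℝ → V n) (χ : ℝ → ℝ) : Prop where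
  contDiff : ContDiff ℝ 2 Φ₀
  bdd : ∀ c, ∃ C : ℝ, ∀ x, |waveComp Φ₀ c x| ≤ C
  prof : ∀ c, Prof (k + 1) (deriv (waveComp Φ₀ c))
  memLp : ∀ c, MemLp (fun x => ψ x c) 2 volume
  bound : ∃ R : ℝ, 0 ≤ R ∧ ∀ c, ∀ᵐ x, |ψ x c| ≤ R
  normalised : ∫ x, ⟪deriv Φ₀ x, ψ x⟫ = 1
  cutoff : IsCutoff χ

theorem waveData {n k : ℕ} {f : V n → V n} {um up : V n} {Φ₀ ψ : ℝ → V n} {c₀ : ℝ} {χ : ℝ → ℝ}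
    (hf : HypF k f um up) (hTw : HypTw f um up Φ₀ c₀) (hψ : IsAdjointKernel f Φ₀ c₀ ψ)
    (hχ : IsCutoff χ) : WaveData k Φ₀ ψ χ :=
  ⟨hTw.contDiff, bdd_waveComp hTw, prof_deriv_waveComp hf hTw (k + 1) le_rfl,
    memLp_adjointKernel hψ, exists_bound_adjointKernel hψ, hψ.normalised, hχ⟩

section Projection

variable {d n k K s : ℕ} {P : Type*} {Φ₀ ψ : ℝ → V n} {χ : ℝ → ℝ}

theorem abs_Upsilon_le (hχ : IsCutoff χ) (θ : Y d → ℝ) (y : Y d) : |Upsilon Φ₀ ψ χ θ y| ≤ 4 := by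
  have h := hχ.ge (innerX (translate θ (deriv Φ₀)) ψ y)
  rw [Upsilon, abs_div, abs_neg, abs_one, abs_of_pos (by linarith), div_le_iff₀ (by linarith)]
  linarith

/-- `⟨T_θ Φ₀' - Φ₀', ψ⟩_{L²_x}`, which is `⟨T_θ Φ₀', ψ⟩_{L²_x} - 1` by the normalisation of `ψ`.  Unlike
`⟨T_θ Φ₀', ψ⟩_{L²_x}` it lies in `H^k_y`. -/
noncomputable def tiltDefect (Φ₀ ψ : ℝ → V n) (θ : Y d → ℝ) : Y d → ℝ :=
  innerX (fun q => translate θ (deriv Φ₀) q - deriv Φ₀ q.1) ψ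

namespace WaveData

variable (H : WaveData k Φ₀ ψ χ)
include H

theorem contDiff_one : ContDiff ℝ 1 Φ₀ := H.contDiff.of_le (by norm_num)

theorem contDiff_waveComp (c : Fin n) : ContDiff ℝ 1 (waveComp Φ₀ c) :=
  PlanarWave.contDiff_waveComp (j := 1) (by exact_mod_cast H.contDiff_one) c

theorem translate_deriv_apply (θ : Y d → ℝ) (q : X d) (c : Fin n) :
    translate θ (deriv Φ₀) q c = deriv (waveComp Φ₀ c) (q.1 - θ q.2) :=
  deriv_apply_eq H.contDiff_one c _

theorem translate_deriv_two_apply (θ : Y d → ℝ) (q : X d) (c : Fin n) :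
    translate θ (iteratedDeriv 2 Φ₀) q c = deriv (deriv (waveComp Φ₀ c)) (q.1 - θ q.2) :=
  iteratedDeriv_two_apply_eq H.contDiff c _

theorem innerX_translate_deriv (θ : Y d → ℝ) (y : Y d) :
    innerX (translate θ (deriv Φ₀)) ψ y = 1 + tiltDefect Φ₀ ψ θ y := by
  have hi : ∀ a : ℝ, Integrable fun x => ⟪deriv Φ₀ (x - a), ψ x⟫ := fun a => by
    simp only [inner_eq_sum, deriv_apply_eq H.contDiff_one]
    refine integrable_finsetSum _ fun c _ => integrable_fun_mul ?_ (H.memLp c)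
    exact (H.prof c).zero.2.1.comp_measurePreserving (measurePreserving_sub_right volume a)
  have h0 := hi 0
  simp only [sub_zero] at h0
  rw [← H.normalised, tiltDefect, innerX, innerX, ← integral_add h0]
  · refine integral_congr_ae (.of_forall fun x => ?_)
    simp only [translate, inner_sub_left]
    ring
  · simp only [inner_sub_left]
    exact (hi (θ y)).sub h0

variable {θ θA θB : P → Y d → ℝ}

theorem dom_translate_deriv_sub (hK : K ≤ k) (hk : SobMul (dirY d) K)
    (hA : Dom (fun p => sobNorm (dirY d) K (θA p)) fun _ => 1)
    (hB : Dom (fun p => sobNorm (dirY d) K (θB p)) fun _ => 1) :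
    Dom (fun p => sobNorm (dirX d) K fun q =>
        translate (θA p) (deriv Φ₀) q - translate (θB p) (deriv Φ₀) q)
      (fun p => sobNorm (dirY d) K fun y => θA p y - θB p y) := by
  refine dom_sobNorm_of_apply (fun p => sobNorm_sub_lt_top (hA.lt_top ENNReal.one_lt_top)
    (hB.lt_top ENNReal.one_lt_top)) fun c => ?_
  simp only [PiLp.sub_apply, H.translate_deriv_apply]
  exact dom_translate_sub hk hA hB K le_rfl (H.prof c).1.1 (H.prof c).1.2.2 ((H.prof c).2.mono hK)

theorem dom_zero : Dom (fun _ : P => sobNorm (dirY d) K fun _ => (0 : ℝ)) fun _ => 1 :=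
  ⟨0, fun p => by simp [sobNorm_zero_fun]⟩

/-- The case `θ_B = 0` of the Lipschitz estimate for translates. -/
theorem dom_tiltDefect (hK : K ≤ k) (hk : SobMul (dirY d) K)
    (hθ : Dom (fun p => sobNorm (dirY d) K (θ p)) fun _ => 1) :
    Dom (fun p => sobNorm (dirY d) K (tiltDefect Φ₀ ψ (θ p))) fun _ => 1 := by
  have h1 := H.dom_translate_deriv_sub hK hk hθ H.dom_zero
  have e : ∀ p, (fun q : X d => translate (θ p) (deriv Φ₀) q - translate (fun _ => 0) (deriv Φ₀) q)
      = fun q => translate (θ p) (deriv Φ₀) q - deriv Φ₀ q.1 := fun p => by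
    ext q c; simp [translate]
  simp only [e, sub_zero] at h1
  exact (dom_innerX H.memLp fun p => h1.lt_top (hθ.lt_top ENNReal.one_lt_top)).trans (h1.trans hθ)

theorem memLp_translate_sub (hK : K ≤ k) (hk : SobMul (dirY d) K) {θ : Y d → ℝ}
    (hθ : sobNorm (dirY d) K θ < ⊤) (c : Fin n) :
    MemLp (fun q => (translate θ (deriv Φ₀) q - deriv Φ₀ q.1) c) 2 volume := by
  have hd : Dom (fun _ : Unit => sobNorm (dirY d) K θ) fun _ => 1 :=
    ⟨(sobNorm (dirY d) K θ).toNNReal, fun _ => by rw [ENNReal.coe_toNNReal hθ.ne, mul_one]⟩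
  have h1 := H.dom_translate_deriv_sub (θA := fun _ : Unit => θ) hK hk hd H.dom_zero
  have e : (fun q : X d => translate θ (deriv Φ₀) q - translate (fun _ => 0) (deriv Φ₀) q)
      = fun q => translate θ (deriv Φ₀) q - deriv Φ₀ q.1 := by
    ext q c; simp [translate]
  simp only [e, sub_zero] at h1
  exact memLp_apply (h1.lt_top (p := ()) hθ) c

theorem dom_tiltDefect_sub (hK : K ≤ k) (hk : SobMul (dirY d) K)
    (hA : Dom (fun p => sobNorm (dirY d) K (θA p)) fun _ => 1)
    (hB : Dom (fun p => sobNorm (dirY d) K (θB p)) fun _ => 1) :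
    Dom (fun p => sobNorm (dirY d) K fun y => tiltDefect Φ₀ ψ (θA p) y - tiltDefect Φ₀ ψ (θB p) y)
      (fun p => sobNorm (dirY d) K fun y => θA p y - θB p y) := by
  have h1 := H.dom_translate_deriv_sub hK hk hA hB
  have e : ∀ p, (fun q : X d => (translate (θA p) (deriv Φ₀) q - deriv Φ₀ q.1) -
      (translate (θB p) (deriv Φ₀) q - deriv Φ₀ q.1)) = fun q =>
      translate (θA p) (deriv Φ₀) q - translate (θB p) (deriv Φ₀) q := fun p => by
    ext q c; simp
  refine (dom_innerX_sub H.memLp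
    (fun p c => H.memLp_translate_sub hK hk (hA.lt_top ENNReal.one_lt_top) c)
    (fun p c => H.memLp_translate_sub hK hk (hB.lt_top ENNReal.one_lt_top) c)
    (s := K) fun p => ?_).trans ?_
  · rw [e]
    exact h1.lt_top (sobNorm_sub_lt_top (hA.lt_top ENNReal.one_lt_top)
      (hB.lt_top ENNReal.one_lt_top))
  · simp only [e]
    exact h1

/-- The argument of `χ` in `Υ(θ)` is the background `1` perturbed by an element of `H^K_y`. -/
theorem bddState_tiltDefect (hK : K ≤ k) (hk : SobMul (dirY d) K)
    (hθ : Dom (fun p => sobNorm (dirY d) K (θ p)) fun _ => 1) :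
    BddState (dirY d) K (fun (_ : Fin 1) (_ : Y d) => (1 : ℝ))
      (fun p _ => tiltDefect Φ₀ ψ (θ p)) :=
  ⟨fun _ => bddDeriv_const _ _ _, fun _ => H.dom_tiltDefect hK hk hθ⟩

theorem contDiff_Upsilon_fun (j : ℕ) : ContDiff ℝ j fun v : Fin 1 → ℝ => -1 / χ (v 0) :=
  contDiff_const.div ((H.cutoff.smooth.of_le (by norm_cast; exact le_top)).comp
    (contDiff_apply ℝ ℝ 0)) fun v => by
    have := H.cutoff.ge (v 0)
    linarith

theorem Upsilon_eq (θ : Y d → ℝ) (y : Y d) : Upsilon Φ₀ ψ χ θ y =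
    (fun v : Fin 1 → ℝ => -1 / χ (v 0)) (bgAdd (fun (_ : Fin 1) (_ : Y d) => (1 : ℝ))
      (fun _ => tiltDefect Φ₀ ψ θ) y) := by
  simp [Upsilon, bgAdd, H.innerX_translate_deriv]

theorem dom_Upsilon_mul (hK : K ≤ k) (hk : SobMul (dirY d) K)
    (hθ : Dom (fun p => sobNorm (dirY d) K (θ p)) fun _ => 1) {h : P → Y d → ℝ}
    (hh : ∀ p, sobNorm (dirY d) K (h p) < ⊤) :
    Dom (fun p => sobNorm (dirY d) K fun y => Upsilon Φ₀ ψ χ (θ p) y * h p y)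
      (fun p => sobNorm (dirY d) K (h p)) := by
  simp only [H.Upsilon_eq]
  exact (H.bddState_tiltDefect hK hk hθ).dom_comp_mul hk K le_rfl (H.contDiff_Upsilon_fun K) hh

theorem dom_Upsilon_sub_mul (hK : K ≤ k) (hk : SobMul (dirY d) K)
    (hA : Dom (fun p => sobNorm (dirY d) K (θA p)) fun _ => 1)
    (hB : Dom (fun p => sobNorm (dirY d) K (θB p)) fun _ => 1) {h : P → Y d → ℝ}
    (hh : ∀ p, sobNorm (dirY d) K (h p) < ⊤) :
    Dom (fun p => sobNorm (dirY d) K fun y =>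
        (Upsilon Φ₀ ψ χ (θA p) y - Upsilon Φ₀ ψ χ (θB p) y) * h p y)
      (fun p => sobNorm (dirY d) K (fun y => θA p y - θB p y) * sobNorm (dirY d) K (h p)) := by
  simp only [H.Upsilon_eq]
  refine (BddState.dom_sub_mul (H.bddState_tiltDefect hK hk hA) (H.bddState_tiltDefect hK hk hB)
    hk K le_rfl (H.contDiff_Upsilon_fun (K + 1)) hh).trans (Dom.mul ?_ (Dom.refl _))
  simp only [compNorm, Fin.sum_univ_one]
  exact H.dom_tiltDefect_sub hK hk hA hB

end WaveData

/-- `Υ(θ) ⟨w, ψ⟩_{L²_x}`. -/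
noncomputable def proj (Φ₀ ψ : ℝ → V n) (χ : ℝ → ℝ) (θ : Y d → ℝ) (w : X d → V n) : Y d → ℝ :=
  fun y => Upsilon Φ₀ ψ χ θ y * innerX w ψ y

/-- `w + Υ(θ) ⟨w, ψ⟩_{L²_x} T_θ Φ₀'`. -/
noncomputable def coproj (Φ₀ ψ : ℝ → V n) (χ : ℝ → ℝ) (θ : Y d → ℝ) (w : X d → V n) : X d → V n :=
  fun q => w q + proj Φ₀ ψ χ θ w q.2 • translate θ (deriv Φ₀) q

namespace WaveData

variable (H : WaveData k Φ₀ ψ χ)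
include H

variable {θ θA θB : P → Y d → ℝ} {w wA wB : P → X d → V n}

theorem dom_proj (hK : K ≤ k) (hk : SobMul (dirY d) K)
    (hθ : Dom (fun p => sobNorm (dirY d) K (θ p)) fun _ => 1)
    (hw : ∀ p, sobNorm (dirX d) K (w p) < ⊤) :
    Dom (fun p => sobNorm (dirY d) K (proj Φ₀ ψ χ (θ p) (w p)))
      (fun p => sobNorm (dirX d) K (w p)) := by
  have h1 := dom_innerX (s := K) H.memLp hw
  exact (H.dom_Upsilon_mul hK hk hθ fun p => h1.lt_top (hw p)).trans h1

theorem dom_coproj (hK : K ≤ k) (hk : SobMul (dirY d) K)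
    (hθ : Dom (fun p => sobNorm (dirY d) K (θ p)) fun _ => 1)
    (hw : ∀ p, sobNorm (dirX d) K (w p) < ⊤) :
    Dom (fun p => sobNorm (dirX d) K (coproj Φ₀ ψ χ (θ p) (w p)))
      (fun p => sobNorm (dirX d) K (w p)) := by
  have h1 := H.dom_proj hK hk hθ hw
  refine dom_sobNorm_of_apply hw fun c => ?_
  simp only [coproj, PiLp.add_apply, PiLp.smul_apply, smul_eq_mul, H.translate_deriv_apply]
  refine dom_sobNorm_add (dom_sobNorm_apply hw c) ?_
  simp only [mul_comm (proj _ _ _ _ _ _)]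
  exact (dom_translate_mul hk hθ K le_rfl ((H.prof c).mono (by omega))
    fun p => h1.lt_top (hw p)).trans h1

/-- `proj` is bilinear in `Υ(θ)` and `w`, so its Lipschitz estimate has one term for each. -/
theorem dom_proj_sub (hK : K ≤ k) (hk : SobMul (dirY d) K)
    (hA : Dom (fun p => sobNorm (dirY d) K (θA p)) fun _ => 1)
    (hB : Dom (fun p => sobNorm (dirY d) K (θB p)) fun _ => 1)
    (hwA : ∀ p, sobNorm (dirX d) K (wA p) < ⊤) (hwB : ∀ p, sobNorm (dirX d) K (wB p) < ⊤)
    (hw : ∀ p, sobNorm (dirX d) K (fun q => wA p q - wB p q) < ⊤) :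
    Dom (fun p => sobNorm (dirY d) K fun y =>
        proj Φ₀ ψ χ (θA p) (wA p) y - proj Φ₀ ψ χ (θB p) (wB p) y)
      (fun p => sobNorm (dirX d) K (fun q => wA p q - wB p q) +
        sobNorm (dirY d) K (fun y => θA p y - θB p y) *
          (sobNorm (dirX d) K (wA p) + sobNorm (dirX d) K (wB p))) := by
  have h1 := dom_innerX (s := K) H.memLp hwA
  have h2 := dom_innerX_sub H.memLp (fun p c => memLp_apply (hwA p) c)
    (fun p c => memLp_apply (hwB p) c) hw
  have h3 := (H.dom_Upsilon_mul hK hk hB fun p => h2.lt_top (hw p)).trans h2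
  have h4 := (H.dom_Upsilon_sub_mul hK hk hA hB fun p => h1.lt_top (hwA p)).trans
    ((Dom.refl _).mul (h1.trans (Dom.of_le fun p =>
      (le_self_add : _ ≤ sobNorm (dirX d) K (wA p) + sobNorm (dirX d) K (wB p)))))
  refine (Dom.of_le fun p => le_of_eq ?_).trans (dom_sobNorm_add
    (h3.trans (Dom.of_le fun p => le_self_add)) (h4.trans (Dom.of_le fun p => le_add_self)))
  congr 1
  ext y
  simp only [proj]
  ring

theorem dom_coproj_sub (hK : K ≤ k) (hk : SobMul (dirY d) K)
    (hA : Dom (fun p => sobNorm (dirY d) K (θA p)) fun _ => 1)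
    (hB : Dom (fun p => sobNorm (dirY d) K (θB p)) fun _ => 1)
    (hwA : ∀ p, sobNorm (dirX d) K (wA p) < ⊤) (hwB : ∀ p, sobNorm (dirX d) K (wB p) < ⊤)
    (hw : ∀ p, sobNorm (dirX d) K (fun q => wA p q - wB p q) < ⊤) :
    Dom (fun p => sobNorm (dirX d) K fun q =>
        coproj Φ₀ ψ χ (θA p) (wA p) q - coproj Φ₀ ψ χ (θB p) (wB p) q)
      (fun p => sobNorm (dirX d) K (fun q => wA p q - wB p q) +
        sobNorm (dirY d) K (fun y => θA p y - θB p y) *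
          (sobNorm (dirX d) K (wA p) + sobNorm (dirX d) K (wB p))) := by
  have hδt : ∀ p, sobNorm (dirY d) K (fun y => θA p y - θB p y) < ⊤ := fun p =>
    sobNorm_sub_lt_top (hA.lt_top ENNReal.one_lt_top) (hB.lt_top ENNReal.one_lt_top)
  have hfin : ∀ p, sobNorm (dirX d) K (fun q => wA p q - wB p q) +
        sobNorm (dirY d) K (fun y => θA p y - θB p y) *
          (sobNorm (dirX d) K (wA p) + sobNorm (dirX d) K (wB p)) < ⊤ := fun p =>
    ENNReal.add_lt_top.2 ⟨hw p, ENNReal.mul_lt_top (hδt p) (ENNReal.add_lt_top.2 ⟨hwA p, hwB p⟩)⟩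
  have h1 := H.dom_proj hK hk hB hwB
  have h2 := H.dom_proj_sub hK hk hA hB hwA hwB hw
  refine dom_sobNorm_of_apply hfin fun c => ?_
  have e : ∀ p (q : X d), (coproj Φ₀ ψ χ (θA p) (wA p) q - coproj Φ₀ ψ χ (θB p) (wB p) q) c =
      (wA p q - wB p q) c + (deriv (waveComp Φ₀ c) (q.1 - θA p q.2) *
        (proj Φ₀ ψ χ (θA p) (wA p) q.2 - proj Φ₀ ψ χ (θB p) (wB p) q.2) +
        (deriv (waveComp Φ₀ c) (q.1 - θA p q.2) - deriv (waveComp Φ₀ c) (q.1 - θB p q.2)) *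
          proj Φ₀ ψ χ (θB p) (wB p) q.2) := fun p q => by
    simp only [coproj, PiLp.add_apply, PiLp.sub_apply, PiLp.smul_apply, smul_eq_mul,
      H.translate_deriv_apply]
    ring
  simp only [e]
  refine dom_sobNorm_add ((dom_sobNorm_apply hw c).trans (Dom.of_le fun p => le_self_add))
    (dom_sobNorm_add ?_ ?_)
  · exact (dom_translate_mul hk hA K le_rfl ((H.prof c).mono (by omega))
      fun p => h2.lt_top (hfin p)).trans h2
  · exact ((dom_translate_sub_mul hk hA hB K le_rfl ((H.prof c).mono (by omega))
      fun p => h1.lt_top (hwB p)).trans ((Dom.refl _).mul (h1.trans (Dom.of_le fun p =>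
        (le_add_self : _ ≤ sobNorm (dirX d) K (wA p) + sobNorm (dirX d) K (wB p)))))).trans
      (Dom.of_le fun p => le_add_self)

end WaveData

end Projection

end PlanarWave

namespace PlanarWave

open scoped NNReal Topology
open Filter

/-! ### Square summable families -/

section SquareSummable

variable {ι P : Type*}

/-- The `ℓ²` norm of a family. -/
noncomputable def l2 (a : ι → ℝ≥0∞) : ℝ≥0∞ := (∑' j, a j ^ 2) ^ (1 / 2 : ℝ)

theorem l2_sq (a : ι → ℝ≥0∞) : l2 a ^ 2 = ∑' j, a j ^ 2 := by
  rw [l2, ← ENNReal.rpow_natCast, ← ENNReal.rpow_mul]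
  norm_num

theorem l2_le_of_sq_le {a : ι → ℝ≥0∞} {C : ℝ≥0∞} (h : ∑' j, a j ^ 2 ≤ C ^ 2) : l2 a ≤ C :=
  (ENNReal.pow_le_pow_left_iff two_ne_zero).1 (by rwa [l2_sq])

theorem le_l2 (a : ι → ℝ≥0∞) (j : ι) : a j ≤ l2 a :=
  (ENNReal.pow_le_pow_left_iff two_ne_zero).1 (by
    rw [l2_sq]; exact ENNReal.le_tsum (f := fun j => a j ^ 2) j)

theorem l2_mono {a a' : ι → ℝ≥0∞} (h : ∀ j, a j ≤ a' j) : l2 a ≤ l2 a' :=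
  l2_le_of_sq_le (by
    rw [l2_sq]; exact ENNReal.tsum_le_tsum fun j => pow_le_pow_left₀ zero_le (h j) 2)

theorem l2_const_mul (C : ℝ≥0∞) (a : ι → ℝ≥0∞) : l2 (fun j => C * a j) ≤ C * l2 a :=
  l2_le_of_sq_le (by simp_rw [mul_pow]; rw [ENNReal.tsum_mul_left, l2_sq])

/-- The factor `2` replaces the Minkowski inequality by the elementary `(a + b)² ≤ 2 (a² + b²)`. -/
theorem l2_add_le (a a' : ι → ℝ≥0∞) : l2 (fun j => a j + a' j) ≤ 2 * (l2 a + l2 a') := by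
  refine l2_le_of_sq_le ?_
  have h1 : ∑' j, (a j + a' j) ^ 2 ≤ 2 * l2 a ^ 2 + 2 * l2 a' ^ 2 := by
    rw [l2_sq, l2_sq, ← ENNReal.tsum_mul_left, ← ENNReal.tsum_mul_left, ← ENNReal.tsum_add]
    refine ENNReal.tsum_le_tsum fun j => ?_
    exact (add_sq_le_two_mul _ _).trans (le_of_eq (by ring))
  refine h1.trans ?_
  calc 2 * l2 a ^ 2 + 2 * l2 a' ^ 2 ≤ 4 * (l2 a ^ 2 + l2 a' ^ 2 + 2 * l2 a * l2 a') := by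
        rw [← mul_add]
        exact mul_le_mul' (by norm_num) le_self_add
    _ = _ := by ring

theorem tsum_mul_le_l2 (a a' : ι → ℝ≥0∞) : ∑' j, a j * a' j ≤ l2 a * l2 a' := by
  let _ : MeasurableSpace ι := ⊤
  have _ : MeasurableSingletonClass ι := ⟨fun _ => trivial⟩
  refine (ENNReal.pow_le_pow_left_iff two_ne_zero).1 ?_
  rw [mul_pow, l2_sq, l2_sq]
  have := lintegral_mul_sq_le (μ := Measure.count) (f := a) (g := a')
    (measurable_from_top).aemeasurable (measurable_from_top).aemeasurable
  simpa only [lintegral_count] using this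

/-- A pointwise estimate with a common constant passes to `ℓ²` norms. -/
theorem Dom.l2 {a a' : P → ι → ℝ≥0∞}
    (h : Dom (fun x : P × ι => a x.1 x.2) (fun x => a' x.1 x.2)) :
    Dom (fun p => PlanarWave.l2 (a p)) (fun p => PlanarWave.l2 (a' p)) := by
  obtain ⟨C, hC⟩ := h
  exact ⟨C, fun p => (l2_mono fun j => hC (p, j)).trans (l2_const_mul _ _)⟩

theorem Dom.l2_add {a a' : P → ι → ℝ≥0∞} {B : P → ℝ≥0∞} (h : Dom (fun p => PlanarWave.l2 (a p)) B)
    (h' : Dom (fun p => PlanarWave.l2 (a' p)) B) :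
    Dom (fun p => PlanarWave.l2 fun j => a p j + a' p j) B :=
  Dom.trans ⟨2, fun p => by exact_mod_cast l2_add_le (a p) (a' p)⟩ (h.add h')

theorem Dom.l2_const_mul {a : P → ι → ℝ≥0∞} {B B' : P → ℝ≥0∞} (h : Dom (fun p => PlanarWave.l2 (a p)) B) :
    Dom (fun p => PlanarWave.l2 fun j => B' p * a p j) fun p => B' p * B p :=
  (Dom.of_le fun p => PlanarWave.l2_const_mul (B' p) (a p)).trans ((Dom.refl B').mul h)

theorem lt_top_of_dom_l2 {a : P → ι → ℝ≥0∞} (h : Dom (fun p => l2 (a p)) fun _ => 1) (p : P)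
    (j : ι) : a p j < ⊤ :=
  (le_l2 (a p) j).trans_lt (h.lt_top ENNReal.one_lt_top)

theorem l2_le_twoSummingNorm {W Z : Type*} [NormedAddCommGroup W] [InnerProductSpace ℝ W]
    (S : W →L[ℝ] W) (nrm : Z → ℝ≥0∞) (B : W → Z) (b : HilbertBasis ι ℝ W) :
    l2 (fun j => nrm (B (S (b j)))) ≤ twoSummingNorm ι S nrm B :=
  le_iSup (fun b : HilbertBasis ι ℝ W => l2 fun j => nrm (B (S (b j)))) b

theorem dom_twoSummingNorm {W Z : Type*} [NormedAddCommGroup W] [InnerProductSpace ℝ W]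
    {S : W →L[ℝ] W} {nrm : Z → ℝ≥0∞} {B : P → W → Z} {D : P → ℝ≥0∞}
    (h : Dom (fun x : P × HilbertBasis ι ℝ W => l2 fun j => nrm (B x.1 (S (x.2 j))))
      fun x => D x.1) :
    Dom (fun p => twoSummingNorm ι S nrm (B p)) D := by
  obtain ⟨C, hC⟩ := h
  exact ⟨C, fun p => iSup_le fun b => hC (p, b)⟩

end SquareSummable

/-! ### Shifts -/

section Shift

variable {κ E F : Type*} [Fintype κ] [NormedAddCommGroup E] [NormedSpace ℝ E]
  [FiniteDimensional ℝ E] [MeasureSpace E] [BorelSpace E] [(volume : Measure E).IsAddHaarMeasure]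
  [NormedAddCommGroup F] [NormedSpace ℝ F]

/-- Translation invariance of weak derivatives. -/
theorem IsWeakDeriv.comp_sub {b : κ → E} {j : ℕ} {w : Fin j → κ} {u u' : E → F}
    (h : IsWeakDeriv b w u u') (a : E) :
    IsWeakDeriv b w (fun x => u (x - a)) (fun x => u' (x - a)) := by
  have hmp := measurePreserving_sub_right (volume : Measure E) a
  have hL : ∀ {u : E → F}, LocallyIntegrable u volume →
      LocallyIntegrable (fun x => u (x - a)) volume := fun hu x => by
    obtain ⟨s, hs, hi⟩ := hu (x - a)
    refine ⟨(fun x => x - a) ⁻¹' s, ?_, ?_⟩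
    · exact (continuous_id.sub continuous_const).continuousAt.preimage_mem_nhds hs
    · exact (hmp.integrableOn_comp_preimage (measurableEmbedding_subRight a)).2 hi
  refine ⟨hL h.1, hL h.2.1, fun φ hφ hc => ?_⟩
  have hφa : ContDiff ℝ ∞ fun x => φ (x + a) := hφ.comp (contDiff_id.add contDiff_const)
  have hca : HasCompactSupport fun x => φ (x + a) := hc.comp_homeomorph (Homeomorph.addRight a)
  have := h.2.2 _ hφa hca
  simp only [iteratedFDeriv_comp_add_right] at this
  rw [← integral_sub_right_eq_self (fun x => (iteratedFDeriv ℝ j φ (x + a) fun i => b (w i)) • u x) a,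
    ← integral_sub_right_eq_self (fun x => φ (x + a) • u' x) a] at this
  simpa only [sub_add_cancel] using this

theorem sobNorm_comp_sub (b : κ → E) (s : ℕ) (u : E → F) (a : E) :
    sobNorm b s (fun x => u (x - a)) = sobNorm b s u := by
  have hle : ∀ (u : E → F) (a : E), sobNorm b s (fun x => u (x - a)) ≤ sobNorm b s u := by
    intro u a
    refine le_iInf₂ fun D hD => (iInf₂_le (fun j w x => D j w (x - a))
      fun j hj w => (hD j hj w).comp_sub a).trans (le_of_eq ?_)
    congr 1
    refine Finset.sum_congr rfl fun j hj => Finset.sum_congr rfl fun w _ => ?_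
    congr 1
    exact eLpNorm_comp_measurePreserving
      (hD j (by simpa [Nat.lt_succ_iff] using hj) w).2.1.aestronglyMeasurable
      (measurePreserving_sub_right volume a)
  refine le_antisymm (hle u a) ?_
  have := hle (fun x => u (x - a)) (-a)
  simpa using this

variable {d : ℕ}

theorem shift_eq (γ : ℝ) (u : X d → F) : shift γ u = fun p => u (p - (γ, 0)) := by
  ext p
  simp [shift, Prod.sub_def]

theorem sobNorm_shift (s : ℕ) (γ : ℝ) (u : X d → F) :
    sobNorm (dirX d) s (shift γ u) = sobNorm (dirX d) s u := by
  rw [shift_eq]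
  exact sobNorm_comp_sub _ _ _ _

theorem measurePreserving_shift (γ : ℝ) :
    MeasurePreserving (fun p : X d => (p.1 - γ, p.2)) volume volume := by
  have := measurePreserving_sub_right (volume : Measure (X d)) (γ, 0)
  simpa [Prod.sub_def] using this

end Shift

/-! ### The noise coefficient -/

section Noise

variable {d n : ℕ} {ι W : Type*} [NormedAddCommGroup W] [InnerProductSpace ℝ W]

theorem coe_cls {E F : Type*} [MeasureSpace E] [TopologicalSpace F] [Zero F] {u : E → F}
    (hu : AEStronglyMeasurable u volume) : ⇑(cls u) =ᵐ[volume] u := by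
  rw [cls, dif_pos hu]
  exact AEEqFun.coeFn_mk u hu

theorem cls_congr {E F : Type*} [MeasureSpace E] [TopologicalSpace F] [Zero F] {u v : E → F}
    (h : u =ᵐ[volume] v) : cls u = cls v := by
  by_cases hu : AEStronglyMeasurable u volume
  · rw [cls, cls, dif_pos hu, dif_pos (hu.congr h)]
    exact AEEqFun.mk_eq_mk.2 h
  · rw [cls, cls, dif_neg hu, dif_neg fun hv => hu (hv.congr h.symm)]

/-- The perturbation `v + T_θ Φ₀ - Φ₀` of the planar wave. -/
def perturbation (Φ₀ : ℝ → V n) (v : X d → V n) (θ : Y d → ℝ) (q : X d) : V n :=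
  v q + (translate θ Φ₀ q - Φ₀ q.1)

/-- The state `v + T_θ Φ₀` is the unshifted wave plus an element of `H^k`, which is the form of the
states in the hypotheses on `g`. -/
theorem stateCls_eq (Φ₀ : ℝ → V n) (v : X d → V n) (θ : Y d → ℝ) :
    stateCls Φ₀ v θ = waveCls Φ₀ 0 (perturbation Φ₀ v θ) := by
  rw [stateCls, waveCls]
  congr 1
  ext q c
  simp [perturbation]
  ring

theorem cls_shift_waveCls {Φ₀ : ℝ → V n} (hΦ : Continuous Φ₀) {w : X d → V n}
    (hw : AEStronglyMeasurable w volume) (γ : ℝ) :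
    cls (shift γ (waveCls Φ₀ 0 w)) = waveCls Φ₀ γ (shift γ w) := by
  have hm : AEStronglyMeasurable (fun p : X d => Φ₀ (p.1 - 0) + w p) volume :=
    (hΦ.comp (continuous_fst.sub continuous_const)).aestronglyMeasurable.add hw
  have h1 := (measurePreserving_shift (d := d) γ).quasiMeasurePreserving.ae_eq_comp (coe_cls hm)
  rw [waveCls, waveCls]
  refine cls_congr (h1.trans (.of_forall fun p => ?_))
  simp [shift, Function.comp]

variable {S : W →L[ℝ] W} {T : ℝ → W →L[ℝ] W} {g : (X d →ₘ[volume] V n) → W →ₗ[ℝ] (X d →ₘ[volume] V n)}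
  {Φ₀ : ℝ → V n} {K : ℕ}

/-- The shift of the noise coefficient in the frame of the wave is the noise coefficient at the
shifted state. -/
theorem shift_noise_ae_eq (hg : HypG ι K Φ₀ S T g) (hT : IsShiftGroup T) (hΦ : Continuous Φ₀)
    {v : X d → V n} {θ : Y d → ℝ} (hw : sobNorm (dirX d) K (perturbation Φ₀ v θ) < ⊤) (γ : ℝ) (η : W) :
    shift γ (g (stateCls Φ₀ v θ) (T (-γ) (S η))) =ᵐ[volume]
      g (waveCls Φ₀ γ (shift γ (perturbation Φ₀ v θ))) (S η) := by
  have h1 := hg.comm (perturbation Φ₀ v θ) hw γ (-γ) η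
  -- The commutation relation is applied to `T_{-γ} S η`, so that the shifts of the noise cancel.
  have h2 : T γ (T (-γ) (S η)) = S η := by
    rw [← ContinuousLinearMap.comp_apply, ← hT.add, add_neg_cancel, hT.zero]
    rfl
  have hwm : AEStronglyMeasurable (perturbation Φ₀ v θ) volume :=
    (locallyIntegrable_of_sobNorm_lt_top hw).aestronglyMeasurable
  rw [h2, cls_shift_waveCls hΦ hwm γ, ← stateCls_eq] at h1
  rw [← h1]
  refine (coe_cls ?_).symm
  exact (AEEqFun.aestronglyMeasurable _).comp_measurePreserving (measurePreserving_shift γ)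

variable {k : ℕ} {P : Type*} {ψ : ℝ → V n} {χ : ℝ → ℝ} {v vA vB : P → X d → V n}
  {θ θA θB : P → Y d → ℝ} {γ : P → ℝ}

/-- The perturbation depends on `(v, θ)` in a Lipschitz way. -/
theorem WaveData.dom_perturbation_sub (H : WaveData k Φ₀ ψ χ) (hK : K ≤ k) (hk : SobMul (dirY d) K)
    (hvA : Dom (fun p => sobNorm (dirX d) K (vA p)) fun _ => 1)
    (hvB : Dom (fun p => sobNorm (dirX d) K (vB p)) fun _ => 1)
    (hA : Dom (fun p => sobNorm (dirY d) K (θA p)) fun _ => 1)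
    (hB : Dom (fun p => sobNorm (dirY d) K (θB p)) fun _ => 1) :
    Dom (fun p => sobNorm (dirX d) K fun q =>
        perturbation Φ₀ (vA p) (θA p) q - perturbation Φ₀ (vB p) (θB p) q)
      (fun p => sobNorm (dirX d) K (fun q => vA p q - vB p q) +
        sobNorm (dirY d) K (fun y => θA p y - θB p y)) := by
  have hv : ∀ p, sobNorm (dirX d) K (fun q => vA p q - vB p q) < ⊤ := fun p =>
    sobNorm_vec_sub_lt_top (hvA.lt_top ENNReal.one_lt_top) (hvB.lt_top ENNReal.one_lt_top)
  refine dom_sobNorm_of_apply (fun p => ENNReal.add_lt_top.2 ⟨hv p,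
    sobNorm_sub_lt_top (hA.lt_top ENNReal.one_lt_top) (hB.lt_top ENNReal.one_lt_top)⟩) fun c => ?_
  have e : ∀ p (q : X d), (perturbation Φ₀ (vA p) (θA p) q - perturbation Φ₀ (vB p) (θB p) q) c =
      (vA p q - vB p q) c + (waveComp Φ₀ c (q.1 - θA p q.2) - waveComp Φ₀ c (q.1 - θB p q.2)) :=
    fun p q => by
      simp only [perturbation, translate, waveComp, PiLp.add_apply, PiLp.sub_apply]
      ring
  simp only [e]
  refine dom_sobNorm_add ((dom_sobNorm_apply hv c).trans (Dom.of_le fun p => le_self_add)) ?_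
  exact (dom_translate_sub hk hA hB K le_rfl (H.contDiff_waveComp c) (H.bdd c)
    ((H.prof c).mono (by omega))).trans (Dom.of_le fun p => le_add_self)

theorem WaveData.dom_perturbation (H : WaveData k Φ₀ ψ χ) (hK : K ≤ k) (hk : SobMul (dirY d) K)
    (hv : Dom (fun p => sobNorm (dirX d) K (v p)) fun _ => 1)
    (hθ : Dom (fun p => sobNorm (dirY d) K (θ p)) fun _ => 1) :
    Dom (fun p => sobNorm (dirX d) K (perturbation Φ₀ (v p) (θ p))) fun _ => 1 := by
  have h0 : Dom (fun _ : P => sobNorm (dirX d) K fun _ => (0 : V n)) fun _ => 1 :=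
    ⟨0, fun p => by simp [sobNorm_zero_fun]⟩
  have h1 := H.dom_perturbation_sub hK hk hv h0 hθ (H.dom_zero (P := P) (d := d))
  have e : ∀ p, (fun q : X d => perturbation Φ₀ (v p) (θ p) q -
      perturbation Φ₀ (fun _ => 0) (fun _ => 0) q) = perturbation Φ₀ (v p) (θ p) := fun p => by
    ext q c; simp [perturbation, translate]
  simp only [e, sub_zero] at h1
  exact h1.trans (hv.add hθ)

/-- Uniform Hilbert–Schmidt bound for the noise coefficient in the frame of the wave. -/
theorem dom_noise (hg : HypG ι K Φ₀ S T g) (hT : IsShiftGroup T) (hΦ : Continuous Φ₀)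
    (hw : Dom (fun p => sobNorm (dirX d) K (perturbation Φ₀ (v p) (θ p))) fun _ => 1) :
    Dom (fun x : P × HilbertBasis ι ℝ W => l2 fun j => sobNorm (dirX d) K
      (g (stateCls Φ₀ (v x.1) (θ x.1)) (T (-γ x.1) (S (x.2 j))))) fun _ => 1 := by
  have hwt : ∀ p, sobNorm (dirX d) K (perturbation Φ₀ (v p) (θ p)) < ⊤ := fun p =>
    hw.lt_top ENNReal.one_lt_top
  obtain ⟨C, hC⟩ := hw
  obtain ⟨D, hD, hb⟩ := hg.bounds (C + 1) (by positivity)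
  refine ⟨D.toNNReal, fun x => ?_⟩
  have hN : normHk K (shift (γ x.1) (perturbation Φ₀ (v x.1) (θ x.1))) ≤ ENNReal.ofReal (C + 1) := by
    rw [normHk, sobNorm_shift]
    refine (hC x.1).trans ?_
    rw [mul_one, ENNReal.ofReal_add (by positivity) zero_le_one, ENNReal.ofReal_coe_nnreal]
    exact le_self_add
  have h1 := (hb (γ x.1) _ _ hN hN).1
  rw [mul_one]
  refine (l2_mono fun j => ?_).trans ((l2_le_twoSummingNorm S (normHk K) _ x.2).trans h1)
  rw [← sobNorm_shift K (γ x.1), sobNorm_congr (shift_noise_ae_eq hg hT hΦ (hwt x.1) _ _), normHk]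

/-- The noise coefficient in the frame of the wave is Lipschitz in the perturbation, in the
Hilbert–Schmidt norm and uniformly over the bases. -/
theorem dom_noise_sub (hg : HypG ι K Φ₀ S T g) (hT : IsShiftGroup T) (hΦ : Continuous Φ₀)
    (hwA : Dom (fun p => sobNorm (dirX d) K (perturbation Φ₀ (vA p) (θA p))) fun _ => 1)
    (hwB : Dom (fun p => sobNorm (dirX d) K (perturbation Φ₀ (vB p) (θB p))) fun _ => 1) :
    Dom (fun x : P × HilbertBasis ι ℝ W => l2 fun j => sobNorm (dirX d) K fun q =>
        g (stateCls Φ₀ (vA x.1) (θA x.1)) (T (-γ x.1) (S (x.2 j))) q -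
          g (stateCls Φ₀ (vB x.1) (θB x.1)) (T (-γ x.1) (S (x.2 j))) q)
      fun x => sobNorm (dirX d) K fun q =>
        perturbation Φ₀ (vA x.1) (θA x.1) q - perturbation Φ₀ (vB x.1) (θB x.1) q := by
  have hwAt : ∀ p, sobNorm (dirX d) K (perturbation Φ₀ (vA p) (θA p)) < ⊤ := fun p =>
    hwA.lt_top ENNReal.one_lt_top
  have hwBt : ∀ p, sobNorm (dirX d) K (perturbation Φ₀ (vB p) (θB p)) < ⊤ := fun p =>
    hwB.lt_top ENNReal.one_lt_top
  obtain ⟨C, hC⟩ := hwA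
  obtain ⟨C', hC'⟩ := hwB
  obtain ⟨D, hD, hb⟩ := hg.bounds (C + C' + 1) (by positivity)
  refine ⟨D.toNNReal, fun x => ?_⟩
  have hN : normHk K (shift (γ x.1) (perturbation Φ₀ (vA x.1) (θA x.1))) ≤
      ENNReal.ofReal (C + C' + 1) := by
    rw [normHk, sobNorm_shift]
    refine (hC x.1).trans ?_
    rw [mul_one, ← ENNReal.ofReal_coe_nnreal]
    exact ENNReal.ofReal_le_ofReal (by linarith [C'.2])
  have hN' : normHk K (shift (γ x.1) (perturbation Φ₀ (vB x.1) (θB x.1))) ≤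
      ENNReal.ofReal (C + C' + 1) := by
    rw [normHk, sobNorm_shift]
    refine (hC' x.1).trans ?_
    rw [mul_one, ← ENNReal.ofReal_coe_nnreal]
    exact ENNReal.ofReal_le_ofReal (by linarith [C.2])
  have h1 := (hb (γ x.1) _ _ hN hN').2
  have h2 : normHk K (shift (γ x.1) (perturbation Φ₀ (vA x.1) (θA x.1)) -
      shift (γ x.1) (perturbation Φ₀ (vB x.1) (θB x.1))) = sobNorm (dirX d) K fun q =>
        perturbation Φ₀ (vA x.1) (θA x.1) q - perturbation Φ₀ (vB x.1) (θB x.1) q := by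
    rw [← sobNorm_shift K (γ x.1)]
    rfl
  rw [h2] at h1
  refine (l2_mono fun j => ?_).trans ((l2_le_twoSummingNorm S (normHk K) _ x.2).trans h1)
  rw [← sobNorm_shift K (γ x.1), normHk]
  refine le_of_eq (sobNorm_congr ?_)
  filter_upwards [shift_noise_ae_eq hg hT hΦ (hwAt x.1) (γ x.1) (x.2 j),
    shift_noise_ae_eq hg hT hΦ (hwBt x.1) (γ x.1) (x.2 j)] with p hp hp'
  rw [← hp, ← hp']
  rfl

/-- `L¹_y` bound for `proj`, from `|Υ| ≤ 4` and Fubini. -/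
theorem normL1_proj_le (hχ : IsCutoff χ) {θ : Y d → ℝ} {w : X d → V n}
    (hw : AEStronglyMeasurable (fun q : X d => ⟪w q, ψ q.1⟫) volume) :
    normL1 (proj Φ₀ ψ χ θ w) ≤ 4 * normL1 fun q : X d => ⟪w q, ψ q.1⟫ := by
  rw [normL1, normL1, eLpNorm_one_eq_lintegral_enorm, eLpNorm_one_eq_lintegral_enorm]
  rw [Measure.volume_eq_prod] at hw ⊢
  rw [lintegral_prod_symm _ hw.enorm, ← lintegral_const_mul' _ _ (by norm_num)]
  refine lintegral_mono fun y => ?_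
  rw [proj, enorm_mul]
  refine mul_le_mul' ?_ (enorm_integral_le_lintegral_enorm _)
  rw [← ofReal_norm, Real.norm_eq_abs, ← ENNReal.ofReal_ofNat]
  exact ENNReal.ofReal_le_ofReal (abs_Upsilon_le hχ θ y)

theorem aestronglyMeasurable_inner_comp_fst (hψ : ∀ c, MemLp (fun x => ψ x c) 2 volume)
    {w : X d → V n} (hw : ∀ c, AEStronglyMeasurable (fun q => w q c) volume) :
    AEStronglyMeasurable (fun q : X d => ⟪w q, ψ q.1⟫) volume := by
  simp only [inner_eq_sum]
  refine Finset.aestronglyMeasurable_fun_sum _ fun c _ => (hw c).mul ?_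
  rw [Measure.volume_eq_prod]
  exact (hψ c).1.comp_fst

/-- The `L¹` hypothesis in the frame of the wave. -/
theorem dom_noise_L1 (hg : HypG ι K Φ₀ S T g) (hL : HypL1 ι K Φ₀ ψ S g) (hT : IsShiftGroup T)
    (hΦ : Continuous Φ₀) (hψ : ∀ c, MemLp (fun x => ψ x c) 2 volume)
    (hw : Dom (fun p => sobNorm (dirX d) K (perturbation Φ₀ (v p) (θ p))) fun _ => 1) :
    Dom (fun x : P × HilbertBasis ι ℝ W => l2 fun j => normL1 fun q : X d =>
      ⟪g (stateCls Φ₀ (v x.1) (θ x.1)) (T (-γ x.1) (S (x.2 j))) q, ψ q.1⟫) fun _ => 1 := by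
  have hwt : ∀ p, sobNorm (dirX d) K (perturbation Φ₀ (v p) (θ p)) < ⊤ := fun p =>
    hw.lt_top ENNReal.one_lt_top
  obtain ⟨C, hC⟩ := hw
  obtain ⟨D, hD, hb⟩ := hL (C + 1) (by positivity)
  refine ⟨(1 + D).toNNReal, fun x => ?_⟩
  have hN : normHk K (shift (γ x.1) (perturbation Φ₀ (v x.1) (θ x.1))) ≤ ENNReal.ofReal (C + 1) := by
    rw [normHk, sobNorm_shift]
    refine (hC x.1).trans ?_
    rw [mul_one, ENNReal.ofReal_add (by positivity) zero_le_one, ENNReal.ofReal_coe_nnreal]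
    exact le_self_add
  have h1 := hb (γ x.1) _ hN
  have h2 : ENNReal.ofReal D ≤ (((1 + D).toNNReal : ℝ≥0) : ℝ≥0∞) ^ 2 := by
    change _ ≤ ENNReal.ofReal (1 + D) ^ 2
    rw [← ENNReal.ofReal_pow (by positivity)]
    exact ENNReal.ofReal_le_ofReal (by nlinarith)
  have h3 := (ENNReal.pow_le_pow_left_iff two_ne_zero).1 (h1.trans h2)
  rw [mul_one]
  refine (l2_mono fun j => ?_).trans ((l2_le_twoSummingNorm S normL1 _ x.2).trans h3)
  have hm : AEStronglyMeasurable (fun q : X d =>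
      ⟪g (stateCls Φ₀ (v x.1) (θ x.1)) (T (-γ x.1) (S (x.2 j))) q, ψ q.1⟫) volume :=
    aestronglyMeasurable_inner_comp_fst hψ fun c =>
      (EuclideanSpace.proj c : V n →L[ℝ] ℝ).continuous.comp_aestronglyMeasurable
        (AEEqFun.aestronglyMeasurable _)
  rw [normL1, normL1, ← eLpNorm_comp_measurePreserving hm (measurePreserving_shift (γ x.1))]
  refine le_of_eq (eLpNorm_congr_ae ?_)
  filter_upwards [shift_noise_ae_eq hg hT hΦ (hwt x.1) (γ x.1) (x.2 j)] with p hp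
  rw [← hp]
  rfl

end Noise

end PlanarWave

namespace PlanarWave

open scoped NNReal Topology
open Filter

/-! ### Sums of squares, and the coefficient of `T_θ Φ₀''` in the drift -/

section SumsOfSquares

variable {κ E P ι : Type*} [Fintype κ] [NormedAddCommGroup E] [NormedSpace ℝ E]
  [FiniteDimensional ℝ E] [MeasureSpace E] [BorelSpace E] [(volume : Measure E).IsAddHaarMeasure]
  [Countable ι] {b : κ → E} {K : ℕ}

theorem dom_sobNorm_const_mul {c : P → ℝ} {u : P → E → ℝ} (hu : ∀ p, sobNorm b K (u p) < ⊤) :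
    Dom (fun p => sobNorm b K fun x => c p * u p x) fun p => ‖c p‖ₑ * sobNorm b K (u p) := by
  obtain ⟨C, hC⟩ := exists_sobNorm_clm_le (F := ℝ) (F' := ℝ) b K
  refine ⟨C, fun p => (hC (c p • ContinuousLinearMap.id ℝ ℝ) (u p) (hu p)).trans ?_⟩
  have h1 : ‖ContinuousLinearMap.id ℝ ℝ‖ₑ ≤ 1 := by
    rw [← ofReal_norm, ← ENNReal.ofReal_one]
    exact ENNReal.ofReal_le_ofReal ContinuousLinearMap.norm_id_le
  rw [enorm_smul]
  exact mul_le_mul_right (mul_le_mul_left ((mul_le_mul_right h1 _).trans (mul_one _).le) _) _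

theorem dom_tsum_sobNorm_mul (hk : SobMul b K) {a a' : P → ι → E → ℝ} {A A' : P → ℝ≥0∞}
    (hA : ∀ p, A p < ⊤) (hA' : ∀ p, A' p < ⊤)
    (h : Dom (fun p => l2 fun j => sobNorm b K (a p j)) A)
    (h' : Dom (fun p => l2 fun j => sobNorm b K (a' p j)) A') :
    Dom (fun p => ∑' j, sobNorm b K fun x => a p j x * a' p j x) fun p => A p * A' p := by
  obtain ⟨C, hC⟩ := hk.dom_mul (P := P × ι) (s := K) le_rfl le_rfl le_rfl
    (p := fun x => a x.1 x.2) (q := fun x => a' x.1 x.2)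
    (fun x => (le_l2 _ x.2).trans_lt (h.lt_top (hA x.1)))
    (fun x => (le_l2 _ x.2).trans_lt (h'.lt_top (hA' x.1)))
  refine Dom.trans ⟨C, fun p => ?_⟩ (h.mul h')
  refine (ENNReal.tsum_le_tsum fun j => hC (p, j)).trans ?_
  rw [ENNReal.tsum_mul_left]
  exact mul_le_mul_right (tsum_mul_le_l2 _ _) _

/-- For square summable families in `H^K`, an algebra, `∑_j a_j a'_j` converges in `H^K` by the
Cauchy–Schwarz inequality. -/
theorem dom_sobNorm_tsum_mul (hk : SobMul b K) {a a' : P → ι → E → ℝ} {A A' : P → ℝ≥0∞}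
    (hA : ∀ p, A p < ⊤) (hA' : ∀ p, A' p < ⊤)
    (h : Dom (fun p => l2 fun j => sobNorm b K (a p j)) A)
    (h' : Dom (fun p => l2 fun j => sobNorm b K (a' p j)) A') :
    Dom (fun p => sobNorm b K fun x => ∑' j, a p j x * a' p j x) fun p => A p * A' p := by
  have h1 := dom_tsum_sobNorm_mul hk hA hA' h h'
  obtain ⟨C, hC⟩ := exists_sobNorm_tsum_le (ι := ι) b K
  exact Dom.trans ⟨C, fun p => hC _ (h1.lt_top (ENNReal.mul_lt_top (hA p) (hA' p)))⟩ h1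

theorem dom_sobNorm_tsum_sq (hk : SobMul b K) {a : P → ι → E → ℝ}
    (h : Dom (fun p => l2 fun j => sobNorm b K (a p j)) fun _ => 1) :
    Dom (fun p => sobNorm b K fun x => ∑' j, a p j x ^ 2) fun _ => 1 := by
  simpa only [sq, mul_one] using dom_sobNorm_tsum_mul hk (fun _ => ENNReal.one_lt_top)
    (fun _ => ENNReal.one_lt_top) h h

theorem ae_summable_sq (hk : SobMul b K) {a : ι → E → ℝ}
    (h : l2 (fun j => sobNorm b K (a j)) < ⊤) : ∀ᵐ x, Summable fun j => a j x ^ 2 := by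
  have hj : ∀ j, sobNorm b K (a j) < ⊤ := fun j => (le_l2 _ j).trans_lt h
  have hm : ∀ j, AEStronglyMeasurable (a j) volume := fun j => (memLp_of_sobNorm_lt_top (hj j)).1
  have h1 := dom_tsum_sobNorm_mul (P := Unit) hk (fun _ => h) (fun _ => h)
    (Dom.refl fun _ => l2 fun j => sobNorm b K (a j)) (Dom.refl _)
  simp only [sq]
  refine ae_summable_of_tsum_eLpNorm_two (fun j => (hm j).mul (hm j)) ?_
  exact (ENNReal.tsum_le_tsum fun j => eLpNorm_le_sobNorm b K _).trans_lt
    (h1.lt_top (p := ()) (ENNReal.mul_lt_top h h))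

/-- Lipschitz estimate for the sum of squares, from `a² - b² = (a - b) (a + b)`. -/
theorem dom_sobNorm_tsum_sq_sub (hk : SobMul b K) {aA aB : P → ι → E → ℝ} {D : P → ℝ≥0∞}
    (hD : ∀ p, D p < ⊤) (hA : Dom (fun p => l2 fun j => sobNorm b K (aA p j)) fun _ => 1)
    (hB : Dom (fun p => l2 fun j => sobNorm b K (aB p j)) fun _ => 1)
    (h : Dom (fun p => l2 fun j => sobNorm b K fun x => aA p j x - aB p j x) D) :
    Dom (fun p => sobNorm b K fun x => (∑' j, aA p j x ^ 2) - ∑' j, aB p j x ^ 2) D := by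
  have hs : Dom (fun p => l2 fun j => sobNorm b K fun x => aA p j x + aB p j x) fun _ => 1 := by
    obtain ⟨C, hC⟩ := exists_sobNorm_add_le (F := ℝ) b K
    refine Dom.trans (Dom.l2 ⟨C, fun x => ?_⟩) (Dom.l2_add hA hB)
    exact hC (aA x.1 x.2) (aB x.1 x.2)
  have h1 := dom_sobNorm_tsum_mul hk hD (fun _ => ENNReal.one_lt_top) h hs
  simp only [mul_one] at h1
  -- Almost everywhere both series converge, so their difference is the series of the differences
  -- and no value of a divergent sum enters.
  refine (Dom.of_le fun p => le_of_eq (sobNorm_congr ?_)).trans h1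
  filter_upwards [ae_summable_sq hk (hA.lt_top (p := p) ENNReal.one_lt_top),
    ae_summable_sq hk (hB.lt_top (p := p) ENNReal.one_lt_top)] with x hx hx'
  rw [← hx.tsum_sub hx']
  exact tsum_congr fun j => by ring

theorem eLpNorm_one_tsum_sq_le {a : ι → E → ℝ} (hm : ∀ j, AEStronglyMeasurable (a j) volume) :
    eLpNorm (fun x => ∑' j, a j x ^ 2) 1 volume ≤ l2 (fun j => eLpNorm (a j) 2 volume) ^ 2 := by
  rw [eLpNorm_one_eq_lintegral_enorm, l2_sq]
  refine (lintegral_mono fun x => enorm_tsum_le_tsum_enorm).trans ?_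
  simp only [enorm_pow]
  rw [lintegral_tsum fun j => (hm j).enorm.pow_const 2]
  exact ENNReal.tsum_le_tsum fun j => (lintegral_sq_eq_eLpNorm _).le

end SumsOfSquares

section Gradient

variable {d K : ℕ} {P : Type*} {θ θA θB : P → Y d → ℝ}

/-- For `θ` in a Sobolev space of positive order the weak partial derivatives exist, so `gradY` is
the weak gradient. -/
theorem wd_weakPartial {θ : Y d → ℝ} (h : sobNorm (dirY d) (K + 1) θ < ⊤) (l : Fin (d - 1)) :
    WD (dirY d) l θ (weakPartial (dirY d) l θ) := by
  have h' : ∃ u', IsWeakDeriv (dirY d) (fun _ : Fin 1 => l) θ u' := exists_wd_of_sobNorm_lt_top h l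
  rw [weakPartial, dif_pos h']
  exact h'.choose_spec

theorem norm_gradY_sq (θ : Y d → ℝ) (y : Y d) :
    ‖gradY θ y‖ ^ 2 = ∑ l, weakPartial (dirY d) l θ y * weakPartial (dirY d) l θ y := by
  rw [EuclideanSpace.real_norm_sq_eq]
  simp [gradY, sq]

theorem dom_sobNorm_gradY (hθ : ∀ p, sobNorm (dirY d) (K + 1) (θ p) < ⊤) :
    Dom (fun p => sobNorm (dirY d) K (gradY (θ p))) fun p => sobNorm (dirY d) (K + 1) (θ p) :=
  dom_sobNorm_of_apply hθ fun c => Dom.of_le fun p => sobNorm_wd_le (wd_weakPartial (hθ p) c)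

theorem dom_norm_gradY_sq (hk : SobMul (dirY d) K) (hθ : ∀ p, sobNorm (dirY d) (K + 1) (θ p) < ⊤) :
    Dom (fun p => sobNorm (dirY d) K fun y => ‖gradY (θ p) y‖ ^ 2)
      fun p => sobNorm (dirY d) K (gradY (θ p)) ^ 2 := by
  have h0 : ∀ p, sobNorm (dirY d) K (gradY (θ p)) < ⊤ := fun p =>
    (dom_sobNorm_gradY hθ).lt_top (hθ p)
  simp only [norm_gradY_sq]
  refine dom_sobNorm_sum fun l _ => ?_
  have h1 := dom_sobNorm_apply h0 l
  simp only [sq]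
  exact (hk.dom_mul (s := K) le_rfl le_rfl le_rfl (fun p => h1.lt_top (h0 p))
    fun p => h1.lt_top (h0 p)).trans (h1.mul h1)

theorem dom_norm_gradY_sq_sub (hk : SobMul (dirY d) K)
    (hA : Dom (fun p => sobNorm (dirY d) (K + 1) (θA p)) fun _ => 1)
    (hB : Dom (fun p => sobNorm (dirY d) (K + 1) (θB p)) fun _ => 1) :
    Dom (fun p => sobNorm (dirY d) K fun y => ‖gradY (θA p) y‖ ^ 2 - ‖gradY (θB p) y‖ ^ 2)
      fun p => sobNorm (dirY d) (K + 1) fun y => θA p y - θB p y := by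
  have hAt : ∀ p, sobNorm (dirY d) (K + 1) (θA p) < ⊤ := fun p => hA.lt_top ENNReal.one_lt_top
  have hBt : ∀ p, sobNorm (dirY d) (K + 1) (θB p) < ⊤ := fun p => hB.lt_top ENNReal.one_lt_top
  have e : ∀ p y, ‖gradY (θA p) y‖ ^ 2 - ‖gradY (θB p) y‖ ^ 2 = ∑ l,
      (weakPartial (dirY d) l (θA p) y - weakPartial (dirY d) l (θB p) y) *
        (weakPartial (dirY d) l (θA p) y + weakPartial (dirY d) l (θB p) y) := fun p y => by
    rw [norm_gradY_sq, norm_gradY_sq, ← Finset.sum_sub_distrib]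
    exact Finset.sum_congr rfl fun l _ => by ring
  simp only [e]
  refine dom_sobNorm_sum fun l _ => ?_
  have h1 : Dom (fun p => sobNorm (dirY d) K fun y =>
      weakPartial (dirY d) l (θA p) y - weakPartial (dirY d) l (θB p) y)
      fun p => sobNorm (dirY d) (K + 1) fun y => θA p y - θB p y :=
    Dom.of_le fun p => sobNorm_wd_le ((wd_weakPartial (hAt p) l).sub (wd_weakPartial (hBt p) l))
  have h2 : Dom (fun p => sobNorm (dirY d) K fun y =>
      weakPartial (dirY d) l (θA p) y + weakPartial (dirY d) l (θB p) y) fun _ => 1 :=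
    dom_sobNorm_add
      ((Dom.of_le fun p => sobNorm_wd_le (wd_weakPartial (hAt p) l)).trans hA)
      ((Dom.of_le fun p => sobNorm_wd_le (wd_weakPartial (hBt p) l)).trans hB)
  simpa only [mul_one] using (hk.dom_mul (s := K) le_rfl le_rfl le_rfl
    (fun p => h1.lt_top (sobNorm_sub_lt_top (hAt p) (hBt p)))
    fun p => h2.lt_top ENNReal.one_lt_top).trans (h1.mul h2)

end Gradient

section TiltCoeff

variable {d n k K : ℕ} {P ι : Type*} [Countable ι] {Φ₀ ψ : ℝ → V n} {χ : ℝ → ℝ}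

/-- The coefficient `|∇_y θ|² - (σ²/2) Υ(θ)² ∑_j m_j²` with which `T_θ Φ₀''` enters the drift;
`m_j` stands for `⟨g(v + T_θ Φ₀) T_{-γ} √Q e_j, ψ⟩_{L²_x}`. -/
noncomputable def tiltCoeff (Φ₀ ψ : ℝ → V n) (χ : ℝ → ℝ) (σ : ℝ) (θ : Y d → ℝ)
    (m : ι → Y d → ℝ) (y : Y d) : ℝ :=
  ‖gradY θ y‖ ^ 2 + -(1 / 2) * σ ^ 2 *
    (Upsilon Φ₀ ψ χ θ y * (Upsilon Φ₀ ψ χ θ y * ∑' j, m j y ^ 2))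

theorem enorm_neg_half_mul_sq_le (σ : ℝ) : ‖-(1 / 2) * σ ^ 2‖ₑ ≤ ENNReal.ofReal (σ ^ 2) := by
  rw [← ofReal_norm, Real.norm_eq_abs]
  refine ENNReal.ofReal_le_ofReal ?_
  rw [abs_mul, abs_of_nonneg (sq_nonneg σ)]
  norm_num
  nlinarith [sq_nonneg σ]

namespace WaveData

variable (H : WaveData k Φ₀ ψ χ)
include H

variable {θ θA θB : P → Y d → ℝ} {σ : P → ℝ} {m mA mB : P → ι → Y d → ℝ}

/-- The coefficient of `T_θ Φ₀''` is of size `σ² + ‖∇_y θ‖²`.  The bound `K + 1` on `θ` is used only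
for finiteness and does not enter the constant. -/
theorem dom_tiltCoeff (hK : K ≤ k) (hk : SobMul (dirY d) K)
    (hθ : Dom (fun p => sobNorm (dirY d) K (θ p)) fun _ => 1)
    (hθt : ∀ p, sobNorm (dirY d) (K + 1) (θ p) < ⊤)
    (hm : Dom (fun p => l2 fun j => sobNorm (dirY d) K (m p j)) fun _ => 1) :
    Dom (fun p => sobNorm (dirY d) K (tiltCoeff Φ₀ ψ χ (σ p) (θ p) (m p)))
      fun p => ENNReal.ofReal (σ p ^ 2) + sobNorm (dirY d) K (gradY (θ p)) ^ 2 := by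
  have h0 := dom_sobNorm_tsum_sq hk hm
  have ht : ∀ p, sobNorm (dirY d) K (fun y => ∑' j, m p j y ^ 2) < ⊤ := fun p =>
    h0.lt_top ENNReal.one_lt_top
  have h1 := H.dom_Upsilon_mul hK hk hθ ht
  have h2 := (H.dom_Upsilon_mul hK hk hθ fun p => h1.lt_top (ht p)).trans (h1.trans h0)
  refine dom_sobNorm_add ((dom_norm_gradY_sq hk hθt).trans (Dom.of_le fun p => le_add_self)) ?_
  have h3 := (dom_sobNorm_const_mul (c := fun p => -(1 / 2) * σ p ^ 2)
    fun p => h2.lt_top ENNReal.one_lt_top).trans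
      ((Dom.of_le fun p => enorm_neg_half_mul_sq_le (σ p)).mul h2)
  simp only [mul_one] at h3
  exact h3.trans (Dom.of_le fun p => le_self_add)

theorem dom_Upsilon_mul_sub (hK : K ≤ k) (hk : SobMul (dirY d) K)
    (hA : Dom (fun p => sobNorm (dirY d) K (θA p)) fun _ => 1)
    (hB : Dom (fun p => sobNorm (dirY d) K (θB p)) fun _ => 1) {uA uB : P → Y d → ℝ}
    (huB : Dom (fun p => sobNorm (dirY d) K (uB p)) fun _ => 1)
    (hu : ∀ p, sobNorm (dirY d) K (fun y => uA p y - uB p y) < ⊤) :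
    Dom (fun p => sobNorm (dirY d) K fun y =>
        Upsilon Φ₀ ψ χ (θA p) y * uA p y - Upsilon Φ₀ ψ χ (θB p) y * uB p y)
      (fun p => sobNorm (dirY d) K (fun y => uA p y - uB p y) +
        sobNorm (dirY d) K (fun y => θA p y - θB p y)) := by
  have h1 := H.dom_Upsilon_mul hK hk hA hu
  have h2 := (H.dom_Upsilon_sub_mul hK hk hA hB fun p => huB.lt_top ENNReal.one_lt_top).trans
    ((Dom.refl _).mul huB)
  simp only [mul_one] at h2
  refine (Dom.of_le fun p => le_of_eq ?_).trans (dom_sobNorm_add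
    (h1.trans (Dom.of_le fun p => le_self_add)) (h2.trans (Dom.of_le fun p => le_add_self)))
  congr 1
  ext y
  ring

/-- Lipschitz estimate for the coefficient of `T_θ Φ₀''`.  The gradient costs one derivative of `θ`;
the dependence `D` of the pairings `m_j` on the state enters with the factor `σ²`. -/
theorem dom_tiltCoeff_sub (hK : K ≤ k) (hk : SobMul (dirY d) K) (hσ : ∀ p, |σ p| ≤ 1)
    (hA : Dom (fun p => sobNorm (dirY d) (K + 1) (θA p)) fun _ => 1)
    (hB : Dom (fun p => sobNorm (dirY d) (K + 1) (θB p)) fun _ => 1)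
    (hmA : Dom (fun p => l2 fun j => sobNorm (dirY d) K (mA p j)) fun _ => 1)
    (hmB : Dom (fun p => l2 fun j => sobNorm (dirY d) K (mB p j)) fun _ => 1)
    {D : P → ℝ≥0∞} (hD : ∀ p, D p < ⊤)
    (hm : Dom (fun p => l2 fun j => sobNorm (dirY d) K fun y => mA p j y - mB p j y) D) :
    Dom (fun p => sobNorm (dirY d) K fun y => tiltCoeff Φ₀ ψ χ (σ p) (θA p) (mA p) y -
        tiltCoeff Φ₀ ψ χ (σ p) (θB p) (mB p) y)
      fun p => ENNReal.ofReal (σ p ^ 2) * D p +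
        sobNorm (dirY d) (K + 1) fun y => θA p y - θB p y := by
  have hA' := (Dom.of_le fun p => sobNorm_mono (dirY d) (Nat.le_succ K) (θA p)).trans hA
  have hB' := (Dom.of_le fun p => sobNorm_mono (dirY d) (Nat.le_succ K) (θB p)).trans hB
  have hδ : ∀ p, sobNorm (dirY d) K (fun y => θA p y - θB p y) < ⊤ := fun p =>
    sobNorm_sub_lt_top (hA'.lt_top ENNReal.one_lt_top) (hB'.lt_top ENNReal.one_lt_top)
  have h0 := dom_sobNorm_tsum_sq_sub hk hD hmA hmB hm
  have hQ := dom_sobNorm_tsum_sq hk hmB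
  have h1 := H.dom_Upsilon_mul_sub hK hk hA' hB' hQ fun p => h0.lt_top (hD p)
  have h1' := h1.trans (h0.add_add (Dom.refl _))
  have hQ' := (H.dom_Upsilon_mul hK hk hB' fun p => hQ.lt_top ENNReal.one_lt_top).trans hQ
  have hfin : ∀ p, D p + sobNorm (dirY d) K (fun y => θA p y - θB p y) < ⊤ := fun p =>
    ENNReal.add_lt_top.2 ⟨hD p, hδ p⟩
  have h2 := H.dom_Upsilon_mul_sub hK hk hA' hB' hQ' fun p => h1'.lt_top (hfin p)
  have h3 : Dom _ fun p => D p + sobNorm (dirY d) K (fun y => θA p y - θB p y) :=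
    h2.trans (h1'.add (Dom.of_le fun p => le_add_self))
  have h4 := (dom_sobNorm_const_mul (c := fun p => -(1 / 2) * σ p ^ 2)
    fun p => h3.lt_top (hfin p)).trans
      ((Dom.of_le fun p => enorm_neg_half_mul_sq_le (σ p)).mul h3)
  have h5 : Dom (fun p => ENNReal.ofReal (σ p ^ 2) *
      (D p + sobNorm (dirY d) K (fun y => θA p y - θB p y))) fun p =>
      ENNReal.ofReal (σ p ^ 2) * D p + sobNorm (dirY d) (K + 1) fun y => θA p y - θB p y := by
    refine Dom.of_le fun p => ?_
    rw [mul_add]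
    have h1 : ENNReal.ofReal (σ p ^ 2) ≤ 1 := by
      rw [ENNReal.ofReal_le_one, sq_le_one_iff_abs_le_one]
      exact hσ p
    gcongr
    calc _ ≤ 1 * sobNorm (dirY d) K (fun y => θA p y - θB p y) := mul_le_mul_left h1 _
      _ ≤ _ := (one_mul _).le.trans (sobNorm_mono _ (Nat.le_succ K) _)
  refine (Dom.of_le fun p => le_of_eq ?_).trans (dom_sobNorm_add
    ((dom_norm_gradY_sq_sub hk hA hB).trans (Dom.of_le fun p => le_add_self)) (h4.trans h5))
  congr 1
  ext y
  simp only [tiltCoeff]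
  ring

end WaveData

end TiltCoeff

end PlanarWave

namespace PlanarWave

open scoped NNReal Topology
open Filter

/-! ### The drift -/

section Drift

namespace BddState

variable {κ E P : Type*} [Fintype κ] [NormedAddCommGroup E] [NormedSpace ℝ E]
  [FiniteDimensional ℝ E] [MeasureSpace E] [BorelSpace E] [(volume : Measure E).IsAddHaarMeasure]
  {m : ℕ} {b : κ → E} {k : ℕ} {a : Fin m → E → ℝ} {uA uB vA vB : P → Fin m → E → ℝ}

/-- Lipschitz estimate for the second-order remainder.  No quadratic gain is needed here, so the
three terms of the remainder are estimated one by one. -/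
theorem dom_tay_sub (huA : BddState b k a uA) (huB : BddState b k a uB) (hvA : BddState b k a vA)
    (hvB : BddState b k a vB) (hk : SobMul b k) {F : (Fin m → ℝ) → ℝ}
    (hF : ContDiff ℝ (k + 1 : ℕ) F) :
    Dom (fun p => sobNorm b k fun x => tay F a (uA p) (vA p) x - tay F a (uB p) (vB p) x)
      fun p => compNorm b k (fun c x => uA p c x - uB p c x) +
        compNorm b k (fun c x => vA p c x - vB p c x) := by
  have hu := huA.compNorm_sub_lt_top huB
  have hv := hvA.compNorm_sub_lt_top hvB
  have hfin : ∀ p, compNorm b k (fun c x => uA p c x - uB p c x) +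
        compNorm b k (fun c x => vA p c x - vB p c x) < ⊤ := fun p =>
    ENNReal.add_lt_top.2 ⟨hu p, hv p⟩
  have h1 := dom_sub (huA.add hvA) (huB.add hvB) hk k le_rfl hF
  have h1' : Dom (fun p => compNorm b k (fun c x => uA p c x + vA p c x - (uB p c x + vB p c x)))
      fun p => compNorm b k (fun c x => uA p c x - uB p c x) +
        compNorm b k (fun c x => vA p c x - vB p c x) := by
    refine Dom.sum fun c _ => ?_
    have e : ∀ p x, uA p c x + vA p c x - (uB p c x + vB p c x) =
        (uA p c x - uB p c x) + (vA p c x - vB p c x) := fun p x => by ring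
    simp only [e]
    exact dom_sobNorm_add
      (Dom.of_le fun p => (sobNorm_le_compNorm b k (fun c x => uA p c x - uB p c x) c).trans
        le_self_add)
      (Dom.of_le fun p => (sobNorm_le_compNorm b k (fun c x => vA p c x - vB p c x) c).trans
        le_add_self)
  have h2 := dom_sub huA huB hk k le_rfl hF
  have h3 : ∀ c, Dom (fun p => sobNorm b k fun x =>
      pd c F (bgAdd a (fun _ _ => 0) x) * (vA p c x - vB p c x)) fun p =>
      sobNorm b k fun x => vA p c x - vB p c x := fun c =>
    huA.zero.dom_comp_mul hk k le_rfl (contDiff_pd hF c) fun p => hvA.sub_lt_top hvB p c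
  have h4 : Dom (fun p => sobNorm b k fun x =>
      ∑ c, pd c F (bgAdd a (fun _ _ => 0) x) * (vA p c x - vB p c x)) fun p =>
      compNorm b k (fun c x => uA p c x - uB p c x) +
        compNorm b k (fun c x => vA p c x - vB p c x) :=
    dom_sobNorm_sum fun c _ => (h3 c).trans (Dom.of_le fun p =>
      (sobNorm_le_compNorm b k (fun c x => vA p c x - vB p c x) c).trans le_add_self)
  refine (Dom.of_le fun p => le_of_eq ?_).trans (dom_sobNorm_sub hfin
    (dom_sobNorm_sub hfin (h1.trans h1') (h2.trans (Dom.of_le fun p => le_self_add))) h4)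
  congr 1
  ext x
  simp only [tay, mul_sub, Finset.sum_sub_distrib]
  ring

end BddState

variable {d n k K : ℕ} {P ι : Type*} [Countable ι] {f : V n → V n} {um up : V n} {c₀ : ℝ}
  {Φ₀ ψ : ℝ → V n} {χ : ℝ → ℝ}

/-- The components of the planar wave, as functions on `ℝ^d`. -/
def waveBg (d : ℕ) (Φ₀ : ℝ → V n) (c : Fin n) (q : X d) : ℝ := waveComp Φ₀ c q.1

/-- The components of `T_θ Φ₀ - Φ₀`. -/
def tilt (Φ₀ : ℝ → V n) (θ : Y d → ℝ) (c : Fin n) (q : X d) : ℝ :=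
  waveComp Φ₀ c (q.1 - θ q.2) - waveComp Φ₀ c q.1

/-- `𝒥 + σ² 𝒥_tr`, with `m_j` in place of `⟨g(v + T_θ Φ₀) T_{-γ} √Q e_j, ψ⟩_{L²_x}`. -/
noncomputable def drift (f : V n → V n) (Φ₀ ψ : ℝ → V n) (χ : ℝ → ℝ) (σ : ℝ) (v : X d → V n)
    (θ : Y d → ℝ) (m : ι → Y d → ℝ) : X d → V n := fun q =>
  calJ f Φ₀ v θ q + σ ^ 2 • (-(1 / 2) * Upsilon Φ₀ ψ χ θ q.2 ^ 2 * ∑' j, m j q.2 ^ 2) •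
    translate θ (iteratedDeriv 2 Φ₀) q

/-- The drift is the Taylor remainder of `f` at `Φ₀` with increments `T_θ Φ₀ - Φ₀` and `v`, plus a
multiple of `T_θ Φ₀''`: both `|∇_y θ|² T_θ Φ₀''` and the trace term are such multiples. -/
theorem WaveData.drift_apply (H : WaveData k Φ₀ ψ χ) (hf : Differentiable ℝ f) (σ : ℝ)
    (v : X d → V n) (θ : Y d → ℝ) (m : ι → Y d → ℝ) (q : X d) (a : Fin n) :
    drift f Φ₀ ψ χ σ v θ m q a =
      BddState.tay (comp f a) (waveBg d Φ₀) (tilt Φ₀ θ) (fun c q => v q c) q +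
        deriv (deriv (waveComp Φ₀ a)) (q.1 - θ q.2) * tiltCoeff Φ₀ ψ χ σ θ m q.2 := by
  have e1 : bgAdd (waveBg d Φ₀) (fun c x => tilt Φ₀ θ c x + v x c) q =
      fun c => (v q + translate θ Φ₀ q) c := by
    ext c
    simp only [bgAdd, waveBg, tilt, translate, waveComp, PiLp.add_apply]
    ring
  have e2 : bgAdd (waveBg d Φ₀) (tilt Φ₀ θ) q = fun c => translate θ Φ₀ q c := by
    ext c
    simp [bgAdd, waveBg, tilt, translate, waveComp]
  have e3 : bgAdd (waveBg d Φ₀) (fun _ _ => 0) q = fun c => Φ₀ q.1 c := by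
    ext c
    simp [bgAdd, waveBg, waveComp]
  have e4 : ∀ u : V n, comp f a (fun c => u c) = f u a := fun u => rfl
  rw [BddState.tay, e1, e2, e3, e4, e4]
  simp only [drift, calJ, PiLp.add_apply, PiLp.sub_apply, PiLp.smul_apply, smul_eq_mul,
    H.translate_deriv_two_apply, tiltCoeff, fderiv_apply_eq_sum_pd_comp hf]
  ring

section States

variable {θ θA θB : P → Y d → ℝ} {v vA vB : P → X d → V n}

theorem WaveData.dom_tilt_sub (H : WaveData k Φ₀ ψ χ) (hK : K ≤ k) (hk : SobMul (dirY d) K)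
    (hA : Dom (fun p => sobNorm (dirY d) K (θA p)) fun _ => 1)
    (hB : Dom (fun p => sobNorm (dirY d) K (θB p)) fun _ => 1) :
    Dom (fun p => compNorm (dirX d) K fun c q => tilt Φ₀ (θA p) c q - tilt Φ₀ (θB p) c q)
      fun p => sobNorm (dirY d) K fun y => θA p y - θB p y := by
  refine Dom.sum fun c _ => ?_
  simp only [tilt, sub_sub_sub_cancel_right]
  exact dom_translate_sub hk hA hB K le_rfl (H.contDiff_waveComp c) (H.bdd c)
    ((H.prof c).mono (by omega))

/-- `T_θ Φ₀ - Φ₀` is of the size of `θ`; this is why `𝒥` contains `‖v‖ ‖θ‖` and no linear term. -/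
theorem WaveData.dom_tilt (H : WaveData k Φ₀ ψ χ) (hK : K ≤ k) (hk : SobMul (dirY d) K)
    (hθ : Dom (fun p => sobNorm (dirY d) K (θ p)) fun _ => 1) :
    Dom (fun p => compNorm (dirX d) K (tilt Φ₀ (θ p))) fun p => sobNorm (dirY d) K (θ p) := by
  have h := H.dom_tilt_sub hK hk hθ (H.dom_zero (P := P) (d := d))
  have e : ∀ p c (q : X d), tilt Φ₀ (θ p) c q - tilt Φ₀ (fun _ => 0) c q = tilt Φ₀ (θ p) c q :=
    fun p c q => by simp [tilt]
  simpa only [e, sub_zero] using h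

theorem bddState_tilt (H : WaveData k Φ₀ ψ χ) (hf : HypF k f um up) (hTw : HypTw f um up Φ₀ c₀)
    (hK : K ≤ k) (hk : SobMul (dirY d) K)
    (hθ : Dom (fun p => sobNorm (dirY d) K (θ p)) fun _ => 1) :
    BddState (dirX d) K (waveBg d Φ₀) fun p => tilt Φ₀ (θ p) :=
  ⟨fun c => (bddDeriv_waveComp hf hTw c).mono hK, fun c =>
    ((Dom.of_le fun p => sobNorm_le_compNorm (dirX d) K (tilt Φ₀ (θ p)) c).trans
      (H.dom_tilt hK hk hθ)).trans hθ⟩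

theorem dom_compNorm_apply (hv : ∀ p, sobNorm (dirX d) K (v p) < ⊤) :
    Dom (fun p => compNorm (dirX d) K fun c q => v p q c) fun p => sobNorm (dirX d) K (v p) :=
  Dom.sum fun c _ => dom_sobNorm_apply hv c

theorem bddState_apply (hf : HypF k f um up) (hTw : HypTw f um up Φ₀ c₀) (hK : K ≤ k)
    (hv : Dom (fun p => sobNorm (dirX d) K (v p)) fun _ => 1) :
    BddState (dirX d) K (waveBg d Φ₀) fun p c q => v p q c :=
  ⟨fun c => (bddDeriv_waveComp hf hTw c).mono hK, fun c =>
    (dom_sobNorm_apply (fun _ => hv.lt_top ENNReal.one_lt_top) c).trans hv⟩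

variable {σ : P → ℝ} {m mA mB : P → ι → Y d → ℝ}

/-- The drift is of the size of `(‖θ‖ + ‖v‖) ‖v‖` and the coefficient of `T_θ Φ₀''`. -/
theorem WaveData.dom_drift (H : WaveData k Φ₀ ψ χ) (hf : HypF k f um up)
    (hTw : HypTw f um up Φ₀ c₀) (hK : K ≤ k) (hk : SobMul (dirY d) K) (hkX : SobMul (dirX d) K)
    (hθ : Dom (fun p => sobNorm (dirY d) K (θ p)) fun _ => 1)
    (hv : Dom (fun p => sobNorm (dirX d) K (v p)) fun _ => 1)
    (hR : ∀ p, sobNorm (dirY d) K (tiltCoeff Φ₀ ψ χ (σ p) (θ p) (m p)) < ⊤) :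
    Dom (fun p => sobNorm (dirX d) K (drift f Φ₀ ψ χ (σ p) (v p) (θ p) (m p)))
      fun p => (sobNorm (dirY d) K (θ p) + sobNorm (dirX d) K (v p)) * sobNorm (dirX d) K (v p) +
        sobNorm (dirY d) K (tiltCoeff Φ₀ ψ χ (σ p) (θ p) (m p)) := by
  have hθt : ∀ p, sobNorm (dirY d) K (θ p) < ⊤ := fun p => hθ.lt_top ENNReal.one_lt_top
  have hvt : ∀ p, sobNorm (dirX d) K (v p) < ⊤ := fun p => hv.lt_top ENNReal.one_lt_top
  refine dom_sobNorm_of_apply (fun p => ENNReal.add_lt_top.2 ⟨ENNReal.mul_lt_top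
    (ENNReal.add_lt_top.2 ⟨hθt p, hvt p⟩) (hvt p), hR p⟩) fun c => ?_
  simp only [H.drift_apply (hf.contDiff.differentiable (by simp))]
  have hF : ContDiff ℝ (K + 2 : ℕ) (comp f c) :=
    contDiff_comp (hf.contDiff.of_le (by exact_mod_cast (by omega : K + 2 ≤ k + 2))) c
  have hvn := dom_compNorm_apply hvt
  refine dom_sobNorm_add ?_ ?_
  · exact (((bddState_tilt H hf hTw hK hk hθ).dom_tay (bddState_apply hf hTw hK hv) hkX K le_rfl
      hF).trans (((H.dom_tilt hK hk hθ).add_add hvn).mul hvn)).trans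
        (Dom.of_le fun p => le_self_add)
  · exact (dom_translate_mul hk hθ K le_rfl ((H.prof c).2.mono hK) hR).trans
      (Dom.of_le fun p => le_add_self)

/-- Lipschitz estimate for the drift.  The difference of the translates of `Φ₀''` requires one
derivative more of `Φ₀`, hence `K + 1 ≤ k`. -/
theorem WaveData.dom_drift_sub (H : WaveData k Φ₀ ψ χ) (hf : HypF k f um up)
    (hTw : HypTw f um up Φ₀ c₀) (hK : K + 1 ≤ k) (hk : SobMul (dirY d) K)
    (hkX : SobMul (dirX d) K)
    (hA : Dom (fun p => sobNorm (dirY d) K (θA p)) fun _ => 1)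
    (hB : Dom (fun p => sobNorm (dirY d) K (θB p)) fun _ => 1)
    (hvA : Dom (fun p => sobNorm (dirX d) K (vA p)) fun _ => 1)
    (hvB : Dom (fun p => sobNorm (dirX d) K (vB p)) fun _ => 1)
    (hv : ∀ p, sobNorm (dirX d) K (fun q => vA p q - vB p q) < ⊤)
    (hRB : Dom (fun p => sobNorm (dirY d) K (tiltCoeff Φ₀ ψ χ (σ p) (θB p) (mB p))) fun _ => 1)
    (hR : ∀ p, sobNorm (dirY d) K (fun y => tiltCoeff Φ₀ ψ χ (σ p) (θA p) (mA p) y -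
      tiltCoeff Φ₀ ψ χ (σ p) (θB p) (mB p) y) < ⊤) :
    Dom (fun p => sobNorm (dirX d) K fun q => drift f Φ₀ ψ χ (σ p) (vA p) (θA p) (mA p) q -
        drift f Φ₀ ψ χ (σ p) (vB p) (θB p) (mB p) q)
      fun p => sobNorm (dirX d) K (fun q => vA p q - vB p q) +
        sobNorm (dirY d) K (fun y => θA p y - θB p y) +
        sobNorm (dirY d) K (fun y => tiltCoeff Φ₀ ψ χ (σ p) (θA p) (mA p) y -
          tiltCoeff Φ₀ ψ χ (σ p) (θB p) (mB p) y) := by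
  have hK' : K ≤ k := by omega
  have hδ : ∀ p, sobNorm (dirY d) K (fun y => θA p y - θB p y) < ⊤ := fun p =>
    sobNorm_sub_lt_top (hA.lt_top ENNReal.one_lt_top) (hB.lt_top ENNReal.one_lt_top)
  refine dom_sobNorm_of_apply (fun p => ENNReal.add_lt_top.2 ⟨ENNReal.add_lt_top.2
    ⟨hv p, hδ p⟩, hR p⟩) fun c => ?_
  have hF : ContDiff ℝ (K + 1 : ℕ) (comp f c) :=
    contDiff_comp (hf.contDiff.of_le (by exact_mod_cast (by omega : K + 1 ≤ k + 2))) c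
  have hvn := dom_compNorm_apply hv
  simp only [PiLp.sub_apply] at hvn
  have h1 := (BddState.dom_tay_sub (bddState_tilt H hf hTw hK' hk hA)
    (bddState_tilt H hf hTw hK' hk hB) (bddState_apply hf hTw hK' hvA)
    (bddState_apply hf hTw hK' hvB) hkX hF).trans ((H.dom_tilt_sub hK' hk hA hB).add_add hvn)
  have h2 := dom_translate_mul hk hA K le_rfl ((H.prof c).2.mono hK') hR
  have h3 := (dom_translate_sub_mul hk hA hB K le_rfl ((H.prof c).2.mono hK)
    fun p => hRB.lt_top ENNReal.one_lt_top).trans ((Dom.refl _).mul hRB)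
  simp only [mul_one] at h3
  have e : ∀ p (q : X d), (drift f Φ₀ ψ χ (σ p) (vA p) (θA p) (mA p) q -
        drift f Φ₀ ψ χ (σ p) (vB p) (θB p) (mB p) q) c =
      (BddState.tay (comp f c) (waveBg d Φ₀) (tilt Φ₀ (θA p)) (fun c q => vA p q c) q -
        BddState.tay (comp f c) (waveBg d Φ₀) (tilt Φ₀ (θB p)) (fun c q => vB p q c) q) +
      (deriv (deriv (waveComp Φ₀ c)) (q.1 - θA p q.2) *
          (tiltCoeff Φ₀ ψ χ (σ p) (θA p) (mA p) q.2 - tiltCoeff Φ₀ ψ χ (σ p) (θB p) (mB p) q.2) +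
        (deriv (deriv (waveComp Φ₀ c)) (q.1 - θA p q.2) -
          deriv (deriv (waveComp Φ₀ c)) (q.1 - θB p q.2)) *
          tiltCoeff Φ₀ ψ χ (σ p) (θB p) (mB p) q.2) := fun p q => by
    rw [PiLp.sub_apply, H.drift_apply (hf.contDiff.differentiable (by simp)),
      H.drift_apply (hf.contDiff.differentiable (by simp))]
    ring
  simp only [e]
  refine dom_sobNorm_add (h1.trans (Dom.of_le fun p => ?_)) (dom_sobNorm_add
    (h2.trans (Dom.of_le fun p => le_add_self)) (h3.trans (Dom.of_le fun p => ?_)))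
  · exact (add_comm _ _).le.trans le_self_add
  · exact le_add_self.trans le_self_add

end States

end Drift

end PlanarWave

namespace PlanarWave

open scoped NNReal Topology
open Filter

/-! ### `L¹` bounds -/

section IntegralNorm

variable {d n k K : ℕ} {P ι : Type*} [Countable ι] {f : V n → V n} {um up : V n} {c₀ : ℝ}
  {Φ₀ ψ : ℝ → V n} {χ : ℝ → ℝ}

theorem eLpNorm_one_mul_le {α : Type*} [MeasurableSpace α] {μ : Measure α} {f g : α → ℝ}
    (hf : AEStronglyMeasurable f μ) (hg : AEStronglyMeasurable g μ) :
    eLpNorm (fun x => f x * g x) 1 μ ≤ eLpNorm f 2 μ * eLpNorm g 2 μ := by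
  rw [eLpNorm_one_eq_lintegral_enorm]
  refine (ENNReal.pow_le_pow_left_iff two_ne_zero).1 ?_
  rw [mul_pow, ← lintegral_sq_eq_eLpNorm, ← lintegral_sq_eq_eLpNorm]
  simp only [enorm_mul]
  exact lintegral_mul_sq_le hf.enorm hg.enorm

theorem dom_normL1_add {u v : P → X d → ℝ} {B : P → ℝ≥0∞}
    (hu : ∀ p, AEStronglyMeasurable (u p) volume) (hv : ∀ p, AEStronglyMeasurable (v p) volume)
    (h : Dom (fun p => normL1 (u p)) B) (h' : Dom (fun p => normL1 (v p)) B) :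
    Dom (fun p => normL1 fun x => u p x + v p x) B :=
  (Dom.of_le fun p => eLpNorm_add_le (hu p) (hv p) le_rfl).trans (h.add h')

theorem dom_normL1_sum {κ : Type*} {s : Finset κ} {u : κ → P → X d → ℝ} {B : P → ℝ≥0∞}
    (hu : ∀ c p, AEStronglyMeasurable (u c p) volume)
    (h : ∀ c ∈ s, Dom (fun p => normL1 (u c p)) B) :
    Dom (fun p => normL1 fun x => ∑ c ∈ s, u c p x) B := by
  refine (Dom.of_le fun p => ?_).trans (Dom.sum h)
  have := eLpNorm_sum_le (s := s) (f := fun c => u c p) (μ := volume) (fun c _ => hu c p) le_rfl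
  simpa only [Finset.sum_fn, normL1] using this

theorem ae_comp_fst {p : ℝ → Prop} (h : ∀ᵐ x, p x) : ∀ᵐ q : X d, p q.1 := by
  rw [Measure.volume_eq_prod]
  exact Measure.quasiMeasurePreserving_fst.ae h

/-- On each slice, `⟨T_θ ζ, ψ⟩` is bounded by the Cauchy–Schwarz inequality, uniformly in `θ`. -/
theorem eLpNorm_one_translate_mul_le {ζ ψ : ℝ → ℝ} (hζ : Continuous ζ)
    (hψ : AEStronglyMeasurable ψ volume) {θ h : Y d → ℝ} (hθ : AEStronglyMeasurable θ volume)
    (hh : AEStronglyMeasurable h volume) :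
    normL1 (fun q : X d => ζ (q.1 - θ q.2) * h q.2 * ψ q.1) ≤
      eLpNorm ζ 2 volume * eLpNorm ψ 2 volume * normL1 h := by
  have hm : AEStronglyMeasurable (fun q : X d => ζ (q.1 - θ q.2) * h q.2 * ψ q.1) volume := by
    refine ((aestronglyMeasurable_comp_sub hζ hθ).mul (aestronglyMeasurable_comp_snd hh)).mul ?_
    rw [Measure.volume_eq_prod]
    exact hψ.comp_fst
  rw [normL1, normL1, eLpNorm_one_eq_lintegral_enorm, eLpNorm_one_eq_lintegral_enorm,
    ← lintegral_const_mul'' _ hh.enorm]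
  rw [Measure.volume_eq_prod] at hm ⊢
  rw [lintegral_prod_symm _ hm.enorm]
  refine lintegral_mono fun y => ?_
  have h1 : ∫⁻ x, ‖ζ (x - θ y) * ψ x‖ₑ ≤ eLpNorm ζ 2 volume * eLpNorm ψ 2 volume := by
    rw [← eLpNorm_one_eq_lintegral_enorm]
    refine (eLpNorm_one_mul_le (hζ.comp (continuous_id.sub continuous_const)).aestronglyMeasurable
      hψ).trans (le_of_eq ?_)
    rw [← eLpNorm_comp_measurePreserving hζ.aestronglyMeasurable
      (measurePreserving_sub_right volume (θ y))]
    rfl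
  calc ∫⁻ x, ‖ζ (x - θ y) * h y * ψ x‖ₑ = ∫⁻ x, ‖h y‖ₑ * ‖ζ (x - θ y) * ψ x‖ₑ := by
        refine lintegral_congr fun x => ?_
        rw [← enorm_mul]
        congr 1
        ring
    _ = ‖h y‖ₑ * ∫⁻ x, ‖ζ (x - θ y) * ψ x‖ₑ := lintegral_const_mul' _ _ enorm_ne_top
    _ ≤ _ := by
        rw [mul_comm]
        exact mul_le_mul_left h1 _

namespace WaveData

variable {θ : P → Y d → ℝ} {v : P → X d → V n} {σ : P → ℝ} {m : P → ι → Y d → ℝ}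

/-- The coefficient of `T_θ Φ₀''` is a sum of squares of elements of `L²_y`, hence in `L¹_y`. -/
theorem dom_normL1_tiltCoeff (H : WaveData k Φ₀ ψ χ)
    (hθt : ∀ p, sobNorm (dirY d) (K + 1) (θ p) < ⊤)
    (hm : Dom (fun p => l2 fun j => sobNorm (dirY d) K (m p j)) fun _ => 1) :
    Dom (fun p => normL1 (tiltCoeff Φ₀ ψ χ (σ p) (θ p) (m p)))
      fun p => ENNReal.ofReal (σ p ^ 2) + sobNorm (dirY d) K (gradY (θ p)) ^ 2 := by
  have hgt : ∀ p, sobNorm (dirY d) K (gradY (θ p)) < ⊤ := fun p =>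
    (dom_sobNorm_gradY hθt).lt_top (hθt p)
  have hmj : ∀ p j, sobNorm (dirY d) K (m p j) < ⊤ := fun p j =>
    (le_l2 _ j).trans_lt (hm.lt_top ENNReal.one_lt_top)
  have hQ : Dom (fun p => eLpNorm (fun y => ∑' j, m p j y ^ 2) 1 volume) fun _ => 1 := by
    have := hm.sq
    simp only [one_pow] at this
    refine (Dom.of_le fun p => ?_).trans this
    refine (eLpNorm_one_tsum_sq_le fun j => (memLp_of_sobNorm_lt_top (hmj p j)).1).trans ?_
    exact pow_le_pow_left₀ zero_le (l2_mono fun j => eLpNorm_le_sobNorm _ _ _) 2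
  have h1 : ∀ p, normL1 (tiltCoeff Φ₀ ψ χ (σ p) (θ p) (m p)) ≤
      sobNorm (dirY d) K (gradY (θ p)) ^ 2 + ENNReal.ofReal (σ p ^ 2) *
        (16 * eLpNorm (fun y => ∑' j, m p j y ^ 2) 1 volume) := fun p => by
    have hg : AEMeasurable (fun y => ‖gradY (θ p) y‖ₑ ^ 2) volume :=
      (memLp_of_sobNorm_lt_top (hgt p)).1.enorm.pow_const 2
    have h2 : ∫⁻ y, ‖gradY (θ p) y‖ₑ ^ 2 ≤ sobNorm (dirY d) K (gradY (θ p)) ^ 2 := by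
      have := lintegral_sq_eq_eLpNorm (μ := volume) fun y => ‖gradY (θ p) y‖
      simp only [enorm_norm, eLpNorm_norm] at this
      rw [this]
      exact pow_le_pow_left₀ zero_le (eLpNorm_le_sobNorm _ _ _) 2
    rw [normL1, eLpNorm_one_eq_lintegral_enorm, eLpNorm_one_eq_lintegral_enorm,
      ← lintegral_const_mul' _ _ (by norm_num), ← lintegral_const_mul' _ _ ENNReal.ofReal_ne_top]
    refine le_trans (lintegral_mono fun y => ?_) ((lintegral_add_left' hg _).le.trans
      (add_le_add_left h2 _))
    refine (enorm_add_le _ _).trans (add_le_add (by rw [enorm_pow, enorm_norm]) ?_)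
    rw [enorm_mul]
    refine mul_le_mul' (enorm_neg_half_mul_sq_le _) ?_
    rw [← mul_assoc, enorm_mul]
    refine mul_le_mul_left ?_ _
    -- The constant `16` is the square of the bound `|Υ| ≤ 4`.
    have h4 := abs_Upsilon_le (Φ₀ := Φ₀) (ψ := ψ) H.cutoff (θ p) y
    rw [← ofReal_norm, norm_mul, Real.norm_eq_abs, ← ENNReal.ofReal_ofNat]
    refine ENNReal.ofReal_le_ofReal ?_
    nlinarith [abs_nonneg (Upsilon Φ₀ ψ χ (θ p) y)]
  refine (Dom.of_le h1).trans (Dom.add (Dom.of_le fun p => le_add_self) ?_)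
  have h3 := (Dom.refl fun p => ENNReal.ofReal (σ p ^ 2)).mul (hQ.const_mul 16)
  simp only [mul_one] at h3
  exact h3.trans (Dom.of_le fun p => le_self_add)

/-- `L¹` bound for the drift paired with `ψ`: the Taylor remainder is a sum of products of elements
of `L²`, and `T_θ Φ₀''` is paired with `ψ` slice by slice. -/
theorem dom_normL1_inner_drift (H : WaveData k Φ₀ ψ χ) (hf : HypF k f um up)
    (hTw : HypTw f um up Φ₀ c₀) (hK : K ≤ k) (hk : SobMul (dirY d) K) (hkX : SobMul (dirX d) K)
    (hθ : Dom (fun p => sobNorm (dirY d) K (θ p)) fun _ => 1)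
    (hv : Dom (fun p => sobNorm (dirX d) K (v p)) fun _ => 1)
    (hR : ∀ p, sobNorm (dirY d) K (tiltCoeff Φ₀ ψ χ (σ p) (θ p) (m p)) < ⊤) :
    Dom (fun p => normL1 fun q : X d =>
        ⟪drift f Φ₀ ψ χ (σ p) (v p) (θ p) (m p) q, ψ q.1⟫)
      fun p => (sobNorm (dirY d) K (θ p) + sobNorm (dirX d) K (v p)) * sobNorm (dirX d) K (v p) +
        normL1 (tiltCoeff Φ₀ ψ χ (σ p) (θ p) (m p)) := by
  have hθt : ∀ p, sobNorm (dirY d) K (θ p) < ⊤ := fun p => hθ.lt_top ENNReal.one_lt_top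
  have hvt : ∀ p, sobNorm (dirX d) K (v p) < ⊤ := fun p => hv.lt_top ENNReal.one_lt_top
  have hF : ∀ c, ContDiff ℝ (K + 2 : ℕ) (comp f c) := fun c =>
    contDiff_comp (hf.contDiff.of_le (by exact_mod_cast (by omega : K + 2 ≤ k + 2))) c
  have hu' := bddState_tilt H hf hTw hK hk hθ
  have hv' := bddState_apply hf hTw hK hv
  have hψm : ∀ c, AEStronglyMeasurable (fun q : X d => ψ q.1 c) volume := fun c => by
    rw [Measure.volume_eq_prod]
    exact (H.memLp c).1.comp_fst
  have htm : ∀ c p, AEStronglyMeasurable (BddState.tay (comp f c) (waveBg d Φ₀) (tilt Φ₀ (θ p))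
      fun c q => v p q c) volume := fun c p =>
    (memLp_of_sobNorm_lt_top ((hu'.dom_tay hv' hkX K le_rfl (hF c)).lt_top (p := p)
      (ENNReal.mul_lt_top (ENNReal.add_lt_top.2 ⟨hu'.compNorm_lt_top p, hv'.compNorm_lt_top p⟩)
        (hv'.compNorm_lt_top p)))).1
  have hθm : ∀ p, AEStronglyMeasurable (θ p) volume := fun p =>
    (memLp_of_sobNorm_lt_top (hθt p)).1
  have hRm : ∀ p, AEStronglyMeasurable (tiltCoeff Φ₀ ψ χ (σ p) (θ p) (m p)) volume := fun p =>
    (memLp_of_sobNorm_lt_top (hR p)).1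
  have hζc : ∀ c, Continuous (deriv (deriv (waveComp Φ₀ c))) := fun c => (H.prof c).2.zero.1
  simp only [inner_eq_sum, H.drift_apply (hf.contDiff.differentiable (by simp)), add_mul]
  refine dom_normL1_sum (fun c p => ((htm c p).mul (hψm c)).add
    (((aestronglyMeasurable_comp_sub (hζc c) (hθm p)).mul
      (aestronglyMeasurable_comp_snd (hRm p))).mul (hψm c))) fun c _ =>
    dom_normL1_add (fun p => (htm c p).mul (hψm c)) (fun p =>
      ((aestronglyMeasurable_comp_sub (hζc c) (hθm p)).mul
      (aestronglyMeasurable_comp_snd (hRm p))).mul (hψm c)) ?_ ?_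
  · -- the Taylor remainder is quadratic and `ψ` is bounded
    obtain ⟨M, hM, hb⟩ := hu'.exists_tay_bound hv' hkX
      ((hF c).of_le (by exact_mod_cast (by omega : 2 ≤ K + 2)))
    obtain ⟨R, hR0, hψR⟩ := H.bound
    have hum : ∀ p e, AEStronglyMeasurable (tilt Φ₀ (θ p) e) volume := fun p e => (hu'.memLp p e).1
    have hvm : ∀ p e, AEStronglyMeasurable (fun q => v p q e) volume := fun p e =>
      (hv'.memLp p e).1
    have h1 : ∀ p, normL1 (fun q : X d => BddState.tay (comp f c) (waveBg d Φ₀) (tilt Φ₀ (θ p))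
        (fun c q => v p q c) q * ψ q.1 c) ≤ (M * R).toNNReal * ∑ ce : Fin n × Fin n,
          eLpNorm (fun q : X d => (|tilt Φ₀ (θ p) ce.2 q| + |v p q ce.2|) * v p q ce.1) 1 volume :=
      fun p => by
        refine eLpNorm_le_of_abs_le_sum le_rfl (by positivity)
          (fun ce _ => ((hum p ce.2).norm.add (hvm p ce.2).norm).mul (hvm p ce.1)) ?_
        filter_upwards [hb p, ae_comp_fst (hψR c)] with q hq hq'
        rw [abs_mul, mul_right_comm]
        exact mul_le_mul hq hq' (abs_nonneg _) ((abs_nonneg _).trans hq)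
    refine Dom.trans ⟨(M * R).toNNReal, h1⟩ (Dom.trans (Dom.sum fun ce _ => ?_)
      (Dom.of_le fun p => le_self_add))
    have h2 : ∀ p, eLpNorm (fun q : X d => (|tilt Φ₀ (θ p) ce.2 q| + |v p q ce.2|) * v p q ce.1) 1
        volume ≤ (compNorm (dirX d) K (tilt Φ₀ (θ p)) + compNorm (dirX d) K fun c q => v p q c) *
          compNorm (dirX d) K fun c q => v p q c := fun p => by
      refine (eLpNorm_one_mul_le ((hum p ce.2).norm.add (hvm p ce.2).norm) (hvm p ce.1)).trans
        (mul_le_mul' ((eLpNorm_add_le (hum p ce.2).norm (hvm p ce.2).norm (by norm_num)).trans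
          (add_le_add ?_ ?_)) ?_)
      · rw [eLpNorm_norm]
        exact (eLpNorm_le_sobNorm _ _ _).trans (sobNorm_le_compNorm _ _ (tilt Φ₀ (θ p)) _)
      · rw [eLpNorm_norm]
        exact (eLpNorm_le_sobNorm _ _ _).trans
          (sobNorm_le_compNorm _ _ (fun c q => v p q c) ce.2)
      · exact (eLpNorm_le_sobNorm _ _ _).trans
          (sobNorm_le_compNorm _ _ (fun c q => v p q c) ce.1)
    have hvn := dom_compNorm_apply hvt
    simpa only [add_mul] using (Dom.of_le h2).trans (((H.dom_tilt hK hk hθ).add_add hvn).mul hvn)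
  · have h1 : eLpNorm (deriv (deriv (waveComp Φ₀ c))) 2 volume *
        eLpNorm (fun x => ψ x c) 2 volume < ⊤ :=
      ENNReal.mul_lt_top (H.prof c).2.zero.2.1.2 (H.memLp c).2
    refine Dom.trans ⟨(eLpNorm (deriv (deriv (waveComp Φ₀ c))) 2 volume *
        eLpNorm (fun x => ψ x c) 2 volume).toNNReal, fun p => ?_⟩ (Dom.of_le fun p => le_add_self)
    rw [ENNReal.coe_toNNReal h1.ne]
    exact eLpNorm_one_translate_mul_le (hζc c) (H.memLp c).1 (hθm p) (hRm p)

end WaveData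

end IntegralNorm

end PlanarWave

namespace PlanarWave

open scoped NNReal Topology
open Filter

/-! ### The nonlinearities of the theorem -/

section Nonlinearities

variable {d n k K L : ℕ} {P ι W : Type*} [Countable ι] [NormedAddCommGroup W]
  [InnerProductSpace ℝ W] {f : V n → V n} {um up : V n} {c₀ : ℝ} {Φ₀ ψ : ℝ → V n} {χ : ℝ → ℝ}
  {S : W →L[ℝ] W} {T : ℝ → W →L[ℝ] W}
  {g : (X d →ₘ[volume] V n) → W →ₗ[ℝ] (X d →ₘ[volume] V n)}
  {v vA vB : P → X d → V n} {θ θA θB : P → Y d → ℝ} {γ σ : P → ℝ}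

/-- `⟨g(v + T_θ Φ₀) T_{-γ} √Q e_j, ψ⟩_{L²_x}`. -/
noncomputable def noiseInner (ψ : ℝ → V n) (Φ₀ : ℝ → V n) (S : W →L[ℝ] W) (T : ℝ → W →L[ℝ] W)
    (g : (X d →ₘ[volume] V n) → W →ₗ[ℝ] (X d →ₘ[volume] V n)) (e : HilbertBasis ι ℝ W)
    (v : X d → V n) (θ : Y d → ℝ) (γ : ℝ) (j : ι) : Y d → ℝ :=
  innerX (g (stateCls Φ₀ v θ) (T (-γ) (S (e j)))) ψ

namespace WaveData

variable (H : WaveData k Φ₀ ψ χ)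
include H

theorem dom_noiseM (hg : HypG ι K Φ₀ S T g) (hT : IsShiftGroup T) (hK : K ≤ k)
    (hk : SobMul (dirY d) K) (hv : Dom (fun p => sobNorm (dirX d) K (v p)) fun _ => 1)
    (hθ : Dom (fun p => sobNorm (dirY d) K (θ p)) fun _ => 1) :
    Dom (fun p => hsHky ι S K fun ξ => noiseM Φ₀ ψ χ g (v p) (θ p) (T (-γ p) ξ)) fun _ => 1 := by
  refine dom_twoSummingNorm ?_
  have hB := dom_noise (γ := γ) hg hT H.contDiff.continuous (H.dom_perturbation hK hk hv hθ)
  have hBt := lt_top_of_dom_l2 hB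
  obtain ⟨C, hC⟩ := H.dom_proj (P := (P × HilbertBasis ι ℝ W) × ι) hK hk
    (θ := fun x => θ x.1.1)
    (w := fun x => g (stateCls Φ₀ (v x.1.1) (θ x.1.1)) (T (-γ x.1.1) (S (x.1.2 x.2))))
    (hθ.comp fun x : (P × HilbertBasis ι ℝ W) × ι => x.1.1)
    fun x => hBt x.1 x.2
  exact Dom.trans ⟨C, fun x => (l2_mono fun j => hC (x, j)).trans (l2_const_mul _ _)⟩ hB

theorem dom_calM (hg : HypG ι K Φ₀ S T g) (hT : IsShiftGroup T) (hK : K ≤ k)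
    (hk : SobMul (dirY d) K) (hv : Dom (fun p => sobNorm (dirX d) K (v p)) fun _ => 1)
    (hθ : Dom (fun p => sobNorm (dirY d) K (θ p)) fun _ => 1) :
    Dom (fun p => hsHk ι S K fun ξ => calM Φ₀ ψ χ g (v p) (θ p) (T (-γ p) ξ)) fun _ => 1 := by
  refine dom_twoSummingNorm ?_
  have hB := dom_noise (γ := γ) hg hT H.contDiff.continuous (H.dom_perturbation hK hk hv hθ)
  have hBt := lt_top_of_dom_l2 hB
  obtain ⟨C, hC⟩ := H.dom_coproj (P := (P × HilbertBasis ι ℝ W) × ι) hK hk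
    (θ := fun x => θ x.1.1)
    (w := fun x => g (stateCls Φ₀ (v x.1.1) (θ x.1.1)) (T (-γ x.1.1) (S (x.1.2 x.2))))
    (hθ.comp fun x : (P × HilbertBasis ι ℝ W) × ι => x.1.1)
    fun x => hBt x.1 x.2
  exact Dom.trans ⟨C, fun x => (l2_mono fun j => hC (x, j)).trans (l2_const_mul _ _)⟩ hB

theorem dom_noiseM_L1 (hg : HypG ι K Φ₀ S T g) (hL : HypL1 ι K Φ₀ ψ S g) (hT : IsShiftGroup T)
    (hK : K ≤ k) (hk : SobMul (dirY d) K)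
    (hv : Dom (fun p => sobNorm (dirX d) K (v p)) fun _ => 1)
    (hθ : Dom (fun p => sobNorm (dirY d) K (θ p)) fun _ => 1) :
    Dom (fun p => pi2L1 ι S fun ξ => noiseM Φ₀ ψ χ g (v p) (θ p) (T (-γ p) ξ)) fun _ => 1 := by
  refine dom_twoSummingNorm ?_
  refine (Dom.l2 ⟨4, fun x => ?_⟩).trans (dom_noise_L1 (γ := γ) hg hL hT H.contDiff.continuous
    H.memLp (H.dom_perturbation hK hk hv hθ))
  exact_mod_cast normL1_proj_le (Φ₀ := Φ₀) H.cutoff (θ := θ x.1.1)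
    (aestronglyMeasurable_inner_comp_fst H.memLp fun c =>
      (EuclideanSpace.proj c : V n →L[ℝ] ℝ).continuous.comp_aestronglyMeasurable
        (AEEqFun.aestronglyMeasurable _))

section Difference

variable (hg : HypG ι K Φ₀ S T g) (hT : IsShiftGroup T) (hK : K ≤ k) (hk : SobMul (dirY d) K)
  (hvA : Dom (fun p => sobNorm (dirX d) K (vA p)) fun _ => 1)
  (hvB : Dom (fun p => sobNorm (dirX d) K (vB p)) fun _ => 1)
  (hA : Dom (fun p => sobNorm (dirY d) K (θA p)) fun _ => 1)
  (hB : Dom (fun p => sobNorm (dirY d) K (θB p)) fun _ => 1)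
include hg hT hK hk hvA hvB hA hB

theorem dom_noise_difference :
    Dom (fun x : P × HilbertBasis ι ℝ W => l2 fun j => sobNorm (dirX d) K fun q =>
        g (stateCls Φ₀ (vA x.1) (θA x.1)) (T (-γ x.1) (S (x.2 j))) q -
          g (stateCls Φ₀ (vB x.1) (θB x.1)) (T (-γ x.1) (S (x.2 j))) q)
      fun x => sobNorm (dirX d) K (fun q => vA x.1 q - vB x.1 q) +
        sobNorm (dirY d) K (fun y => θA x.1 y - θB x.1 y) :=
  (dom_noise_sub hg hT H.contDiff.continuous (H.dom_perturbation hK hk hvA hA)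
    (H.dom_perturbation hK hk hvB hB)).trans
    ((H.dom_perturbation_sub hK hk hvA hvB hA hB).comp Prod.fst)

/-- Passage to `ℓ²` norms in the Lipschitz estimates for `proj` and `coproj`, uniformly over the
orthonormal bases. -/
theorem dom_l2_of_dom_sub {a : (P × HilbertBasis ι ℝ W) → ι → ℝ≥0∞}
    (h : ∃ C : ℝ≥0, ∀ x j, a x j ≤ C * (sobNorm (dirX d) K (fun q =>
        g (stateCls Φ₀ (vA x.1) (θA x.1)) (T (-γ x.1) (S (x.2 j))) q -
          g (stateCls Φ₀ (vB x.1) (θB x.1)) (T (-γ x.1) (S (x.2 j))) q) +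
        sobNorm (dirY d) K (fun y => θA x.1 y - θB x.1 y) *
          (sobNorm (dirX d) K (g (stateCls Φ₀ (vA x.1) (θA x.1)) (T (-γ x.1) (S (x.2 j)))) +
          sobNorm (dirX d) K (g (stateCls Φ₀ (vB x.1) (θB x.1)) (T (-γ x.1) (S (x.2 j))))))) :
    Dom (fun x => l2 (a x)) fun x => sobNorm (dirX d) K (fun q => vA x.1 q - vB x.1 q) +
        sobNorm (dirY d) K (fun y => θA x.1 y - θB x.1 y) := by
  have hA' := dom_noise (γ := γ) hg hT H.contDiff.continuous (H.dom_perturbation hK hk hvA hA)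
  have hB' := dom_noise (γ := γ) hg hT H.contDiff.continuous (H.dom_perturbation hK hk hvB hB)
  have h2 := (Dom.l2_add hA' hB').l2_const_mul
    (B' := fun x : P × HilbertBasis ι ℝ W => sobNorm (dirY d) K fun y => θA x.1 y - θB x.1 y)
  simp only [mul_one] at h2
  obtain ⟨C, hC⟩ := h
  exact Dom.trans ⟨C, fun x => (l2_mono fun j => hC x j).trans (l2_const_mul _ _)⟩
    (Dom.l2_add (H.dom_noise_difference hg hT hK hk hvA hvB hA hB)
      (h2.trans (Dom.of_le fun x => le_add_self)))

theorem dom_noiseM_sub :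
    Dom (fun p => hsHky ι S K fun ξ => noiseM Φ₀ ψ χ g (vA p) (θA p) (T (-γ p) ξ) -
        noiseM Φ₀ ψ χ g (vB p) (θB p) (T (-γ p) ξ))
      fun p => sobNorm (dirX d) K (fun q => vA p q - vB p q) +
        sobNorm (dirY d) K (fun y => θA p y - θB p y) := by
  refine dom_twoSummingNorm ?_
  have hAt := lt_top_of_dom_l2
    (dom_noise (γ := γ) hg hT H.contDiff.continuous (H.dom_perturbation hK hk hvA hA))
  have hBt := lt_top_of_dom_l2
    (dom_noise (γ := γ) hg hT H.contDiff.continuous (H.dom_perturbation hK hk hvB hB))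
  obtain ⟨C, hC⟩ := H.dom_proj_sub (P := (P × HilbertBasis ι ℝ W) × ι) hK hk
    (θA := fun x => θA x.1.1) (θB := fun x => θB x.1.1)
    (wA := fun x => g (stateCls Φ₀ (vA x.1.1) (θA x.1.1)) (T (-γ x.1.1) (S (x.1.2 x.2))))
    (wB := fun x => g (stateCls Φ₀ (vB x.1.1) (θB x.1.1)) (T (-γ x.1.1) (S (x.1.2 x.2))))
    (hA.comp fun x : (P × HilbertBasis ι ℝ W) × ι => x.1.1)
    (hB.comp fun x : (P × HilbertBasis ι ℝ W) × ι => x.1.1)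
    (fun x => hAt x.1 x.2) (fun x => hBt x.1 x.2) fun x => sobNorm_vec_sub_lt_top (hAt x.1 x.2) (hBt x.1 x.2)
  exact H.dom_l2_of_dom_sub hg hT hK hk hvA hvB hA hB ⟨C, fun x j => hC (x, j)⟩

theorem dom_calM_sub :
    Dom (fun p => hsHk ι S K fun ξ => calM Φ₀ ψ χ g (vA p) (θA p) (T (-γ p) ξ) -
        calM Φ₀ ψ χ g (vB p) (θB p) (T (-γ p) ξ))
      fun p => sobNorm (dirX d) K (fun q => vA p q - vB p q) +
        sobNorm (dirY d) K (fun y => θA p y - θB p y) := by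
  refine dom_twoSummingNorm ?_
  have hAt := lt_top_of_dom_l2
    (dom_noise (γ := γ) hg hT H.contDiff.continuous (H.dom_perturbation hK hk hvA hA))
  have hBt := lt_top_of_dom_l2
    (dom_noise (γ := γ) hg hT H.contDiff.continuous (H.dom_perturbation hK hk hvB hB))
  obtain ⟨C, hC⟩ := H.dom_coproj_sub (P := (P × HilbertBasis ι ℝ W) × ι) hK hk
    (θA := fun x => θA x.1.1) (θB := fun x => θB x.1.1)
    (wA := fun x => g (stateCls Φ₀ (vA x.1.1) (θA x.1.1)) (T (-γ x.1.1) (S (x.1.2 x.2))))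
    (wB := fun x => g (stateCls Φ₀ (vB x.1.1) (θB x.1.1)) (T (-γ x.1.1) (S (x.1.2 x.2))))
    (hA.comp fun x : (P × HilbertBasis ι ℝ W) × ι => x.1.1)
    (hB.comp fun x : (P × HilbertBasis ι ℝ W) × ι => x.1.1)
    (fun x => hAt x.1 x.2) (fun x => hBt x.1 x.2) fun x => sobNorm_vec_sub_lt_top (hAt x.1 x.2) (hBt x.1 x.2)
  exact H.dom_l2_of_dom_sub hg hT hK hk hvA hvB hA hB ⟨C, fun x j => hC (x, j)⟩

theorem dom_noiseInner_sub (e : HilbertBasis ι ℝ W) :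
    Dom (fun p => l2 fun j => sobNorm (dirY d) K fun y =>
        noiseInner ψ Φ₀ S T g e (vA p) (θA p) (γ p) j y -
          noiseInner ψ Φ₀ S T g e (vB p) (θB p) (γ p) j y)
      fun p => sobNorm (dirX d) K (fun q => vA p q - vB p q) +
        sobNorm (dirY d) K (fun y => θA p y - θB p y) := by
  have hAt := lt_top_of_dom_l2
    (dom_noise (γ := γ) hg hT H.contDiff.continuous (H.dom_perturbation hK hk hvA hA))
  have hBt := lt_top_of_dom_l2
    (dom_noise (γ := γ) hg hT H.contDiff.continuous (H.dom_perturbation hK hk hvB hB))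
  obtain ⟨C, hC⟩ := dom_innerX_sub (P := P × ι) (s := K) H.memLp
    (w := fun x => g (stateCls Φ₀ (vA x.1) (θA x.1)) (T (-γ x.1) (S (e x.2))))
    (w' := fun x => g (stateCls Φ₀ (vB x.1) (θB x.1)) (T (-γ x.1) (S (e x.2))))
    (fun x c => memLp_apply (hAt (x.1, e) x.2) c) (fun x c => memLp_apply (hBt (x.1, e) x.2) c)
    fun x => sobNorm_vec_sub_lt_top (hAt (x.1, e) x.2) (hBt (x.1, e) x.2)
  exact Dom.trans ⟨C, fun p => (l2_mono fun j => hC (p, j)).trans (l2_const_mul _ _)⟩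
    ((H.dom_noise_difference (γ := γ) hg hT hK hk hvA hvB hA hB).comp fun p => (p, e))

end Difference

theorem dom_noiseInner (hg : HypG ι K Φ₀ S T g) (hT : IsShiftGroup T) (hK : K ≤ k)
    (hk : SobMul (dirY d) K) (hv : Dom (fun p => sobNorm (dirX d) K (v p)) fun _ => 1)
    (hθ : Dom (fun p => sobNorm (dirY d) K (θ p)) fun _ => 1) (e : HilbertBasis ι ℝ W) :
    Dom (fun p => l2 fun j => sobNorm (dirY d) K
      (noiseInner ψ Φ₀ S T g e (v p) (θ p) (γ p) j)) fun _ => 1 := by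
  have hB : Dom (fun p => l2 fun j => sobNorm (dirX d) K
      (g (stateCls Φ₀ (v p) (θ p)) (T (-γ p) (S (e j))))) fun _ => 1 :=
    (dom_noise (γ := γ) hg hT H.contDiff.continuous
      (H.dom_perturbation hK hk hv hθ)).comp fun p => (p, e)
  have hBt := lt_top_of_dom_l2 hB
  obtain ⟨C, hC⟩ := dom_innerX (P := P × ι) (s := K) H.memLp
    (w := fun x => g (stateCls Φ₀ (v x.1) (θ x.1)) (T (-γ x.1) (S (e x.2))))
    fun x => hBt x.1 x.2
  exact Dom.trans ⟨C, fun p => (l2_mono fun j => hC (p, j)).trans (l2_const_mul _ _)⟩ hB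

/-- The quadratic bound for the two drift terms; by definition, these are `proj` and `coproj` of
`drift`. -/
theorem dom_drift_terms (hf : HypF k f um up) (hTw : HypTw f um up Φ₀ c₀)
    (hg : HypG ι k Φ₀ S T g) (hT : IsShiftGroup T) (hk : SobMul (dirY d) k)
    (hkX : SobMul (dirX d) k) (e : HilbertBasis ι ℝ W)
    (hv : Dom (fun p => sobNorm (dirX d) k (v p)) fun _ => 1)
    (hθ : Dom (fun p => sobNorm (dirY d) k (θ p)) fun _ => 1)
    (hθt : ∀ p, sobNorm (dirY d) (k + 1) (θ p) < ⊤) :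
    Dom (fun p => (normHky k (Nsig f Φ₀ ψ χ e S T g (σ p) (v p) (θ p) (γ p)) +
          normL1 (Nsig f Φ₀ ψ χ e S T g (σ p) (v p) (θ p) (γ p))) +
        normHk k (calNsig f Φ₀ ψ χ e S T g (σ p) (v p) (θ p) (γ p)))
      fun p => boundRHS k (σ p) (v p) (θ p) := by
  have hm := H.dom_noiseInner (γ := γ) hg hT le_rfl hk hv hθ e
  have hR := H.dom_tiltCoeff (σ := σ) le_rfl hk hθ hθt hm
  have hvt : ∀ p, sobNorm (dirX d) k (v p) < ⊤ := fun p => hv.lt_top ENNReal.one_lt_top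
  have hθt' : ∀ p, sobNorm (dirY d) k (θ p) < ⊤ := fun p => hθ.lt_top ENNReal.one_lt_top
  have hRt : ∀ p, ENNReal.ofReal (σ p ^ 2) + sobNorm (dirY d) k (gradY (θ p)) ^ 2 < ⊤ := fun p =>
    ENNReal.add_lt_top.2 ⟨ENNReal.ofReal_lt_top,
      ENNReal.pow_lt_top ((dom_sobNorm_gradY hθt).lt_top (hθt p))⟩
  have hRlt := fun p => hR.lt_top (hRt p)
  have hb : Dom (fun p => (sobNorm (dirY d) k (θ p) + sobNorm (dirX d) k (v p)) *
      sobNorm (dirX d) k (v p) + (ENNReal.ofReal (σ p ^ 2) +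
        sobNorm (dirY d) k (gradY (θ p)) ^ 2)) fun p => boundRHS k (σ p) (v p) (θ p) :=
    Dom.of_le fun p => le_of_eq (by simp only [boundRHS, normHk, normHky]; ring)
  have hF := (H.dom_drift hf hTw le_rfl hk hkX hθ hv hRlt)
  have hFt : ∀ p, sobNorm (dirX d) k (drift f Φ₀ ψ χ (σ p) (v p) (θ p)
      (noiseInner ψ Φ₀ S T g e (v p) (θ p) (γ p))) < ⊤ := fun p =>
    hF.lt_top (ENNReal.add_lt_top.2 ⟨ENNReal.mul_lt_top
      (ENNReal.add_lt_top.2 ⟨hθt' p, hvt p⟩) (hvt p), hRlt p⟩)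
  have hF' := (hF.trans ((Dom.refl _).add_add hR)).trans hb
  have h1 := (H.dom_proj le_rfl hk hθ hFt).trans hF'
  have h2 := (H.dom_coproj le_rfl hk hθ hFt).trans hF'
  have h3 := ((H.dom_normL1_inner_drift hf hTw le_rfl hk hkX hθ hv hRlt).trans
    ((Dom.refl _).add_add (H.dom_normL1_tiltCoeff hθt hm))).trans hb
  have h4 : Dom (fun p => normL1 (proj Φ₀ ψ χ (θ p) (drift f Φ₀ ψ χ (σ p) (v p) (θ p)
      (noiseInner ψ Φ₀ S T g e (v p) (θ p) (γ p))))) _ :=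
    Dom.trans ⟨4, fun p => by
      exact_mod_cast normL1_proj_le H.cutoff (aestronglyMeasurable_inner_comp_fst H.memLp fun c =>
        (memLp_apply (hFt p) c).1)⟩ h3
  exact (h1.add h4).add h2

/-- The Lipschitz bound for the two drift terms at level `K`, when the noise coefficient is
Lipschitz at level `L ≥ K`. -/
theorem dom_drift_terms_sub (hf : HypF k f um up) (hTw : HypTw f um up Φ₀ c₀)
    (hg : HypG ι L Φ₀ S T g) (hT : IsShiftGroup T) (hKL : K ≤ L) (hLk : L ≤ k) (hKk : K + 1 ≤ k)
    (hk : SobMul (dirY d) K) (hkX : SobMul (dirX d) K) (e : HilbertBasis ι ℝ W)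
    (hσ : ∀ p, |σ p| ≤ 1)
    (hvA : Dom (fun p => sobNorm (dirX d) L (vA p)) fun _ => 1)
    (hvB : Dom (fun p => sobNorm (dirX d) L (vB p)) fun _ => 1)
    (hAL : Dom (fun p => sobNorm (dirY d) L (θA p)) fun _ => 1)
    (hBL : Dom (fun p => sobNorm (dirY d) L (θB p)) fun _ => 1)
    (hA : Dom (fun p => sobNorm (dirY d) (K + 1) (θA p)) fun _ => 1)
    (hB : Dom (fun p => sobNorm (dirY d) (K + 1) (θB p)) fun _ => 1) :
    Dom (fun p => normHky K (Nsig f Φ₀ ψ χ e S T g (σ p) (vA p) (θA p) (γ p) -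
          Nsig f Φ₀ ψ χ e S T g (σ p) (vB p) (θB p) (γ p)) +
        normHk K (calNsig f Φ₀ ψ χ e S T g (σ p) (vA p) (θA p) (γ p) -
          calNsig f Φ₀ ψ χ e S T g (σ p) (vB p) (θB p) (γ p)))
      fun p => normHk K (vA p - vB p) + ENNReal.ofReal (σ p ^ 2) *
        (normHk L (vA p - vB p) + normHky L (θA p - θB p)) +
          normHky (K + 1) (θA p - θB p) := by
  have hKk' : K ≤ k := by omega
  have hone : ∀ p : P, (fun _ : P => (1 : ℝ≥0∞)) p < ⊤ := fun _ => ENNReal.one_lt_top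
  have hvA' := (Dom.of_le fun p => sobNorm_mono (dirX d) hKL (vA p)).trans hvA
  have hvB' := (Dom.of_le fun p => sobNorm_mono (dirX d) hKL (vB p)).trans hvB
  have hA' := (Dom.of_le fun p => sobNorm_mono (dirY d) K.le_succ (θA p)).trans hA
  have hB' := (Dom.of_le fun p => sobNorm_mono (dirY d) K.le_succ (θB p)).trans hB
  have hkL := hk.mono hKL
  -- The pairings are estimated at level `L`, where the noise coefficient is controlled, and only
  -- then restricted to level `K`.
  have hmono : ∀ m : P → ι → Y d → ℝ, Dom (fun p => l2 fun j => sobNorm (dirY d) K (m p j))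
      fun p => l2 fun j => sobNorm (dirY d) L (m p j) := fun m =>
    Dom.of_le fun p => l2_mono fun j => sobNorm_mono _ hKL _
  have hmA := (hmono _).trans (H.dom_noiseInner (γ := γ) hg hT hLk hkL hvA hAL e)
  have hmB := (hmono _).trans (H.dom_noiseInner (γ := γ) hg hT hLk hkL hvB hBL e)
  have hm := (hmono fun p j y => noiseInner ψ Φ₀ S T g e (vA p) (θA p) (γ p) j y -
      noiseInner ψ Φ₀ S T g e (vB p) (θB p) (γ p) j y).trans
    (H.dom_noiseInner_sub (γ := γ) hg hT hLk hkL hvA hvB hAL hBL e)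
  have hδ : ∀ {s : ℕ}, Dom (fun p => sobNorm (dirY d) s (θA p)) (fun _ => 1) →
      Dom (fun p => sobNorm (dirY d) s (θB p)) (fun _ => 1) → ∀ p,
      sobNorm (dirY d) s (fun y => θA p y - θB p y) < ⊤ := fun h h' p =>
    sobNorm_sub_lt_top (h.lt_top (hone p)) (h'.lt_top (hone p))
  have hvt : ∀ {s : ℕ}, Dom (fun p => sobNorm (dirX d) s (vA p)) (fun _ => 1) →
      Dom (fun p => sobNorm (dirX d) s (vB p)) (fun _ => 1) → ∀ p,
      sobNorm (dirX d) s (fun q => vA p q - vB p q) < ⊤ := fun h h' p =>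
    sobNorm_vec_sub_lt_top (h.lt_top (hone p)) (h'.lt_top (hone p))
  have hDt : ∀ p, sobNorm (dirX d) L (fun q => vA p q - vB p q) +
      sobNorm (dirY d) L (fun y => θA p y - θB p y) < ⊤ := fun p =>
    ENNReal.add_lt_top.2 ⟨hvt hvA hvB p, hδ hAL hBL p⟩
  have hRs := H.dom_tiltCoeff_sub (σ := σ) hKk' hk hσ hA hB hmA hmB hDt hm
  have hRst := fun p => hRs.lt_top (p := p) (ENNReal.add_lt_top.2
    ⟨ENNReal.mul_lt_top ENNReal.ofReal_lt_top (hDt p), hδ hA hB p⟩)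
  have hRone : ∀ {v : P → X d → V n} {θ : P → Y d → ℝ},
      Dom (fun p => sobNorm (dirY d) (K + 1) (θ p)) (fun _ => 1) →
      Dom (fun p => l2 fun j => sobNorm (dirY d) K (noiseInner ψ Φ₀ S T g e (v p) (θ p) (γ p) j))
        (fun _ => 1) →
      Dom (fun p => sobNorm (dirY d) K (tiltCoeff Φ₀ ψ χ (σ p) (θ p)
        (noiseInner ψ Φ₀ S T g e (v p) (θ p) (γ p)))) fun _ => 1 := by
    intro v θ hθ hm
    have hgr := ((dom_sobNorm_gradY fun p => hθ.lt_top (hone p)).trans hθ).sq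
    simp only [one_pow] at hgr
    refine (H.dom_tiltCoeff hKk' hk ((Dom.of_le fun p => sobNorm_mono (dirY d) K.le_succ
      (θ p)).trans hθ) (fun p => hθ.lt_top (hone p)) hm).trans (Dom.add (Dom.of_le fun p => ?_) hgr)
    rw [ENNReal.ofReal_le_one, sq_le_one_iff_abs_le_one]
    exact hσ p
  have hRA := hRone hA hmA
  have hRB := hRone hB hmB
  have hF := H.dom_drift_sub (σ := σ) hf hTw hKk hk hkX hA' hB' hvA' hvB' (hvt hvA' hvB') hRB hRst
  have hFone : ∀ {v : P → X d → V n} {θ : P → Y d → ℝ},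
      Dom (fun p => sobNorm (dirY d) K (θ p)) (fun _ => 1) →
      Dom (fun p => sobNorm (dirX d) K (v p)) (fun _ => 1) →
      Dom (fun p => sobNorm (dirY d) K (tiltCoeff Φ₀ ψ χ (σ p) (θ p)
        (noiseInner ψ Φ₀ S T g e (v p) (θ p) (γ p)))) (fun _ => 1) →
      Dom (fun p => sobNorm (dirX d) K (drift f Φ₀ ψ χ (σ p) (v p) (θ p)
        (noiseInner ψ Φ₀ S T g e (v p) (θ p) (γ p)))) fun _ => 1 := by
    intro v θ hθ hv hR
    refine (H.dom_drift hf hTw hKk' hk hkX hθ hv fun p => hR.lt_top (hone p)).trans (Dom.add ?_ hR)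
    simpa only [mul_one] using (hθ.add hv).mul hv
  have hFA := hFone hA' hvA' hRA
  have hFB := hFone hB' hvB' hRB
  have hFt := fun p => hF.lt_top (p := p) (ENNReal.add_lt_top.2
    ⟨ENNReal.add_lt_top.2 ⟨hvt hvA' hvB' p, hδ hA' hB' p⟩, hRst p⟩)
  have hsum := (Dom.refl fun p => sobNorm (dirY d) K (fun y => θA p y - θB p y)).mul (hFA.add hFB)
  simp only [mul_one] at hsum
  have hθle : Dom (fun p => sobNorm (dirY d) K (fun y => θA p y - θB p y)) fun p =>
      normHk K (vA p - vB p) + ENNReal.ofReal (σ p ^ 2) *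
        (normHk L (vA p - vB p) + normHky L (θA p - θB p)) + normHky (K + 1) (θA p - θB p) :=
    Dom.of_le fun p => (sobNorm_mono (dirY d) K.le_succ _).trans le_add_self
  -- The difference of the coefficients of `T_θ Φ₀''` carries the contribution of the pairings, with
  -- the factor `σ²`.
  have hFle := hF.trans (Dom.add (Dom.add (Dom.of_le fun p => le_self_add.trans le_self_add) hθle)
    (hRs.trans (Dom.of_le fun p => add_le_add_left
      (le_add_self (a := ENNReal.ofReal (σ p ^ 2) *
        (normHk L (vA p - vB p) + normHky L (θA p - θB p))) (b := normHk K (vA p - vB p))) _)))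
  have h1 := (H.dom_proj_sub hKk' hk hA' hB' (fun p => hFA.lt_top (hone p))
    (fun p => hFB.lt_top (hone p)) hFt).trans (hFle.add (hsum.trans hθle))
  have h2 := (H.dom_coproj_sub hKk' hk hA' hB' (fun p => hFA.lt_top (hone p))
    (fun p => hFB.lt_top (hone p)) hFt).trans (hFle.add (hsum.trans hθle))
  exact h1.add h2

end WaveData

end Nonlinearities

end PlanarWave

namespace PlanarWave

open scoped NNReal Topology
open Filter

/-! ### Uniform constants on bounded sets -/

section Uniform

variable {d n k K L : ℕ} {P ι W : Type*} [Countable ι] [NormedAddCommGroup W]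
  [InnerProductSpace ℝ W] {f : V n → V n} {um up : V n} {c₀ : ℝ} {Φ₀ ψ : ℝ → V n} {χ : ℝ → ℝ}
  {S : W →L[ℝ] W} {T : ℝ → W →L[ℝ] W}
  {g : (X d →ₘ[volume] V n) → W →ₗ[ℝ] (X d →ₘ[volume] V n)}

/-- The Lipschitz bound for the noise terms on bounded sets. -/
theorem WaveData.exists_noise_lipschitz (H : WaveData k Φ₀ ψ χ) (hT : IsShiftGroup T)
    (hk : SobMul (dirY d) k) (hg : HypG ι k Φ₀ S T g) (N : ℝ) : ∃ K : ℝ, 0 < K ∧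
        ∀ (γ : ℝ) (vA vB : X d → V n) (θA θB : Y d → ℝ),
        normHk k vA ≤ ENNReal.ofReal N → normHk k vB ≤ ENNReal.ofReal N →
        normHky k θA ≤ ENNReal.ofReal N → normHky k θB ≤ ENNReal.ofReal N →
        hsHky ι S k (fun ξ => noiseM Φ₀ ψ χ g vA θA (T (-γ) ξ) - noiseM Φ₀ ψ χ g vB θB (T (-γ) ξ))
          + hsHk ι S k (fun ξ => calM Φ₀ ψ χ g vA θA (T (-γ) ξ) - calM Φ₀ ψ χ g vB θB (T (-γ) ξ))
            ≤ ENNReal.ofReal K * (normHk k (vA - vB) + normHky k (θA - θB)) := by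
  -- The parameter set of all shifts and pairs of states with norms at most `N`.
  let P := {p : ℝ × (X d → V n) × (X d → V n) × (Y d → ℝ) × (Y d → ℝ) //
    (normHk k p.2.1 ≤ ENNReal.ofReal N ∧ normHk k p.2.2.1 ≤ ENNReal.ofReal N) ∧
      normHky k p.2.2.2.1 ≤ ENNReal.ofReal N ∧ normHky k p.2.2.2.2 ≤ ENNReal.ofReal N}
  have hvA : Dom (fun p : P => sobNorm (dirX d) k p.1.2.1) fun _ => 1 :=
    dom_one_of_le fun p => p.2.1.1
  have hvB : Dom (fun p : P => sobNorm (dirX d) k p.1.2.2.1) fun _ => 1 :=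
    dom_one_of_le fun p => p.2.1.2
  have hA : Dom (fun p : P => sobNorm (dirY d) k p.1.2.2.2.1) fun _ => 1 :=
    dom_one_of_le fun p => p.2.2.1
  have hB : Dom (fun p : P => sobNorm (dirY d) k p.1.2.2.2.2) fun _ => 1 :=
    dom_one_of_le fun p => p.2.2.2
  obtain ⟨K, hK, h⟩ := ((H.dom_noiseM_sub (γ := fun p : P => p.1.1) hg hT le_rfl hk
    hvA hvB hA hB).add (H.dom_calM_sub (γ := fun p : P => p.1.1) hg hT le_rfl hk
    hvA hvB hA hB)).exists_real
  exact ⟨K, hK, fun γ vA vB θA θB h1 h2 h3 h4 => h ⟨(γ, vA, vB, θA, θB), ⟨h1, h2⟩, h3, h4⟩⟩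

/-- The Lipschitz bound for the drift terms on bounded sets, at level `k - 1`, when the noise
coefficient is Lipschitz at a level `L` between `k - 1` and `k`. -/
theorem WaveData.exists_drift_lipschitz (H : WaveData k Φ₀ ψ χ) (hf : HypF k f um up)
    (hTw : HypTw f um up Φ₀ c₀) (hT : IsShiftGroup T) (hk' : SobMul (dirY d) (k - 1))
    (hkX' : SobMul (dirX d) (k - 1)) (hkk : k - 1 + 1 = k) (e : HilbertBasis ι ℝ W)
    (hkL : k - 1 ≤ L) (hLk : L ≤ k) (hgL : HypG ι L Φ₀ S T g) (N : ℝ) : ∃ K : ℝ, 0 < K ∧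
        ∀ (γ : ℝ) (vA vB : X d → V n) (θA θB : Y d → ℝ),
        normHk k vA ≤ ENNReal.ofReal N → normHk k vB ≤ ENNReal.ofReal N →
        normHky k θA ≤ ENNReal.ofReal N → normHky k θB ≤ ENNReal.ofReal N →
        ∀ σ : ℝ, 0 ≤ σ → σ ≤ 1 →
          normHky (k - 1) (Nsig f Φ₀ ψ χ e S T g σ vA θA γ - Nsig f Φ₀ ψ χ e S T g σ vB θB γ) +
          normHk (k - 1)
            (calNsig f Φ₀ ψ χ e S T g σ vA θA γ - calNsig f Φ₀ ψ χ e S T g σ vB θB γ)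
            ≤ ENNReal.ofReal K * (normHk (k - 1) (vA - vB) +
              ENNReal.ofReal (σ ^ 2) * normHk L (vA - vB) + normHky k (θA - θB)) := by
  -- The parameters are `((γ, σ), vA, vB, θA, θB)`, with `|σ| ≤ 1` and norms at most `N`.
  let P := {p : (ℝ × ℝ) × (X d → V n) × (X d → V n) × (Y d → ℝ) × (Y d → ℝ) //
    |p.1.2| ≤ 1 ∧ (normHk k p.2.1 ≤ ENNReal.ofReal N ∧ normHk k p.2.2.1 ≤ ENNReal.ofReal N) ∧
      normHky k p.2.2.2.1 ≤ ENNReal.ofReal N ∧ normHky k p.2.2.2.2 ≤ ENNReal.ofReal N}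
  have hvA : Dom (fun p : P => sobNorm (dirX d) L p.1.2.1) fun _ => 1 :=
    dom_one_of_le fun p => (sobNorm_mono _ hLk _).trans p.2.2.1.1
  have hvB : Dom (fun p : P => sobNorm (dirX d) L p.1.2.2.1) fun _ => 1 :=
    dom_one_of_le fun p => (sobNorm_mono _ hLk _).trans p.2.2.1.2
  have hA : ∀ s ≤ k, Dom (fun p : P => sobNorm (dirY d) s p.1.2.2.2.1) fun _ => 1 := fun s hs =>
    dom_one_of_le fun p => (sobNorm_mono _ hs _).trans p.2.2.2.1
  have hB : ∀ s ≤ k, Dom (fun p : P => sobNorm (dirY d) s p.1.2.2.2.2) fun _ => 1 := fun s hs =>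
    dom_one_of_le fun p => (sobNorm_mono _ hs _).trans p.2.2.2.2
  obtain ⟨K, hK, h⟩ := (H.dom_drift_terms_sub (P := P) (γ := fun p => p.1.1.1)
    (σ := fun p => p.1.1.2) hf hTw hgL hT hkL hLk hkk.le hk' hkX' e
    (fun p => p.2.1) hvA hvB (hA L hLk) (hB L hLk) (hA _ hkk.le) (hB _ hkk.le)).exists_real
  refine ⟨K * 2, by positivity, fun γ vA vB θA θB h1 h2 h3 h4 σ hσ0 hσ1 => ?_⟩
  refine (h ⟨((γ, σ), vA, vB, θA, θB), abs_le.2 ⟨by linarith, hσ1⟩, ⟨h1, h2⟩, h3, h4⟩).trans ?_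
  -- The term `σ² ‖θA - θB‖` at level `L` is absorbed into `‖θA - θB‖` at level `k`, as `σ ≤ 1`.
  have hs : ENNReal.ofReal (σ ^ 2) ≤ 1 := by
    rw [ENNReal.ofReal_le_one]
    exact pow_le_one₀ hσ0 hσ1
  have hθ : ENNReal.ofReal (σ ^ 2) * normHky L (θA - θB) ≤ normHky k (θA - θB) :=
    (mul_le_mul_left hs _).trans ((one_mul _).le.trans (sobNorm_mono _ hLk _))
  rw [ENNReal.ofReal_mul hK.le, mul_assoc, ENNReal.ofReal_ofNat, hkk]
  refine mul_le_mul_right ?_ _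
  calc _ ≤ normHk (k - 1) (vA - vB) + (ENNReal.ofReal (σ ^ 2) * normHk L (vA - vB) +
        normHky k (θA - θB)) + normHky k (θA - θB) := by
        rw [mul_add]
        gcongr
    _ ≤ _ := by
        rw [← add_assoc, two_mul]
        gcongr
        exact le_add_self

end Uniform

end PlanarWave

theorem mainTheorem9 {d n : ℕ} (hd : 2 ≤ d)
    {ι W : Type*} [Countable ι] [NormedAddCommGroup W] [InnerProductSpace ℝ W] [CompleteSpace W]
    (e : HilbertBasis ι ℝ W) (Q S : W →L[ℝ] W) (hS : IsSqrt S Q)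
    (T : ℝ → W →L[ℝ] W) (hT : IsShiftGroup T)
    (g : (X d →ₘ[volume] V n) → W →ₗ[ℝ] (X d →ₘ[volume] V n))
    (f : V n → V n) (um up : V n) (Φ₀ : ℝ → V n) (c₀ : ℝ) (ψ : ℝ → V n) (χ : ℝ → ℝ) (k : ℕ)
    (hf : HypF k f um up) (hTw : HypTw f um up Φ₀ c₀) (hψ : IsAdjointKernel f Φ₀ c₀ ψ)
    (hχ : IsCutoff χ) (hg : HypG ι k Φ₀ S T g) :
    -- uniform bounds
    ((d : ℝ) / 2 < k → HypL1 ι k Φ₀ ψ S g →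
      ∀ N : ℝ, 0 < N → ∃ K : ℝ, 0 < K ∧ ∀ (γ : ℝ) (v : X d → V n) (θ : Y d → ℝ),
        normHk k v ≤ ENNReal.ofReal N → normHky k θ ≤ ENNReal.ofReal N →
        (hsHky ι S k (fun ξ => noiseM Φ₀ ψ χ g v θ (T (-γ) ξ))
            + pi2L1 ι S (fun ξ => noiseM Φ₀ ψ χ g v θ (T (-γ) ξ)) ≤ ENNReal.ofReal K ∧
          hsHk ι S k (fun ξ => calM Φ₀ ψ χ g v θ (T (-γ) ξ)) ≤ ENNReal.ofReal K) ∧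
        (normHky (k + 1) θ < ⊤ → ∀ σ : ℝ,
          normHky k (Nsig f Φ₀ ψ χ e S T g σ v θ γ) + normL1 (Nsig f Φ₀ ψ χ e S T g σ v θ γ)
              ≤ ENNReal.ofReal K * boundRHS k σ v θ ∧
          normHk k (calNsig f Φ₀ ψ χ e S T g σ v θ γ) ≤ ENNReal.ofReal K * boundRHS k σ v θ)) ∧
    -- local Lipschitz bounds
    ((d : ℝ) / 2 + 1 < k →
      -- for the noise terms, and for the drift terms under the hypotheses at level `k` alone
      (∀ N : ℝ, 0 < N → ∃ K : ℝ, 0 < K ∧ ∀ (γ : ℝ) (vA vB : X d → V n) (θA θB : Y d → ℝ),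
        normHk k vA ≤ ENNReal.ofReal N → normHk k vB ≤ ENNReal.ofReal N →
        normHky k θA ≤ ENNReal.ofReal N → normHky k θB ≤ ENNReal.ofReal N →
        (hsHky ι S k (fun ξ => noiseM Φ₀ ψ χ g vA θA (T (-γ) ξ) - noiseM Φ₀ ψ χ g vB θB (T (-γ) ξ))
            ≤ ENNReal.ofReal K * (normHk k (vA - vB) + normHky k (θA - θB)) ∧
          hsHk ι S k (fun ξ => calM Φ₀ ψ χ g vA θA (T (-γ) ξ) - calM Φ₀ ψ χ g vB θB (T (-γ) ξ))
            ≤ ENNReal.ofReal K * (normHk k (vA - vB) + normHky k (θA - θB))) ∧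
        ∀ σ : ℝ, 0 ≤ σ → σ ≤ 1 →
          normHky (k - 1) (Nsig f Φ₀ ψ χ e S T g σ vA θA γ - Nsig f Φ₀ ψ χ e S T g σ vB θB γ)
            ≤ ENNReal.ofReal K * (normHk (k - 1) (vA - vB)
                + ENNReal.ofReal (σ ^ 2) * normHk k (vA - vB) + normHky k (θA - θB)) ∧
          normHk (k - 1)
              (calNsig f Φ₀ ψ χ e S T g σ vA θA γ - calNsig f Φ₀ ψ χ e S T g σ vB θB γ)
            ≤ ENNReal.ofReal K * (normHk (k - 1) (vA - vB)
                + ENNReal.ofReal (σ ^ 2) * normHk k (vA - vB) + normHky k (θA - θB))) ∧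
      -- for the drift terms, when the noise hypothesis holds at level `k - 1` as well
      (HypG ι (k - 1) Φ₀ S T g →
        ∀ N : ℝ, 0 < N → ∃ K : ℝ, 0 < K ∧ ∀ (γ : ℝ) (vA vB : X d → V n) (θA θB : Y d → ℝ),
        normHk k vA ≤ ENNReal.ofReal N → normHk k vB ≤ ENNReal.ofReal N →
        normHky k θA ≤ ENNReal.ofReal N → normHky k θB ≤ ENNReal.ofReal N →
        ∀ σ : ℝ, 0 ≤ σ → σ ≤ 1 →
          normHky (k - 1) (Nsig f Φ₀ ψ χ e S T g σ vA θA γ - Nsig f Φ₀ ψ χ e S T g σ vB θB γ)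
            ≤ ENNReal.ofReal K * (normHk (k - 1) (vA - vB) + normHky k (θA - θB)) ∧
          normHk (k - 1)
              (calNsig f Φ₀ ψ χ e S T g σ vA θA γ - calNsig f Φ₀ ψ χ e S T g σ vB θB γ)
            ≤ ENNReal.ofReal K * (normHk (k - 1) (vA - vB) + normHky k (θA - θB)))) := by
  -- `k > d / 2` in the form required by the product estimate
  have hk0 : (d : ℝ) / 2 < k → d < 2 * k := fun h => by
    have : (d : ℝ) < ((2 * k : ℕ) : ℝ) := by push_cast; linarith
    exact_mod_cast this
  have H : WaveData k Φ₀ ψ χ := waveData hf hTw hψ hχ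
  refine ⟨fun hdk hL N hN => ?_, fun hdk => ?_⟩
  · have hk1 := hk0 hdk
    have hk : SobMul (dirY d) k := sobMul_dirY (by omega)
    have hkX : SobMul (dirX d) k := sobMul_dirX (by omega) hk1
    -- admissible triples `(γ, v, θ)` for the noise terms; `P'` adds `σ` and the extra regularity of
    -- `θ`
    let P := {p : ℝ × (X d → V n) × (Y d → ℝ) //
      normHk k p.2.1 ≤ ENNReal.ofReal N ∧ normHky k p.2.2 ≤ ENNReal.ofReal N}
    let P' := {p : P × ℝ // normHky (k + 1) p.1.1.2.2 < ⊤}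
    have hv : Dom (fun p : P => sobNorm (dirX d) k p.1.2.1) fun _ => 1 :=
      dom_one_of_le fun p => p.2.1
    have hθ : Dom (fun p : P => sobNorm (dirY d) k p.1.2.2) fun _ => 1 :=
      dom_one_of_le fun p => p.2.2
    obtain ⟨K₁, hK₁, h₁⟩ := (((H.dom_noiseM (γ := fun p : P => p.1.1) hg hT le_rfl hk hv hθ).add
      (H.dom_noiseM_L1 (γ := fun p : P => p.1.1) hg hL hT le_rfl hk hv hθ)).add
      (H.dom_calM (γ := fun p : P => p.1.1) hg hT le_rfl hk hv hθ)).exists_real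
    obtain ⟨K₂, hK₂, h₂⟩ := (H.dom_drift_terms (γ := fun p : P' => p.1.1.1.1)
      (σ := fun p : P' => p.1.2) hf hTw hg hT hk hkX e (hv.comp fun p : P' => p.1.1)
      (hθ.comp fun p : P' => p.1.1) fun p => p.2).exists_real
    refine ⟨K₁ + K₂, by positivity, fun γ v θ hvN hθN => ⟨?_, fun hθk σ => ?_⟩⟩
    · have h := h₁ ⟨(γ, v, θ), hvN, hθN⟩
      rw [mul_one] at h
      have hK := h.trans (ENNReal.ofReal_le_ofReal (le_add_of_nonneg_right hK₂.le))
      exact ⟨le_self_add.trans hK, le_add_self.trans hK⟩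
    · have hK := (h₂ ⟨(⟨(γ, v, θ), hvN, hθN⟩, σ), hθk⟩).trans
        (mul_le_mul_left (ENNReal.ofReal_le_ofReal (le_add_of_nonneg_left hK₁.le)) _)
      exact ⟨le_self_add.trans hK, le_add_self.trans hK⟩
  · have hk1 := hk0 (by linarith)
    have hk2 : d < 2 * (k - 1) := by
      have : (d : ℝ) + 2 < ((2 * k : ℕ) : ℝ) := by push_cast; linarith
      have : d + 2 < 2 * k := by exact_mod_cast this
      omega
    have hkk : k - 1 + 1 = k := by omega
    have hk : SobMul (dirY d) k := sobMul_dirY (by omega)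
    have hk' : SobMul (dirY d) (k - 1) := sobMul_dirY (by omega)
    have hkX' : SobMul (dirX d) (k - 1) := sobMul_dirX (by omega) hk2
    -- The two Lipschitz bounds for the drift are the cases `L = k` and `L = k - 1`.
    have hdrift := fun (L : ℕ) =>
      H.exists_drift_lipschitz (L := L) (S := S) (g := g) hf hTw hT hk' hkX' hkk e
    refine ⟨fun N hN => ?_, fun hg' N hN => ?_⟩
    · obtain ⟨K₁, hK₁, h₁⟩ := H.exists_noise_lipschitz hT hk hg N
      obtain ⟨K₂, hK₂, h₂⟩ := hdrift k (Nat.sub_le k 1) le_rfl hg N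
      refine ⟨K₁ + K₂, by positivity, fun γ vA vB θA θB h1 h2 h3 h4 =>
        ⟨?_, fun σ hσ0 hσ1 => ?_⟩⟩
      · have hK := (h₁ γ vA vB θA θB h1 h2 h3 h4).trans
          (mul_le_mul_left (ENNReal.ofReal_le_ofReal (le_add_of_nonneg_right hK₂.le)) _)
        exact ⟨le_self_add.trans hK, le_add_self.trans hK⟩
      · have hK := (h₂ γ vA vB θA θB h1 h2 h3 h4 σ hσ0 hσ1).trans
          (mul_le_mul_left (ENNReal.ofReal_le_ofReal (le_add_of_nonneg_left hK₁.le)) _)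
        exact ⟨le_self_add.trans hK, le_add_self.trans hK⟩
    · obtain ⟨K, hK, h⟩ := hdrift (k - 1) le_rfl (Nat.sub_le k 1) hg' N
      refine ⟨K * 2, by positivity, fun γ vA vB θA θB h1 h2 h3 h4 σ hσ0 hσ1 => ?_⟩
      have hs : ENNReal.ofReal (σ ^ 2) ≤ 1 := by
        rw [ENNReal.ofReal_le_one]
        exact pow_le_one₀ hσ0 hσ1
      -- for `L = k - 1` the middle term is absorbed, as `σ ≤ 1`
      have hle := (h γ vA vB θA θB h1 h2 h3 h4 σ hσ0 hσ1).trans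
        (show _ ≤ ENNReal.ofReal (K * 2) * (normHk (k - 1) (vA - vB) + normHky k (θA - θB)) by
          rw [ENNReal.ofReal_mul hK.le, mul_assoc, ENNReal.ofReal_ofNat]
          refine mul_le_mul_right ?_ _
          calc _ ≤ normHk (k - 1) (vA - vB) + 1 * normHk (k - 1) (vA - vB) +
                normHky k (θA - θB) := by gcongr
            _ ≤ normHk (k - 1) (vA - vB) + 1 * normHk (k - 1) (vA - vB) +
                (normHky k (θA - θB) + normHky k (θA - θB)) := by
                gcongr
                exact le_self_add
            _ = _ := by ring)
      exact ⟨le_self_add.trans hle, le_add_self.trans hle⟩
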